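/- Let $d\ge 3$. Let $(M,g)$ be a smooth Riemannian $d$-manifold and let $\Sigma=\{s=0\}$ be a hypersurface given by a smooth defining function $s$ ($ds\neq0$ along $\Sigma$), oriented by $ds$. Write $n$ for the unit normal, $\mathrm{II}$ for the second fundamental form, $H=\frac{1}{d-1}\mathrm{tr}\,\mathrm{II}$ for the mean curvature, $\bar\nabla$ and $\bar\Delta$ for the Levi-Civita connection and Laplacian of the induced metric, and $\nabla$, $R$, $W$, $\mathrm{Sc}$ for the Levi-Civita connection, Riemann, Weyl and scalar curvature of $g$. For a function $\sigma$ put $$S(\sigma)=|\nabla\sigma|^2-\tfrac2d\,\sigma\Big(\Delta+\tfrac{\mathrm{Sc}}{2(d-1)}\Big)\sigma .$$ Let $\sigma$ be a smooth defining function for $\Sigma$, inducing the same orientation as $s$, such that $$S(\sigma)=1+\sigma^dB,\qquad B\in C^\infty(M).$$ The obstruction density is $\mathcal B=B|_\Sigma$. (Here densities on the conformal manifold $(M,[g])$ are written as functions in the scale $g$; since $g$ is arbitrary, the statement holds in every scale of a conformal class.) By a *contraction* we mean a complete contraction, by means of the inverse metric and the undifferentiated normal $n$, of a finite product of tensors $\bar\nabla^\ell\mathrm{II}$,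 $\nabla^mR$ and $\nabla^mW$. In each dimension $d$ the following holds, with the constant, the contractions and their real coefficients depending only on $d$ (not on $M,g,\Sigma,\sigma$). 1. If $d-1$ is even, there are a constant $a\ne0$ and a finite linear combination $L$ of contractions, in which $\mathrm{II}$ occurs only through $\bar\nabla^\ell\mathrm{II}$ with $\ell\le d-2$ and the curvatures only through $\nabla^mR,\nabla^mW$ with $m\le d-2$, such that always $$\mathcal B=a\left(\bar\Delta^{\frac{d-1}{2}}H+L\right)\quad\text{on }\Sigma .$$ So $L$ is of lower order, as $\bar\Delta^{(d-1)/2}H$ is a contraction of $\bar\nabla^{d-1}\mathrm{II}$. 2. If $d-1$ is odd, $\mathcal B$ is fully non-linear: there is a finite linear combination $L$ of contractions, none of which is linear in the jets of the ambient curvature and the conormal, such that always $\mathcal B=L$ on $\Sigma$. More precisely, each contraction in $L$ either has at least two factors among $\bar\nabla^\ell\mathrm{II}$, $\nabla^mR$, $\nabla^mW$, or is a single $\nabla^mW$ contracted with at least two copies of $n$. In particular, if $g$ is conformally flat, every contraction that contributes has at least two such factors. -/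

import Mathlib

open scoped Manifold ContDiff

noncomputable section

namespace SingularYamabe

/-! ### Tensor calculus in coordinates

Everything in this part takes place on (an open subset of) `ℝᵈ`, with metric components `G x i j`.
A covariant `k`-tensor field is given by its components. All formulas are the classical ones; they
are only used at points near which the data are smooth and `G` is positive definite. -/

/-- The coordinate space. -/
abbrev Coord (d : ℕ) : Type := EuclideanSpace ℝ (Fin d)

/-- Components of a covariant `k`-tensor field. -/
abbrev Tensor (d k : ℕ) : Type := Coord d → (Fin k → Fin d) → ℝ

/-- Components of a metric. -/
abbrev MetricField (d : ℕ) : Type := Coord d → Matrix (Fin d) (Fin d) ℝ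

variable {d : ℕ}

/-- The partial derivative `∂ᵢ f`. -/
def partialDeriv (i : Fin d) (f : Coord d → ℝ) (x : Coord d) : ℝ :=
  fderiv ℝ f x (EuclideanSpace.single i (1 : ℝ))

/-- The Christoffel symbol `Γᶜₐᵦ`. -/
def christoffel (G : MetricField d) (c a b : Fin d) (x : Coord d) : ℝ :=
  (1 / 2) * ∑ e, (G x)⁻¹ c e *
    (partialDeriv a (fun y => G y e b) x + partialDeriv b (fun y => G y e a) x
      - partialDeriv e (fun y => G y a b) x)

/-- The Levi-Civita derivative of a covariant tensor; the new (derivative) index comes first. -/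
def covD (G : MetricField d) {k : ℕ} (T : Tensor d k) : Tensor d (k + 1) := fun x I =>
  partialDeriv (I 0) (fun y => T y (Fin.tail I)) x
    - ∑ m : Fin k, ∑ c : Fin d,
        christoffel G c (I 0) (Fin.tail I m) x * T x (Function.update (Fin.tail I) m c)

/-- The iterated Levi-Civita derivative `∇ᵐ T`. -/
def iterCovD (G : MetricField d) {k : ℕ} (T : Tensor d k) : (m : ℕ) → Tensor d (k + m)
  | 0 => T
  | m + 1 => covD G (iterCovD G T m)

/-- The curvature `R_{ab}{}^c{}_d`, where `R(u,v)w = ∇ᵤ∇ᵥw - ∇ᵥ∇ᵤw - ∇_{[u,v]}w` has components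
`uᵃ vᵇ wᵈ R_{ab}{}^c{}_d`. -/
def riemannUp (G : MetricField d) (a b c e : Fin d) (x : Coord d) : ℝ :=
  partialDeriv a (fun y => christoffel G c b e y) x
    - partialDeriv b (fun y => christoffel G c a e y) x
    + ∑ f, (christoffel G c a f x * christoffel G f b e x
        - christoffel G c b f x * christoffel G f a e x)

/-- The curvature tensor `R_{abcd}`. -/
def riemann (G : MetricField d) : Tensor d 4 := fun x I =>
  ∑ f, G x (I 2) f * riemannUp G (I 0) (I 1) f (I 3) x

/-- The Ricci tensor `Ric_{ab} = R_{ca}{}^c{}_b`. -/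
def ricci (G : MetricField d) (x : Coord d) (a b : Fin d) : ℝ :=
  ∑ c, riemannUp G c a c b x

/-- The scalar curvature. -/
def scalarCurv (G : MetricField d) (x : Coord d) : ℝ :=
  ∑ a, ∑ b, (G x)⁻¹ a b * ricci G x a b

/-- `J = Sc / (2(d-1))`. -/
def traceSchouten (G : MetricField d) (x : Coord d) : ℝ :=
  scalarCurv G x / (2 * ((d : ℝ) - 1))

/-- The Schouten tensor, `Ric = (d-2) P + J g`. -/
def schouten (G : MetricField d) (x : Coord d) (a b : Fin d) : ℝ :=
  (ricci G x a b - traceSchouten G x * G x a b) / ((d : ℝ) - 2)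

/-- The Weyl tensor, `R_{abcd} = W_{abcd} + 2 g_{c[a}P_{b]d} + 2 g_{d[b}P_{a]c}`. -/
def weyl (G : MetricField d) : Tensor d 4 := fun x I =>
  riemann G x I
    - (G x (I 2) (I 0) * schouten G x (I 1) (I 3) - G x (I 2) (I 1) * schouten G x (I 0) (I 3))
    - (G x (I 3) (I 1) * schouten G x (I 0) (I 2) - G x (I 3) (I 0) * schouten G x (I 1) (I 2))

/-- A function as a `0`-tensor. -/
def ofFun (f : Coord d → ℝ) : Tensor d 0 := fun x _ => f x

/-- The squared length `|df|²`. -/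
def gradSq (G : MetricField d) (f : Coord d → ℝ) (x : Coord d) : ℝ :=
  ∑ a, ∑ b, (G x)⁻¹ a b * partialDeriv a f x * partialDeriv b f x

/-- The Laplacian `Δ f = gᵃᵇ ∇ₐ∇ᵦ f`. -/
def laplacian (G : MetricField d) (f : Coord d → ℝ) (x : Coord d) : ℝ :=
  ∑ a, ∑ b, (G x)⁻¹ a b * covD G (covD G (ofFun f)) x ![a, b]

/-- `S(σ) = |∇σ|² - (2/d) σ (Δ + Sc/(2(d-1))) σ`, the squared length of the scale tractor of `σ`. -/
def yamabeS (G : MetricField d) (σ : Coord d → ℝ) (x : Coord d) : ℝ :=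
  gradSq G σ x - (2 / (d : ℝ)) * σ x * (laplacian G σ x + traceSchouten G x * σ x)

/-! ### Hypersurface geometry in coordinates

The hypersurface is the zero locus of a function `s`. The quantities below are defined wherever
`ds ≠ 0`, and there they are those of the level sets of `s`; they are evaluated on `s = 0`. Tensors
on the hypersurface are identified with ambient tensors that annihilate the normal. -/

/-- The unit conormal `nₐ = ∂ₐ s / |ds|`. -/
def conormal (G : MetricField d) (s : Coord d → ℝ) (a : Fin d) (x : Coord d) : ℝ :=
  partialDeriv a s x / Real.sqrt (gradSq G s x)

/-- The unit normal `nᵃ`. -/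
def normal (G : MetricField d) (s : Coord d → ℝ) (a : Fin d) (x : Coord d) : ℝ :=
  ∑ b, (G x)⁻¹ a b * conormal G s b x

/-- The orthogonal projection `γₐᵇ = δₐᵇ - nₐ nᵇ` to the tangent spaces of the level sets. -/
def proj (G : MetricField d) (s : Coord d → ℝ) (a b : Fin d) (x : Coord d) : ℝ :=
  (if a = b then 1 else 0) - conormal G s a x * normal G s b x

/-- The projection of a tensor in all its indices. -/
def tangential (G : MetricField d) (s : Coord d → ℝ) {k : ℕ} (T : Tensor d k) : Tensor d k :=
  fun x I => ∑ L : Fin k → Fin d, (∏ m, proj G s (I m) (L m) x) * T x L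

/-- The second fundamental form `IIₐᵦ = (∇ₐ nᵦ)^⊤`. -/
def secondFF (G : MetricField d) (s : Coord d → ℝ) : Tensor d 2 :=
  tangential G s (covD G (k := 1) (fun x I => conormal G s (I 0) x))

/-- The mean curvature `H = IIᵃₐ / (d-1)`. -/
def meanCurv (G : MetricField d) (s : Coord d → ℝ) (x : Coord d) : ℝ :=
  (1 / ((d : ℝ) - 1)) * ∑ a, ∑ b, (G x)⁻¹ a b * secondFF G s x ![a, b]

/-- The intrinsic Levi-Civita derivative `∇̄` of a tangential tensor, by the Gauss formula: the
ambient derivative projected in all indices. -/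
def barD (G : MetricField d) (s : Coord d → ℝ) {k : ℕ} (T : Tensor d k) : Tensor d (k + 1) :=
  tangential G s (covD G T)

/-- The iterated intrinsic derivative `∇̄ᵐ T`. -/
def iterBarD (G : MetricField d) (s : Coord d → ℝ) {k : ℕ} (T : Tensor d k) :
    (m : ℕ) → Tensor d (k + m)
  | 0 => T
  | m + 1 => barD G s (iterBarD G s T m)

/-- The intrinsic Laplacian `Δ̄ f = gᵃᵇ ∇̄ₐ∇̄ᵦ f`. -/
def barLaplacian (G : MetricField d) (s : Coord d → ℝ) (f : Coord d → ℝ) (x : Coord d) : ℝ :=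
  ∑ a, ∑ b, (G x)⁻¹ a b * barD G s (barD G s (ofFun f)) x ![a, b]

/-! ### Universal expressions -/

/-- The index slots of a product of tensors `∇̄^ℓ II` (`ℓ = α i`), `∇ᵐ R` (`m = β j`) and
`∇ᵐ W` (`m = γ j`). -/
abbrev Slots {p q r : ℕ} (α : Fin p → ℕ) (β : Fin q → ℕ) (γ : Fin r → ℕ) : Type :=
  ((Σ i : Fin p, Fin (2 + α i)) ⊕ (Σ j : Fin q, Fin (4 + β j))) ⊕ (Σ j : Fin r, Fin (4 + γ j))

/-- A complete contraction of a product of tensors `∇̄^ℓ II`, `∇ᵐ R` and `∇ᵐ W` with copies of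
the inverse metric and of the undifferentiated unit normal: each index slot is either one end of
one of `numPairs` pairs, contracted with the inverse metric, or is contracted with one of
`numNormals` copies of the normal. -/
structure Contraction where
  /-- number of factors `∇̄^ℓ II` -/
  numII : ℕ
  /-- the orders `ℓ` of these factors -/
  ordII : Fin numII → ℕ
  /-- number of factors `∇ᵐ R` -/
  numR : ℕ
  /-- the orders `m` of these factors -/
  ordR : Fin numR → ℕ
  /-- number of factors `∇ᵐ W` -/
  numW : ℕ
  /-- the orders `m` of these factors -/
  ordW : Fin numW → ℕ
  /-- number of copies of the inverse metric -/
  numPairs : ℕ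
  /-- number of copies of the normal -/
  numNormals : ℕ
  /-- which slot is contracted with what -/
  wiring : Slots ordII ordR ordW ≃ (Fin numPairs × Fin 2) ⊕ Fin numNormals

/-- The value of a complete contraction at a point, for the metric `G` and the hypersurface given
by `s`. -/
def Contraction.eval (t : Contraction) (G : MetricField d) (s : Coord d → ℝ) (x : Coord d) : ℝ :=
  ∑ I : Slots t.ordII t.ordR t.ordW → Fin d,
    (∏ i, iterBarD G s (secondFF G s) (t.ordII i) x (fun m => I (Sum.inl (Sum.inl ⟨i, m⟩))))
    * (∏ j, iterCovD G (riemann G) (t.ordR j) x (fun m => I (Sum.inl (Sum.inr ⟨j, m⟩))))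
    * (∏ j, iterCovD G (weyl G) (t.ordW j) x (fun m => I (Sum.inr ⟨j, m⟩)))
    * (∏ c, (G x)⁻¹ (I (t.wiring.symm (Sum.inl (c, 0)))) (I (t.wiring.symm (Sum.inl (c, 1)))))
    * (∏ c, normal G s (I (t.wiring.symm (Sum.inr c))) x)

/-- A finite linear combination of complete contractions, with constant coefficients. -/
abbrev Expression : Type := List (ℝ × Contraction)

/-- The value of an expression at a point. -/
def Expression.eval (L : Expression) (G : MetricField d) (s : Coord d → ℝ) (x : Coord d) : ℝ :=
  (L.map (fun t => t.1 * t.2.eval G s x)).sum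

/-- In ambient dimension `d`: the contraction is of lower order than `Δ̄^((d-1)/2) H`, which is a
contraction of `∇̄^(d-1) II`. It contains `II` to intrinsic order at most `d - 2` only, and the
ambient curvature to order at most `d - 2`. -/
def Contraction.IsLowerOrder (d : ℕ) (t : Contraction) : Prop :=
  (∀ i, t.ordII i ≤ d - 2) ∧ (∀ j, t.ordR j ≤ d - 2) ∧ (∀ j, t.ordW j ≤ d - 2)

/-- The contraction is not linear in the jets of the ambient curvature and the conormal: it has at
least two factors among `∇̄^ℓ II`, `∇ᵐ R`, `∇ᵐ W`, or it is a single `∇ᵐ W` contracted with at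
least two conormals. -/
def Contraction.IsNonlinear (t : Contraction) : Prop :=
  2 ≤ t.numII + t.numR + t.numW ∨
    (t.numII = 0 ∧ t.numR = 0 ∧ t.numW = 1 ∧ 2 ≤ t.numNormals)

/-! ### Riemannian manifolds and the obstruction density -/

section Manifold

variable {M : Type*} [TopologicalSpace M] [ChartedSpace (EuclideanSpace ℝ (Fin d)) M]
  [IsManifold (𝓡 d) ∞ M]

variable (d M) in
/-- Smooth Riemannian metrics on `M`. -/
abbrev SmoothMetric : Type _ :=
  Bundle.ContMDiffRiemannianMetric (𝓡 d) ∞ (EuclideanSpace ℝ (Fin d))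
    (fun p : M => TangentSpace (𝓡 d) p)

/-- The components of a metric in a chart. -/
def metricInChart (g : SmoothMetric d M)
    (e : OpenPartialHomeomorph M (EuclideanSpace ℝ (Fin d))) : MetricField d := fun x =>
  Matrix.of fun i j =>
    g.inner (e.symm x)
      (mfderiv (𝓡 d) (𝓡 d) e.symm x (EuclideanSpace.single i (1 : ℝ)))
      (mfderiv (𝓡 d) (𝓡 d) e.symm x (EuclideanSpace.single j (1 : ℝ)))

/-- The differential `df_p(v)`. -/
def differential (f : M → ℝ) (p : M) (v : TangentSpace (𝓡 d) p) : ℝ :=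
  mfderiv (𝓡 d) 𝓘(ℝ, ℝ) f p v

/-- `s` is a smooth defining function for its zero locus, a smooth hypersurface. -/
structure IsDefiningFunction (s : M → ℝ) : Prop where
  smooth : ContMDiff (𝓡 d) 𝓘(ℝ, ℝ) ∞ s
  deriv_ne_zero : ∀ p, s p = 0 → ∃ v : TangentSpace (𝓡 d) p, differential s p v ≠ 0

/-- Let `Σ` be the zero locus of the defining function `s`. In the scale given by `g`, in which
densities are functions, `σ` is a defining density for `Σ`, inducing the same orientation as `s`,
and `S(σ) = 1 + σᵈ B` with `B` smooth. Thus `σ` is a conformal unit defining density and the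
restriction of `B` to `Σ` is the obstruction density of `Σ` for the conformal class of `g`. The
equation is invariant under changes of coordinates; it is imposed in every chart. -/
structure IsUnitDefiningDensity (g : SmoothMetric d M) (s σ B : M → ℝ) : Prop where
  defining : IsDefiningFunction (d := d) σ
  smooth : ContMDiff (𝓡 d) 𝓘(ℝ, ℝ) ∞ B
  zero_iff : ∀ p, σ p = 0 ↔ s p = 0
  oriented : ∀ p, s p = 0 → ∃ c : ℝ, 0 < c ∧ ∀ v : TangentSpace (𝓡 d) p,
    differential σ p v = c * differential s p v
  equation : ∀ e ∈ IsManifold.maximalAtlas (𝓡 d) ∞ M, ∀ x ∈ e.target,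
    yamabeS (metricInChart g e) (fun y => σ (e.symm y)) x
      = 1 + σ (e.symm x) ^ d * B (e.symm x)

end Manifold

end SingularYamabe

end

open scoped Manifold ContDiff

noncomputable section

set_option linter.unusedSectionVars false

namespace SingularYamabe

/-! ### Tensor calculus over a commutative algebra with commuting derivations -/

/-! Let `X` be the gradient of `σ`, `L` the derivative along `X`, `X_0 = dσ`, `X_{k+1} = ∇_X X_k`
and `u_k = ⟨X_k, X_0⟩`. Cleared of its denominator, the equation for `σ` reads `d u_0 - 2σ(Δσ + Jσ)
= d + d σ^d B`. Apply `L^k` and restrict to `Σ`, where `σ = 0` and `|dσ| = 1`. Modulo products of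
two factors, `L^k u_0` is `2 u_k`, while `L^k(σ Δσ)` is `k L^{k-1} Δσ`. Commuting the derivatives in
the latter produces a Ricci term; its normal part is `u_k` and its tangential part is `Δ̄ u_{k-2}`.
With `r_m = L^m Ric(X,X)` and `j_m = L^m J` this gives, for `3 ≤ k < d`, `(d - k) u_k ≈ k (Δ̄
u_{k-2} - r_{k-2} + (k-1) j_{k-2})`. At `k = d` the coefficient of `u_d` vanishes and the remainder
contributes instead: `B ≈ -(2/d!) (Δ̄ u_{d-2} - r_{d-2} + (d-1) j_{d-2})`.

If `d` is odd, the recursion starts from `u_1 = H`. The curvature terms have lower order and count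
as errors, so `u_{2k+1}` is a non-zero multiple of `Δ̄^k H`, and so is `B` for the exponent
`(d-1)/2`.

If `d` is even, the recursion starts from `(d-2) u_2 ≈ 2 (j_0 - r_0)` and the linear curvature terms
have to cancel. The double divergence of the Weyl tensor and the contracted Bianchi identities give
`Δ̄(r_m - j_m) ≈ (d-1) j_{m+2} - r_{m+2}`, the error now including a double trace of `∇^{m+2} W` all
of whose remaining indices are contracted with normals. Induction yields `(d-2) u_k ≈ k (j_{k-2} -
r_{k-2})`, and at `k = d` the linear terms disappear.

The errors are controlled by two gradings: the weight, which bounds the orders of derivatives, and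
the degree, which counts factors. A Weyl factor with two normals has degree two; a Riemann factor
has degree `ρ`, with `ρ = 2` for odd and `ρ = 1` for even `d`. Tangential differentiation preserves
these classes (`HC_tnab`), and the covectors `X_k` with `k < d` lie in them (`good`). The heart of
the matter is `recursion`, followed by `u_odd`, `HC0_tLap_r_sub_j` and `u_even`; `exists_expression`
turns membership in a class into an explicit list of contractions.

The coefficients must not depend on the manifold. The calculus is therefore carried out over an
abstract algebra with commuting derivations, and applied to a single universal algebra, whose
elements are families of smooth functions on all coordinate domains carrying such data at once. -/

/-- Covariant tensors with index set `κ` and components in `A`. -/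
abbrev Ten (d : ℕ) (A : Type*) (κ : Type) : Type _ := (κ → Fin d) → A

variable {d : ℕ} {A : Type*} [CommRing A] [Algebra ℝ A] {κ μ : Type}

/-- The tensor product. -/
def mulT (F : Ten d A κ) (H : Ten d A μ) : Ten d A (κ ⊕ μ) :=
  fun J => F (J ∘ Sum.inl) * H (J ∘ Sum.inr)

/-- Renaming the indices. -/
def re (e : κ ≃ μ) (F : Ten d A κ) : Ten d A μ := fun J => F (J ∘ e)

/-- Contraction of two indices with the matrix `h`. -/
def ctr (h : Fin d → Fin d → A) (F : Ten d A (Fin 2 ⊕ κ)) : Ten d A κ :=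
  fun J => ∑ b, ∑ c, h b c * F (Sum.elim ![b, c] J)

/-- Contraction of one index with a vector. -/
def iv (v : Fin d → A) (F : Ten d A (Unit ⊕ κ)) : Ten d A κ :=
  fun J => ∑ b, v b * F (Sum.elim (fun _ => b) J)

section action

variable [Fintype κ] [DecidableEq κ] [Fintype μ] [DecidableEq μ]

/-- The derivation of the tensor algebra induced by a matrix. -/
def act (P : Fin d → Fin d → A) (F : Ten d A κ) : Ten d A κ :=
  fun J => ∑ m, ∑ c, P c (J m) * F (Function.update J m c)

/-- Actions in two different slots commute, so only the terms with both matrices in the same slot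
survive, and these form the matrix commutator. -/
lemma act_act (P Q : Fin d → Fin d → A) (F : Ten d A κ) (J : κ → Fin d) :
    act P (act Q F) J - act Q (act P F) J
      = act (fun c e => ∑ f, (Q c f * P f e - P c f * Q f e)) F J := by
  -- Separate the terms in which the second action hits the slot already used from those with two
  -- distinct slots; only the former see the order of the matrices.
  have key : ∀ P Q : Fin d → Fin d → A, act P (act Q F) J
      = act (fun c e => ∑ f, Q c f * P f e) F J
        + ∑ m, ∑ m', if m' = m then 0 else ∑ c, ∑ c', P c (J m) * Q c' (J m') *
            F (Function.update (Function.update J m c) m' c') := by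
    intro P Q
    unfold act
    rw [← Finset.sum_add_distrib]
    refine Finset.sum_congr rfl fun m _ => ?_
    have : ∀ c, P c (J m) * ∑ m', ∑ c', Q c' (Function.update J m c m') *
          F (Function.update (Function.update J m c) m' c')
        = (∑ c', P c (J m) * Q c' c * F (Function.update J m c'))
          + ∑ m', if m' = m then 0 else ∑ c', P c (J m) * Q c' (J m') *
            F (Function.update (Function.update J m c) m' c') := by
      intro c
      rw [← Finset.add_sum_erase _ _ (Finset.mem_univ m),
        ← Finset.add_sum_erase Finset.univ (fun m' => ite (m' = m) (0 : A) _) (Finset.mem_univ m), mul_add]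
      simp only [Function.update_self, Function.update_idem, ↓reduceIte, zero_add]
      congr 1
      · rw [Finset.mul_sum]; exact Finset.sum_congr rfl fun _ _ => by ring
      · rw [Finset.mul_sum]
        refine Finset.sum_congr rfl fun m' hm' => ?_
        have hne := (Finset.mem_erase.1 hm').1
        rw [if_neg hne, Finset.mul_sum]
        refine Finset.sum_congr rfl fun c' _ => ?_
        rw [Function.update_of_ne hne]; ring
    simp_rw [this]
    rw [Finset.sum_add_distrib]
    congr 1
    · rw [Finset.sum_comm]
      refine Finset.sum_congr rfl fun c' _ => ?_
      rw [Finset.sum_mul]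
      exact Finset.sum_congr rfl fun _ _ => by ring
    · rw [Finset.sum_comm]
      refine Finset.sum_congr rfl fun m' _ => ?_
      split_ifs <;> simp
  rw [key P Q, key Q P]
  have sw : ∀ P Q : Fin d → Fin d → A,
      (∑ m, ∑ m', if m' = m then 0 else ∑ c, ∑ c', P c (J m) * Q c' (J m') *
            F (Function.update (Function.update J m c) m' c'))
      = (∑ m, ∑ m', if m' = m then 0 else ∑ c, ∑ c', Q c (J m) * P c' (J m') *
            F (Function.update (Function.update J m c) m' c')) := by
    intro P Q
    rw [Finset.sum_comm]
    refine Finset.sum_congr rfl fun m _ => Finset.sum_congr rfl fun m' _ => ?_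
    by_cases h : m' = m
    · simp [h]
    · rw [if_neg h, if_neg (Ne.symm h), Finset.sum_comm]
      refine Finset.sum_congr rfl fun c _ => Finset.sum_congr rfl fun c' _ => ?_
      rw [Function.update_comm h]; ring
  rw [sw P Q]
  unfold act
  simp only [Finset.sum_sub_distrib, sub_mul]
  ring

lemma act_mulT (P : Fin d → Fin d → A) (F : Ten d A κ) (H : Ten d A μ) :
    act P (mulT F H) = mulT (act P F) H + mulT F (act P H) := by
  funext J
  simp only [act, mulT, Pi.add_apply, Fintype.sum_sum_type, Finset.sum_mul, Finset.mul_sum,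
    Function.comp_apply]
  congr 1 <;> refine Finset.sum_congr rfl fun m _ => Finset.sum_congr rfl fun c _ => ?_
  · rw [Function.update_comp_eq_of_injective _ Sum.inl_injective,
      Function.update_comp_eq_of_forall_ne _ _ (by simp)]; ring
  · rw [Function.update_comp_eq_of_injective _ Sum.inr_injective,
      Function.update_comp_eq_of_forall_ne _ _ (by simp)]; ring

lemma act_re (P : Fin d → Fin d → A) (e : κ ≃ μ) (F : Ten d A κ) :
    act P (re e F) = re e (act P F) := by
  funext J
  simp only [act, re, Function.comp_apply]
  rw [← Equiv.sum_comp e]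
  refine Finset.sum_congr rfl fun m _ => Finset.sum_congr rfl fun c _ => ?_
  rw [Function.update_comp_eq_of_injective _ e.injective]

lemma update_elim_inr {α : Type} (f : α → Fin d) [DecidableEq α]
    (J : κ → Fin d) (m : κ) (c : Fin d) :
    Function.update (Sum.elim f J) (Sum.inr m) c = Sum.elim f (Function.update J m c) := by
  funext i; rcases i with i | i
  · simp
  · by_cases h : i = m
    · subst h; simp
    · simp [h]

lemma update_elim_inl {α : Type} (f : α → Fin d) [DecidableEq α]
    (J : κ → Fin d) (m : α) (c : Fin d) :
    Function.update (Sum.elim f J) (Sum.inl m) c = Sum.elim (Function.update f m c) J := by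
  funext i; rcases i with i | i
  · by_cases h : i = m
    · subst h; simp
    · simp [h]
  · simp

lemma act_elim {α : Type} [Fintype α] [DecidableEq α] (P : Fin d → Fin d → A)
    (F : Ten d A (α ⊕ κ)) (f : α → Fin d) (J : κ → Fin d) :
    act P F (Sum.elim f J) = (∑ m, ∑ c, P c (f m) * F (Sum.elim (Function.update f m c) J))
      + act P (fun J => F (Sum.elim f J)) J := by
  simp only [act, Fintype.sum_sum_type, Sum.elim_inl, Sum.elim_inr, update_elim_inr,
    update_elim_inl]

lemma act_sum_mul {ι : Type*} (s : Finset ι) (P : Fin d → Fin d → A) (w : ι → A)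
    (F : ι → Ten d A κ) :
    act P (fun J => ∑ i ∈ s, w i * F i J) = fun J => ∑ i ∈ s, w i * act P (F i) J := by
  funext J
  simp only [act, Finset.mul_sum]
  conv_rhs => rw [Finset.sum_comm]
  refine Finset.sum_congr rfl fun m _ => ?_
  conv_rhs => rw [Finset.sum_comm]
  refine Finset.sum_congr rfl fun c _ => Finset.sum_congr rfl fun i _ => by ring

/-- Acting on the contracted slot amounts to acting on the vector. The correction is exactly what
completes `D v` to the covariant derivative `cdUp` in `cd_iv`. -/
lemma act_iv (P : Fin d → Fin d → A) (v : Fin d → A) (F : Ten d A (Unit ⊕ κ)) (J : κ → Fin d) :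
    act P (iv v F) J
      = iv v (act P F) J - iv (fun c => ∑ b, P c b * v b) F J := by
  have : ∀ b, act P F (Sum.elim (fun _ => b) J) = (∑ c, P c b * F (Sum.elim (fun _ => c) J))
      + act P (fun J => F (Sum.elim (fun _ => b) J)) J := by
    intro b
    rw [act_elim]
    simp only [Finset.univ_unique, Finset.sum_singleton]
    congr 2
  have h2 : act P (iv v F) J = ∑ b, v b * act P (fun J => F (Sum.elim (fun _ => b) J)) J :=
    congrFun (act_sum_mul Finset.univ P v fun b J => F (Sum.elim (fun _ => b) J)) J
  rw [h2]
  simp only [iv, this, mul_add, Finset.sum_add_distrib, Finset.sum_mul, Finset.mul_sum]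
  rw [Finset.sum_comm (f := fun b c => v b * (P c b * F (Sum.elim (fun _ => c) J)))]
  have h1 : (∑ y, ∑ x, v x * (P y x * F (Sum.elim (fun _ => y) J)))
      = ∑ x, ∑ i, P x i * v i * F (Sum.elim (fun _ => x) J) :=
    Finset.sum_congr rfl fun _ _ => Finset.sum_congr rfl fun _ _ => by ring
  rw [h1, add_sub_cancel_left]

lemma act_ctr (P : Fin d → Fin d → A) (h : Fin d → Fin d → A) (F : Ten d A (Fin 2 ⊕ κ))
    (J : κ → Fin d) :
    act P (ctr h F) J = ctr h (act P F) J
      - ctr (fun b c => ∑ e, (P b e * h e c + P c e * h b e)) F J := by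
  have : ∀ b c, act P F (Sum.elim ![b, c] J) = (∑ e, P e b * F (Sum.elim ![e, c] J))
      + (∑ e, P e c * F (Sum.elim ![b, e] J))
      + act P (fun J => F (Sum.elim ![b, c] J)) J := by
    intro b c
    rw [act_elim]
    simp only [Fin.sum_univ_two, Matrix.cons_val_zero, Matrix.cons_val_one]
    congr 2 <;> refine Finset.sum_congr rfl fun e _ => ?_ <;> congr 3 <;> funext i <;>
      fin_cases i <;> rfl
  have h2 : act P (ctr h F) J
      = ∑ b, ∑ c, h b c * act P (fun J => F (Sum.elim ![b, c] J)) J := by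
    have := congrFun (act_sum_mul (Finset.univ ×ˢ Finset.univ) P (fun i => h i.1 i.2)
      fun i J => F (Sum.elim ![i.1, i.2] J)) J
    simp only [Finset.sum_product] at this
    exact this
  rw [h2]
  simp only [ctr, this, mul_add, Finset.sum_add_distrib, Finset.sum_mul, Finset.mul_sum, add_mul]
  have h1 : (∑ x, ∑ y, ∑ z, h x y * (P z x * F (Sum.elim ![z, y] J)))
      = ∑ x, ∑ y, ∑ z, P x z * h z y * F (Sum.elim ![x, y] J) := by
    conv_lhs => enter [2, x]; rw [Finset.sum_comm]
    rw [Finset.sum_comm]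
    refine Finset.sum_congr rfl fun _ _ => ?_
    rw [Finset.sum_comm]
    exact Finset.sum_congr rfl fun _ _ => Finset.sum_congr rfl fun _ _ => by ring
  have h3 : (∑ x, ∑ y, ∑ z, h x y * (P z y * F (Sum.elim ![x, z] J)))
      = ∑ x, ∑ y, ∑ z, P y z * h x z * F (Sum.elim ![x, y] J) := by
    refine Finset.sum_congr rfl fun _ _ => ?_
    rw [Finset.sum_comm]
    exact Finset.sum_congr rfl fun _ _ => Finset.sum_congr rfl fun _ _ => by ring
  rw [h1, h3]
  ring

end action

/-- A metric `g` with inverse `h` over an algebra `A` with commuting derivations `D`. -/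
structure MetricAlg (d : ℕ) (A : Type*) [CommRing A] [Algebra ℝ A] where
  /-- the partial derivatives -/
  D : Fin d → Derivation ℝ A A
  D_comm : ∀ a b f, D a (D b f) = D b (D a f)
  /-- the metric -/
  g : Fin d → Fin d → A
  /-- the inverse metric -/
  h : Fin d → Fin d → A
  g_symm : ∀ a b, g a b = g b a
  h_symm : ∀ a b, h a b = h b a
  g_mul_h : ∀ a b, ∑ c, g a c * h c b = if a = b then 1 else 0

namespace MetricAlg

variable (M : MetricAlg d A)

lemma h_mul_g (a b : Fin d) : ∑ c, M.h a c * M.g c b = if a = b then 1 else 0 := by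
  have := M.g_mul_h b a
  rw [show (if a = b then (1 : A) else 0) = if b = a then 1 else 0 by simp [eq_comm], ← this]
  exact Finset.sum_congr rfl fun c _ => by rw [M.h_symm a c, M.g_symm c b, mul_comm]

/-- The Christoffel symbols. -/
def Γ (c a b : Fin d) : A :=
  (1 / 2 : ℝ) • ∑ e, M.h c e * (M.D a (M.g e b) + M.D b (M.g e a) - M.D e (M.g a b))

lemma Γ_symm (c a b : Fin d) : M.Γ c a b = M.Γ c b a := by
  unfold Γ
  congr 1
  refine Finset.sum_congr rfl fun e _ => ?_
  rw [M.g_symm a b]; ring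

/-- The Christoffel symbols as matrices. -/
def Γm (a : Fin d) (c b : Fin d) : A := M.Γ c a b

lemma g_mul_h_mul (a : Fin d) (f : Fin d → A) :
    ∑ c, M.g a c * ∑ e, M.h c e * f e = f a := by
  simp only [Finset.mul_sum]
  rw [Finset.sum_comm]
  have : ∀ e, ∑ c, M.g a c * (M.h c e * f e) = if a = e then f e else 0 := by
    intro e
    simp only [← mul_assoc]
    rw [← Finset.sum_mul, M.g_mul_h]; simp
  simp [this]

lemma h_mul_g_mul (a : Fin d) (f : Fin d → A) :
    ∑ c, M.h a c * ∑ e, M.g c e * f e = f a := by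
  simp only [Finset.mul_sum]
  rw [Finset.sum_comm]
  have : ∀ e, ∑ c, M.h a c * (M.g c e * f e) = if a = e then f e else 0 := by
    intro e
    simp only [← mul_assoc]
    rw [← Finset.sum_mul, M.h_mul_g]; simp
  simp [this]

lemma g_mul_Γ (f a b : Fin d) :
    ∑ c, M.g f c * M.Γ c a b
      = (1 / 2 : ℝ) • (M.D a (M.g f b) + M.D b (M.g f a) - M.D f (M.g a b)) := by
  unfold Γ
  simp only [mul_smul_comm]
  rw [← Finset.smul_sum, M.g_mul_h_mul f
    (fun e => M.D a (M.g e b) + M.D b (M.g e a) - M.D e (M.g a b))]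

lemma D_g (a b c : Fin d) :
    M.D a (M.g b c) = (∑ e, M.Γ e a b * M.g e c) + ∑ e, M.Γ e a c * M.g b e := by
  have h1 : ∑ e, M.Γ e a b * M.g e c = ∑ e, M.g c e * M.Γ e a b :=
    Finset.sum_congr rfl fun e _ => by rw [M.g_symm e c, mul_comm]
  have h2 : ∑ e, M.Γ e a c * M.g b e = ∑ e, M.g b e * M.Γ e a c :=
    Finset.sum_congr rfl fun e _ => by rw [mul_comm]
  rw [h1, h2, g_mul_Γ, g_mul_Γ, M.g_symm c b, M.g_symm c a, M.g_symm a b, ← smul_add]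
  have : M.D a (M.g b c) + M.D b (M.g a c) - M.D c (M.g b a)
      + (M.D a (M.g b c) + M.D c (M.g b a) - M.D b (M.g a c)) = (2 : ℝ) • M.D a (M.g b c) := by
    rw [two_smul]; ring
  rw [this, smul_smul]; norm_num

/-- Differentiate `g h = 1`, insert `D_g` and multiply by `h`: the inverse metric is parallel. -/
lemma D_h (a b c : Fin d) :
    M.D a (M.h b c) = - ∑ e, (M.Γ b a e * M.h e c + M.Γ c a e * M.h b e) := by
  have key : ∀ f, ∑ e, M.g f e * M.D a (M.h e c) = - ∑ e, M.D a (M.g f e) * M.h e c := by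
    intro f
    have := congrArg (M.D a) (M.g_mul_h f c)
    have h0 : M.D a (if f = c then (1 : A) else 0) = 0 := by split_ifs <;> simp
    rw [h0, map_sum] at this
    simp only [Derivation.leibniz, smul_eq_mul, Finset.sum_add_distrib] at this
    rw [eq_neg_iff_add_eq_zero, ← this]
    congr 1
    exact Finset.sum_congr rfl fun e _ => by ring
  rw [← M.h_mul_g_mul b (fun e => M.D a (M.h e c))]
  have h1 : ∀ f, ∑ e, (∑ i, M.Γ i a f * M.g i e) * M.h e c = M.Γ c a f := by
    intro f
    simp only [Finset.sum_mul]
    rw [Finset.sum_comm]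
    simp only [mul_assoc, ← Finset.mul_sum, M.g_mul_h]
    simp
  have h2 : ∑ f, M.h b f * ∑ e, (∑ i, M.Γ i a e * M.g f i) * M.h e c
      = ∑ e, M.Γ b a e * M.h e c := by
    have : ∀ f, ∑ e, (∑ i, M.Γ i a e * M.g f i) * M.h e c
        = ∑ i, M.g f i * ∑ e, M.Γ i a e * M.h e c := by
      intro f
      simp only [Finset.sum_mul, Finset.mul_sum]
      rw [Finset.sum_comm]
      exact Finset.sum_congr rfl fun _ _ => Finset.sum_congr rfl fun _ _ => by ring
    simp only [this]
    exact M.h_mul_g_mul b (fun i => ∑ e, M.Γ i a e * M.h e c)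
  simp only [key, D_g]
  simp only [add_mul, Finset.sum_add_distrib, mul_neg, mul_add, Finset.sum_neg_distrib, neg_add]
  rw [h2, add_comm]
  simp only [h1]
  congr 2
  exact Finset.sum_congr rfl fun _ _ => mul_comm _ _

section cd

variable [Fintype κ] [DecidableEq κ] [Fintype μ] [DecidableEq μ]

/-- The covariant derivative in the `a`-th coordinate direction. -/
def cd (a : Fin d) (F : Ten d A κ) : Ten d A κ := fun J => M.D a (F J) - act (M.Γm a) F J

lemma cd_apply (a : Fin d) (F : Ten d A κ) (J : κ → Fin d) :
    M.cd a F J = M.D a (F J) - act (M.Γm a) F J := rfl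

lemma cd_mulT (a : Fin d) (F : Ten d A κ) (H : Ten d A μ) :
    M.cd a (mulT F H) = mulT (M.cd a F) H + mulT F (M.cd a H) := by
  funext J
  have := congrFun (act_mulT (M.Γm a) F H) J
  simp only [Pi.add_apply] at this ⊢
  simp only [cd_apply, this]
  simp only [mulT, cd_apply, Derivation.leibniz, smul_eq_mul]
  ring

lemma cd_re (a : Fin d) (e : κ ≃ μ) (F : Ten d A κ) : M.cd a (re e F) = re e (M.cd a F) := by
  funext J
  have := congrFun (act_re (M.Γm a) e F) J
  simp only [cd, this]
  rfl

/-- The correction term of `act_ctr` cancels `D h`, since `h` is parallel. -/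
lemma cd_ctr (a : Fin d) (F : Ten d A (Fin 2 ⊕ κ)) :
    M.cd a (ctr M.h F) = ctr M.h (M.cd a F) := by
  funext J
  simp only [cd_apply, act_ctr]
  simp only [ctr, cd_apply, mul_sub, Finset.sum_sub_distrib, map_sum, Derivation.leibniz, smul_eq_mul,
    Finset.sum_add_distrib, D_h, Γm]
  simp only [mul_neg, Finset.sum_neg_distrib]
  have : ∀ b c, F (Sum.elim ![b, c] J) * ((∑ e, M.Γ b a e * M.h e c) + ∑ e, M.Γ c a e * M.h b e)
    = ((∑ e, M.Γ b a e * M.h e c) + ∑ e, M.Γ c a e * M.h b e) * F (Sum.elim ![b, c] J) :=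
    fun _ _ => mul_comm _ _
  simp only [this]
  ring

/-- The covariant derivative of a vector field. -/
def cdUp (a : Fin d) (v : Fin d → A) (c : Fin d) : A := M.D a (v c) + ∑ b, M.Γ c a b * v b

lemma cd_iv (a : Fin d) (v : Fin d → A) (F : Ten d A (Unit ⊕ κ)) :
    M.cd a (iv v F) = iv v (M.cd a F) + iv (M.cdUp a v) F := by
  funext J
  simp only [Pi.add_apply, cd_apply, act_iv]
  simp only [iv, cd_apply, mul_sub, Finset.sum_sub_distrib, map_sum, Derivation.leibniz, smul_eq_mul,
    Finset.sum_add_distrib, Γm, cdUp, add_mul]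
  have : ∀ b, F (Sum.elim (fun _ => b) J) * M.D a (v b) = M.D a (v b) * F (Sum.elim (fun _ => b) J) :=
    fun _ => mul_comm _ _
  simp only [this]
  ring

lemma cd_add (a : Fin d) (F H : Ten d A κ) : M.cd a (F + H) = M.cd a F + M.cd a H := by
  funext J
  simp only [cd, act, Pi.add_apply, map_add, mul_add, Finset.sum_add_distrib]; ring

lemma cd_smul (a : Fin d) (r : ℝ) (F : Ten d A κ) : M.cd a (r • F) = r • M.cd a F := by
  funext J
  simp only [cd, act, Pi.smul_apply, Derivation.map_smul, mul_smul_comm, smul_sub,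
    Finset.smul_sum]

lemma cd_sub (a : Fin d) (F H : Ten d A κ) : M.cd a (F - H) = M.cd a F - M.cd a H := by
  funext J
  simp only [cd, act, Pi.sub_apply, map_sub, mul_sub, Finset.sum_sub_distrib]; ring

/-- Multiplication of a tensor by a function. -/
lemma cd_fmul (a : Fin d) (f : A) (F : Ten d A κ) (J : κ → Fin d) :
    M.cd a (fun J => f * F J) J = f * M.cd a F J + M.D a f * F J := by
  simp only [cd, act, Derivation.leibniz, smul_eq_mul, mul_sub, Finset.mul_sum]
  have : ∀ m c, M.Γm a c (J m) * (f * F (Function.update J m c))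
      = f * (M.Γm a c (J m) * F (Function.update J m c)) := fun _ _ => by ring
  simp only [this]
  ring

/-- The covariant derivative; the new index is the first one. -/
def nabla (F : Ten d A κ) : Ten d A (Unit ⊕ κ) :=
  fun I => M.cd (I (Sum.inl ())) F (I ∘ Sum.inr)

@[simp] lemma nabla_elim (F : Ten d A κ) (f : Unit → Fin d) (J : κ → Fin d) :
    M.nabla F (Sum.elim f J) = M.cd (f ()) F J := rfl

/-- The curvature with one index raised. -/
def Rup (a b c e : Fin d) : A :=
  M.D a (M.Γ c b e) - M.D b (M.Γ c a e)
    + ∑ f, (M.Γ c a f * M.Γ f b e - M.Γ c b f * M.Γ f a e)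

/-- The Christoffel term comes from the slot of the inner derivative. It is symmetric in `a` and
`b`, hence invisible in the Ricci identity. -/
lemma cd_nabla (a b : Fin d) (F : Ten d A κ) (J : κ → Fin d) :
    M.cd a (M.nabla F) (Sum.elim (fun _ => b) J)
      = M.cd a (M.cd b F) J - ∑ c, M.Γ c a b * M.cd c F J := by
  conv_lhs => rw [cd, act_elim]
  simp only [Finset.univ_unique, Finset.sum_singleton, nabla_elim, Function.update_self, cd, Γm]
  have : ∀ c, Function.update (fun _ : Unit => b) default c default = c := fun c => by simp
  ring_nf
  rfl

/-- The Ricci identity. -/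
lemma ricci_identity (a b : Fin d) (F : Ten d A κ) (J : κ → Fin d) :
    M.cd a (M.nabla F) (Sum.elim (fun _ => b) J) - M.cd b (M.nabla F) (Sum.elim (fun _ => a) J)
      = - act (fun c e => M.Rup a b c e) F J := by
  rw [cd_nabla, cd_nabla]
  simp only [M.Γ_symm _ b a]
  rw [sub_sub_sub_cancel_right]
  -- The pure second derivative and the two mixed terms are symmetric in `a` and `b`; the commutator
  -- keeps only the derivative of the Christoffel symbols and the iterated action.
  have h1 : ∀ a b, M.cd a (M.cd b F) J = M.D a (M.D b (F J))
      - act (fun c e => M.D a (M.Γ c b e)) F J - act (M.Γm b) (fun J => M.D a (F J)) J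
      - act (M.Γm a) (fun J => M.D b (F J)) J + act (M.Γm a) (act (M.Γm b) F) J := by
    intro a b
    simp only [cd, act, Γm, map_sub, map_sum, Derivation.leibniz, smul_eq_mul, mul_sub,
      Finset.sum_sub_distrib, Finset.sum_add_distrib]
    have : ∀ m c, F (Function.update J m c) * M.D a (M.Γ c b (J m))
      = M.D a (M.Γ c b (J m)) * F (Function.update J m c) := fun _ _ => mul_comm _ _
    simp only [this]
    ring
  rw [h1, h1, M.D_comm b a]
  have h2 := act_act (M.Γm a) (M.Γm b) F J
  have h3 : act (fun c e => M.Rup a b c e) F J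
      = act (fun c e => M.D a (M.Γ c b e)) F J - act (fun c e => M.D b (M.Γ c a e)) F J
        - act (fun c e => ∑ f, (M.Γm b c f * M.Γm a f e - M.Γm a c f * M.Γm b f e)) F J := by
    simp only [act, ← Finset.sum_sub_distrib, ← sub_mul]
    refine Finset.sum_congr rfl fun m _ => Finset.sum_congr rfl fun c _ => ?_
    congr 1
    simp only [Rup, Γm, Finset.sum_sub_distrib]
    ring
  rw [h3, ← h2]
  ring

end cd

end MetricAlg
end SingularYamabe

namespace SingularYamabe

variable {d : ℕ} {A : Type*} [CommRing A] [Algebra ℝ A]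

/-- The algebra may have zero divisors, but `2` is invertible because real scalars act. -/
lemma two_mul_cancel {x : A} (h : 2 * x = 0) : x = 0 := by
  have : (2 : ℝ) • x = 0 := by rw [two_smul, ← two_mul, h]
  simpa using this

lemma sum_comm₄ {ι : Type*} [Fintype ι] (f : ι → ι → ι → ι → A) :
    ∑ a, ∑ b, ∑ c, ∑ e, f a b c e = ∑ c, ∑ e, ∑ a, ∑ b, f a b c e := by
  conv_lhs => enter [2, a]; rw [Finset.sum_comm]
  rw [Finset.sum_comm]
  refine Finset.sum_congr rfl fun c _ => ?_
  conv_lhs => enter [2, a]; rw [Finset.sum_comm]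
  rw [Finset.sum_comm]

namespace MetricAlg

variable (M : MetricAlg d A)

/-! ### Curvature identities -/

/-- The metric as a tensor. -/
def gT : Ten d A (Fin 2) := fun I => M.g (I 0) (I 1)

/-- Evaluation of `cd` on a `k`-tensor, `k = 1, 2, 4`. -/
lemma cd_one (a : Fin d) (F : Ten d A (Fin 1)) (b : Fin d) :
    M.cd a F ![b] = M.D a (F ![b]) - ∑ c, M.Γ c a b * F ![c] := by
  simp only [cd_apply, act, Γm, Finset.univ_unique, Finset.sum_singleton]
  congr 1
  refine Finset.sum_congr rfl fun c _ => ?_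
  congr 2
  funext i; fin_cases i; rfl

lemma cd_two (a : Fin d) (F : Ten d A (Fin 2)) (b c : Fin d) :
    M.cd a F ![b, c] = M.D a (F ![b, c]) - ∑ e, M.Γ e a b * F ![e, c]
      - ∑ e, M.Γ e a c * F ![b, e] := by
  simp only [cd_apply, act, Γm, Fin.sum_univ_two, Matrix.cons_val_zero, Matrix.cons_val_one]
  rw [sub_sub]
  congr 2 <;> refine Finset.sum_congr rfl fun e _ => ?_ <;> congr 2 <;> funext i <;>
    fin_cases i <;> rfl

lemma cd_four (a : Fin d) (F : Ten d A (Fin 4)) (i j k l : Fin d) :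
    M.cd a F ![i, j, k, l] = M.D a (F ![i, j, k, l]) - ∑ e, M.Γ e a i * F ![e, j, k, l]
      - ∑ e, M.Γ e a j * F ![i, e, k, l] - ∑ e, M.Γ e a k * F ![i, j, e, l]
      - ∑ e, M.Γ e a l * F ![i, j, k, e] := by
  simp only [cd_apply, act, Γm, Fin.sum_univ_four]
  simp only [sub_sub]
  have : ∀ e, Function.update ![i, j, k, l] 0 e = ![e, j, k, l] := fun e => by
    funext i; fin_cases i <;> rfl
  have h1 : ∀ e, Function.update ![i, j, k, l] 1 e = ![i, e, k, l] := fun e => by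
    funext i; fin_cases i <;> rfl
  have h2 : ∀ e, Function.update ![i, j, k, l] 2 e = ![i, j, e, l] := fun e => by
    funext i; fin_cases i <;> rfl
  have h3 : ∀ e, Function.update ![i, j, k, l] 3 e = ![i, j, k, e] := fun e => by
    funext i; fin_cases i <;> rfl
  simp only [this, h1, h2, h3]
  congr 2

lemma cd_gT (a : Fin d) : M.cd a M.gT = 0 := by
  funext I
  have : I = ![I 0, I 1] := by funext i; fin_cases i <;> rfl
  rw [this, cd_two]
  simp [gT, D_g]

lemma Rup_antisymm (a b c e : Fin d) : M.Rup a b c e = - M.Rup b a c e := by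
  simp only [Rup, Finset.sum_sub_distrib]; ring

lemma Rup_cyclic (a b c e : Fin d) : M.Rup a b c e + M.Rup b e c a + M.Rup e a c b = 0 := by
  simp only [Rup, Finset.sum_sub_distrib, M.Γ_symm _ b a, M.Γ_symm _ e a, M.Γ_symm _ e b]
  ring

/-- The Riemann tensor. -/
def Riem : Ten d A (Fin 4) := fun I => ∑ f, M.g (I 2) f * M.Rup (I 0) (I 1) f (I 3)

lemma Riem_apply (a b c e : Fin d) :
    M.Riem ![a, b, c, e] = ∑ f, M.g c f * M.Rup a b f e := rfl

lemma h_mul_Riem (a b c e : Fin d) : ∑ f, M.h c f * M.Riem ![a, b, f, e] = M.Rup a b c e := by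
  simp only [Riem_apply]
  exact M.h_mul_g_mul c (fun f => M.Rup a b f e)

lemma Riem_swap₁ (a b c e : Fin d) : M.Riem ![a, b, c, e] = - M.Riem ![b, a, c, e] := by
  simp only [Riem_apply, M.Rup_antisymm a b, mul_neg, Finset.sum_neg_distrib]

lemma Riem_cyclic (a b c e : Fin d) :
    M.Riem ![a, b, c, e] + M.Riem ![b, e, c, a] + M.Riem ![e, a, c, b] = 0 := by
  simp only [Riem_apply, ← Finset.sum_add_distrib, ← mul_add, Rup_cyclic, mul_zero,
    Finset.sum_const_zero]

/-- The Ricci identity applied to the parallel tensor `g`. -/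
lemma Riem_swap₂ (a b c e : Fin d) : M.Riem ![a, b, c, e] = - M.Riem ![a, b, e, c] := by
  have h := M.ricci_identity a b M.gT ![c, e]
  have h0 : M.nabla M.gT = 0 := by
    funext I; simp [nabla, cd_gT]
  have hz : ∀ a J, M.cd a (0 : Ten d A (Unit ⊕ Fin 2)) J = 0 := by
    intro a J; simp [cd_apply, act]
  rw [h0, hz, hz, sub_zero, eq_comm, neg_eq_zero] at h
  simp only [act, Fin.sum_univ_two, Matrix.cons_val_zero, Matrix.cons_val_one, gT,
    Function.update_self] at h
  simp only [ne_eq, one_ne_zero, not_false_eq_true, Function.update_of_ne, zero_ne_one,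
    Matrix.cons_val_zero, Matrix.cons_val_one] at h
  rw [Riem_apply, Riem_apply, eq_neg_iff_add_eq_zero, ← h, add_comm]
  congr 1
  · exact Finset.sum_congr rfl fun f _ => by rw [M.g_symm e f]; ring
  · exact Finset.sum_congr rfl fun f _ => by ring

/-- The classical octahedron argument: four first Bianchi identities combined with the two
antisymmetries give twice the claim. -/
lemma Riem_pair (a b c e : Fin d) : M.Riem ![a, b, c, e] = M.Riem ![c, e, a, b] := by
  rw [← sub_eq_zero]
  apply two_mul_cancel
  have h1 := M.Riem_cyclic a b c e
  have h2 := M.Riem_cyclic b c e a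
  have h3 := M.Riem_cyclic c e a b
  have h4 := M.Riem_cyclic e a b c
  have s1 := M.Riem_swap₁
  have s2 := M.Riem_swap₂
  linear_combination h1 - h2 - h3 + h4 + s2 a b c e + s2 b c e a - s2 e a c b
    - s2 c e a b + s1 c a e b - s2 a c e b + s1 e b a c - s2 b e a c

section bianchi

/-- Entrywise derivative of a matrix. -/
def Dm (a : Fin d) (P : Matrix (Fin d) (Fin d) A) : Matrix (Fin d) (Fin d) A := P.map (M.D a)

lemma Dm_mul (a : Fin d) (P Q : Matrix (Fin d) (Fin d) A) :
    M.Dm a (P * Q) = M.Dm a P * Q + P * M.Dm a Q := by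
  ext i j
  simp only [Dm, Matrix.map_apply, Matrix.mul_apply, map_sum, Derivation.leibniz, smul_eq_mul,
    Matrix.add_apply, ← Finset.sum_add_distrib]
  exact Finset.sum_congr rfl fun _ _ => by ring

lemma Dm_add (a : Fin d) (P Q : Matrix (Fin d) (Fin d) A) :
    M.Dm a (P + Q) = M.Dm a P + M.Dm a Q := by
  ext i j; simp [Dm]

lemma Dm_sub (a : Fin d) (P Q : Matrix (Fin d) (Fin d) A) :
    M.Dm a (P - Q) = M.Dm a P - M.Dm a Q := by
  ext i j; simp [Dm]

lemma Dm_comm (a b : Fin d) (P : Matrix (Fin d) (Fin d) A) :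
    M.Dm a (M.Dm b P) = M.Dm b (M.Dm a P) := by
  ext i j; simp [Dm, M.D_comm a b]

/-- The connection matrices. -/
def Γmat (a : Fin d) : Matrix (Fin d) (Fin d) A := Matrix.of (M.Γm a)

/-- The curvature matrices. -/
def Rmat (a b : Fin d) : Matrix (Fin d) (Fin d) A := Matrix.of fun c e => M.Rup a b c e

lemma Rmat_eq (a b : Fin d) : M.Rmat a b = M.Dm a (M.Γmat b) - M.Dm b (M.Γmat a)
    + (M.Γmat a * M.Γmat b - M.Γmat b * M.Γmat a) := by
  ext c e
  simp [Rmat, Rup, Dm, Γmat, Γm, Matrix.mul_apply, Finset.sum_sub_distrib]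

/-- With connection and curvature written as matrices, the second Bianchi identity is formal:
partial derivatives commute and everything else cancels in the free non-commutative ring. -/
lemma Rmat_bianchi (a b c : Fin d) :
    (M.Dm a (M.Rmat b c) + M.Γmat a * M.Rmat b c - M.Rmat b c * M.Γmat a)
    + (M.Dm b (M.Rmat c a) + M.Γmat b * M.Rmat c a - M.Rmat c a * M.Γmat b)
    + (M.Dm c (M.Rmat a b) + M.Γmat c * M.Rmat a b - M.Rmat a b * M.Γmat c) = 0 := by
  simp only [Rmat_eq, Dm_add, Dm_sub, Dm_mul, M.Dm_comm b a, M.Dm_comm c a, M.Dm_comm c b]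
  noncomm_ring

lemma Rup_bianchi (a b c i j : Fin d) :
    (M.D a (M.Rup b c i j) + ∑ f, M.Γ i a f * M.Rup b c f j - ∑ f, M.Γ f a j * M.Rup b c i f)
    + (M.D b (M.Rup c a i j) + ∑ f, M.Γ i b f * M.Rup c a f j - ∑ f, M.Γ f b j * M.Rup c a i f)
    + (M.D c (M.Rup a b i j) + ∑ f, M.Γ i c f * M.Rup a b f j - ∑ f, M.Γ f c j * M.Rup a b i f)
    = 0 := by
  have h := congrFun (congrFun (M.Rmat_bianchi a b c) i) j
  simp only [Matrix.add_apply, Matrix.sub_apply, Matrix.mul_apply, Dm, Matrix.map_apply, Rmat,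
    Γmat, Matrix.of_apply, Γm, Matrix.zero_apply] at h
  have hc : ∀ p q r : Fin d, ∑ f, M.Rup p q i f * M.Γ f r j = ∑ f, M.Γ f r j * M.Rup p q i f :=
    fun _ _ _ => Finset.sum_congr rfl fun _ _ => mul_comm _ _
  simpa only [hc] using h

lemma cd_Riem (a b c i j : Fin d) :
    M.cd a M.Riem ![b, c, i, j] = (∑ k, M.g i k * (M.D a (M.Rup b c k j)
      + ∑ f, M.Γ k a f * M.Rup b c f j - ∑ f, M.Γ f a j * M.Rup b c k f))
      - ∑ e, M.Γ e a b * M.Riem ![e, c, i, j] - ∑ e, M.Γ e a c * M.Riem ![b, e, i, j] := by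
  have h1 : M.D a (M.Riem ![b, c, i, j]) = (∑ e, M.Γ e a i * M.Riem ![b, c, e, j])
      + ∑ k, M.g i k * (M.D a (M.Rup b c k j) + ∑ f, M.Γ k a f * M.Rup b c f j) := by
    simp only [Riem_apply, map_sum, Derivation.leibniz, smul_eq_mul, D_g, mul_add,
      Finset.sum_add_distrib, Finset.mul_sum]
    rw [add_comm (∑ x, _) (_ + _), add_assoc, add_comm (∑ x, _) (∑ x, ∑ y, M.g i _ * _),
      ← add_assoc, ← add_assoc]
    congr 1
    congr 1
    · rw [Finset.sum_comm]
      exact Finset.sum_congr rfl fun _ _ => Finset.sum_congr rfl fun _ _ => by ring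
    · rw [Finset.sum_comm]
      exact Finset.sum_congr rfl fun _ _ => Finset.sum_congr rfl fun _ _ => by ring
  have h2 : ∑ e, M.Γ e a j * M.Riem ![b, c, i, e]
      = ∑ k, M.g i k * ∑ f, M.Γ f a j * M.Rup b c k f := by
    simp only [Riem_apply, Finset.mul_sum]
    rw [Finset.sum_comm]
    exact Finset.sum_congr rfl fun _ _ => Finset.sum_congr rfl fun _ _ => by ring
  rw [cd_four, h1, h2]
  simp only [mul_sub, Finset.sum_sub_distrib]
  ring

/-- The matrix identity differs from the covariant one by the Christoffel terms of the first two
curvature indices; these cancel cyclically because the connection is torsion free. -/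
lemma Riem_bianchi (a b c i j : Fin d) :
    M.cd a M.Riem ![b, c, i, j] + M.cd b M.Riem ![c, a, i, j] + M.cd c M.Riem ![a, b, i, j]
      = 0 := by
  have h : (∑ k, M.g i k * ((M.D a (M.Rup b c k j) + ∑ f, M.Γ k a f * M.Rup b c f j
        - ∑ f, M.Γ f a j * M.Rup b c k f)
      + (M.D b (M.Rup c a k j) + ∑ f, M.Γ k b f * M.Rup c a f j
        - ∑ f, M.Γ f b j * M.Rup c a k f)
      + (M.D c (M.Rup a b k j) + ∑ f, M.Γ k c f * M.Rup a b f j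
        - ∑ f, M.Γ f c j * M.Rup a b k f))) = 0 := by
    simp only [Rup_bianchi, mul_zero, Finset.sum_const_zero]
  simp only [mul_add (M.g i _) (_ + _) _, mul_add (M.g i _) (_ - _) _, Finset.sum_add_distrib] at h
  simp only [cd_Riem, M.Γ_symm _ b a, M.Γ_symm _ c a, M.Γ_symm _ c b]
  have s : ∀ p q, M.Riem ![p, q, i, j] = - M.Riem ![q, p, i, j] := fun p q => M.Riem_swap₁ p q i j
  have e1 : ∑ e, M.Γ e a b * M.Riem ![e, c, i, j] = - ∑ e, M.Γ e a b * M.Riem ![c, e, i, j] := by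
    rw [← Finset.sum_neg_distrib]; exact Finset.sum_congr rfl fun e _ => by rw [s e c]; ring
  have e2 : ∑ e, M.Γ e a c * M.Riem ![b, e, i, j] = - ∑ e, M.Γ e a c * M.Riem ![e, b, i, j] := by
    rw [← Finset.sum_neg_distrib]; exact Finset.sum_congr rfl fun e _ => by rw [s b e]; ring
  have e3 : ∑ e, M.Γ e b c * M.Riem ![e, a, i, j] = - ∑ e, M.Γ e b c * M.Riem ![a, e, i, j] := by
    rw [← Finset.sum_neg_distrib]; exact Finset.sum_congr rfl fun e _ => by rw [s e a]; ring
  rw [e1, e2, e3]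
  linear_combination h

end bianchi

/-! ### Ricci, Schouten and Weyl curvature -/

/-- The Ricci tensor. -/
def Ric : Ten d A (Fin 2) := fun I => ∑ c, M.Rup c (I 0) c (I 1)

lemma Ric_eq (a b : Fin d) : M.Ric ![a, b] = ∑ c, ∑ e, M.h c e * M.Riem ![c, a, e, b] := by
  simp only [h_mul_Riem]; rfl

lemma Ric_symm (a b : Fin d) : M.Ric ![a, b] = M.Ric ![b, a] := by
  rw [Ric_eq, Ric_eq, Finset.sum_comm]
  refine Finset.sum_congr rfl fun c _ => Finset.sum_congr rfl fun e _ => ?_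
  rw [M.h_symm, M.Riem_pair]

/-- The scalar curvature. -/
def Sc : A := ∑ a, ∑ b, M.h a b * M.Ric ![a, b]

/-- The trace of the Schouten tensor. -/
def J : A := (1 / (2 * ((d : ℝ) - 1))) • M.Sc

/-- The Schouten tensor. -/
def P : Ten d A (Fin 2) :=
  fun I => (1 / ((d : ℝ) - 2)) • (M.Ric ![I 0, I 1] - M.J * M.g (I 0) (I 1))

/-- The Weyl tensor. -/
def Weyl : Ten d A (Fin 4) := fun I =>
  M.Riem I - (M.g (I 2) (I 0) * M.P ![I 1, I 3] - M.g (I 2) (I 1) * M.P ![I 0, I 3])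
    - (M.g (I 3) (I 1) * M.P ![I 0, I 2] - M.g (I 3) (I 0) * M.P ![I 1, I 2])

/-- The index renaming that brings the two entries to be contracted to the front. -/
def traceEquiv : Fin 4 ≃ Fin 2 ⊕ Fin 2 where
  toFun := ![Sum.inl 0, Sum.inr 0, Sum.inl 1, Sum.inr 1]
  invFun := Sum.elim ![0, 2] ![1, 3]
  left_inv i := by fin_cases i <;> rfl
  right_inv i := by rcases i with i | i <;> fin_cases i <;> rfl

lemma elim_comp_traceEquiv (a b c e : Fin d) :
    Sum.elim ![a, b] ![c, e] ∘ traceEquiv = ![a, c, b, e] := by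
  funext i; fin_cases i <;> rfl

lemma eq_vec_one (I : Fin 1 → Fin d) : I = ![I 0] := by funext i; fin_cases i; rfl

lemma eq_vec_two (I : Fin 2 → Fin d) : I = ![I 0, I 1] := by funext i; fin_cases i <;> rfl

lemma eq_vec_three (I : Fin 3 → Fin d) : I = ![I 0, I 1, I 2] := by
  funext i; fin_cases i <;> rfl

lemma eq_vec_four (I : Fin 4 → Fin d) : I = ![I 0, I 1, I 2, I 3] := by
  funext i; fin_cases i <;> rfl

lemma Ric_eq_ctr : M.Ric = ctr M.h (re traceEquiv M.Riem) := by
  funext I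
  rw [eq_vec_two I, Ric_eq]
  simp only [ctr, re, elim_comp_traceEquiv]

lemma cd_Ric (f a b : Fin d) :
    M.cd f M.Ric ![a, b] = ∑ c, ∑ e, M.h c e * M.cd f M.Riem ![c, a, e, b] := by
  rw [Ric_eq_ctr, cd_ctr, cd_re]
  simp only [ctr, re, elim_comp_traceEquiv]

lemma cd_Riem_swap₁ (f a b c e : Fin d) :
    M.cd f M.Riem ![a, b, c, e] = - M.cd f M.Riem ![b, a, c, e] := by
  simp only [cd_four, M.Riem_swap₁ a b, map_neg, mul_neg, Finset.sum_neg_distrib]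
  have : ∀ i, M.Riem ![a, i, c, e] = - M.Riem ![i, a, c, e] := fun i => M.Riem_swap₁ _ _ _ _
  have h2 : ∀ i, M.Riem ![i, b, c, e] = - M.Riem ![b, i, c, e] := fun i => M.Riem_swap₁ _ _ _ _
  simp only [this, h2, mul_neg, Finset.sum_neg_distrib]
  ring

lemma cd_Riem_pair (f a b c e : Fin d) :
    M.cd f M.Riem ![a, b, c, e] = M.cd f M.Riem ![c, e, a, b] := by
  simp only [cd_four]
  have h1 : ∀ i, M.Riem ![i, b, c, e] = M.Riem ![c, e, i, b] := fun i => M.Riem_pair _ _ _ _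
  have h2 : ∀ i, M.Riem ![a, i, c, e] = M.Riem ![c, e, a, i] := fun i => M.Riem_pair _ _ _ _
  have h3 : ∀ i, M.Riem ![a, b, i, e] = M.Riem ![i, e, a, b] := fun i => M.Riem_pair _ _ _ _
  have h4 : ∀ i, M.Riem ![a, b, c, i] = M.Riem ![c, i, a, b] := fun i => M.Riem_pair _ _ _ _
  rw [M.Riem_pair a b c e]
  simp only [h1, h2, h3, h4]
  ring

lemma cd_Riem_swap₂ (f a b c e : Fin d) :
    M.cd f M.Riem ![a, b, c, e] = - M.cd f M.Riem ![a, b, e, c] := by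
  rw [cd_Riem_pair, cd_Riem_swap₁, cd_Riem_pair]

/-- The contracted second Bianchi identity. -/
lemma div_Riem (b c f : Fin d) :
    ∑ e, ∑ a, M.h e a * M.cd e M.Riem ![a, b, c, f]
      = M.cd c M.Ric ![f, b] - M.cd f M.Ric ![c, b] := by
  have h := fun e a => M.Riem_bianchi e c f a b
  have h' : ∑ e, ∑ a, M.h e a * (M.cd e M.Riem ![c, f, a, b] + M.cd c M.Riem ![f, e, a, b]
      + M.cd f M.Riem ![e, c, a, b]) = 0 := by simp [h]
  simp only [mul_add, Finset.sum_add_distrib] at h'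
  have e1 : ∑ e, ∑ a, M.h e a * M.cd c M.Riem ![f, e, a, b] = - M.cd c M.Ric ![f, b] := by
    simp only [cd_Ric, M.cd_Riem_swap₁ c f, mul_neg, Finset.sum_neg_distrib]
  have e2 : ∑ e, ∑ a, M.h e a * M.cd f M.Riem ![e, c, a, b] = M.cd f M.Ric ![c, b] := by
    simp only [cd_Ric]
  simp only [M.cd_Riem_pair _ _ b c f]
  rw [e1, e2] at h'
  linear_combination h'

lemma D_trace (f : Fin d) (F : Ten d A (Fin 2)) :
    M.D f (∑ a, ∑ b, M.h a b * F ![a, b]) = ∑ a, ∑ b, M.h a b * M.cd f F ![a, b] := by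
  have h := congrFun (M.cd_ctr (κ := Empty) f (re (Equiv.sumEmpty (Fin 2) Empty).symm F))
    Empty.elim
  rw [cd_re] at h
  have hc : ∀ a b : Fin d, (Sum.elim ![a, b] Empty.elim : Fin 2 ⊕ Empty → Fin d)
      ∘ (Equiv.sumEmpty (Fin 2) Empty).symm = ![a, b] := fun a b => by
    funext i; fin_cases i <;> rfl
  simp only [cd_apply, act, Finset.univ_eq_empty, Finset.sum_empty, sub_zero, ctr, re, hc] at h
  rw [h]
  rfl

lemma D_Sc (f : Fin d) : M.D f M.Sc = ∑ a, ∑ b, M.h a b * M.cd f M.Ric ![a, b] :=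
  M.D_trace f M.Ric

lemma cd_Ric_symm (f a b : Fin d) : M.cd f M.Ric ![a, b] = M.cd f M.Ric ![b, a] := by
  simp only [cd_two]
  have h1 : ∀ i, M.Ric ![i, b] = M.Ric ![b, i] := fun i => M.Ric_symm _ _
  have h2 : ∀ i, M.Ric ![a, i] = M.Ric ![i, a] := fun i => M.Ric_symm _ _
  rw [M.Ric_symm a b]; simp only [h1, h2]; ring

/-- The twice contracted second Bianchi identity. -/
lemma two_mul_div_Ric (f : Fin d) :
    2 * ∑ c, ∑ b, M.h c b * M.cd c M.Ric ![b, f] = M.D f M.Sc := by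
  have h : ∑ b, ∑ c, M.h b c * ∑ e, ∑ a, M.h e a * M.cd e M.Riem ![a, b, f, c]
      = ∑ b, ∑ c, M.h b c * (M.cd f M.Ric ![c, b] - M.cd c M.Ric ![f, b]) := by
    simp only [div_Riem]
  simp only [mul_sub, Finset.sum_sub_distrib] at h
  have e1 : ∑ b, ∑ c, M.h b c * M.cd f M.Ric ![c, b] = M.D f M.Sc := by
    rw [D_Sc]
    exact Finset.sum_congr rfl fun _ _ => Finset.sum_congr rfl fun _ _ => by rw [cd_Ric_symm]
  have e2 : ∑ b, ∑ c, M.h b c * M.cd c M.Ric ![f, b] = ∑ c, ∑ b, M.h c b * M.cd c M.Ric ![b, f] := by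
    rw [Finset.sum_comm]
    exact Finset.sum_congr rfl fun _ _ => Finset.sum_congr rfl fun _ _ => by
      rw [cd_Ric_symm, M.h_symm]
  have e3 : ∑ b, ∑ c, M.h b c * ∑ e, ∑ a, M.h e a * M.cd e M.Riem ![a, b, f, c]
      = ∑ e, ∑ a, M.h e a * M.cd e M.Ric ![a, f] := by
    simp only [Finset.mul_sum]
    rw [sum_comm₄]
    refine Finset.sum_congr rfl fun e _ => Finset.sum_congr rfl fun a _ => ?_
    rw [cd_Ric, Finset.mul_sum]
    refine Finset.sum_congr rfl fun b _ => ?_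
    rw [Finset.mul_sum]
    refine Finset.sum_congr rfl fun c _ => ?_
    rw [cd_Riem_swap₁, cd_Riem_swap₂]
    ring
  rw [e1, e2, e3] at h
  linear_combination h

/-- The divergence of the Ricci tensor, in terms of `J`. -/
lemma div_Ric (hd : 3 ≤ d) (f : Fin d) :
    ∑ c, ∑ b, M.h c b * M.cd c M.Ric ![b, f] = ((d : ℝ) - 1) • M.D f M.J := by
  have hd' : (3 : ℝ) ≤ d := by exact_mod_cast hd
  have h1 : (d : ℝ) - 1 ≠ 0 := by linarith
  rw [J, Derivation.map_smul, smul_smul, ← two_mul_div_Ric]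
  have : ((d : ℝ) - 1) * (1 / (2 * ((d : ℝ) - 1))) = 1 / 2 := by field_simp
  rw [this, two_mul, ← two_smul ℝ, smul_smul]
  norm_num

lemma cd_g_mul (e : Fin d) (f : A) (a b : Fin d) :
    M.cd e (fun I : Fin 2 → Fin d => f * M.g (I 0) (I 1)) ![a, b] = M.D e f * M.g a b := by
  have := M.cd_fmul e f M.gT ![a, b]
  rw [cd_gT] at this
  simpa [gT] using this

lemma cd_P (e a b : Fin d) : M.cd e M.P ![a, b]
    = (1 / ((d : ℝ) - 2)) • (M.cd e M.Ric ![a, b] - M.D e M.J * M.g a b) := by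
  have : M.P = (1 / ((d : ℝ) - 2)) • (M.Ric - fun I => M.J * M.g (I 0) (I 1)) := by
    funext I
    rw [eq_vec_two I]; rfl
  rw [this, cd_smul, cd_sub]
  simp only [Pi.smul_apply, Pi.sub_apply, cd_g_mul]

lemma cd_Weyl (e a b c f : Fin d) : M.cd e M.Weyl ![a, b, c, f] = M.cd e M.Riem ![a, b, c, f]
    - (M.g c a * M.cd e M.P ![b, f] - M.g c b * M.cd e M.P ![a, f])
    - (M.g f b * M.cd e M.P ![a, c] - M.g f a * M.cd e M.P ![b, c]) := by
  -- Each correction term is a permutation of `g ⊗ P`, recorded by `s`, and `g` is parallel.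
  have key : ∀ (i j k l : Fin 4) (s : Equiv.Perm (Fin 4)), s 0 = i → s 1 = j → s 2 = k →
      s 3 = l → ∀ I : Fin 4 → Fin d,
      M.cd e (fun I : Fin 4 → Fin d => M.g (I i) (I j) * M.P ![I k, I l]) I
        = M.g (I i) (I j) * M.cd e M.P ![I k, I l] := by
    intro i j k l s hi hj hk hl I
    let t : Fin 2 ⊕ Fin 2 ≃ Fin 4 := finSumFinEquiv.trans s
    have h1 : (fun I : Fin 4 → Fin d => M.g (I i) (I j) * M.P ![I k, I l])
        = re t (mulT M.gT M.P) := by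
      subst hi hj hk hl
      funext I
      simp only [re, mulT, gT]
      congr 2
      funext m; fin_cases m <;> rfl
    rw [h1, cd_re, cd_mulT, cd_gT]
    subst hi hj hk hl
    simp only [re, Pi.add_apply, mulT, Pi.zero_apply, zero_mul, zero_add, gT]
    congr 2
    funext m; fin_cases m <;> rfl
  have hW : M.Weyl = M.Riem - ((fun I => M.g (I 2) (I 0) * M.P ![I 1, I 3])
      - fun I => M.g (I 2) (I 1) * M.P ![I 0, I 3])
      - ((fun I => M.g (I 3) (I 1) * M.P ![I 0, I 2])
      - fun I => M.g (I 3) (I 0) * M.P ![I 1, I 2]) := rfl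
  rw [hW]
  simp only [cd_sub, Pi.sub_apply]
  rw [key 2 0 1 3 ⟨![2, 0, 1, 3], ![1, 2, 0, 3], by decide, by decide⟩ rfl rfl rfl rfl,
    key 2 1 0 3 ⟨![2, 1, 0, 3], ![2, 1, 0, 3], by decide, by decide⟩ rfl rfl rfl rfl,
    key 3 1 0 2 ⟨![3, 1, 0, 2], ![2, 1, 3, 0], by decide, by decide⟩ rfl rfl rfl rfl,
    key 3 0 1 2 ⟨![3, 0, 1, 2], ![1, 2, 3, 0], by decide, by decide⟩ rfl rfl rfl rfl]
  rfl

lemma h_trace_g (F : Fin d → A) (c : Fin d) :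
    ∑ e, ∑ a, M.h e a * (M.g c a * F e) = F c := by
  have : ∀ e, ∑ a, M.h e a * (M.g c a * F e) = if e = c then F e else 0 := by
    intro e
    have h := M.h_mul_g e c
    have h2 : ∑ a, M.h e a * (M.g c a * F e) = (∑ a, M.h e a * M.g a c) * F e := by
      rw [Finset.sum_mul]
      exact Finset.sum_congr rfl fun a _ => by rw [M.g_symm c a]; ring
    rw [h2, h]; simp
  simp [this]

lemma div_P (hd : 3 ≤ d) (f : Fin d) :
    ∑ e, ∑ a, M.h e a * M.cd e M.P ![a, f] = M.D f M.J := by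
  have hd' : (3 : ℝ) ≤ d := by exact_mod_cast hd
  have h1 : (d : ℝ) - 2 ≠ 0 := by linarith
  simp only [cd_P, mul_smul_comm, ← Finset.smul_sum, mul_sub, Finset.sum_sub_distrib]
  rw [div_Ric M hd]
  have : ∑ e, ∑ a, M.h e a * (M.D e M.J * M.g a f) = M.D f M.J := by
    rw [← M.h_trace_g (fun e => M.D e M.J) f]
    exact Finset.sum_congr rfl fun _ _ => Finset.sum_congr rfl fun a _ => by
      rw [M.g_symm f a]; ring
  rw [this]
  have h2 : ((d : ℝ) - 1) • M.D f M.J - M.D f M.J = ((d : ℝ) - 2) • M.D f M.J := by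
    module
  rw [h2, smul_smul, one_div, inv_mul_cancel₀ h1, one_smul]

/-- The divergence of the Weyl tensor. -/
lemma div_Weyl (hd : 3 ≤ d) (b c f : Fin d) :
    ∑ e, ∑ a, M.h e a * M.cd e M.Weyl ![a, b, c, f]
      = (((d : ℝ) - 3) / ((d : ℝ) - 2)) • (M.cd c M.Ric ![f, b] - M.cd f M.Ric ![c, b]
          - M.D c M.J * M.g f b + M.D f M.J * M.g c b) := by
  have hd' : (3 : ℝ) ≤ d := by exact_mod_cast hd
  have h1 : (d : ℝ) - 2 ≠ 0 := by linarith
  simp only [cd_Weyl, mul_sub, Finset.sum_sub_distrib]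
  rw [div_Riem, M.h_trace_g (fun e => M.cd e M.P ![b, f]),
    M.h_trace_g (fun e => M.cd e M.P ![b, c])]
  have e1 : ∀ c b f, ∑ e, ∑ a, M.h e a * (M.g c b * M.cd e M.P ![a, f])
      = M.g c b * M.D f M.J := by
    intro c b f
    rw [← div_P M hd, Finset.mul_sum]
    refine Finset.sum_congr rfl fun _ _ => ?_
    rw [Finset.mul_sum]
    exact Finset.sum_congr rfl fun _ _ => by ring
  rw [e1, e1, cd_P, cd_P, M.cd_Ric_symm c b f, M.cd_Ric_symm f b c, M.g_symm b f, M.g_symm b c]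
  have h2 : (1 : ℝ) - 1 / ((d : ℝ) - 2) = ((d : ℝ) - 3) / ((d : ℝ) - 2) := by field_simp; ring
  rw [← h2]
  simp only [sub_smul, one_smul, smul_sub, smul_add]
  ring_nf

end MetricAlg
end SingularYamabe

namespace SingularYamabe

variable {d : ℕ} {A : Type*} [CommRing A] [Algebra ℝ A]

/-! ### Tensors generated by atoms -/

/-- Families of atoms: tensors tagged with a weight and a degree. -/
abbrev Atoms (d : ℕ) (A : Type*) : Type _ := (κ : Type) → ℕ → ℕ → Ten d A κ → Prop

/-- Tensors obtained from atoms by products, renaming of indices and contractions with `h`;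
weights and degrees are additive. -/
inductive Gen (h : Fin d → Fin d → A) (At : Atoms d A) :
    (κ : Type) → [Fintype κ] → [DecidableEq κ] → ℕ → ℕ → Ten d A κ → Prop
  | one : Gen h At Empty 0 0 (fun _ => 1)
  | atom {κ : Type} [Fintype κ] [DecidableEq κ] {w δ : ℕ} {F : Ten d A κ} :
      At κ w δ F → Gen h At κ w δ F
  | mul {κ μ : Type} [Fintype κ] [DecidableEq κ] [Fintype μ] [DecidableEq μ] {w δ w' δ' : ℕ}
      {F : Ten d A κ} {H : Ten d A μ} :
      Gen h At κ w δ F → Gen h At μ w' δ' H → Gen h At (κ ⊕ μ) (w + w') (δ + δ') (mulT F H)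
  | re {κ μ : Type} [Fintype κ] [DecidableEq κ] [Fintype μ] [DecidableEq μ] {w δ : ℕ}
      {F : Ten d A κ} (e : κ ≃ μ) : Gen h At κ w δ F → Gen h At μ w δ (re e F)
  | ctr {κ : Type} [Fintype κ] [DecidableEq κ] {w δ : ℕ} {F : Ten d A (Fin 2 ⊕ κ)} :
      Gen h At (Fin 2 ⊕ κ) w δ F → Gen h At κ w δ (ctr h F)

/-- Tensors with components in an ideal. -/
def idealTen (Z : Ideal A) (κ : Type) : Submodule ℝ (Ten d A κ) where
  carrier := {F | ∀ J, F J ∈ Z}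
  add_mem' hF hH J := Z.add_mem (hF J) (hH J)
  zero_mem' _ := Z.zero_mem
  smul_mem' r F hF J := by
    have : (r • F) J = algebraMap ℝ A r * F J := by simp [Algebra.smul_def]
    rw [this]; exact Z.mul_mem_left _ (hF J)

/-- Linear combinations, modulo an ideal, of generated tensors of weight `w` and of degree at
least `δ`. -/
def Cl (h : Fin d → Fin d → A) (At : Atoms d A) (Z : Ideal A) (κ : Type) [Fintype κ]
    [DecidableEq κ] (w δ : ℕ) : Submodule ℝ (Ten d A κ) :=
  Submodule.span ℝ {F | ∃ δ', δ ≤ δ' ∧ Gen h At κ w δ' F} ⊔ idealTen Z κ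

namespace Cl

variable {h : Fin d → Fin d → A} {At At' : Atoms d A} {Z Z' : Ideal A} {κ μ ν : Type}
  [Fintype κ] [DecidableEq κ] [Fintype μ] [DecidableEq μ] [Fintype ν] [DecidableEq ν]
  {w w' δ δ' : ℕ}

lemma of_gen {F : Ten d A κ} (hF : Gen h At κ w δ F) (hδ : δ' ≤ δ) : F ∈ Cl h At Z κ w δ' :=
  Submodule.mem_sup_left (Submodule.subset_span ⟨δ, hδ, hF⟩)

lemma of_atom {F : Ten d A κ} (hF : At κ w δ F) : F ∈ Cl h At Z κ w δ :=
  of_gen (Gen.atom hF) le_rfl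

lemma of_ideal {F : Ten d A κ} (hF : ∀ J, F J ∈ Z) : F ∈ Cl h At Z κ w δ :=
  Submodule.mem_sup_right hF

lemma anti (hδ : δ' ≤ δ) : Cl h At Z κ w δ ≤ Cl h At Z κ w δ' :=
  sup_le_sup_right (Submodule.span_mono (by rintro F ⟨k, hk, hF⟩; exact ⟨k, hδ.trans hk, hF⟩)) _

/-- Induction principle. -/
lemma induct {F : Ten d A κ} (hF : F ∈ Cl h At Z κ w δ) {S : Submodule ℝ (Ten d A κ)}
    (hgen : ∀ δ' F, δ ≤ δ' → Gen h At κ w δ' F → F ∈ S) (hZ : ∀ F, (∀ J, F J ∈ Z) → F ∈ S) :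
    F ∈ S := by
  have : Cl h At Z κ w δ ≤ S :=
    sup_le (Submodule.span_le.2 fun F ⟨k, hk, hF⟩ => hgen k F hk hF) fun F hF => hZ F hF
  exact this hF

/-- Multiplication by a tensor as a linear map. -/
def mulL (F : Ten d A κ) : Ten d A μ →ₗ[ℝ] Ten d A (κ ⊕ μ) where
  toFun H := mulT F H
  map_add' H H' := by funext J; simp [mulT, mul_add]
  map_smul' r H := by funext J; simp [mulT]

/-- Multiplication by a tensor as a linear map. -/
def mulR (H : Ten d A μ) : Ten d A κ →ₗ[ℝ] Ten d A (κ ⊕ μ) where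
  toFun F := mulT F H
  map_add' F F' := by funext J; simp [mulT, add_mul]
  map_smul' r F := by funext J; simp [mulT]

lemma mul {F : Ten d A κ} {H : Ten d A μ} (hF : F ∈ Cl h At Z κ w δ)
    (hH : H ∈ Cl h At Z μ w' δ') : mulT F H ∈ Cl h At Z (κ ⊕ μ) (w + w') (δ + δ') := by
  refine induct hF (S := (Cl h At Z (κ ⊕ μ) (w + w') (δ + δ')).comap (mulR H)) ?_ ?_
  · intro k F hk hF
    refine induct hH (S := (Cl h At Z (κ ⊕ μ) (w + w') (δ + δ')).comap (mulL F)) ?_ ?_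
    · intro k' H hk' hH
      exact of_gen (Gen.mul hF hH) (add_le_add hk hk')
    · intro H hH
      exact of_ideal fun J => Z.mul_mem_left _ (hH _)
  · intro F hF
    exact of_ideal fun J => Z.mul_mem_right _ (hF _)

/-- Renaming as a linear map. -/
def reL (e : κ ≃ μ) : Ten d A κ →ₗ[ℝ] Ten d A μ where
  toFun F := re e F
  map_add' _ _ := rfl
  map_smul' _ _ := rfl

lemma re {F : Ten d A κ} (e : κ ≃ μ) (hF : F ∈ Cl h At Z κ w δ) :
    re e F ∈ Cl h At Z μ w δ := by
  refine induct hF (S := (Cl h At Z μ w δ).comap (reL e)) ?_ ?_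
  · intro k F hk hF
    exact of_gen (Gen.re e hF) hk
  · intro F hF
    exact of_ideal fun J => hF _

/-- Contraction as a linear map. -/
def ctrL (h : Fin d → Fin d → A) : Ten d A (Fin 2 ⊕ κ) →ₗ[ℝ] Ten d A κ where
  toFun F := SingularYamabe.ctr h F
  map_add' F F' := by funext J; simp [SingularYamabe.ctr, mul_add, Finset.sum_add_distrib]
  map_smul' r F := by funext J; simp [SingularYamabe.ctr, Finset.smul_sum]

lemma ctr {F : Ten d A (Fin 2 ⊕ κ)} (hF : F ∈ Cl h At Z (Fin 2 ⊕ κ) w δ) :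
    ctr h F ∈ Cl h At Z κ w δ := by
  refine induct hF (S := (Cl h At Z κ w δ).comap (ctrL h)) ?_ ?_
  · intro k F hk hF
    exact of_gen (Gen.ctr hF) hk
  · intro F hF
    refine of_ideal fun J => ?_
    change ∑ b, ∑ c, h b c * F (Sum.elim ![b, c] J) ∈ Z
    exact Z.sum_mem fun _ _ => Z.sum_mem fun _ _ => Z.mul_mem_left _ (hF _)

/-- Substitution of atoms. -/
lemma subst_gen {F : Ten d A κ} (hF : Gen h At κ w δ F)
    (hat : ∀ (κ : Type) [Fintype κ] [DecidableEq κ] (w δ : ℕ) (F : Ten d A κ), At κ w δ F →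
      ∃ (_ : Fintype κ) (_ : DecidableEq κ), F ∈ Cl h At' Z' κ w δ) : F ∈ Cl h At' Z' κ w δ := by
  induction hF with
  | one => exact of_gen Gen.one le_rfl
  | @atom κ i j w δ F h =>
    -- The hypothesis on atoms brings its own instances on the index type; both kinds being
    -- subsingletons, they are identified with the ambient ones.
    obtain ⟨i', j', h⟩ := hat _ _ _ _ h
    cases Subsingleton.elim i' i
    cases Subsingleton.elim j' j
    exact h
  | mul _ _ h1 h2 => exact mul h1 h2
  | re e _ h => exact re e h
  | ctr _ h => exact ctr h

lemma subst {F : Ten d A κ} (hF : F ∈ Cl h At Z κ w δ) (hZ : Z ≤ Z')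
    (hat : ∀ (κ : Type) [Fintype κ] [DecidableEq κ] (w δ : ℕ) (F : Ten d A κ), At κ w δ F →
      ∃ (_ : Fintype κ) (_ : DecidableEq κ), F ∈ Cl h At' Z' κ w δ) : F ∈ Cl h At' Z' κ w δ :=
  induct hF (fun _ _ hk hF => anti hk (subst_gen hF hat)) fun _ hF => of_ideal fun J => hZ (hF J)

end Cl

namespace MetricAlg

variable (M : MetricAlg d A) {ε κ μ : Type} [Fintype κ] [DecidableEq κ] [Fintype μ]
  [DecidableEq μ] [Fintype ε] [DecidableEq ε]

/-- Covariant derivative along a family of vectors. -/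
def dV (V : (ε → Fin d) → Fin d → A) (F : Ten d A κ) : Ten d A (ε ⊕ κ) :=
  fun I => ∑ b, V (I ∘ Sum.inl) b * M.cd b F (I ∘ Sum.inr)

lemma dV_apply (V : (ε → Fin d) → Fin d → A) (F : Ten d A κ) (I : ε ⊕ κ → Fin d) :
    M.dV V F I = ∑ b, V (I ∘ Sum.inl) b * M.cd b F (I ∘ Sum.inr) := rfl

/-- Moving the first block of indices past the second one. -/
def sumLeftComm (α β γ : Type) : α ⊕ (β ⊕ γ) ≃ β ⊕ (α ⊕ γ) :=
  ((Equiv.sumAssoc α β γ).symm.trans ((Equiv.sumComm α β).sumCongr (Equiv.refl γ))).trans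
    (Equiv.sumAssoc β α γ)

lemma dV_mulT (V : (ε → Fin d) → Fin d → A) (F : Ten d A κ) (H : Ten d A μ) :
    M.dV V (mulT F H) = re (Equiv.sumAssoc ε κ μ) (mulT (M.dV V F) H)
      + re (sumLeftComm κ ε μ) (mulT F (M.dV V H)) := by
  funext I
  simp only [dV, cd_mulT, Pi.add_apply, re, mulT, mul_add, Finset.sum_add_distrib, Finset.sum_mul,
    Finset.mul_sum]
  congr 1
  · exact Finset.sum_congr rfl fun b _ => (mul_assoc _ _ _).symm
  · exact Finset.sum_congr rfl fun b _ => mul_left_comm _ _ _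

lemma dV_re (V : (ε → Fin d) → Fin d → A) (e : κ ≃ μ) (F : Ten d A κ) :
    M.dV V (re e F) = re ((Equiv.refl ε).sumCongr e) (M.dV V F) := by
  funext I
  simp only [dV, cd_re, re]
  rfl

lemma dV_ctr (V : (ε → Fin d) → Fin d → A) (F : Ten d A (Fin 2 ⊕ κ)) :
    M.dV V (ctr M.h F) = ctr M.h (re (sumLeftComm ε (Fin 2) κ) (M.dV V F)) := by
  funext I
  have h1 : ∀ b c, (Sum.elim ![b, c] I ∘ sumLeftComm ε (Fin 2) κ) ∘ Sum.inl = I ∘ Sum.inl :=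
    fun b c => by funext i; rfl
  have h2 : ∀ b c, (Sum.elim ![b, c] I ∘ sumLeftComm ε (Fin 2) κ) ∘ Sum.inr
      = Sum.elim ![b, c] (I ∘ Sum.inr) := fun b c => by
    funext i; rcases i with i | i <;> rfl
  simp only [dV, cd_ctr, re, ctr, Finset.mul_sum, h1, h2]
  rw [Finset.sum_comm]
  refine Finset.sum_congr rfl fun b _ => ?_
  rw [Finset.sum_comm]
  exact Finset.sum_congr rfl fun c _ => Finset.sum_congr rfl fun e _ => by ring

lemma dV_const (V : (ε → Fin d) → Fin d → A) :
    M.dV V (fun _ : Empty → Fin d => (1 : A)) = 0 := by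
  funext I
  simp [dV, cd_apply, act]

/-- `dV` as a linear map. -/
def dVL (V : (ε → Fin d) → Fin d → A) : Ten d A κ →ₗ[ℝ] Ten d A (ε ⊕ κ) where
  toFun F := M.dV V F
  map_add' F H := by funext I; simp [dV, cd_add, mul_add, Finset.sum_add_distrib]
  map_smul' r F := by funext I; simp [dV, cd_smul, Finset.smul_sum]

/-- The connection terms are algebraic in the components, so it is enough that the plain derivatives
along `V` preserve the ideal. -/
lemma dV_mem_ideal {Z : Ideal A} (V : (ε → Fin d) → Fin d → A)
    (hZ : ∀ f ∈ Z, ∀ i, ∑ b, V i b * M.D b f ∈ Z) (F : Ten d A κ) (hF : ∀ J, F J ∈ Z)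
    (I : ε ⊕ κ → Fin d) : M.dV V F I ∈ Z := by
  simp only [dV, cd_apply, mul_sub, Finset.sum_sub_distrib]
  refine Z.sub_mem (hZ _ (hF _) _) (Z.sum_mem fun b _ => Z.mul_mem_left _ ?_)
  exact Z.sum_mem fun _ _ => Z.sum_mem fun _ _ => Z.mul_mem_left _ (hF _)

variable {At At' : Atoms d A} {Z : Ideal A} {w δ : ℕ}

/-- By the Leibniz rule exactly one atom is differentiated in each summand, and `h` is parallel, so
only derivatives of atoms matter. Two families `At` and `At'` are needed because differentiation
along the gradient of `σ` enlarges the list of atoms. -/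
lemma dV_gen {κ : Type} (V : (ε → Fin d) → Fin d → A)
    (hsub : ∀ (κ : Type) (w δ : ℕ) (F : Ten d A κ), At κ w δ F → At' κ w δ F)
    (hat : ∀ (κ : Type) [Fintype κ] [DecidableEq κ] (w δ : ℕ) (F : Ten d A κ), At κ w δ F →
      ∃ (_ : Fintype κ) (_ : DecidableEq κ), M.dV V F ∈ Cl M.h At' Z (ε ⊕ κ) (w + 1) δ) [Fintype κ] [DecidableEq κ] {F : Ten d A κ}
    (hF : Gen M.h At κ w δ F) :
    M.dV V F ∈ Cl M.h At' Z (ε ⊕ κ) (w + 1) δ := by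
  have up : ∀ {κ : Type} [Fintype κ] [DecidableEq κ] {w δ : ℕ} {F : Ten d A κ},
      Gen M.h At κ w δ F → F ∈ Cl M.h At' Z κ w δ := fun hF =>
    Cl.subst_gen hF fun κ i j w δ F hF => ⟨i, j, Cl.of_atom (hsub κ w δ F hF)⟩
  induction hF with
  | one => rw [dV_const]; exact Submodule.zero_mem _
  | @atom κ i j w δ F h =>
    obtain ⟨i', j', h⟩ := hat _ _ _ _ h
    cases Subsingleton.elim i' i
    cases Subsingleton.elim j' j
    exact h
  | @mul κ μ _ _ _ _ w δ w' δ' F H hF hH h1 h2 =>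
    rw [dV_mulT]
    refine Submodule.add_mem _ ?_ ?_
    · have := Cl.re (Equiv.sumAssoc ε κ μ) (Cl.mul h1 (up hH))
      rwa [show w + 1 + w' = w + w' + 1 by ring] at this
    · have := Cl.re (sumLeftComm κ ε μ) (Cl.mul (up hF) h2)
      exact this
  | re e _ h => rw [dV_re]; exact Cl.re _ h
  | ctr _ h => rw [dV_ctr]; exact Cl.ctr (Cl.re _ h)

/-- Differentiation raises the weight by one and preserves the degree. -/
theorem dV_mem (V : (ε → Fin d) → Fin d → A) (hZ : ∀ f ∈ Z, ∀ i, ∑ b, V i b * M.D b f ∈ Z)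
    (hsub : ∀ (κ : Type) (w δ : ℕ) (F : Ten d A κ), At κ w δ F → At' κ w δ F)
    (hat : ∀ (κ : Type) [Fintype κ] [DecidableEq κ] (w δ : ℕ) (F : Ten d A κ), At κ w δ F →
      ∃ (_ : Fintype κ) (_ : DecidableEq κ), M.dV V F ∈ Cl M.h At' Z (ε ⊕ κ) (w + 1) δ) {F : Ten d A κ} (hF : F ∈ Cl M.h At Z κ w δ) :
    M.dV V F ∈ Cl M.h At' Z (ε ⊕ κ) (w + 1) δ :=
  Cl.induct hF (S := (Cl M.h At' Z (ε ⊕ κ) (w + 1) δ).comap (M.dVL V))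
    (fun _ _ hk hF => Cl.anti hk (M.dV_gen V hsub hat hF))
    fun F hF => Cl.of_ideal (M.dV_mem_ideal V hZ F hF)

end MetricAlg

namespace Cl

variable {h : Fin d → Fin d → A} {At : Atoms d A} {Z : Ideal A} {κ μ ν : Type}
  [Fintype κ] [DecidableEq κ] [Fintype μ] [DecidableEq μ] [Fintype ν] [DecidableEq ν]
  {w w' δ δ' : ℕ}

/-- Contraction of a product. -/
lemma mul_ctr {F : Ten d A κ} {H : Ten d A μ} (hF : F ∈ Cl h At Z κ w δ)
    (hH : H ∈ Cl h At Z μ w' δ') (e : κ ⊕ μ ≃ Fin 2 ⊕ ν) :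
    (fun J : ν → Fin d => ∑ b, ∑ c, h b c * (F (fun i => Sum.elim ![b, c] J (e (Sum.inl i)))
      * H (fun i => Sum.elim ![b, c] J (e (Sum.inr i)))))
      ∈ Cl h At Z ν (w + w') (δ + δ') :=
  ctr (re e (mul hF hH))

/-- A product with renamed indices. -/
lemma mul_re {F : Ten d A κ} {H : Ten d A μ} (hF : F ∈ Cl h At Z κ w δ)
    (hH : H ∈ Cl h At Z μ w' δ') (e : κ ⊕ μ ≃ ν) :
    (fun J : ν → Fin d => F (fun i => J (e (Sum.inl i))) * H (fun i => J (e (Sum.inr i))))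
      ∈ Cl h At Z ν (w + w') (δ + δ') :=
  re e (mul hF hH)

/-- Contraction with a covector. -/
lemma iv {X : Fin d → A} {F : Ten d A (Unit ⊕ κ)}
    (hX : (fun I : Fin 1 → Fin d => X (I 0)) ∈ Cl h At Z (Fin 1) w δ)
    (hF : F ∈ Cl h At Z (Unit ⊕ κ) w' δ') :
    iv (fun b => ∑ a, h a b * X a) F ∈ Cl h At Z κ (w + w') (δ + δ') := by
  have := mul_ctr hX hF (⟨Sum.elim (fun _ => Sum.inl 0) (Sum.elim (fun _ => Sum.inl 1) Sum.inr),
    Sum.elim ![Sum.inl 0, Sum.inr (Sum.inl ())] (fun i => Sum.inr (Sum.inr i)),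
    by rintro (i | i | i) <;> [(fin_cases i; rfl); rfl; rfl],
    by rintro (i | i) <;> [(fin_cases i <;> rfl); rfl]⟩ : Fin 1 ⊕ (Unit ⊕ κ) ≃ Fin 2 ⊕ κ)
  convert this using 1
  funext J
  simp only [SingularYamabe.iv, Finset.sum_mul]
  rw [Finset.sum_comm]
  refine Finset.sum_congr rfl fun b _ => Finset.sum_congr rfl fun c _ => ?_
  rw [mul_assoc]
  congr 3
  funext i
  rcases i with i | i <;> rfl

end Cl

/-! Membership of scalars, covectors and bilinear forms given by their components. -/

/-- Membership of a scalar. -/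
def Cl0 (h : Fin d → Fin d → A) (At : Atoms d A) (Z : Ideal A) (w δ : ℕ) (f : A) : Prop :=
  (fun _ : Fin 0 → Fin d => f) ∈ Cl h At Z (Fin 0) w δ

/-- Membership of a covector. -/
def Cl1 (h : Fin d → Fin d → A) (At : Atoms d A) (Z : Ideal A) (w δ : ℕ) (X : Fin d → A) : Prop :=
  (fun I : Fin 1 → Fin d => X (I 0)) ∈ Cl h At Z (Fin 1) w δ

/-- Membership of a bilinear form. -/
def Cl2 (h : Fin d → Fin d → A) (At : Atoms d A) (Z : Ideal A) (w δ : ℕ)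
    (Y : Fin d → Fin d → A) : Prop :=
  (fun I : Fin 2 → Fin d => Y (I 0) (I 1)) ∈ Cl h At Z (Fin 2) w δ

section

variable {h : Fin d → Fin d → A} {At : Atoms d A} {Z : Ideal A} {w w' δ δ' : ℕ}

lemma Cl0.mul {f f' : A} (hf : Cl0 h At Z w δ f) (hf' : Cl0 h At Z w' δ' f') :
    Cl0 h At Z (w + w') (δ + δ') (f * f') :=
  Cl.mul_re hf hf' (Equiv.sumEmpty (Fin 0) (Fin 0))

lemma Cl0.smul₁ {f : A} {X : Fin d → A} (hf : Cl0 h At Z w δ f) (hX : Cl1 h At Z w' δ' X) :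
    Cl1 h At Z (w + w') (δ + δ') (fun a => f * X a) :=
  Cl.mul_re hf hX (Equiv.emptySum (Fin 0) (Fin 1))

lemma Cl1.dot {X Y : Fin d → A} (hX : Cl1 h At Z w δ X) (hY : Cl1 h At Z w' δ' Y) :
    Cl0 h At Z (w + w') (δ + δ') (∑ b, ∑ c, h b c * (X b * Y c)) :=
  Cl.mul_ctr hX hY (⟨Sum.elim ![Sum.inl 0] ![Sum.inl 1],
    Sum.elim ![Sum.inl 0, Sum.inr 0] Fin.elim0, by decide, by decide⟩ :
    Fin 1 ⊕ Fin 1 ≃ Fin 2 ⊕ Fin 0)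

lemma Cl1.tmul {X Y : Fin d → A} (hX : Cl1 h At Z w δ X) (hY : Cl1 h At Z w' δ' Y) :
    Cl2 h At Z (w + w') (δ + δ') (fun b c => X b * Y c) :=
  Cl.mul_re hX hY (finSumFinEquiv : Fin 1 ⊕ Fin 1 ≃ Fin 2)

lemma Cl2.mulVec {Y : Fin d → Fin d → A} {X : Fin d → A} (hY : Cl2 h At Z w δ Y)
    (hX : Cl1 h At Z w' δ' X) :
    Cl1 h At Z (w + w') (δ + δ') (fun a => ∑ b, ∑ c, h b c * (Y a b * X c)) :=
  Cl.mul_ctr hY hX (⟨Sum.elim ![Sum.inr 0, Sum.inl 0] ![Sum.inl 1],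
    Sum.elim ![Sum.inl 1, Sum.inr 0] ![Sum.inl 0], by decide, by decide⟩ :
    Fin 2 ⊕ Fin 1 ≃ Fin 2 ⊕ Fin 1)

lemma Cl2.mul {Y Y' : Fin d → Fin d → A} (hY : Cl2 h At Z w δ Y)
    (hY' : Cl2 h At Z w' δ' Y') :
    Cl2 h At Z (w + w') (δ + δ') (fun a e => ∑ b, ∑ c, h b c * (Y a b * Y' c e)) :=
  Cl.mul_ctr hY hY' (⟨Sum.elim ![Sum.inr 0, Sum.inl 0] ![Sum.inl 1, Sum.inr 1],
    Sum.elim ![Sum.inl 1, Sum.inr 0] ![Sum.inl 0, Sum.inr 1], by decide, by decide⟩ :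
    Fin 2 ⊕ Fin 2 ≃ Fin 2 ⊕ Fin 2)

lemma Cl2.trace {Y : Fin d → Fin d → A} (hY : Cl2 h At Z w δ Y) :
    Cl0 h At Z w δ (∑ b, ∑ c, h b c * Y b c) :=
  Cl.ctr (Cl.re (Equiv.sumEmpty (Fin 2) (Fin 0)).symm hY)

end

end SingularYamabe

/-! ### The unit conormal and the class of tensors built from hypersurface data -/

namespace SingularYamabe

variable {d : ℕ} {A : Type*} [CommRing A] [Algebra ℝ A]

namespace MetricAlg

variable (M : MetricAlg d A) {κ : Type} [Fintype κ] [DecidableEq κ]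

/-- Raising the index of a covector. -/
def up (X : Fin d → A) (b : Fin d) : A := ∑ a, M.h b a * X a

lemma up_eq (X : Fin d → A) : M.up X = fun b => ∑ a, M.h a b * X a := by
  funext b
  exact Finset.sum_congr rfl fun a _ => by rw [M.h_symm]

/-- The covariant derivative of a covector. -/
def cdC (a : Fin d) (X : Fin d → A) (b : Fin d) : A := M.D a (X b) - ∑ c, M.Γ c a b * X c

lemma cd_fin_one (a : Fin d) (X : Fin d → A) (I : Fin 1 → Fin d) :
    M.cd a (fun I : Fin 1 → Fin d => X (I 0)) I = M.cdC a X (I 0) := by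
  conv_lhs => rw [eq_vec_one I]
  rw [cd_one]
  rfl

lemma cdUp_up (a : Fin d) (X : Fin d → A) : M.cdUp a (M.up X) = M.up (M.cdC a X) := by
  funext c
  simp only [cdUp, up, cdC, map_sum, Derivation.leibniz, smul_eq_mul, D_h, mul_sub,
    Finset.sum_add_distrib, Finset.sum_sub_distrib, Finset.mul_sum, mul_neg,
    Finset.sum_neg_distrib, mul_add]
  have h1 : ∑ x, ∑ i, X x * (M.Γ c a i * M.h i x) = ∑ x, ∑ i, M.Γ c a x * (M.h x i * X i) := by
    rw [Finset.sum_comm]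
    exact Finset.sum_congr rfl fun _ _ => Finset.sum_congr rfl fun _ _ => by ring
  have h2 : ∑ x, ∑ i, X x * (M.Γ x a i * M.h c i) = ∑ x, ∑ i, M.h c x * (M.Γ i a x * X i) := by
    rw [Finset.sum_comm]
    exact Finset.sum_congr rfl fun _ _ => Finset.sum_congr rfl fun _ _ => by ring
  rw [h1, h2]
  ring

/-- The covariant derivative for tensors indexed by `Fin k`. -/
def covF {k : ℕ} (F : Ten d A (Fin k)) : Ten d A (Fin (k + 1)) :=
  fun I => M.cd (I 0) F (Fin.tail I)

/-- Iterated covariant derivatives. -/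
def iterCov {k : ℕ} (F : Ten d A (Fin k)) : (m : ℕ) → Ten d A (Fin (k + m))
  | 0 => F
  | m + 1 => M.covF (iterCov F m)

/-- Separating the first index. -/
def consEquiv (k : ℕ) : Fin (k + 1) ≃ Unit ⊕ Fin k where
  toFun := Fin.cases (Sum.inl ()) Sum.inr
  invFun := Sum.elim (fun _ => 0) Fin.succ
  left_inv i := by refine Fin.cases ?_ (fun i => ?_) i <;> rfl
  right_inv i := by rcases i with i | i <;> rfl

lemma nabla_eq_re {k : ℕ} (F : Ten d A (Fin k)) : M.nabla F = re (consEquiv k) (M.covF F) := by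
  funext I; rfl

lemma covF_eq_re {k : ℕ} (F : Ten d A (Fin k)) :
    M.covF F = re (consEquiv k).symm (M.nabla F) := by
  funext I; rfl

/-- Contraction of the first index with a linear combination. -/
lemma dV_iv {ε : Type} [Fintype ε] [DecidableEq ε] (V : (ε → Fin d) → Fin d → A) (v : Fin d → A)
    (F : Ten d A (Unit ⊕ κ)) :
    M.dV V (iv v F) = iv v (re (sumLeftComm ε Unit κ) (M.dV V F))
      + fun I => iv (fun c => ∑ b, V (I ∘ Sum.inl) b * M.cdUp b v c) F (I ∘ Sum.inr) := by
  funext I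
  have h1 : ∀ b, (Sum.elim (fun _ => b) I ∘ sumLeftComm ε Unit κ) ∘ Sum.inl = I ∘ Sum.inl :=
    fun b => by funext i; rfl
  have h2 : ∀ b, (Sum.elim (fun _ => b) I ∘ sumLeftComm ε Unit κ) ∘ Sum.inr
      = Sum.elim (fun _ => b) (I ∘ Sum.inr) := fun b => by
    funext i; rcases i with i | i <;> rfl
  simp only [dV_apply, cd_iv, Pi.add_apply, mul_add, Finset.sum_add_distrib]
  congr 1
  · simp only [iv, re, dV_apply, h1, h2, Finset.mul_sum]
    rw [Finset.sum_comm]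
    exact Finset.sum_congr rfl fun _ _ => Finset.sum_congr rfl fun _ _ => by ring
  · simp only [iv, Finset.mul_sum, Finset.sum_mul]
    rw [Finset.sum_comm]
    exact Finset.sum_congr rfl fun _ _ => Finset.sum_congr rfl fun _ _ => by ring

end MetricAlg

/-- A unit conormal `N` of a hypersurface with vanishing ideal `Z`. -/
structure HypAlg (d : ℕ) (A : Type*) [CommRing A] [Algebra ℝ A] extends MetricAlg d A where
  /-- the conormal -/
  N : Fin d → A
  /-- the functions vanishing on the hypersurface -/
  Z : Ideal A
  N_unit : ∑ b, ∑ c, h b c * (N b * N c) = 1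
  -- A normal derivative need not preserve `Z`, so congruences on the hypersurface may be
  -- differentiated tangentially only.
  Z_tan : ∀ f ∈ Z, ∀ a,
    ∑ b, ((if a = b then 1 else 0) - N a * toMetricAlg.up N b) * D b f ∈ Z

namespace HypAlg

variable (M : HypAlg d A) {κ μ : Type} [Fintype κ] [DecidableEq κ] [Fintype μ] [DecidableEq μ]

/-- The normal vector. -/
def Nup : Fin d → A := M.up M.N

/-- The tangential projection. -/
def γ (a b : Fin d) : A := (if a = b then 1 else 0) - M.N a * M.Nup b

lemma Nup_mul_N : ∑ b, M.Nup b * M.N b = 1 := by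
  rw [← M.N_unit]
  refine Finset.sum_congr rfl fun b _ => ?_
  rw [Nup, MetricAlg.up, Finset.sum_mul]
  exact Finset.sum_congr rfl fun _ _ => by ring

lemma Nup_mul_γ (b : Fin d) : ∑ a, M.Nup a * M.γ a b = 0 := by
  simp only [γ, mul_sub, Finset.sum_sub_distrib, ← mul_assoc, ← Finset.sum_mul, Nup_mul_N]
  simp

lemma γ_mul (a : Fin d) (f : Fin d → A) :
    ∑ b, M.γ a b * f b = f a - M.N a * ∑ b, M.Nup b * f b := by
  simp [γ, sub_mul, Finset.sum_sub_distrib, Finset.mul_sum, mul_assoc]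

lemma γ_mul_γ (a c : Fin d) : ∑ b, M.γ a b * M.γ b c = M.γ a c := by
  rw [γ_mul, Nup_mul_γ]; ring

/-- The projection of a tensor in all its indices. -/
def tang (F : Ten d A κ) : Ten d A κ :=
  fun I => ∑ L : κ → Fin d, (∏ m, M.γ (I m) (L m)) * F L

/-- The second fundamental form. -/
def II : Ten d A (Fin 2) := M.tang (M.covF (k := 1) (fun I => M.N (I 0)))

/-- Iterated intrinsic derivatives of the second fundamental form. -/
def iterII : (ℓ : ℕ) → Ten d A (Fin (2 + ℓ))
  | 0 => M.II
  | ℓ + 1 => M.tang (M.covF (iterII ℓ))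

/-- The tangential part of the covariant derivative. -/
def tnab (F : Ten d A κ) : Ten d A (Unit ⊕ κ) := M.dV (fun f b => M.γ (f ()) b) F

lemma tnab_apply (F : Ten d A κ) (I : Unit ⊕ κ → Fin d) :
    M.tnab F I = ∑ b, M.γ (I (Sum.inl ())) b * M.cd b F (I ∘ Sum.inr) := rfl

/-- Projection of the first index. -/
def pr (F : Ten d A (Unit ⊕ κ)) : Ten d A (Unit ⊕ κ) :=
  fun I => ∑ b, M.γ (I (Sum.inl ())) b * F (Sum.elim (fun _ => b) (I ∘ Sum.inr))

lemma tnab_eq_pr (F : Ten d A κ) : M.tnab F = M.pr (M.nabla F) := rfl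

lemma pr_eq (F : Ten d A (Unit ⊕ κ)) : M.pr F = F - fun I => M.N (I (Sum.inl ()))
    * iv M.Nup F (I ∘ Sum.inr) := by
  funext I
  rw [pr, γ_mul]
  simp only [Pi.sub_apply, iv]
  congr 2
  funext i; rcases i with i | i <;> rfl

/-- The tensors from which the contractions are built. -/
inductive HAtom (ρ : ℕ) : Atoms d A
  | N : HAtom ρ (Fin 1) 0 0 (fun I => M.N (I 0))
  | II (ℓ : ℕ) : HAtom ρ (Fin (2 + ℓ)) (1 + ℓ) 1 (M.iterII ℓ)
  -- The degree of a curvature factor is left open: `ρ = 2` makes every term with `∇^m R`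
  -- negligible, `ρ = 1` keeps track of the linear ones.
  | R (m : ℕ) : HAtom ρ (Fin (4 + m)) (2 + m) ρ (M.iterCov M.Riem m)
  | W (m : ℕ) : HAtom ρ (Fin (4 + m)) (2 + m) 1 (M.iterCov M.Weyl m)
  -- A Weyl factor with two normals counts as nonlinear. It is an atom of its own, because
  -- contraction of `W` with conormals alone would leave the degree at one.
  | WNN (m : ℕ) (κ : Type) (e : Fin (4 + m) ≃ Unit ⊕ (Unit ⊕ κ)) :
      HAtom ρ κ (2 + m) 2 (iv M.Nup (iv M.Nup (re e (M.iterCov M.Weyl m))))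

/-- The class of tensors generated by `HAtom`, modulo tensors vanishing on the hypersurface. -/
abbrev HC (ρ : ℕ) (κ : Type) [Fintype κ] [DecidableEq κ] (w δ : ℕ) : Submodule ℝ (Ten d A κ) :=
  Cl M.h (M.HAtom ρ) M.Z κ w δ

variable {M} {ρ w δ w' δ' : ℕ}

lemma HC_N : (fun I : Fin 1 → Fin d => M.N (I 0)) ∈ M.HC ρ (Fin 1) 0 0 :=
  Cl.of_atom HAtom.N

lemma HC_iv {F : Ten d A (Unit ⊕ κ)} (hF : F ∈ M.HC ρ (Unit ⊕ κ) w δ) :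
    iv M.Nup F ∈ M.HC ρ κ w δ := by
  have := Cl.iv HC_N hF
  rw [← M.up_eq, zero_add, zero_add] at this
  exact this

/-- Merging a one-element index set. -/
def unitEquiv (κ : Type) : Fin 1 ⊕ κ ≃ Unit ⊕ κ :=
  (Equiv.ofUnique (Fin 1) Unit).sumCongr (Equiv.refl κ)

lemma HC_pr {F : Ten d A (Unit ⊕ κ)} (hF : iv M.Nup F ∈ M.HC ρ κ w δ) :
    F - M.pr F ∈ M.HC ρ (Unit ⊕ κ) w δ := by
  rw [pr_eq, sub_sub_cancel]
  have := Cl.mul_re HC_N hF (unitEquiv κ)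
  rw [zero_add, zero_add] at this
  exact this

lemma HC_pr_mem {F : Ten d A (Unit ⊕ κ)} (hF : F ∈ M.HC ρ (Unit ⊕ κ) w δ) :
    M.pr F ∈ M.HC ρ (Unit ⊕ κ) w δ := by
  have := Submodule.sub_mem _ hF (HC_pr (HC_iv hF))
  rwa [sub_sub_cancel] at this

variable (M)

/-- Differentiate `⟨N, N⟩ = 1`, which holds identically and not only on the hypersurface. -/
lemma Nup_mul_cdC_N (a : Fin d) : ∑ c, M.Nup c * M.cdC a M.N c = 0 := by
  apply two_mul_cancel
  have h := congrArg (M.D a) M.Nup_mul_N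
  rw [map_sum] at h
  simp only [Derivation.leibniz, smul_eq_mul, Finset.sum_add_distrib] at h
  rw [Derivation.map_one_eq_zero] at h
  have h1 : ∀ c, M.D a (M.Nup c) = M.up (M.cdC a M.N) c - ∑ b, M.Γ c a b * M.Nup b := by
    intro c
    have := congrFun (M.cdUp_up a M.N) c
    rw [← this]
    simp only [MetricAlg.cdUp, Nup]
    ring
  have h2 : ∑ c, M.N c * M.up (M.cdC a M.N) c = ∑ c, M.Nup c * M.cdC a M.N c := by
    simp only [MetricAlg.up, Nup, Finset.mul_sum, Finset.sum_mul]
    rw [Finset.sum_comm]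
    exact Finset.sum_congr rfl fun c _ => Finset.sum_congr rfl fun b _ => by
      rw [M.h_symm b c]; ring
  have h3 : ∑ c, M.Nup c * M.D a (M.N c) = (∑ c, M.Nup c * M.cdC a M.N c)
      + ∑ c, M.N c * ∑ b, M.Γ c a b * M.Nup b := by
    simp only [MetricAlg.cdC, mul_sub, Finset.sum_sub_distrib, Finset.mul_sum]
    rw [Finset.sum_comm (f := fun c b => M.N c * (M.Γ c a b * M.Nup b)), sub_add,
      sub_eq_self.2]
    rw [sub_eq_zero]
    exact Finset.sum_congr rfl fun c _ => Finset.sum_congr rfl fun b _ => by ring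
  simp only [h1, mul_sub, Finset.sum_sub_distrib] at h
  rw [h3, h2] at h
  linear_combination h

/-- `∇N` has no normal component in its second index, so the second projection is superfluous. -/
lemma II_apply (a c : Fin d) : M.II ![a, c] = ∑ b, M.γ a b * M.cdC b M.N c := by
  have h0 : ∀ L : Fin 2 → Fin d, M.covF (k := 1) (fun I => M.N (I 0)) L = M.cdC (L 0) M.N (L 1) :=
    fun L => M.cd_fin_one _ _ _
  simp only [II, tang, Fin.prod_univ_two, h0, Matrix.cons_val_zero, Matrix.cons_val_one]
  rw [← Equiv.sum_comp (finTwoArrowEquiv (Fin d)).symm, Fintype.sum_prod_type]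
  simp only [finTwoArrowEquiv_symm_apply, Matrix.cons_val_zero, Matrix.cons_val_one, mul_assoc,
    ← Finset.mul_sum]
  refine Finset.sum_congr rfl fun b _ => ?_
  rw [γ_mul, Nup_mul_cdC_N]; ring

/-- Bringing the index `m` to the front. -/
def slotEquiv (m : κ) : κ ≃ Unit ⊕ {j // ¬ j = m} :=
  (Equiv.sumCompl (fun j => j = m)).symm.trans
    ((Equiv.ofUnique {j // j = m} Unit).sumCongr (Equiv.refl _))

lemma slotEquiv_self (m : κ) : slotEquiv m m = Sum.inl () := by
  simp [slotEquiv, Equiv.sumCompl_symm_apply_of_pos]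

lemma elim_comp_equiv (m : κ) (e : κ ≃ Unit ⊕ μ) (he : e m = Sum.inl ()) (b : Fin d)
    (I : κ → Fin d) :
    Sum.elim (fun _ => b) ((I ∘ e.symm) ∘ Sum.inr) ∘ e = Function.update I m b := by
  funext i
  by_cases h : i = m
  · subst h
    simp [he]
  · rcases hi : e i with j | j
    · exact absurd (e.injective (hi.trans he.symm)) h
    · rw [Function.comp_apply, hi, Sum.elim_inr, Function.update_of_ne h, Function.comp_apply,
        Function.comp_apply, ← hi, Equiv.symm_apply_apply]

lemma tang_re (e : κ ≃ μ) (F : Ten d A κ) : M.tang (re e F) = re e (M.tang F) := by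
  funext I
  simp only [tang, re]
  refine Fintype.sum_equiv (Equiv.arrowCongr e.symm (Equiv.refl _)) _ _ fun L => ?_
  congr 1
  · refine Fintype.prod_equiv e.symm _ _ fun m => ?_
    simp
  
lemma tang_unit (F : Ten d A (Unit ⊕ κ)) (I : Unit ⊕ κ → Fin d) :
    M.tang F I = ∑ b, M.γ (I (Sum.inl ())) b * ∑ L : κ → Fin d,
      (∏ m, M.γ (I (Sum.inr m)) (L m)) * F (Sum.elim (fun _ => b) L) := by
  simp only [tang]
  rw [← Equiv.sum_comp (Equiv.sumArrowEquivProdArrow Unit κ (Fin d)).symm, Fintype.sum_prod_type,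
    ← Equiv.sum_comp (Equiv.funUnique Unit (Fin d)).symm]
  refine Finset.sum_congr rfl fun b _ => ?_
  rw [Finset.mul_sum]
  refine Finset.sum_congr rfl fun L _ => ?_
  rw [Fintype.prod_sum_type, Finset.univ_unique, Finset.prod_singleton, ← mul_assoc]
  rfl

lemma iv_tang (F : Ten d A (Unit ⊕ κ)) : iv M.Nup (M.tang F) = 0 := by
  funext J
  simp only [iv, tang_unit, Sum.elim_inl, Sum.elim_inr, Finset.mul_sum, Pi.zero_apply]
  rw [Finset.sum_comm]
  refine Finset.sum_eq_zero fun b _ => ?_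
  rw [Finset.sum_comm]
  refine Finset.sum_eq_zero fun L _ => ?_
  simp only [← mul_assoc, ← Finset.sum_mul, Nup_mul_γ, zero_mul]

lemma tang_pr (F : Ten d A (Unit ⊕ κ)) : M.tang (M.pr F) = M.tang F := by
  funext I
  simp only [tang_unit, pr, Sum.elim_inl, Sum.elim_comp_inr]
  have h : ∀ c, M.γ (I (Sum.inl ())) c * ∑ L : κ → Fin d,
      (∏ m, M.γ (I (Sum.inr m)) (L m)) * F (Sum.elim (fun _ => c) L)
      = ∑ b, M.γ (I (Sum.inl ())) b * (M.γ b c * ∑ L : κ → Fin d,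
      (∏ m, M.γ (I (Sum.inr m)) (L m)) * F (Sum.elim (fun _ => c) L)) := by
    intro c
    rw [← M.γ_mul_γ (I (Sum.inl ())) c, Finset.sum_mul]
    exact Finset.sum_congr rfl fun _ _ => by ring
  rw [Finset.sum_congr rfl fun c _ => h c, Finset.sum_comm]
  refine Finset.sum_congr rfl fun b _ => ?_
  rw [← Finset.mul_sum]
  congr 1
  simp only [Finset.mul_sum]
  rw [Finset.sum_comm]
  exact Finset.sum_congr rfl fun c _ => Finset.sum_congr rfl fun L _ => by ring

lemma iterII_eq_tang (ℓ : ℕ) : ∃ F, M.iterII ℓ = M.tang F := by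
  cases ℓ with
  | zero => exact ⟨_, rfl⟩
  | succ ℓ => exact ⟨_, rfl⟩

/-- The projection of the indices in `s`. -/
def tangS (s : Finset κ) (F : Ten d A κ) : Ten d A κ := fun I => ∑ L : κ → Fin d,
  (∏ m, if m ∈ s then M.γ (I m) (L m) else if I m = L m then 1 else 0) * F L

lemma tangS_empty (F : Ten d A κ) : M.tangS ∅ F = F := by
  funext I
  have : ∀ L : κ → Fin d, (∏ m, if I m = L m then (1 : A) else 0) = if I = L then 1 else 0 := by
    intro L
    rw [Fintype.prod_boole]
    simp [funext_iff]
  simp [tangS, this]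

lemma tangS_univ (F : Ten d A κ) : M.tangS Finset.univ F = M.tang F := by
  funext I
  simp [tangS, tang]

/-- The projection of the index `m`. -/
def prSlot (m : κ) (F : Ten d A κ) : Ten d A κ :=
  fun I => ∑ b, M.γ (I m) b * F (Function.update I m b)

lemma prSlot_eq (m : κ) (e : κ ≃ Unit ⊕ μ) (he : e m = Sum.inl ()) (F : Ten d A κ) :
    M.prSlot m F = re e.symm (M.pr (re e F)) := by
  funext I
  simp only [prSlot, re, pr]
  refine Finset.sum_congr rfl fun b _ => ?_
  have h1 : (I ∘ e.symm) (Sum.inl ()) = I m := by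
    rw [Function.comp_apply, ← he, Equiv.symm_apply_apply]
  rw [h1, elim_comp_equiv m e he]

/-- Projections in different slots are independent, so the full projection can be reached one slot
at a time; this drives the induction in `HC_sub_tang`. -/
lemma tangS_insert (s : Finset κ) (m : κ) (hm : m ∉ s) (F : Ten d A κ) :
    M.tangS (insert m s) F = M.prSlot m (M.tangS s F) := by
  funext I
  simp only [prSlot, tangS, Finset.mul_sum]
  rw [Finset.sum_comm]
  refine Finset.sum_congr rfl fun L _ => ?_
  have h1 : ∀ b, (∏ i, if i ∈ s then M.γ (Function.update I m b i) (L i) else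
      if Function.update I m b i = L i then (1 : A) else 0)
      = (if b = L m then 1 else 0) * ∏ i ∈ Finset.univ.erase m,
          if i ∈ s then M.γ (I i) (L i) else if I i = L i then 1 else 0 := by
    intro b
    rw [← Finset.mul_prod_erase _ _ (Finset.mem_univ m), Function.update_self, if_neg hm]
    congr 1
    exact Finset.prod_congr rfl fun i hi => by
      rw [Function.update_of_ne (Finset.mem_erase.1 hi).1]
  simp only [h1]
  rw [← Finset.mul_prod_erase _ _ (Finset.mem_univ m), if_pos (Finset.mem_insert_self m s)]
  have h2 : (∏ i ∈ Finset.univ.erase m, if i ∈ insert m s then M.γ (I i) (L i) else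
      if I i = L i then (1 : A) else 0) = ∏ i ∈ Finset.univ.erase m,
          if i ∈ s then M.γ (I i) (L i) else if I i = L i then 1 else 0 :=
    Finset.prod_congr rfl fun i hi => by
      simp [Finset.mem_insert, (Finset.mem_erase.1 hi).1]
  rw [h2]
  simp [mul_assoc]

variable {M}

/-- Projecting one slot subtracts a conormal times the normal contraction in that slot. If all these
contractions lie in the class, so does the total difference, since projection itself preserves the
class. -/
lemma HC_sub_tang {F : Ten d A κ}
    (hF : ∀ m, ∃ (μ : Type) (_ : Fintype μ) (_ : DecidableEq μ) (e : κ ≃ Unit ⊕ μ),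
      e m = Sum.inl () ∧ iv M.Nup (re e F) ∈ M.HC ρ μ w δ) :
    F - M.tang F ∈ M.HC ρ κ w δ := by
  rw [← tangS_univ]
  suffices h : ∀ s : Finset κ, F - M.tangS s F ∈ M.HC ρ κ w δ from h _
  intro s
  induction s using Finset.induction_on with
  | empty => rw [tangS_empty, sub_self]; exact Submodule.zero_mem _
  | insert m s hm ih =>
    rw [tangS_insert _ _ _ hm]
    obtain ⟨μ, _, _, e, he, hm⟩ := hF m
    have h1 : F - M.prSlot m F ∈ M.HC ρ κ w δ := by
      rw [prSlot_eq M m e he]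
      have := Cl.re e.symm (HC_pr hm)
      convert this using 1
      funext I
      simp only [re, Pi.sub_apply]
      congr 2
      funext i; simp
    have h2 : M.prSlot m (F - M.tangS s F) ∈ M.HC ρ κ w δ := by
      rw [prSlot_eq M m e he]
      exact Cl.re _ (HC_pr_mem (Cl.re _ ih))
    have h3 : F - M.prSlot m (M.tangS s F)
        = (F - M.prSlot m F) + M.prSlot m (F - M.tangS s F) := by
      funext I
      simp only [prSlot, Pi.sub_apply, Pi.add_apply, mul_sub, Finset.sum_sub_distrib]
      ring
    rw [h3]
    exact Submodule.add_mem _ h1 h2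

variable (M)

/-- The derivative of a contraction with the normal. -/
lemma tnab_iv (F : Ten d A (Unit ⊕ κ)) :
    M.tnab (iv M.Nup F) = iv M.Nup (re (MetricAlg.sumLeftComm Unit Unit κ) (M.tnab F))
      + fun I => ∑ b, ∑ c, M.h b c * (M.II ![I (Sum.inl ()), b]
          * F (Sum.elim (fun _ => c) (I ∘ Sum.inr))) := by
  rw [tnab, MetricAlg.dV_iv]
  congr 1
  funext I
  simp only [iv, Nup, MetricAlg.cdUp_up, II_apply, Finset.mul_sum, Finset.sum_mul, MetricAlg.up]
  conv_lhs => enter [2, c]; rw [Finset.sum_comm]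
  rw [Finset.sum_comm]
  refine Finset.sum_congr rfl fun b _ => Finset.sum_congr rfl fun c _ =>
    Finset.sum_congr rfl fun e _ => ?_
  rw [M.h_symm c b]
  simp only [Function.comp_apply]
  ring

variable {M}

lemma HC_II_mul {F : Ten d A (Unit ⊕ κ)} (hF : F ∈ M.HC ρ (Unit ⊕ κ) w δ) :
    (fun I : Unit ⊕ κ → Fin d => ∑ b, ∑ c, M.h b c * (M.II ![I (Sum.inl ()), b]
      * F (Sum.elim (fun _ => c) (I ∘ Sum.inr)))) ∈ M.HC ρ (Unit ⊕ κ) (w + 1) (δ + 1) := by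
  have h1 : M.II ∈ M.HC ρ (Fin 2) 1 1 := Cl.of_atom (HAtom.II 0)
  have := Cl.mul_ctr h1 hF (⟨Sum.elim ![Sum.inr (Sum.inl ()), Sum.inl 0]
      (Sum.elim (fun _ => Sum.inl 1) (fun j => Sum.inr (Sum.inr j))),
    Sum.elim ![Sum.inl 1, Sum.inr (Sum.inl ())] (Sum.elim (fun _ => Sum.inl 0)
      fun j => Sum.inr (Sum.inr j)),
    by rintro (i | i | i) <;> [(fin_cases i <;> rfl); rfl; rfl],
    by rintro (i | i | i) <;> [(fin_cases i <;> rfl); rfl; rfl]⟩ :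
      Fin 2 ⊕ (Unit ⊕ κ) ≃ Fin 2 ⊕ (Unit ⊕ κ))
  rw [add_comm w, add_comm δ]
  convert this using 1
  funext I
  refine Finset.sum_congr rfl fun b _ => Finset.sum_congr rfl fun c _ => ?_
  congr 3
  · funext i; fin_cases i <;> rfl
  · funext i; rcases i with i | i <;> rfl

/-- The difference arises from differentiating the normal, which yields a factor `II` and hence one
more degree. -/
lemma HC_tnab_iv {F : Ten d A (Unit ⊕ κ)} (hF : F ∈ M.HC ρ (Unit ⊕ κ) w δ) :
    M.tnab (iv M.Nup F) - iv M.Nup (re (MetricAlg.sumLeftComm Unit Unit κ) (M.tnab F))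
      ∈ M.HC ρ (Unit ⊕ κ) (w + 1) (δ + 1) := by
  rw [tnab_iv, add_sub_cancel_left]
  exact HC_II_mul hF

lemma HC_tnab_N : M.tnab (fun I : Fin 1 → Fin d => M.N (I 0)) ∈ M.HC ρ (Unit ⊕ Fin 1) 1 0 := by
  have h1 : M.II ∈ M.HC ρ (Fin 2) 1 0 := Cl.anti zero_le_one (Cl.of_atom (HAtom.II 0))
  convert Cl.re (MetricAlg.consEquiv 1) h1 using 1
  funext I
  have : I ∘ MetricAlg.consEquiv 1 = ![I (Sum.inl ()), I (Sum.inr 0)] := by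
    funext i; fin_cases i <;> rfl
  simp only [re, this, II_apply, tnab_apply, MetricAlg.cd_fin_one]
  rfl

lemma HC_tnab_iterCov {k : ℕ} {F : Ten d A (Fin k)} (m : ℕ)
    (hF : M.iterCov F (m + 1) ∈ M.HC ρ (Fin (k + (m + 1))) w δ) :
    M.tnab (M.iterCov F m) ∈ M.HC ρ (Unit ⊕ Fin (k + m)) w δ := by
  rw [tnab_eq_pr, MetricAlg.nabla_eq_re]
  exact HC_pr_mem (Cl.re _ hF)

lemma tang_tnab {k : ℕ} (F : Ten d A (Fin k)) :
    M.tang (M.tnab F) = re (MetricAlg.consEquiv k) (M.tang (M.covF F)) := by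
  rw [tnab_eq_pr, tang_pr, MetricAlg.nabla_eq_re, tang_re]

/-- The tangential part is the next atom. The normal contractions of the derivative are `II` times
`∇̄^ℓ II` up to sign, so passing from the derivative to its projection costs only terms of degree
two. -/
lemma HC_tnab_iterII (ℓ : ℕ) :
    M.tnab (M.iterII ℓ) ∈ M.HC ρ (Unit ⊕ Fin (2 + ℓ)) (1 + ℓ + 1) 1 := by
  have h1 : M.tang (M.tnab (M.iterII ℓ)) ∈ M.HC ρ (Unit ⊕ Fin (2 + ℓ)) (1 + ℓ + 1) 1 := by
    rw [tang_tnab]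
    exact Cl.re _ (Cl.of_atom (HAtom.II (ℓ + 1)))
  have h2 : M.tnab (M.iterII ℓ) - M.tang (M.tnab (M.iterII ℓ))
      ∈ M.HC ρ (Unit ⊕ Fin (2 + ℓ)) (1 + ℓ + 1) 1 := by
    apply HC_sub_tang
    rintro (m | m)
    · refine ⟨_, inferInstance, inferInstance, Equiv.refl _, rfl, ?_⟩
      convert Submodule.zero_mem _ using 1
      funext J
      simp only [iv, re, Equiv.coe_refl, Function.comp_id, tnab_apply, Sum.elim_inl,
        Sum.elim_comp_inr, Finset.mul_sum, Pi.zero_apply]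
      rw [Finset.sum_comm]
      refine Finset.sum_eq_zero fun b _ => ?_
      simp only [← mul_assoc, ← Finset.sum_mul, Nup_mul_γ, zero_mul]
    · refine ⟨_, inferInstance, inferInstance, ((Equiv.refl Unit).sumCongr (slotEquiv m)).trans
        (MetricAlg.sumLeftComm Unit Unit _), ?_, ?_⟩
      · simp [MetricAlg.sumLeftComm, slotEquiv_self]
      -- The tensor is a projection, so its normal contraction vanishes identically and may be
      -- differentiated.
      have h3 : M.tnab (iv M.Nup (re (slotEquiv m) (M.iterII ℓ))) = 0 := by
        obtain ⟨F, hF⟩ := M.iterII_eq_tang ℓ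
        rw [hF, ← tang_re, iv_tang]
        funext I; simp [tnab_apply, MetricAlg.cd_apply, act]
      have h4 := HC_tnab_iv (M := M) (ρ := ρ) (w := 1 + ℓ) (δ := 1)
        (F := re (slotEquiv m) (M.iterII ℓ)) (Cl.re _ (Cl.of_atom (HAtom.II ℓ)))
      rw [h3, zero_sub, Submodule.neg_mem_iff, tnab, MetricAlg.dV_re] at h4
      exact Cl.anti (by norm_num) h4
  have := Submodule.add_mem _ h1 h2
  rwa [add_sub_cancel] at this

/-- Renaming the first index block. -/
lemma re_iv (e : κ ≃ μ) (v : Fin d → A) (F : Ten d A (Unit ⊕ κ)) :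
    re e (iv v F) = iv v (re ((Equiv.refl Unit).sumCongr e) F) := by
  funext J
  simp only [re, iv]
  refine Finset.sum_congr rfl fun b _ => ?_
  congr 2
  funext i; rcases i with i | i <;> rfl

lemma iv_sub (v : Fin d → A) (F H : Ten d A (Unit ⊕ κ)) : iv v (F - H) = iv v F - iv v H := by
  funext J; simp [iv, mul_sub, Finset.sum_sub_distrib]

lemma re_sub (e : κ ≃ μ) (F H : Ten d A κ) : re e (F - H) = re e F - re e H := rfl

lemma iv_pr (v : Fin d → A) (F : Ten d A (Unit ⊕ (Unit ⊕ κ))) :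
    iv v (re (MetricAlg.sumLeftComm Unit Unit κ) (M.pr F))
      = M.pr (iv v (re (MetricAlg.sumLeftComm Unit Unit κ) F)) := by
  funext J
  simp only [iv, re, pr, Finset.mul_sum]
  rw [Finset.sum_comm]
  refine Finset.sum_congr rfl fun b _ => Finset.sum_congr rfl fun c _ => ?_
  rw [mul_left_comm]
  refine congrArg₂ _ rfl (congrArg₂ _ rfl (congrArg F ?_))
  funext i
  rcases i with i | i | i <;> rfl

/-- Differentiating either normal gives a product of `II` and `∇^m W`, of degree two; otherwise the
derivative falls on the Weyl factor and both normals survive. -/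
lemma HC_tnab_WNN (m : ℕ) (e : Fin (4 + m) ≃ Unit ⊕ (Unit ⊕ κ)) :
    M.tnab (iv M.Nup (iv M.Nup (re e (M.iterCov M.Weyl m)))) ∈ M.HC ρ (Unit ⊕ κ) (2 + m + 1) 2 := by
  have hW : re e (M.iterCov M.Weyl m) ∈ M.HC ρ (Unit ⊕ (Unit ⊕ κ)) (2 + m) 1 :=
    Cl.re _ (Cl.of_atom (HAtom.W m))
  have h1 := HC_tnab_iv hW
  have h2 := HC_tnab_iv (HC_iv hW)
  have h3 := HC_iv (Cl.re (MetricAlg.sumLeftComm Unit Unit κ) h1)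
  have h4 := Submodule.add_mem _ h2 h3
  have h5 : iv M.Nup (re (MetricAlg.sumLeftComm Unit Unit κ) (iv M.Nup (re
      (MetricAlg.sumLeftComm Unit Unit (Unit ⊕ κ)) (M.tnab (re e (M.iterCov M.Weyl m))))))
      ∈ M.HC ρ (Unit ⊕ κ) (2 + m + 1) 2 := by
    rw [tnab, MetricAlg.dV_re]
    change iv M.Nup (re _ (iv M.Nup (re _ (re _ (M.tnab _))))) ∈ _
    have hp : re ((Equiv.refl Unit).sumCongr e) (M.tnab (M.iterCov M.Weyl m))
        = M.pr (re ((Equiv.refl Unit).sumCongr e) (M.nabla (M.iterCov M.Weyl m))) := rfl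
    rw [hp, iv_pr, iv_pr, re_iv, MetricAlg.nabla_eq_re]
    exact HC_pr_mem (Cl.of_atom (HAtom.WNN (m + 1) (Unit ⊕ κ)
      (((((MetricAlg.consEquiv (4 + m)).trans ((Equiv.refl Unit).sumCongr e)).trans
      (MetricAlg.sumLeftComm Unit Unit (Unit ⊕ κ)))).trans
      ((Equiv.refl Unit).sumCongr (MetricAlg.sumLeftComm Unit Unit κ)))))
  have h6 := Submodule.add_mem _ h4 h5
  convert h6 using 1
  rw [re_sub, iv_sub]
  abel

/-- The class is stable under tangential differentiation. -/
theorem HC_tnab {F : Ten d A κ} (hF : F ∈ M.HC ρ κ w δ) :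
    M.tnab F ∈ M.HC ρ (Unit ⊕ κ) (w + 1) δ := by
  refine M.dV_mem (At := M.HAtom ρ) _ (fun f hf i => M.Z_tan f hf _) (fun _ _ _ _ h => h) ?_ hF
  intro κ i1 i2 w δ F hF
  cases hF with
  | N => exact ⟨_, _, HC_tnab_N⟩
  | II ℓ => exact ⟨_, _, HC_tnab_iterII ℓ⟩
  | R m => exact ⟨_, _, HC_tnab_iterCov m (Cl.of_atom (HAtom.R (m + 1)))⟩
  | W m => exact ⟨_, _, HC_tnab_iterCov m (Cl.of_atom (HAtom.W (m + 1)))⟩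
  | WNN m κ e => exact ⟨_, _, HC_tnab_WNN m e⟩

end HypAlg

end SingularYamabe

/-! ### The equation for `σ` and iterated derivatives along its gradient -/

namespace SingularYamabe

variable {d : ℕ} {A : Type*} [CommRing A] [Algebra ℝ A]

namespace MetricAlg

variable (M : MetricAlg d A) {κ : Type} [Fintype κ] [DecidableEq κ]

/-- The inner product of covectors. -/
def dot (X Y : Fin d → A) : A := ∑ b, ∑ c, M.h b c * (X b * Y c)

lemma dot_comm (X Y : Fin d → A) : M.dot X Y = M.dot Y X := by
  unfold dot
  rw [Finset.sum_comm]
  exact Finset.sum_congr rfl fun b _ => Finset.sum_congr rfl fun c _ => by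
    rw [M.h_symm b c]; ring

lemma sum_up_mul (X Y : Fin d → A) : ∑ a, M.up X a * Y a = M.dot X Y := by
  simp only [up, dot, Finset.sum_mul]
  rw [Finset.sum_comm]
  exact Finset.sum_congr rfl fun b _ => Finset.sum_congr rfl fun c _ => by
    rw [M.h_symm b c]; ring

lemma D_dot (a : Fin d) (X Y : Fin d → A) :
    M.D a (M.dot X Y) = M.dot (M.cdC a X) Y + M.dot X (M.cdC a Y) := by
  have h := M.D_trace a (fun I => X (I 0) * Y (I 1))
  have hc : ∀ b c, M.cd a (fun I : Fin 2 → Fin d => X (I 0) * Y (I 1)) ![b, c]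
      = M.cdC a X b * Y c + X b * M.cdC a Y c := by
    intro b c
    rw [cd_two]
    simp only [Matrix.cons_val_zero, Matrix.cons_val_one, Derivation.leibniz, smul_eq_mul, cdC,
      sub_mul, mul_sub, Finset.sum_mul, Finset.mul_sum]
    have h1 : ∀ e, X b * (M.Γ e a c * Y e) = M.Γ e a c * (X b * Y e) := fun e => by ring
    have h2 : ∀ e, M.Γ e a b * X e * Y c = M.Γ e a b * (X e * Y c) := fun e => by ring
    simp only [h1, h2]
    ring
  simp only [hc, Matrix.cons_val_zero, Matrix.cons_val_one] at h
  rw [dot, h]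
  simp only [dot, mul_add, Finset.sum_add_distrib]

/-- The differential of a function. -/
def grad (f : A) (a : Fin d) : A := M.D a f

lemma cdC_grad_symm (f : A) (a b : Fin d) : M.cdC a (M.grad f) b = M.cdC b (M.grad f) a := by
  simp only [cdC, grad, M.D_comm a b, M.Γ_symm _ a b]

/-- The Ricci tensor evaluated on the duals of two covectors. -/
def ric (X Y : Fin d → A) : A := ∑ a, ∑ e, M.up X a * M.up Y e * M.Ric ![a, e]

end MetricAlg

/-- A defining density `σ` with `S(σ) = 1 + σᵈ B`. -/
structure YamabeAlg (d : ℕ) (A : Type*) [CommRing A] [Algebra ℝ A] extends HypAlg d A where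
  /-- the density -/
  σ : A
  /-- the remainder -/
  B : A
  three_le : 3 ≤ d
  σ_mem : σ ∈ Z
  D_σ : ∀ a, D a σ - N a ∈ Z
  eqn : toMetricAlg.dot (toMetricAlg.grad σ) (toMetricAlg.grad σ) - (2 / (d : ℝ)) •
    (σ * ((∑ b, ∑ c, h b c * toMetricAlg.cdC b (toMetricAlg.grad σ) c) + toMetricAlg.J * σ))
      = 1 + σ ^ d * B

namespace YamabeAlg

variable (M : YamabeAlg d A) {κ μ : Type} [Fintype κ] [DecidableEq κ] [Fintype μ] [DecidableEq μ]

/-- The gradient of `σ` as a vector. -/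
def Xup : Fin d → A := M.up (M.grad M.σ)

/-- The derivative of tensors along the gradient of `σ`. -/
def cdX (F : Ten d A κ) : Ten d A κ := fun J => ∑ b, M.Xup b * M.cd b F J

/-- The derivative of functions along the gradient of `σ`. -/
def L (f : A) : A := ∑ b, M.Xup b * M.D b f

/-- The iterated derivatives of `dσ` along the gradient of `σ`. -/
def X : ℕ → Fin d → A
  | 0 => M.grad M.σ
  | k + 1 => fun c => ∑ b, M.Xup b * M.cdC b (X k) c

/-- The covariant derivatives of the covectors `X k`. -/
def Y (k : ℕ) (b c : Fin d) : A := M.cdC b (M.X k) c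

/-- The components of `X k` in the direction of the gradient. -/
def u (k : ℕ) : A := M.dot (M.X k) (M.X 0)

lemma Xup_eq : M.Xup = M.up (M.X 0) := rfl

lemma L_add (f g : A) : M.L (f + g) = M.L f + M.L g := by
  simp [L, mul_add, Finset.sum_add_distrib]

lemma L_sub (f g : A) : M.L (f - g) = M.L f - M.L g := by
  simp [L, mul_sub, Finset.sum_sub_distrib]

lemma L_smul (r : ℝ) (f : A) : M.L (r • f) = r • M.L f := by
  simp [L, Finset.smul_sum]

lemma L_mul (f g : A) : M.L (f * g) = M.L f * g + f * M.L g := by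
  simp only [L, Derivation.leibniz, smul_eq_mul, mul_add, Finset.sum_add_distrib, Finset.sum_mul,
    Finset.mul_sum]
  rw [add_comm]
  congr 1 <;> exact Finset.sum_congr rfl fun _ _ => by ring

lemma L_one : M.L 1 = 0 := by simp [L]

lemma L_σ : M.L M.σ = M.u 0 := by
  rw [L, Xup_eq, u]; exact M.sum_up_mul _ _

lemma L_dot (V W : Fin d → A) : M.L (M.dot V W)
    = M.dot (fun c => ∑ b, M.Xup b * M.cdC b V c) W
      + M.dot V (fun c => ∑ b, M.Xup b * M.cdC b W c) := by
  simp only [L, MetricAlg.D_dot, mul_add, Finset.sum_add_distrib]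
  simp only [MetricAlg.dot, Finset.mul_sum, Finset.sum_mul]
  congr 1
  · conv_rhs => enter [2, b]; rw [Finset.sum_comm]
    conv_rhs => rw [Finset.sum_comm]
    refine Finset.sum_congr rfl fun _ _ => ?_
    exact Finset.sum_congr rfl fun _ _ => Finset.sum_congr rfl fun _ _ => by ring
  · conv_rhs => enter [2, b]; rw [Finset.sum_comm]
    conv_rhs => rw [Finset.sum_comm]
    refine Finset.sum_congr rfl fun _ _ => ?_
    exact Finset.sum_congr rfl fun _ _ => Finset.sum_congr rfl fun _ _ => by ring

lemma L_u (k : ℕ) : M.L (M.u k) = M.u (k + 1) + M.dot (M.X k) (M.X 1) := by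
  rw [u, L_dot]; rfl

lemma L_u_zero : M.L (M.u 0) = (2 : ℝ) • M.u 1 := by
  rw [L_u, MetricAlg.dot_comm, two_smul]; rfl

lemma grad_u (k : ℕ) (a : Fin d) :
    M.D a (M.u k) = M.dot (M.Y k a) (M.X 0) + M.dot (M.X k) (M.Y 0 a) := by
  rw [u, MetricAlg.D_dot]; rfl

lemma Y_zero_symm (a b : Fin d) : M.Y 0 a b = M.Y 0 b a := M.cdC_grad_symm _ _ _

/-- The Hessian of `σ` is symmetric, so `∇_X dσ` is half the differential of `|dσ|²`. -/
lemma X_one_eq (c : Fin d) : M.X 1 c = (1 / 2 : ℝ) • M.D c (M.u 0) := by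
  rw [grad_u, M.dot_comm (M.X 0), ← two_smul ℝ, smul_smul]
  norm_num
  rw [M.dot_comm, ← M.sum_up_mul]
  change ∑ b, M.Xup b * M.Y 0 b c = _
  exact Finset.sum_congr rfl fun b _ => by rw [M.Y_zero_symm b c]; rfl

/-- The derivative of a differential along the gradient of `σ`. -/
lemma cdX_grad (f : A) (c : Fin d) :
    ∑ b, M.Xup b * M.cdC b (M.grad f) c = M.D c (M.L f) - M.dot (M.Y 0 c) (M.grad f) := by
  have h1 : M.L f = M.dot (M.X 0) (M.grad f) := M.sum_up_mul _ _
  rw [h1, MetricAlg.D_dot]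
  have h2 : M.cdC c (M.X 0) = M.Y 0 c := rfl
  rw [h2, add_sub_cancel_left, ← M.sum_up_mul]
  exact Finset.sum_congr rfl fun b _ => by rw [M.cdC_grad_symm]; rfl

/-- The Leibniz rule for the contraction of `∇W` with the gradient; the derivative of the gradient
is the Hessian `Y 0`. -/
lemma cdC_sum_Xup (b : Fin d) (W : Fin d → A) (c : Fin d) :
    M.cdC b (fun c => ∑ a, M.Xup a * M.cdC a W c) c
      = (∑ a, M.Xup a * M.cd b (fun I : Fin 2 → Fin d => M.cdC (I 0) W (I 1)) ![a, c])
        + ∑ a, M.up (M.Y 0 b) a * M.cdC a W c := by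
  have h := congrFun (M.cd_iv b M.Xup (M.nabla (fun I : Fin 1 → Fin d => W (I 0)))) ![c]
  have h1 : (iv M.Xup (M.nabla (fun I : Fin 1 → Fin d => W (I 0))))
      = fun I : Fin 1 → Fin d => ∑ a, M.Xup a * M.cdC a W (I 0) := by
    funext I
    simp only [iv, MetricAlg.nabla_elim, MetricAlg.cd_fin_one]
  rw [h1, M.cd_fin_one b (fun c => ∑ a, M.Xup a * M.cdC a W c)] at h
  simp only [Matrix.cons_val_zero, Pi.add_apply] at h
  rw [h]
  have h2 : M.nabla (fun I : Fin 1 → Fin d => W (I 0)) = re (MetricAlg.consEquiv 1)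
      (fun I : Fin 2 → Fin d => M.cdC (I 0) W (I 1)) := by
    rw [MetricAlg.nabla_eq_re]
    congr 1
    funext I
    exact M.cd_fin_one _ _ _
  congr 1
  · rw [h2, M.cd_re]
    simp only [iv, re]
    refine Finset.sum_congr rfl fun a _ => ?_
    congr 2
    funext i; fin_cases i <;> rfl
  · rw [Xup_eq, M.cdUp_up]
    simp only [iv, MetricAlg.nabla_elim, MetricAlg.cd_fin_one]
    rfl

/-- Commuting covariant derivatives of a covector. -/
lemma cd_cdC (a b : Fin d) (W : Fin d → A) (c : Fin d) :
    M.cd a (fun I : Fin 2 → Fin d => M.cdC (I 0) W (I 1)) ![b, c]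
      = M.cd b (fun I : Fin 2 → Fin d => M.cdC (I 0) W (I 1)) ![a, c]
        - ∑ f, M.Rup a b f c * W f := by
  have h := M.ricci_identity a b (fun I : Fin 1 → Fin d => W (I 0)) ![c]
  have h2 : M.nabla (fun I : Fin 1 → Fin d => W (I 0)) = re (MetricAlg.consEquiv 1)
      (fun I : Fin 2 → Fin d => M.cdC (I 0) W (I 1)) := by
    rw [MetricAlg.nabla_eq_re]
    congr 1
    funext I
    exact M.cd_fin_one _ _ _
  have h3 : ∀ b, (Sum.elim (fun _ => b) ![c] ∘ MetricAlg.consEquiv 1 : Fin 2 → Fin d)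
      = ![b, c] := fun b => by funext i; fin_cases i <;> rfl
  rw [h2, M.cd_re, M.cd_re] at h
  simp only [re, h3, act, Finset.univ_unique, Finset.sum_singleton] at h
  rw [sub_eq_iff_eq_add'] at h
  rw [h, sub_eq_add_neg]
  simp

/-- The derivative of `Y k` along the gradient of `σ`. -/
lemma cdX_Y (k : ℕ) (b c : Fin d) :
    ∑ a, M.Xup a * M.cd a (fun I : Fin 2 → Fin d => M.Y k (I 0) (I 1)) ![b, c]
      = M.Y (k + 1) b c - (∑ a, M.up (M.Y 0 b) a * M.Y k a c)
        - ∑ a, ∑ e, M.Xup a * M.up (M.X k) e * M.Riem ![a, b, e, c] := by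
  have h1 := M.cdC_sum_Xup b (M.X k) c
  have h2 : ∀ a, M.cd a (fun I : Fin 2 → Fin d => M.Y k (I 0) (I 1)) ![b, c]
      = M.cd b (fun I : Fin 2 → Fin d => M.cdC (I 0) (M.X k) (I 1)) ![a, c]
        - ∑ f, M.Rup a b f c * M.X k f := fun a => M.cd_cdC a b (M.X k) c
  simp only [h2, mul_sub, Finset.sum_sub_distrib]
  have h3 : M.Y (k + 1) b c = M.cdC b (fun c => ∑ a, M.Xup a * M.cdC a (M.X k) c) c := rfl
  have h4 : ∀ a, M.Xup a * ∑ f, M.Rup a b f c * M.X k f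
      = ∑ e, M.Xup a * M.up (M.X k) e * M.Riem ![a, b, e, c] := by
    intro a
    simp only [← MetricAlg.h_mul_Riem, MetricAlg.up, Finset.sum_mul, Finset.mul_sum]
    rw [Finset.sum_comm]
    exact Finset.sum_congr rfl fun e _ => Finset.sum_congr rfl fun f _ => by
      rw [M.h_symm e f]; ring
  simp only [h4]
  rw [h3, h1]
  simp only [Y]
  ring

/-- The divergence of `X k`. -/
def dv (k : ℕ) : A := ∑ b, ∑ c, M.h b c * M.Y k b c

/-- The trace of the product of `Y 0` and `Y k`. -/
def trYY (k : ℕ) : A := ∑ b, ∑ c, M.h b c * ∑ a, ∑ e, M.h a e * (M.Y 0 b a * M.Y k e c)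

lemma up_mul_Y (k : ℕ) (b c : Fin d) : ∑ a, M.up (M.Y 0 b) a * M.Y k a c
    = ∑ a, ∑ e, M.h a e * (M.Y 0 b a * M.Y k e c) := by
  simp only [MetricAlg.up, Finset.sum_mul]
  rw [Finset.sum_comm]
  exact Finset.sum_congr rfl fun _ _ => Finset.sum_congr rfl fun _ _ => by
    rw [M.h_symm]; ring

lemma L_trace (V : Fin d → Fin d → A) : M.L (∑ b, ∑ c, M.h b c * V b c)
    = ∑ b, ∑ c, M.h b c * ∑ a, M.Xup a * M.cd a (fun I : Fin 2 → Fin d => V (I 0) (I 1)) ![b, c]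
    := by
  have h := fun a => M.D_trace a (fun I => V (I 0) (I 1))
  simp only [Matrix.cons_val_zero, Matrix.cons_val_one] at h
  simp only [L, h, Finset.mul_sum]
  rw [Finset.sum_comm]
  refine Finset.sum_congr rfl fun _ _ => ?_
  rw [Finset.sum_comm]
  exact Finset.sum_congr rfl fun _ _ => Finset.sum_congr rfl fun _ _ => by ring

/-- The trace of `cdX_Y`. For `k = 0` this is the Bochner formula: the derivative of `Δσ` along `X`
is the divergence of `∇_X X` minus the squared length of the Hessian minus `Ric(X, X)`. -/
lemma L_dv (k : ℕ) : M.L (M.dv k) = M.dv (k + 1) - M.trYY k - M.ric (M.X 0) (M.X k) := by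
  rw [dv, L_trace]
  simp only [cdX_Y, mul_sub, Finset.sum_sub_distrib, up_mul_Y]
  rw [dv, trYY]
  congr 1
  have h1 : ∀ a e, ∑ b, ∑ c, M.h b c * M.Riem ![a, b, e, c] = M.Ric ![a, e] := by
    intro a e
    rw [M.Ric_eq]
    exact Finset.sum_congr rfl fun _ _ => Finset.sum_congr rfl fun _ _ => by
      rw [M.Riem_swap₁, M.Riem_swap₂, neg_neg]
  simp only [MetricAlg.ric, ← h1, Finset.mul_sum]
  rw [sum_comm₄]
  exact Finset.sum_congr rfl fun _ _ => Finset.sum_congr rfl fun _ _ =>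
    Finset.sum_congr rfl fun _ _ => Finset.sum_congr rfl fun _ _ => by rw [Xup_eq]; ring

end YamabeAlg

end SingularYamabe

/-! ### Weights and degrees of derivatives along the gradient -/

namespace SingularYamabe

variable {d : ℕ} {A : Type*} [CommRing A] [Algebra ℝ A]

section

variable {h : Fin d → Fin d → A} {At At' : Atoms d A} {Z Z' : Ideal A} {w w' δ δ' : ℕ}

lemma Cl0.zero : Cl0 h At Z w δ 0 := Submodule.zero_mem _

lemma Cl0.add {f f' : A} (hf : Cl0 h At Z w δ f) (hf' : Cl0 h At Z w δ f') :
    Cl0 h At Z w δ (f + f') := Submodule.add_mem _ hf hf'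

lemma Cl0.sub {f f' : A} (hf : Cl0 h At Z w δ f) (hf' : Cl0 h At Z w δ f') :
    Cl0 h At Z w δ (f - f') := Submodule.sub_mem _ hf hf'

lemma Cl0.neg {f : A} (hf : Cl0 h At Z w δ f) : Cl0 h At Z w δ (-f) := Submodule.neg_mem _ hf

lemma Cl0.smul {f : A} (r : ℝ) (hf : Cl0 h At Z w δ f) : Cl0 h At Z w δ (r • f) :=
  Submodule.smul_mem _ r hf

lemma Cl0.anti {f : A} (hf : Cl0 h At Z w δ f) (hδ : δ' ≤ δ) : Cl0 h At Z w δ' f := Cl.anti hδ hf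

lemma Cl0.of_ideal {f : A} (hf : f ∈ Z) : Cl0 h At Z w δ f := Cl.of_ideal fun _ => hf

/-- Equality modulo a class. -/
lemma Cl0.congr {f f' : A} (hf : Cl0 h At Z w δ f) (h' : f' = f) : Cl0 h At Z w δ f' := h' ▸ hf

lemma Cl1.add {X Y : Fin d → A} (hX : Cl1 h At Z w δ X) (hY : Cl1 h At Z w δ Y) :
    Cl1 h At Z w δ (fun a => X a + Y a) := Submodule.add_mem _ hX hY

lemma Cl1.sub {X Y : Fin d → A} (hX : Cl1 h At Z w δ X) (hY : Cl1 h At Z w δ Y) :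
    Cl1 h At Z w δ (fun a => X a - Y a) := Submodule.sub_mem _ hX hY

lemma Cl1.smul {X : Fin d → A} (r : ℝ) (hX : Cl1 h At Z w δ X) :
    Cl1 h At Z w δ (fun a => r • X a) := Submodule.smul_mem _ r hX

lemma Cl1.anti {X : Fin d → A} (hX : Cl1 h At Z w δ X) (hδ : δ' ≤ δ) : Cl1 h At Z w δ' X :=
  Cl.anti hδ hX

lemma Cl1.of_ideal {X : Fin d → A} (hX : ∀ a, X a ∈ Z) : Cl1 h At Z w δ X :=
  Cl.of_ideal fun _ => hX _

lemma Cl1.congr {X Y : Fin d → A} (hX : Cl1 h At Z w δ X) (h' : ∀ a, Y a = X a) :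
    Cl1 h At Z w δ Y := by
  rwa [show Y = X from funext h']

lemma Cl2.add {X Y : Fin d → Fin d → A} (hX : Cl2 h At Z w δ X) (hY : Cl2 h At Z w δ Y) :
    Cl2 h At Z w δ (fun a b => X a b + Y a b) := Submodule.add_mem _ hX hY

lemma Cl2.sub {X Y : Fin d → Fin d → A} (hX : Cl2 h At Z w δ X) (hY : Cl2 h At Z w δ Y) :
    Cl2 h At Z w δ (fun a b => X a b - Y a b) := Submodule.sub_mem _ hX hY

lemma Cl2.anti {X : Fin d → Fin d → A} (hX : Cl2 h At Z w δ X) (hδ : δ' ≤ δ) :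
    Cl2 h At Z w δ' X := Cl.anti hδ hX

lemma Cl2.of_ideal {X : Fin d → Fin d → A} (hX : ∀ a b, X a b ∈ Z) : Cl2 h At Z w δ X :=
  Cl.of_ideal fun _ => hX _ _

lemma Cl2.congr {X Y : Fin d → Fin d → A} (hX : Cl2 h At Z w δ X) (h' : ∀ a b, Y a b = X a b) :
    Cl2 h At Z w δ Y := by
  rwa [show Y = X from funext fun a => funext (h' a)]

lemma Cl.cast {κ : Type} [Fintype κ] [DecidableEq κ] {F H : Ten d A κ} (hF : F ∈ Cl h At Z κ w δ)
    (hw : w' = w) (hδ : δ' ≤ δ) (hH : ∀ I, H I = F I) : H ∈ Cl h At Z κ w' δ' := by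
  rw [show H = F from funext hH, hw]
  exact Cl.anti hδ hF

lemma Cl0.cast {f f' : A} (hf : Cl0 h At Z w δ f) (hw : w' = w) (hδ : δ' ≤ δ) (h' : f' = f) :
    Cl0 h At Z w' δ' f' := Cl.cast hf hw hδ fun _ => h'

lemma Cl1.cast {X Y : Fin d → A} (hX : Cl1 h At Z w δ X) (hw : w' = w) (hδ : δ' ≤ δ)
    (h' : ∀ a, Y a = X a) : Cl1 h At Z w' δ' Y := Cl.cast hX hw hδ fun _ => h' _

lemma Cl2.cast {X Y : Fin d → Fin d → A} (hX : Cl2 h At Z w δ X) (hw : w' = w) (hδ : δ' ≤ δ)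
    (h' : ∀ a b, Y a b = X a b) : Cl2 h At Z w' δ' Y := Cl.cast hX hw hδ fun _ => h' _ _

end

namespace MetricAlg

variable (M : MetricAlg d A) {At : Atoms d A} {Z : Ideal A} {w w' δ δ' : ℕ}

lemma Cl_iv_up {κ : Type} [Fintype κ] [DecidableEq κ] {X : Fin d → A} {F : Ten d A (Unit ⊕ κ)}
    (hX : Cl1 M.h At Z w δ X) (hF : F ∈ Cl M.h At Z (Unit ⊕ κ) w' δ') :
    iv (M.up X) F ∈ Cl M.h At Z κ (w + w') (δ + δ') := by
  rw [up_eq]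
  exact Cl.iv hX hF

/-- Separating the third and the first index. -/
def fourEquiv : Fin 4 ≃ Unit ⊕ (Unit ⊕ Fin 2) where
  toFun := ![Sum.inr (Sum.inl ()), Sum.inr (Sum.inr 0), Sum.inl (), Sum.inr (Sum.inr 1)]
  invFun := Sum.elim (fun _ => 2) (Sum.elim (fun _ => 0) ![1, 3])
  left_inv := by decide
  right_inv := by decide

/-- Contraction of a four-tensor with two covectors. -/
lemma Cl2_mul_vec_vec {F : Ten d A (Fin 4)} {X Y : Fin d → A} {w₀ δ₀ : ℕ}
    (hF : F ∈ Cl M.h At Z (Fin 4) w₀ δ₀) (hX : Cl1 M.h At Z w δ X) (hY : Cl1 M.h At Z w' δ' Y) :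
    Cl2 M.h At Z (w + (w' + w₀)) (δ + (δ' + δ₀)) (fun b c => ∑ a, ∑ e,
      M.up X a * M.up Y e * F ![a, b, e, c]) := by
  refine Cl.cast (M.Cl_iv_up hX (M.Cl_iv_up hY (Cl.re fourEquiv hF))) rfl le_rfl fun I => ?_
  simp only [iv, re, Finset.mul_sum, mul_assoc]
  refine Finset.sum_congr rfl fun a _ => Finset.sum_congr rfl fun e _ => ?_
  congr 3
  funext i; fin_cases i <;> rfl

/-- Contraction of a bilinear form with two covectors. -/
lemma Cl0_mul_vec_vec {F : Ten d A (Fin 2)} {X Y : Fin d → A} {w₀ δ₀ : ℕ}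
    (hF : F ∈ Cl M.h At Z (Fin 2) w₀ δ₀) (hX : Cl1 M.h At Z w δ X) (hY : Cl1 M.h At Z w' δ' Y) :
    Cl0 M.h At Z (w + (w' + w₀)) (δ + (δ' + δ₀)) (∑ a, ∑ e,
      M.up X a * M.up Y e * F ![a, e]) := by
  refine Cl.cast (M.Cl_iv_up hX (M.Cl_iv_up hY (Cl.re (⟨![Sum.inr (Sum.inl ()), Sum.inl ()],
    Sum.elim (fun _ => 1) (Sum.elim (fun _ => 0) Fin.elim0), by decide, by decide⟩ :
    Fin 2 ≃ Unit ⊕ (Unit ⊕ Fin 0)) hF))) rfl le_rfl fun I => ?_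
  simp only [iv, re, Finset.mul_sum, mul_assoc]
  refine Finset.sum_congr rfl fun a _ => Finset.sum_congr rfl fun e _ => ?_
  congr 3
  funext i; fin_cases i <;> rfl

end MetricAlg

namespace YamabeAlg

/-- The tensors generating the derivatives of the data along the gradient of `σ`. -/
inductive AAtom (M : YamabeAlg d A) (ρ K : ℕ) : Atoms d A
  -- `X 0` restricts to the conormal and has degree zero, every later `X i` counts as one factor.
  -- The bound `K` records how many of these covectors occur, so that they can be identified on the
  -- hypersurface by induction.
  | X (i : ℕ) : i ≤ K → AAtom M ρ K (Fin 1) i (min i 1) (fun I => M.X i (I 0))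
  | Y (i : ℕ) : i + 1 ≤ K → AAtom M ρ K (Fin 2) (i + 1) 1 (fun I => M.Y i (I 0) (I 1))
  | R (m : ℕ) : AAtom M ρ K (Fin (4 + m)) (2 + m) ρ (M.iterCov M.Riem m)

variable (M : YamabeAlg d A) {κ μ : Type} [Fintype κ] [DecidableEq κ] [Fintype μ] [DecidableEq μ]
  {ρ K K' w w' δ δ' : ℕ}

/-- The class of tensors generated by `AAtom`. -/
abbrev AC (ρ K : ℕ) (κ : Type) [Fintype κ] [DecidableEq κ] (w δ : ℕ) : Submodule ℝ (Ten d A κ) :=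
  Cl M.h (M.AAtom ρ K) ⊥ κ w δ

/-- Scalars in the class generated by `AAtom`. -/
abbrev AC0 (ρ K w δ : ℕ) (f : A) : Prop := Cl0 M.h (M.AAtom ρ K) ⊥ w δ f

/-- Covectors in the class generated by `AAtom`. -/
abbrev AC1 (ρ K w δ : ℕ) (X : Fin d → A) : Prop := Cl1 M.h (M.AAtom ρ K) ⊥ w δ X

/-- Bilinear forms in the class generated by `AAtom`. -/
abbrev AC2 (ρ K w δ : ℕ) (X : Fin d → Fin d → A) : Prop := Cl2 M.h (M.AAtom ρ K) ⊥ w δ X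

variable {M}

lemma AC_mono (hK : K ≤ K') {F : Ten d A κ} (hF : F ∈ M.AC ρ K κ w δ) : F ∈ M.AC ρ K' κ w δ := by
  refine Cl.subst hF le_rfl fun κ _ _ w δ F hF => ?_
  cases hF with
  | X _ hi => exact ⟨inferInstance, inferInstance, Cl.of_atom (AAtom.X _ (hi.trans hK))⟩
  | Y _ hi => exact ⟨inferInstance, inferInstance, Cl.of_atom (AAtom.Y _ (hi.trans hK))⟩
  | R m => exact ⟨inferInstance, inferInstance, Cl.of_atom (AAtom.R m)⟩

lemma AC0.mono (hK : K ≤ K') {f : A} (hf : M.AC0 ρ K w δ f) : M.AC0 ρ K' w δ f := AC_mono hK hf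

lemma AC1.mono (hK : K ≤ K') {f : Fin d → A} (hf : M.AC1 ρ K w δ f) : M.AC1 ρ K' w δ f :=
  AC_mono hK hf

lemma AC1_X {i : ℕ} (hi : i ≤ K) : M.AC1 ρ K i (min i 1) (M.X i) := Cl.of_atom (AAtom.X i hi)

lemma AC2_Y {i : ℕ} (hi : i + 1 ≤ K) : M.AC2 ρ K (i + 1) 1 (M.Y i) := Cl.of_atom (AAtom.Y i hi)

lemma AC_R (m : ℕ) : M.iterCov M.Riem m ∈ M.AC ρ K (Fin (4 + m)) (2 + m) ρ :=
  Cl.of_atom (AAtom.R m)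

variable (M)

lemma cdX_eq (F : Ten d A κ) :
    M.cdX F = re (Equiv.emptySum Empty κ) (M.dV (fun _ : Empty → Fin d => M.Xup) F) := rfl

lemma cdX_iterCov {k : ℕ} (F : Ten d A (Fin k)) (m : ℕ) : M.cdX (M.iterCov F m)
    = iv M.Xup (re (MetricAlg.consEquiv (k + m)) (M.iterCov F (m + 1))) := by
  rw [MetricAlg.iterCov, ← MetricAlg.nabla_eq_re]; rfl

variable {M}

/-- The derivative along the gradient with an empty block of indices. -/
lemma dV_Xup (F : Ten d A κ) : M.dV (fun _ : Empty → Fin d => M.Xup) F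
    = re (Equiv.emptySum Empty κ).symm (M.cdX F) := by
  funext I
  rw [cdX_eq]
  simp only [re]
  congr 1
  funext i; rcases i with i | i
  · exact i.elim
  · rfl

lemma dV_Xup_mem {F : Ten d A κ} (hF : M.cdX F ∈ M.AC ρ K κ w δ) :
    M.dV (fun _ : Empty → Fin d => M.Xup) F ∈ M.AC ρ K (Empty ⊕ κ) w δ := by
  rw [dV_Xup]
  exact Cl.re _ hF

lemma AC_cdX_X {i : ℕ} (hi : i ≤ K) :
    M.cdX (fun I : Fin 1 → Fin d => M.X i (I 0)) ∈ M.AC ρ (K + 1) (Fin 1) (i + 1) (min i 1) := by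
  refine Cl.cast (AC1_X (M := M) (ρ := ρ) (show i + 1 ≤ K + 1 by omega)) rfl (by omega)
    fun I => ?_
  simp only [cdX, MetricAlg.cd_fin_one]
  rfl

/-- Besides `Y (i + 1)`, formula `cdX_Y` contains a product of two `Y` and a curvature term; the
latter has degree at least one only because `1 ≤ ρ`. -/
lemma AC_cdX_Y {i : ℕ} (hi : i + 1 ≤ K) (hρ : 1 ≤ ρ) :
    M.cdX (fun I : Fin 2 → Fin d => M.Y i (I 0) (I 1)) ∈ M.AC ρ (K + 1) (Fin 2) (i + 1 + 1) 1 := by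
  have h1 := AC2_Y (M := M) (ρ := ρ) (show i + 1 + 1 ≤ K + 1 by omega)
  have h2 := (AC2_Y (M := M) (ρ := ρ) (show 0 + 1 ≤ K + 1 by omega)).mul
    (AC2_Y (M := M) (ρ := ρ) (show i + 1 ≤ K + 1 by omega))
  have h3 := M.Cl2_mul_vec_vec (AC_R (M := M) (K := K + 1) (ρ := ρ) 0)
    (AC1_X (M := M) (ρ := ρ) (show 0 ≤ K + 1 by omega))
    (AC1_X (M := M) (ρ := ρ) (show i ≤ K + 1 by omega))
  refine Cl.cast ((h1.sub (h2.cast (w' := i + 1 + 1) (δ' := 1) (by omega) (by omega)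
    fun _ _ => rfl)).sub (h3.cast (w' := i + 1 + 1) (δ' := 1) (by omega) (by omega)
    fun _ _ => rfl)) rfl le_rfl fun I => ?_
  have h4 := M.cdX_Y i (I 0) (I 1)
  rw [← MetricAlg.eq_vec_two I] at h4
  rw [cdX, h4, up_mul_Y]
  rfl

lemma AC_cdX_R (m : ℕ) : M.cdX (M.iterCov M.Riem m) ∈ M.AC ρ (K + 1) (Fin (4 + m)) (2 + m + 1) ρ := by
  rw [cdX_iterCov]
  exact Cl.cast (M.Cl_iv_up (AC1_X (M := M) (ρ := ρ) (show 0 ≤ K + 1 by omega))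
    (Cl.re (MetricAlg.consEquiv (4 + m)) (AC_R (M := M) (K := K + 1) (ρ := ρ) (m + 1))))
    (by omega) (by omega) fun _ => rfl

lemma AC_dV_atom (hρ : 1 ≤ ρ) {κ : Type} {F : Ten d A κ} (hF : M.AAtom ρ K κ w δ F) :
    ∃ (_ : Fintype κ) (_ : DecidableEq κ),
      M.dV (fun _ : Empty → Fin d => M.Xup) F ∈ M.AC ρ (K + 1) (Empty ⊕ κ) (w + 1) δ := by
  cases hF with
  | X _ hi => exact ⟨_, _, dV_Xup_mem (AC_cdX_X hi)⟩
  | Y _ hi => exact ⟨_, _, dV_Xup_mem (AC_cdX_Y hi hρ)⟩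
  | R m => exact ⟨_, _, dV_Xup_mem (AC_cdX_R m)⟩

/-- The ideal is `⊥` here: the gradient is transverse to the hypersurface, so these identities are
kept exact until all derivatives have been taken. -/
lemma AC_cdX (hρ : 1 ≤ ρ) {F : Ten d A κ} (hF : F ∈ M.AC ρ K κ w δ) :
    M.cdX F ∈ M.AC ρ (K + 1) κ (w + 1) δ := by
  rw [cdX_eq]
  refine Cl.re _ (M.dV_mem (At := M.AAtom ρ K) _ ?_ ?_ ?_ hF)
  · intro f hf _
    rw [Ideal.mem_bot] at hf
    simp [hf]
  · intro κ w δ F hF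
    cases hF with
    | X _ hi => exact AAtom.X _ (by omega)
    | Y _ hi => exact AAtom.Y _ (by omega)
    | R m => exact AAtom.R m
  · exact fun κ _ _ w δ F hF => AC_dV_atom hρ hF

lemma AC0_L (hρ : 1 ≤ ρ) {f : A} (hf : M.AC0 ρ K w δ f) : M.AC0 ρ (K + 1) (w + 1) δ (M.L f) := by
  refine Cl.cast (AC_cdX hρ hf) rfl le_rfl fun I => ?_
  simp [cdX, L, MetricAlg.cd_apply, act]

lemma AC0_iterate_L (hρ : 1 ≤ ρ) {f : A} (hf : M.AC0 ρ K w δ f) (n : ℕ) :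
    M.AC0 ρ (K + n) (w + n) δ (M.L^[n] f) := by
  induction n with
  | zero => exact hf
  | succ n ih => rw [Function.iterate_succ_apply']; exact AC0_L hρ ih

/-- The derivative of covectors along the gradient of `σ`. -/
lemma AC1_cdX (hρ : 1 ≤ ρ) {V : Fin d → A} (hV : M.AC1 ρ K w δ V) :
    M.AC1 ρ (K + 1) (w + 1) δ (fun c => ∑ b, M.Xup b * M.cdC b V c) := by
  refine Cl.cast (AC_cdX hρ hV) rfl le_rfl fun I => ?_
  simp only [cdX, MetricAlg.cd_fin_one]


lemma AC0_u {k : ℕ} (hk : k ≤ K) : M.AC0 ρ K k (min k 1) (M.u k) :=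
  Cl0.cast (Cl1.dot (AC1_X hk) (AC1_X (Nat.zero_le K))) (by simp) (by simp) rfl

lemma AC_Ric : M.Ric ∈ M.AC ρ K (Fin 2) 2 ρ := by
  rw [M.Ric_eq_ctr]
  exact Cl.ctr (Cl.re _ (AC_R 0))

lemma AC0_J : M.AC0 ρ K 2 ρ M.J := by
  refine (Cl2.trace (Y := fun a b => M.Ric ![a, b]) ?_).smul (1 / (2 * ((d : ℝ) - 1)))
  exact Cl.cast AC_Ric rfl le_rfl fun I => congrArg _ (MetricAlg.eq_vec_two I).symm

lemma AC0_ric {i j : ℕ} (hi : i ≤ K) (hj : j ≤ K) :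
    M.AC0 ρ K (i + j + 2) (min i 1 + min j 1 + ρ) (M.ric (M.X i) (M.X j)) :=
  Cl0.cast (M.Cl0_mul_vec_vec AC_Ric (AC1_X hi) (AC1_X hj)) (by omega) (by omega) rfl

lemma AC0_trYY {k : ℕ} (hk : k + 1 ≤ K) : M.AC0 ρ K (k + 2) 2 (M.trYY k) :=
  Cl0.cast (Cl2.trace (Cl2.mul (AC2_Y (show 0 + 1 ≤ K by omega)) (AC2_Y hk))) (by omega) le_rfl rfl

lemma AC0_dv {k : ℕ} (hk : k + 1 ≤ K) : M.AC0 ρ K (k + 1) 1 (M.dv k) := Cl2.trace (AC2_Y hk)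

/-- Iterated derivatives of `|dσ|²`. -/
lemma iterate_L_u_zero (hρ : 1 ≤ ρ) (k : ℕ) :
    M.AC0 ρ k (k + 1) 2 (M.L^[k + 1] (M.u 0) - (2 : ℝ) • M.u (k + 1)) := by
  induction k with
  | zero =>
    rw [Function.iterate_one, L_u_zero, sub_self]
    exact Cl0.zero
  | succ k ih =>
    have h1 := AC0_L hρ ih
    -- By `L_u` the derivative of `u (k + 1)` is `u (k + 2)` plus `⟨X_{k+1}, X_1⟩`, a product of two
    -- factors of positive degree.
    have h2 := (Cl1.dot (AC1_X (M := M) (ρ := ρ) (le_refl (k + 1)))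
      (AC1_X (M := M) (ρ := ρ) (show 1 ≤ k + 1 by omega))).smul (2 : ℝ)
    refine (h1.add (h2.cast (w' := k + 1 + 1) (δ' := 2) rfl (by omega) rfl)).congr ?_
    rw [Function.iterate_succ_apply' _ (k + 1), L_sub, L_smul, L_u, smul_add]
    change _ = _ + (2 : ℝ) • M.dot _ _
    abel

/-- The covectors `X k` are differentials up to terms of higher degree. -/
lemma X_sub_grad (hρ : 1 ≤ ρ) (k : ℕ) :
    M.AC1 ρ (k + 1) (k + 2) 2 (fun c => M.X (k + 2) c - M.D c (M.u (k + 1))) := by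
  induction k with
  | zero =>
    have h1 := Cl2.mulVec (AC2_Y (M := M) (ρ := ρ) (show 0 + 1 ≤ 0 + 1 by omega))
      (AC1_X (M := M) (ρ := ρ) (show 1 ≤ 0 + 1 by omega))
    refine (h1.smul (-1)).cast (by omega) (by omega) fun c => ?_
    have h2 : M.X 2 c = ∑ b, M.Xup b * M.cdC b (M.X 1) c := rfl
    -- The base case rests on `X_1` being exactly half of `d u_0` and on `L u_0 = 2 u_1`.
    have h3 : M.X 1 = (1 / 2 : ℝ) • M.grad (M.u 0) := funext fun c => M.X_one_eq c
    have h4 := M.cdX_grad (M.u 0) c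
    have h5 : ∑ b, M.Xup b * M.cdC b (M.X 1) c
        = (1 / 2 : ℝ) • ∑ b, M.Xup b * M.cdC b (M.grad (M.u 0)) c := by
      rw [h3]
      simp only [MetricAlg.cdC, Pi.smul_apply, Derivation.map_smul, mul_smul_comm, smul_sub,
        mul_sub, ← Finset.smul_sum, Finset.sum_sub_distrib]
    have h6 : M.dot (M.Y 0 c) (M.X 1) = (1 / 2 : ℝ) • M.dot (M.Y 0 c) (M.grad (M.u 0)) := by
      rw [h3]
      simp only [MetricAlg.dot, Pi.smul_apply, mul_smul_comm, Finset.smul_sum]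
    change _ = (-1 : ℝ) • M.dot (M.Y 0 c) (M.X 1)
    rw [h2, h5, h4, h6, L_u_zero, Derivation.map_smul, smul_sub, smul_smul]
    norm_num
  | succ k ih =>
    have h1 := AC1_cdX hρ ih
    -- Moving `∇_X` past `d` costs the Hessian applied to `d u_{k+1}`, expressed by `h2` and `h3`;
    -- differentiating the extra product in `L_u` costs `h4` and `h5`.
    have hY := AC2_Y (M := M) (ρ := ρ) (show 0 + 1 ≤ k + 1 + 1 by omega)
    have h2 := Cl2.mulVec hY (AC1_X (M := M) (ρ := ρ) (show k + 2 ≤ k + 1 + 1 by omega))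
    have h3 := Cl2.mulVec hY (AC1.mono (Nat.le_succ _) ih)
    have h4 := Cl2.mulVec (AC2_Y (M := M) (ρ := ρ) (show k + 1 + 1 ≤ k + 1 + 1 by omega))
      (AC1_X (M := M) (ρ := ρ) (show 1 ≤ k + 1 + 1 by omega))
    have h5 := Cl2.mulVec (AC2_Y (M := M) (ρ := ρ) (show 1 + 1 ≤ k + 1 + 1 by omega))
      (AC1_X (M := M) (ρ := ρ) (show k + 1 ≤ k + 1 + 1 by omega))
    refine ((((h1.sub (h2.cast (w' := k + 2 + 1) (δ' := 2) (by omega) (by omega)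
      fun _ => rfl)).add (h3.cast (w' := k + 2 + 1) (δ' := 2) (by omega) (by omega)
      fun _ => rfl)).add (h4.cast (w' := k + 2 + 1) (δ' := 2) (by omega) (by omega)
      fun _ => rfl)).add (h5.cast (w' := k + 2 + 1) (δ' := 2) (by omega) (by omega)
      fun _ => rfl)).congr fun c => ?_
    have h6 : M.X (k + 1 + 2) c = ∑ b, M.Xup b * M.cdC b (M.X (k + 2)) c := rfl
    have h7 := M.cdX_grad (M.u (k + 1)) c
    rw [L_u, map_add, MetricAlg.D_dot] at h7
    have h8 : ∑ b, M.Xup b * M.cdC b (fun c => M.X (k + 2) c - M.D c (M.u (k + 1))) c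
        = (∑ b, M.Xup b * M.cdC b (M.X (k + 2)) c)
          - ∑ b, M.Xup b * M.cdC b (M.grad (M.u (k + 1))) c := by
      simp only [MetricAlg.cdC, MetricAlg.grad, map_sub, mul_sub, Finset.sum_sub_distrib]
      ring
    have h9 : (∑ b, ∑ e, M.h b e * (M.Y 0 c b * (M.X (k + 2) e - M.D e (M.u (k + 1)))))
        = M.dot (M.Y 0 c) (M.X (k + 2)) - M.dot (M.Y 0 c) (M.grad (M.u (k + 1))) := by
      simp only [MetricAlg.dot, MetricAlg.grad, mul_sub, Finset.sum_sub_distrib]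
    have h10 : M.dot (M.X (k + 1)) (M.cdC c (M.X 1))
      = ∑ b, ∑ e, M.h b e * (M.Y 1 c b * M.X (k + 1) e) := M.dot_comm _ _
    rw [h6, h8, h7, h9, h10]
    simp only [MetricAlg.dot, Y]
    ring

/-- Iterated derivatives of the divergence of `dσ`. -/
lemma iterate_L_dv (hρ : 1 ≤ ρ) (m : ℕ) :
    M.AC0 ρ (m + 1) (m + 2) 2
      (M.L^[m + 1] (M.dv 0) - M.dv (m + 1) + M.L^[m] (M.ric (M.X 0) (M.X 0))) := by
  induction m with
  | zero =>
    refine (AC0_trYY (M := M) (ρ := ρ) (show 0 + 1 ≤ 0 + 1 by omega)).neg.congr ?_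
    rw [Function.iterate_one, L_dv, Function.iterate_zero, id]
    ring
  | succ m ih =>
    have h1 := AC0_L hρ ih
    have h2 := AC0_trYY (M := M) (ρ := ρ) (show m + 1 + 1 ≤ m + 1 + 1 by omega)
    have h3 := AC0_ric (M := M) (ρ := ρ) (Nat.zero_le (m + 1 + 1)) (show m + 1 ≤ m + 1 + 1 by omega)
    refine ((h1.sub (h2.cast (w' := m + 2 + 1) (δ' := 2) (by omega) (by omega) rfl)).sub
      (h3.cast (w' := m + 2 + 1) (δ' := 2) (by omega) (by omega) rfl)).congr ?_
    rw [Function.iterate_succ_apply' _ (m + 1) (M.dv 0),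
      Function.iterate_succ_apply' _ m (M.ric _ _), L_add, L_sub, L_dv]
    ring

end YamabeAlg

end SingularYamabe

/-! ### Iterated derivatives of the powers of `σ` -/

namespace SingularYamabe

variable {d : ℕ} {A : Type*} [CommRing A] [Algebra ℝ A]

namespace YamabeAlg

variable (M : YamabeAlg d A) {ρ K K' w w' δ δ' : ℕ}

lemma iterate_L_add (n : ℕ) (f g : A) : M.L^[n] (f + g) = M.L^[n] f + M.L^[n] g := by
  induction n generalizing f g with
  | zero => rfl
  | succ n ih => simp only [Function.iterate_succ_apply, L_add, ih]

lemma iterate_L_sub (n : ℕ) (f g : A) : M.L^[n] (f - g) = M.L^[n] f - M.L^[n] g := by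
  induction n generalizing f g with
  | zero => rfl
  | succ n ih => simp only [Function.iterate_succ_apply, L_sub, ih]

lemma iterate_L_smul (n : ℕ) (r : ℝ) (f : A) : M.L^[n] (r • f) = r • M.L^[n] f := by
  induction n generalizing f with
  | zero => rfl
  | succ n ih => simp only [Function.iterate_succ_apply, L_smul, ih]

lemma iterate_L_one (n : ℕ) : M.L^[n + 1] 1 = 0 := by
  induction n with
  | zero => exact M.L_one
  | succ n ih => rw [Function.iterate_succ_apply', ih]; simp [L]

lemma L_σ_pow (n : ℕ) : M.L (M.σ ^ (n + 1)) = (n + 1 : ℝ) • (M.σ ^ n * M.u 0) := by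
  induction n with
  | zero => simp [L_σ]
  | succ n ih =>
    rw [pow_succ, L_mul, ih, L_σ]
    simp only [Algebra.smul_def, map_add, map_one, map_natCast]
    push_cast
    ring

/-- Unless the `n` derivatives fall on the `n` factors `σ`, one on each, a factor `σ` is left over;
the `n!` remaining distributions each give `u_0^n f`. -/
lemma iterate_L_σ_pow_mul (n : ℕ) (f : A) :
    M.L^[n] (M.σ ^ n * f) - (n.factorial : ℝ) • (M.u 0 ^ n * f) ∈ Ideal.span {M.σ} := by
  induction n generalizing f with
  | zero => simp
  | succ n ih =>
    -- One derivative of `σ^{n+1} f` is `σ^n` times the sum of the two arguments to which the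
    -- induction hypothesis is applied.
    have h1 := ih ((n + 1 : ℝ) • (M.u 0 * f))
    have h2 := ih (M.σ * M.L f)
    have h3 : (n.factorial : ℝ) • (M.u 0 ^ n * (M.σ * M.L f)) ∈ Ideal.span {M.σ} := by
      rw [Algebra.smul_def]
      exact Ideal.mul_mem_left _ _ (Ideal.mul_mem_left _ _
        (Ideal.mul_mem_right _ _ (Ideal.mem_span_singleton_self _)))
    have h4 := Ideal.add_mem _ h1 (Ideal.add_mem _ h2 h3)
    convert h4 using 1
    rw [Function.iterate_succ_apply, L_mul, L_σ_pow, iterate_L_add, Nat.factorial_succ]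
    have h5 : (n + 1 : ℝ) • (M.σ ^ n * M.u 0) * f = M.σ ^ n * ((n + 1 : ℝ) • (M.u 0 * f)) := by
      simp only [Algebra.smul_def]; ring
    have h6 : M.σ ^ (n + 1) * M.L f = M.σ ^ n * (M.σ * M.L f) := by ring
    rw [h5, h6]
    simp only [Algebra.smul_def]
    push_cast
    ring

lemma span_σ_le : Ideal.span {M.σ} ≤ M.Z := by
  rw [Ideal.span_le]; simpa using M.σ_mem

/-- Fewer derivatives than factors always leave a factor `σ`. -/
lemma iterate_L_σ_pow_mem {n m : ℕ} (h : n < m) (f : A) : M.L^[n] (M.σ ^ m * f) ∈ M.Z := by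
  obtain ⟨k, rfl⟩ := Nat.exists_eq_add_of_lt h
  have h1 := M.span_σ_le (M.iterate_L_σ_pow_mul n (M.σ * (M.σ ^ k * f)))
  have h2 : (n.factorial : ℝ) • (M.u 0 ^ n * (M.σ * (M.σ ^ k * f))) ∈ M.Z := by
    rw [Algebra.smul_def]
    exact Ideal.mul_mem_left _ _ (Ideal.mul_mem_left _ _ (Ideal.mul_mem_right _ _ M.σ_mem))
  have h3 := Ideal.add_mem _ h1 h2
  rw [sub_add_cancel] at h3
  convert h3 using 2
  ring

/-- In the equation for `σ` every term other than `|dσ|²` and `1` contains `σ`. -/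
lemma u_zero_sub_one : M.u 0 - 1 ∈ M.Z := by
  have h := M.eqn
  have h0 : 0 < d := by have := M.three_le; omega
  obtain ⟨n, hn⟩ : ∃ n, d = n + 1 := ⟨d - 1, by omega⟩
  have h1 : M.u 0 - 1 = M.σ * (M.σ ^ n * M.B + (2 / (d : ℝ)) •
      ((∑ b, ∑ c, M.h b c * M.cdC b (M.grad M.σ) c) + M.J * M.σ)) := by
    rw [sub_eq_iff_eq_add] at h
    change M.dot (M.grad M.σ) (M.grad M.σ) - 1 = _
    rw [h]
    have : M.σ ^ d = M.σ * M.σ ^ n := by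
      conv_lhs => rw [show M.σ ^ d = M.σ ^ (n + 1) by rw [← hn]]
      ring
    rw [this, mul_add M.σ (_ * _), mul_smul_comm]
    ring
  rw [h1]
  exact Ideal.mul_mem_right _ _ M.σ_mem

variable {M}

/-- If two derivatives fall on `σ`, they give `2 u_1`, and the product with a derivative of `Δσ` has
degree two. The term with `σ` is kept explicitly, since `L` does not preserve the ideal of the
hypersurface. -/
lemma iterate_L_σ_mul (hρ : 1 ≤ ρ) (n : ℕ) : ∃ E, M.AC0 ρ n (n + 1) 2 E ∧
    M.L^[n + 1] (M.σ * M.dv 0)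
      = M.σ * M.L^[n + 1] (M.dv 0) + (n + 1 : ℝ) • (M.u 0 * M.L^[n] (M.dv 0)) + E := by
  induction n with
  | zero =>
    refine ⟨0, Cl0.zero, ?_⟩
    simp only [zero_add, Function.iterate_one, Function.iterate_zero, id, L_mul, L_σ,
      CharP.cast_eq_zero, one_smul]
    ring
  | succ n ih =>
    obtain ⟨E, hE, h⟩ := ih
    have h1 := AC0_iterate_L hρ (AC0_dv (M := M) (ρ := ρ) (le_refl (0 + 1))) n
    have h2 := ((AC0_u (M := M) (ρ := ρ) (show 1 ≤ n + 1 by omega)).mul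
      (h1.mono (show 0 + 1 + n ≤ n + 1 by omega))).smul ((n + 1 : ℝ) * 2)
    refine ⟨_, (h2.cast (w' := n + 1 + 1) (δ' := 2) (by omega) (by omega) rfl).add (AC0_L hρ hE), ?_⟩
    rw [Function.iterate_succ_apply' _ (n + 1), h, L_add, L_add, L_smul, L_mul, L_mul, L_σ, L_u_zero,
      Function.iterate_succ_apply' _ (n + 1) (M.dv 0), Function.iterate_succ_apply' _ n (M.dv 0)]
    simp only [Algebra.smul_def, map_add, map_one, map_natCast, map_mul]
    push_cast
    ring

/-- On the hypersurface and below degree two only the summands with one derivative on each factor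
`σ` remain. The error `E` multiplying `σ` has to be recorded, as the next derivative moves it into
`E'`. -/
lemma iterate_L_σ_sq_mul (hρ : 1 ≤ ρ) (n : ℕ) : ∃ E E', M.AC0 ρ (n + 1) (n + 3) 2 E ∧
    M.AC0 ρ (n + 1) (n + 2) 2 E' ∧ M.L^[n + 2] (M.σ * (M.J * M.σ))
      = M.σ * (M.σ * M.L^[n + 2] M.J)
        + M.σ * ((2 * (n + 2) : ℝ) • (M.u 0 * M.L^[n + 1] M.J) + E)
        + (((n + 2) * (n + 1) : ℝ) • (M.u 0 * (M.u 0 * M.L^[n] M.J)) + E') := by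
  induction n with
  | zero =>
    have h2 := ((AC0_u (M := M) (ρ := ρ) (show 1 ≤ 0 + 1 by omega)).mul
      (AC0_J (M := M) (ρ := ρ))).smul (4 : ℝ)
    refine ⟨_, 0, h2.cast (by omega) (by omega) rfl, Cl0.zero, ?_⟩
    simp only [Function.iterate_succ_apply, Function.iterate_zero, id, L_mul, L_add, L_σ, L_u_zero]
    simp only [Algebra.smul_def, map_mul, map_add, map_ofNat, Nat.cast_zero, map_zero, map_one]
    ring
  | succ n ih =>
    obtain ⟨E, E', hE, hE', h⟩ := ih
    have h1 := AC0_iterate_L hρ (AC0_J (M := M) (ρ := ρ) (K := 0))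
    have hu := AC0_u (M := M) (ρ := ρ) (show 1 ≤ n + 1 + 1 by omega)
    have h0 := AC0_u (M := M) (ρ := ρ) (show 0 ≤ n + 1 + 1 by omega)
    have h2 := (hu.mul ((h1 (n + 1)).mono (show 0 + (n + 1) ≤ n + 1 + 1 by omega))).smul
      (4 * (n + 2) : ℝ)
    have h3 := ((hu.mul h0).mul
      ((h1 n).mono (show 0 + n ≤ n + 1 + 1 by omega))).smul (4 * (n + 2) * (n + 1) : ℝ)
    have h4 := h0.mul (hE.mono (show n + 1 ≤ n + 1 + 1 by omega))
    refine ⟨_, _, (h2.cast (w' := n + 1 + 3) (δ' := 2) (by omega) (by omega) rfl).add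
      ((AC0_L hρ hE).cast (w' := n + 1 + 3) (by omega) le_rfl rfl),
      ((h3.cast (w' := n + 1 + 2) (δ' := 2) (by omega) (by omega) rfl).add
      (h4.cast (w' := n + 1 + 2) (δ' := 2) (by omega) (by omega) rfl)).add
      ((AC0_L hρ hE').cast (w' := n + 1 + 2) (by omega) le_rfl rfl), ?_⟩
    rw [Function.iterate_succ_apply' _ (n + 2), h]
    simp only [L_add, L_smul, L_mul, L_σ, L_u_zero, Function.iterate_succ_apply']
    simp only [Algebra.smul_def, map_mul, map_add, map_ofNat, map_one, map_natCast]
    push_cast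
    ring

end YamabeAlg

end SingularYamabe

/-! ### Tangential operators and restriction to the hypersurface -/

namespace SingularYamabe

variable {d : ℕ} {A : Type*} [CommRing A] [Algebra ℝ A]

lemma Cl0.natMul {h : Fin d → Fin d → A} {At : Atoms d A} {Z : Ideal A} {w δ : ℕ} {f : A} (n : ℕ)
    (hf : Cl0 h At Z w δ f) : Cl0 h At Z w δ (n * f) :=
  (hf.smul (n : ℝ)).congr (by rw [Algebra.smul_def, map_natCast])

namespace HypAlg

variable (M : HypAlg d A) {ρ w δ : ℕ}

/-- Scalars in the class of the hypersurface. -/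
abbrev HC0 (ρ w δ : ℕ) (f : A) : Prop := Cl0 M.h (M.HAtom ρ) M.Z w δ f

/-- Covectors in the class of the hypersurface. -/
abbrev HC1 (ρ w δ : ℕ) (X : Fin d → A) : Prop := Cl1 M.h (M.HAtom ρ) M.Z w δ X

/-- Bilinear forms in the class of the hypersurface. -/
abbrev HC2 (ρ w δ : ℕ) (Y : Fin d → Fin d → A) : Prop := Cl2 M.h (M.HAtom ρ) M.Z w δ Y

/-- The tangential derivative of a function. -/
def tgrad (f : A) (a : Fin d) : A := ∑ b, M.γ a b * M.D b f

/-- The tangential derivative of a covector. -/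
def tcd (X : Fin d → A) (a c : Fin d) : A := ∑ b, M.γ a b * M.cdC b X c

/-- The tangential divergence of a covector. -/
def tdiv (X : Fin d → A) : A := ∑ a, ∑ c, M.h a c * M.tcd X a c

/-- The intrinsic Laplacian. -/
def tLap (f : A) : A := M.tdiv (M.tgrad f)

/-- The mean curvature. -/
def mean : A := (1 / ((d : ℝ) - 1)) • ∑ a, ∑ b, M.h a b * M.II ![a, b]

lemma tgrad_mem {f : A} (hf : f ∈ M.Z) (a : Fin d) : M.tgrad f a ∈ M.Z := M.Z_tan f hf a

lemma tgrad_sub (f f' : A) (a : Fin d) : M.tgrad (f - f') a = M.tgrad f a - M.tgrad f' a := by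
  simp [tgrad, mul_sub, Finset.sum_sub_distrib]

lemma cdC_sub (X Y : Fin d → A) (a c : Fin d) :
    M.cdC a (fun c => X c - Y c) c = M.cdC a X c - M.cdC a Y c := by
  simp only [MetricAlg.cdC, map_sub, mul_sub, Finset.sum_sub_distrib]; ring

lemma tcd_sub (X Y : Fin d → A) (a c : Fin d) :
    M.tcd (fun c => X c - Y c) a c = M.tcd X a c - M.tcd Y a c := by
  simp [tcd, cdC_sub, mul_sub, Finset.sum_sub_distrib]

lemma tdiv_sub (X Y : Fin d → A) : M.tdiv (fun c => X c - Y c) = M.tdiv X - M.tdiv Y := by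
  simp [tdiv, tcd_sub, mul_sub, Finset.sum_sub_distrib]

lemma tcd_mem {X : Fin d → A} (hX : ∀ a, X a ∈ M.Z) (a c : Fin d) : M.tcd X a c ∈ M.Z := by
  simp only [tcd, MetricAlg.cdC, mul_sub, Finset.sum_sub_distrib]
  exact sub_mem (M.tgrad_mem (hX c) a)
    (Ideal.sum_mem _ fun _ _ => Ideal.mul_mem_left _ _ (Ideal.sum_mem _ fun _ _ =>
      Ideal.mul_mem_left _ _ (hX _)))

lemma tdiv_mem {X : Fin d → A} (hX : ∀ a, X a ∈ M.Z) : M.tdiv X ∈ M.Z :=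
  Ideal.sum_mem _ fun _ _ => Ideal.sum_mem _ fun _ _ => Ideal.mul_mem_left _ _ (M.tcd_mem hX _ _)

lemma tLap_sub (f f' : A) : M.tLap (f - f') = M.tLap f - M.tLap f' := by
  have : M.tgrad (f - f') = fun a => M.tgrad f a - M.tgrad f' a := funext (M.tgrad_sub f f')
  rw [tLap, this, tdiv_sub]; rfl

lemma tLap_smul (r : ℝ) (f : A) : M.tLap (r • f) = r • M.tLap f := by
  simp only [tLap, tdiv, tcd, tgrad, MetricAlg.cdC, Derivation.map_smul, mul_smul_comm,
    ← Finset.smul_sum, ← smul_sub]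

lemma tcd_N (a c : Fin d) : M.tcd M.N a c = M.II ![a, c] := (M.II_apply a c).symm

lemma mean_eq : (d - 1 : ℝ) ≠ 0 → ((d : ℝ) - 1) • M.mean = M.tdiv M.N := by
  intro h
  rw [mean, smul_smul, mul_one_div_cancel h, one_smul]
  simp only [tdiv, tcd_N]

lemma sum_γ_h (b : Fin d) (F : Fin d → A) : F b = (∑ a, M.γ b a * F a)
    + M.N b * ∑ a, M.Nup a * F a := by
  rw [γ_mul]; ring

variable {M}

lemma HC1_N : M.HC1 ρ 0 0 M.N := Cl.of_atom HAtom.N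

lemma HC1_tgrad {f : A} (hf : M.HC0 ρ w δ f) : M.HC1 ρ (w + 1) δ (M.tgrad f) := by
  refine Cl.cast (Cl.re (⟨Sum.elim (fun _ => 0) Fin.elim0, fun _ => Sum.inl (), by decide,
    by decide⟩ : Unit ⊕ Fin 0 ≃ Fin 1) (HC_tnab hf)) rfl le_rfl fun I => ?_
  simp [re, tnab_apply, tgrad, MetricAlg.cd_apply, act]

lemma HC2_tcd {X : Fin d → A} (hX : M.HC1 ρ w δ X) : M.HC2 ρ (w + 1) δ (M.tcd X) := by
  refine Cl.cast (Cl.re (MetricAlg.consEquiv 1).symm (HC_tnab hX)) rfl le_rfl fun I => ?_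
  simp only [re, tnab_apply, MetricAlg.cd_fin_one, tcd]
  rfl

lemma HC0_tdiv {X : Fin d → A} (hX : M.HC1 ρ w δ X) : M.HC0 ρ (w + 1) δ (M.tdiv X) :=
  Cl2.trace (HC2_tcd hX)

lemma HC0_tLap {f : A} (hf : M.HC0 ρ w δ f) : M.HC0 ρ (w + 2) δ (M.tLap f) :=
  HC0_tdiv (HC1_tgrad hf)

lemma HC2_II : M.HC2 ρ 1 1 (M.tcd M.N) := by
  refine Cl.cast (Cl.of_atom (HAtom.II 0)) rfl le_rfl fun I => ?_
  rw [tcd_N, ← MetricAlg.eq_vec_two]; rfl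

lemma HC0_tdiv_N : M.HC0 ρ 1 1 (M.tdiv M.N) := Cl2.trace HC2_II

lemma HC0_mean : M.HC0 ρ 1 1 M.mean :=
  (HC0_tdiv_N.smul (1 / ((d : ℝ) - 1))).congr (by simp only [mean, tdiv, tcd_N])

end HypAlg

namespace YamabeAlg

variable (M : YamabeAlg d A) {κ : Type} [Fintype κ] [DecidableEq κ] {ρ K K' w w' δ δ' : ℕ}

lemma X_zero_sub_N (a : Fin d) : M.X 0 a - M.N a ∈ M.Z := M.D_σ a

lemma Nup_sub_Xup (a : Fin d) : M.Nup a - M.Xup a ∈ M.Z := by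
  have : M.Nup a - M.Xup a = ∑ b, M.h a b * (M.N b - M.X 0 b) := by
    simp only [mul_sub, Finset.sum_sub_distrib]; rfl
  rw [this]
  exact Ideal.sum_mem _ fun b _ => Ideal.mul_mem_left _ _
    (neg_sub (M.X 0 b) (M.N b) ▸ neg_mem (M.X_zero_sub_N b))

lemma Nup_mul_Y (i : ℕ) (c : Fin d) : (∑ a, M.Nup a * M.Y i a c) - M.X (i + 1) c ∈ M.Z := by
  have : (∑ a, M.Nup a * M.Y i a c) - M.X (i + 1) c = ∑ a, (M.Nup a - M.Xup a) * M.Y i a c := by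
    simp only [sub_mul, Finset.sum_sub_distrib]; rfl
  rw [this]
  exact Ideal.sum_mem _ fun b _ => Ideal.mul_mem_right _ _ (M.Nup_sub_Xup b)

/-- Split the derivative index into tangential and normal parts; along the hypersurface the normal
is the gradient of `σ`, so the normal part is `∇_X X_i = X_{i+1}`. -/
lemma Y_sub (i : ℕ) (b c : Fin d) :
    M.Y i b c - (M.tcd (M.X i) b c + M.N b * M.X (i + 1) c) ∈ M.Z := by
  have h := M.sum_γ_h b (fun a => M.Y i a c)
  have : M.Y i b c - (M.tcd (M.X i) b c + M.N b * M.X (i + 1) c)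
      = M.N b * ((∑ a, M.Nup a * M.Y i a c) - M.X (i + 1) c) := by
    simp only [HypAlg.tcd]
    simp only [Y] at h ⊢
    linear_combination h
  rw [this]
  exact Ideal.mul_mem_left _ _ (M.Nup_mul_Y i c)

lemma tcd_X_zero (b c : Fin d) : M.tcd (M.X 0) b c - M.tcd M.N b c ∈ M.Z := by
  rw [← HypAlg.tcd_sub]
  exact M.tcd_mem M.X_zero_sub_N b c

lemma dot_N_sub_u (i : ℕ) : M.dot M.N (M.X i) - M.u i ∈ M.Z := by
  have : M.dot M.N (M.X i) - M.u i = ∑ b, ∑ c, M.h b c * ((M.N b - M.X 0 b) * M.X i c) := by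
    rw [u, M.dot_comm (M.X i)]
    simp only [MetricAlg.dot, sub_mul, mul_sub, Finset.sum_sub_distrib]
  rw [this]
  exact Ideal.sum_mem _ fun b _ => Ideal.sum_mem _ fun c _ => Ideal.mul_mem_left _ _
    (Ideal.mul_mem_right _ _ (neg_sub (M.X 0 b) (M.N b) ▸ neg_mem (M.X_zero_sub_N b)))

/-- The trace of `Y_sub`. The summand `u (i + 1)` is what turns the coefficient `d` of the recursion
into `d - (i + 1)`. -/
lemma dv_sub (i : ℕ) : M.dv i - (M.tdiv (M.X i) + M.u (i + 1)) ∈ M.Z := by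
  have : M.dv i - (M.tdiv (M.X i) + M.u (i + 1)) = (∑ b, ∑ c, M.h b c *
      (M.Y i b c - (M.tcd (M.X i) b c + M.N b * M.X (i + 1) c)))
      + (M.dot M.N (M.X (i + 1)) - M.u (i + 1)) := by
    simp only [dv, HypAlg.tdiv, MetricAlg.dot, mul_sub, mul_add, Finset.sum_sub_distrib,
      Finset.sum_add_distrib]
    ring
  rw [this]
  exact add_mem (Ideal.sum_mem _ fun b _ => Ideal.sum_mem _ fun c _ => Ideal.mul_mem_left _ _
    (M.Y_sub i b c)) (M.dot_N_sub_u _)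

/-- The covectors `X i` with `i ≤ K` belong to the class of the hypersurface. -/
def Good (ρ K : ℕ) : Prop := ∀ i ≤ K, M.HC1 ρ i (min i 1) (M.X i)

variable {M}

lemma Good.mono (hG : M.Good ρ K) (hK : K' ≤ K) : M.Good ρ K' := fun i hi => hG i (hi.trans hK)

lemma HC1_X_zero : M.HC1 ρ 0 0 (M.X 0) :=
  (HypAlg.HC1_N.add (Cl1.of_ideal M.X_zero_sub_N)).congr fun _ => by ring

lemma HC2_tcd_X {i : ℕ} (hX : M.HC1 ρ i (min i 1) (M.X i)) :
    M.HC2 ρ (i + 1) 1 (M.tcd (M.X i)) := by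
  rcases Nat.eq_zero_or_pos i with rfl | hi
  · exact (HypAlg.HC2_II.add (Cl2.of_ideal M.tcd_X_zero)).congr fun _ _ => by ring
  · exact (HypAlg.HC2_tcd hX).anti (by omega)

lemma HC2_Y {i : ℕ} (hG : M.Good ρ (i + 1)) : M.HC2 ρ (i + 1) 1 (M.Y i) := by
  have h1 := HC2_tcd_X (hG i (Nat.le_succ i))
  have h2 := Cl1.tmul HypAlg.HC1_N (hG (i + 1) le_rfl)
  exact ((h1.add (h2.cast (w' := i + 1) (δ' := 1) (by omega) (by omega) fun _ _ => rfl)).add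
    (Cl2.of_ideal (M.Y_sub i))).congr fun _ _ => by ring

lemma HC_of_AAtom (hG : M.Good ρ K) {κ : Type} {F : Ten d A κ} (hF : M.AAtom ρ K κ w δ F) :
    ∃ (_ : Fintype κ) (_ : DecidableEq κ), F ∈ M.HC ρ κ w δ := by
  cases hF with
  | X _ hi => exact ⟨_, _, hG _ hi⟩
  | Y _ hi => exact ⟨_, _, HC2_Y (hG.mono hi)⟩
  | R m => exact ⟨_, _, Cl.of_atom (HypAlg.HAtom.R m)⟩

/-- Once the `X_i` with `i ≤ K` are known on the hypersurface, any expression in transverse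
derivatives becomes one in hypersurface data by substitution of atoms, with the same weight and
degree. -/
lemma HC_of_AC (hG : M.Good ρ K) {F : Ten d A κ} (hF : F ∈ M.AC ρ K κ w δ) : F ∈ M.HC ρ κ w δ :=
  Cl.subst hF bot_le fun _ _ _ _ _ _ hF => HC_of_AAtom hG hF

lemma HC0_of_AC0 (hG : M.Good ρ K) {f : A} (hf : M.AC0 ρ K w δ f) : M.HC0 ρ w δ f :=
  HC_of_AC hG hf

lemma HC1_of_AC1 (hG : M.Good ρ K) {f : Fin d → A} (hf : M.AC1 ρ K w δ f) : M.HC1 ρ w δ f :=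
  HC_of_AC hG hf

variable (M)

/-- The equation without denominator; `dv 0` is the Laplacian of `σ`. -/
lemma natCast_eqn : (d : A) * M.u 0 - 2 * (M.σ * M.dv 0 + M.σ * (M.J * M.σ))
    = d * 1 + d * (M.σ ^ d * M.B) := by
  have h := M.eqn
  have h0 : (d : ℝ) ≠ 0 := by have := M.three_le; positivity
  have h1 := congrArg (fun f => (d : ℝ) • f) h
  simp only [smul_sub, smul_smul, mul_div_cancel₀ _ h0] at h1
  simp only [Algebra.smul_def, map_natCast, map_ofNat] at h1
  change (d : A) * M.u 0 - 2 * (M.σ * (M.dv 0 + M.J * M.σ)) = _ at h1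
  linear_combination h1

/-- Iterated derivatives along the gradient of `σ` of the remainder. -/
def rem (k : ℕ) : A := M.L^[k] (M.σ ^ d * M.B)

lemma iterate_L_natMul (n k : ℕ) (f : A) : M.L^[k] (n * f) = n * M.L^[k] f := by
  have := M.iterate_L_smul k n f
  simpa only [Algebra.smul_def, map_natCast] using this

lemma rem_mem {k : ℕ} (hk : k < d) : M.rem k ∈ M.Z := M.iterate_L_σ_pow_mem hk _

/-- All `d` derivatives must be spent on the `d` factors `σ`, and `u_0` is `1` on the hypersurface.
-/
lemma rem_self : M.rem d - (d.factorial : ℝ) • M.B ∈ M.Z := by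
  have h1 := M.span_σ_le (M.iterate_L_σ_pow_mul d M.B)
  have h2 : M.u 0 ^ d - 1 ∈ M.Z := Ideal.mem_of_dvd _ (sub_one_dvd_pow_sub_one (M.u 0) d) M.u_zero_sub_one
  have h3 := add_mem h1 (Ideal.mul_mem_left M.Z (algebraMap ℝ A d.factorial * M.B) h2)
  convert h3 using 1
  rw [rem]
  simp only [Algebra.smul_def]
  ring

/-- One derivative of the equation gives `d u_1 = Δσ` on the hypersurface, while `Δσ = (d - 1) H +
u_1` there. -/
lemma u_one_sub_mean : M.u 1 - M.mean ∈ M.Z := by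
  have hd := M.three_le
  have h1 := congrArg M.L M.natCast_eqn
  have hB : M.rem 1 ∈ M.Z := M.rem_mem (by omega)
  have h2' : (2 : A) = (2 : ℕ) := by norm_num
  have hn : ∀ (n : ℕ) f, M.L (n * f) = n * M.L f := fun n f => M.iterate_L_natMul n 1 f
  have hrem : M.L (M.σ ^ d * M.B) = M.rem 1 := rfl
  rw [h2', L_sub, hn, hn, L_add, L_add, hn, hn, L_one, hrem, L_mul, L_mul, L_σ, L_u_zero] at h1
  have h3 : M.tdiv (M.X 0) - M.tdiv M.N ∈ M.Z := by
    rw [← HypAlg.tdiv_sub]; exact M.tdiv_mem M.X_zero_sub_N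
  have hd' : ((d : ℝ) - 1) ≠ 0 := by
    have : (3 : ℝ) ≤ d := by exact_mod_cast hd
    linarith
  have h4 := M.mean_eq hd'
  have h5 : (2 * ((d : ℝ) - 1)) • (M.u 1 - M.mean) ∈ M.Z := by
    have := add_mem (Ideal.mul_mem_left _ 2 (add_mem (add_mem (M.dv_sub 0) h3)
      (Ideal.mul_mem_right (M.dv 0) _ M.u_zero_sub_one)))
      (add_mem (Ideal.mul_mem_right (2 * (M.L (M.dv 0) + M.L (M.J * M.σ) + M.u 0 * M.J)) _ M.σ_mem)
      (Ideal.mul_mem_left _ (d : A) hB))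
    convert this using 1
    simp only [Algebra.smul_def, map_mul, map_sub, map_natCast, map_ofNat, map_one, zero_add,
      Nat.cast_ofNat] at h1 h4 ⊢
    linear_combination h1 - 2 * h4
  have h6 : M.u 1 - M.mean = algebraMap ℝ A (2 * ((d : ℝ) - 1))⁻¹ *
      ((2 * ((d : ℝ) - 1)) • (M.u 1 - M.mean)) := by
    rw [← Algebra.smul_def, smul_smul, inv_mul_cancel₀ (by simpa using hd'), one_smul]
  rw [h6]
  exact Ideal.mul_mem_left _ _ h5

variable {M}

/-- The derivative `L^{n+2}` of the equation, restricted to the hypersurface. `L^{n+2} u_0` becomes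
`2 u_{n+2}`; the term `σ Δσ` becomes `n + 2` times `L^{n+1} Δσ`, that is the divergence of `X_{n+1}`
minus a Ricci term; the term with `σ²` becomes `(n + 2)(n + 1) L^n J`. All else has degree two. -/
lemma recursion (hρ : 1 ≤ ρ) (n : ℕ) (hG : M.Good ρ (n + 1)) :
    M.HC0 ρ (n + 2) 2 (2 * (d * M.u (n + 2) - (n + 2 : ℕ) * (M.u (n + 2) + M.tdiv (M.X (n + 1))
      - M.L^[n] (M.ric (M.X 0) (M.X 0)) + (n + 1 : ℕ) * M.L^[n] M.J)) - d * M.rem (n + 2)) := by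
  obtain ⟨E, hE, h1⟩ := iterate_L_σ_mul (M := M) hρ (n + 1)
  obtain ⟨E₁, E₂, -, hE₂, h2⟩ := iterate_L_σ_sq_mul (M := M) hρ n
  have h3 := iterate_L_u_zero (M := M) hρ (n + 1)
  have h4 := iterate_L_dv (M := M) hρ n
  have hz := M.dv_sub (n + 1)
  have hu := M.u_zero_sub_one
  have hs := M.σ_mem
  have h5 := congrArg (M.L^[n + 2]) M.natCast_eqn
  have h2' : (2 : A) = (2 : ℕ) := by norm_num
  have hrem : M.L^[n + 2] (M.σ ^ d * M.B) = M.rem (n + 2) := rfl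
  rw [h2', iterate_L_sub, iterate_L_add, iterate_L_natMul, iterate_L_natMul, iterate_L_natMul,
    iterate_L_natMul, iterate_L_add, iterate_L_one, h1, h2, hrem] at h5
  have m1 := (((h3.natMul d).neg.add ((h4.natMul (2 * (n + 2))))).add
    ((hE.add hE₂).natMul 2))
  have m2 := HC0_of_AC0 hG m1
  -- The contributions vanishing on the hypersurface: those with a factor `σ`, those from replacing
  -- `u_0` and `u_0²` by `1`, and the splitting of the divergence of `X_{n+1}`.
  have m3 := add_mem (add_mem
    (Ideal.mul_mem_right (2 * (M.L^[n + 2] (M.dv 0) + M.σ * M.L^[n + 2] M.J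
      + ((2 * (n + 2) : ℝ) • (M.u 0 * M.L^[n + 1] M.J) + E₁))) _ hs)
    (Ideal.mul_mem_right (2 * (n + 2) * M.L^[n + 1] (M.dv 0)
      + 2 * (n + 2) * (n + 1) * (M.u 0 + 1) * M.L^[n] M.J) _ hu))
    (Ideal.mul_mem_left _ (2 * (n + 2) : A) hz)
  refine (m2.add (Cl0.of_ideal m3)).congr ?_
  simp only [Algebra.smul_def, map_mul, map_add, map_natCast, map_ofNat, map_one] at h5 ⊢
  push_cast at h5 ⊢
  linear_combination h5

end YamabeAlg

end SingularYamabe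

/-! ### Solving the recursion; odd ambient dimension -/

namespace SingularYamabe

variable {d : ℕ} {A : Type*} [CommRing A] [Algebra ℝ A]

namespace HypAlg

variable {M : HypAlg d A} {ρ w δ w' δ' : ℕ}

lemma HC1_proj {X : Fin d → A} (hX : M.HC1 ρ w δ X) : M.HC1 ρ w δ (fun a => ∑ b, M.γ a b * X b) := by
  have h1 := Cl0.smul₁ (Cl1.dot HC1_N hX) (HC1_N (M := M) (ρ := ρ))
  refine (hX.sub (h1.cast (w' := w) (δ' := δ) (by omega) (by omega) fun _ => rfl)).congr fun a => ?_
  rw [γ_mul, Nup, M.sum_up_mul]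
  simp only [MetricAlg.dot]
  ring

lemma HC1_N_mul {f : A} (hf : M.HC0 ρ w δ f) : M.HC1 ρ w δ (fun a => M.N a * f) :=
  (Cl0.smul₁ hf (HC1_N (M := M) (ρ := ρ))).cast (by omega) (by omega) fun _ => mul_comm _ _

/-- The derivative of `f` would enter through its tangential gradient paired with `N`, which is
zero. -/
lemma tdiv_N_mul (f : A) : M.tdiv (fun a => M.N a * f) = f * M.tdiv M.N := by
  have h1 : ∀ a c, M.tcd (fun a => M.N a * f) a c = f * M.tcd M.N a c + M.tgrad f a * M.N c := by
    intro a c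
    have h2 : ∀ b, M.cdC b (fun a => M.N a * f) c = f * M.cdC b M.N c + M.D b f * M.N c := by
      intro b
      simp only [MetricAlg.cdC, Derivation.leibniz, smul_eq_mul, ← mul_assoc, ← Finset.sum_mul]
      ring
    simp only [tcd, h2, tgrad, mul_add, Finset.sum_add_distrib, Finset.sum_mul, Finset.mul_sum]
    congr 1
    · exact Finset.sum_congr rfl fun _ _ => by ring
    · exact Finset.sum_congr rfl fun _ _ => by ring
  have h3 : ∑ a, ∑ c, M.h a c * (M.tgrad f a * M.N c) = 0 := by
    have : ∑ a, ∑ c, M.h a c * (M.tgrad f a * M.N c) = ∑ a, M.Nup a * M.tgrad f a := by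
      refine Finset.sum_congr rfl fun a _ => ?_
      rw [Nup, MetricAlg.up, Finset.sum_mul]
      exact Finset.sum_congr rfl fun _ _ => by ring
    rw [this]
    simp only [tgrad, Finset.mul_sum]
    rw [Finset.sum_comm]
    refine Finset.sum_eq_zero fun b _ => ?_
    rw [← zero_mul (M.D b f), ← M.Nup_mul_γ b, Finset.sum_mul]
    exact Finset.sum_congr rfl fun _ _ => by ring
  simp only [tdiv, h1, mul_add, Finset.sum_add_distrib, h3, add_zero, Finset.mul_sum]
  exact Finset.sum_congr rfl fun _ _ => Finset.sum_congr rfl fun _ _ => by ring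

end HypAlg

namespace YamabeAlg

variable (M : YamabeAlg d A) {ρ K w δ : ℕ}

/-- Iterated derivatives of `Ric(∇σ, ∇σ)` along the gradient of `σ`. -/
def r (n : ℕ) : A := M.L^[n] (M.ric (M.X 0) (M.X 0))

/-- Iterated derivatives of `J` along the gradient of `σ`. -/
def j (n : ℕ) : A := M.L^[n] M.J

lemma X_eq (k : ℕ) (c : Fin d) :
    M.X k c - ((∑ b, M.γ c b * M.X k b) + M.N c * M.u k) ∈ M.Z := by
  have h := M.sum_γ_h c (M.X k)
  have h1 : ∑ a, M.Nup a * M.X k a = M.dot M.N (M.X k) := M.sum_up_mul _ _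
  have : M.X k c - ((∑ b, M.γ c b * M.X k b) + M.N c * M.u k)
      = M.N c * (M.dot M.N (M.X k) - M.u k) := by
    rw [← h1]; linear_combination h
  rw [this]
  exact Ideal.mul_mem_left _ _ (M.dot_N_sub_u k)

/-- `X_1` is half of `d|dσ|²`, and `|dσ|²` is constant along the hypersurface, so its tangential
part vanishes there. -/
lemma X_one_sub (c : Fin d) : M.X 1 c - M.N c * M.u 1 ∈ M.Z := by
  have h1 : ∑ b, M.γ c b * M.X 1 b ∈ M.Z := by
    have h2 := M.tgrad_mem M.u_zero_sub_one c
    have : ∑ b, M.γ c b * M.X 1 b = algebraMap ℝ A (1 / 2) * M.tgrad (M.u 0 - 1) c := by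
      simp only [X_one_eq, HypAlg.tgrad, map_sub, Derivation.map_one_eq_zero, sub_zero,
        Finset.mul_sum, Algebra.smul_def]
      exact Finset.sum_congr rfl fun _ _ => by ring
    rw [this]
    exact Ideal.mul_mem_left _ _ h2
  convert add_mem (M.X_eq 1 c) h1 using 1
  ring

variable {M}

lemma AC0_r (hρ : 1 ≤ ρ) (n : ℕ) : M.AC0 ρ n (n + 2) ρ (M.r n) :=
  AC0.mono (K := 0 + n) (by omega) (Cl0.cast (AC0_iterate_L hρ (AC0_ric (K := 0) le_rfl le_rfl) n)
    (by omega) (by omega) rfl)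

lemma AC0_j (hρ : 1 ≤ ρ) (n : ℕ) : M.AC0 ρ n (n + 2) ρ (M.j n) :=
  AC0.mono (K := 0 + n) (by omega) (Cl0.cast (AC0_iterate_L hρ (AC0_J (K := 0)) n)
    (by omega) (by omega) rfl)

/-- The tangential part of `X_{k+2}` agrees with that of `d u_{k+1}` by `X_sub_grad`; its normal
component is `u_{k+2}`. -/
lemma HC1_X_sub (hρ : 1 ≤ ρ) {k : ℕ} (hG : M.Good ρ (k + 1)) :
    M.HC1 ρ (k + 2) 2 (fun c => M.X (k + 2) c - (M.tgrad (M.u (k + 1)) c + M.N c * M.u (k + 2))) := by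
  have h1 := HypAlg.HC1_proj (HC1_of_AC1 hG (X_sub_grad (M := M) hρ k))
  refine (h1.add (Cl1.of_ideal (M.X_eq (k + 2)))).congr fun c => ?_
  simp only [mul_sub, Finset.sum_sub_distrib, HypAlg.tgrad]
  ring

/-- On the hypersurface `X_1 = u_1 N` with `u_1 = H`, so the tangential divergence is a multiple of
`H²`. -/
lemma HC0_tdiv_X_one : M.HC0 ρ 2 2 (M.tdiv (M.X 1)) := by
  have h1 : M.tdiv (M.X 1) - M.tdiv (fun a => M.N a * M.u 1) ∈ M.Z := by
    rw [← HypAlg.tdiv_sub]; exact M.tdiv_mem M.X_one_sub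
  rw [HypAlg.tdiv_N_mul] at h1
  have h2 := ((HypAlg.HC0_mean (M := M.toHypAlg) (ρ := ρ)).add (Cl0.of_ideal M.u_one_sub_mean)).mul
    (HypAlg.HC0_tdiv_N (M := M.toHypAlg) (ρ := ρ))
  exact (h2.add (Cl0.of_ideal h1)).congr (by ring)

lemma HC0_u_one : M.HC0 ρ 1 1 (M.u 1) :=
  ((HypAlg.HC0_mean (M := M.toHypAlg) (ρ := ρ)).add (Cl0.of_ideal M.u_one_sub_mean)).congr (by ring)

/-- The divergence of `HC1_X_sub`: the tangential gradient yields the intrinsic Laplacian, and the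
normal part yields `u_{k+2}` times the trace of `II`, of degree two. -/
lemma HC0_tdiv_X (hρ : 1 ≤ ρ) {k : ℕ} (hG : M.Good ρ (k + 1)) (hu : M.HC0 ρ (k + 2) 1 (M.u (k + 2))) :
    M.HC0 ρ (k + 3) 2 (M.tdiv (M.X (k + 2)) - M.tLap (M.u (k + 1))) := by
  have h1 := HypAlg.HC0_tdiv (HC1_X_sub hρ hG)
  have h2 := hu.mul (HypAlg.HC0_tdiv_N (M := M.toHypAlg) (ρ := ρ))
  refine (h1.add h2).congr ?_
  have h3 : (fun c => M.X (k + 2) c - (M.tgrad (M.u (k + 1)) c + M.N c * M.u (k + 2)))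
      = fun c => (fun c => M.X (k + 2) c - M.tgrad (M.u (k + 1)) c) c
        - (fun c => M.N c * M.u (k + 2)) c := by
    funext c; ring
  rw [h3, HypAlg.tdiv_sub, HypAlg.tdiv_sub, HypAlg.tdiv_N_mul, HypAlg.tLap]
  change _ = M.tdiv (M.X (k + 2)) - M.tdiv (M.tgrad (M.u (k + 1))) - _ + _
  ring

lemma Good.r (hρ : 1 ≤ ρ) {k : ℕ} (hG : M.Good ρ k) : M.HC0 ρ (k + 2) ρ (M.r k) :=
  HC0_of_AC0 hG (AC0_r hρ k)

lemma Good.j (hρ : 1 ≤ ρ) {k : ℕ} (hG : M.Good ρ k) : M.HC0 ρ (k + 2) ρ (M.j k) :=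
  HC0_of_AC0 hG (AC0_j hρ k)

lemma Good.u (hG : M.Good ρ K) {k : ℕ} (hk : k ≤ K) : M.HC0 ρ k (min k 1) (M.u k) :=
  HC0_of_AC0 hG (AC0_u hk)

lemma good_one : M.Good ρ 1 := by
  intro i hi
  interval_cases i
  · exact HC1_X_zero
  · exact ((HypAlg.HC1_N_mul HC0_u_one).add (Cl1.of_ideal M.X_one_sub)).congr fun _ => by ring

lemma Cl0.of_natMul {h : Fin d → Fin d → A} {At : Atoms d A} {Z : Ideal A} {w δ : ℕ} {f : A} {n : ℕ}
    (hn : n ≠ 0) (hf : Cl0 h At Z w δ (n * f)) : Cl0 h At Z w δ f := by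
  refine (hf.smul (n : ℝ)⁻¹).congr ?_
  have : (n : A) * f = (n : ℝ) • f := by rw [Algebra.smul_def, map_natCast]
  rw [this, smul_smul, inv_mul_cancel₀ (by exact_mod_cast hn), one_smul]

/-- Below order `d` the remainder vanishes on the hypersurface and the recursion can be solved for
the next `u`. Together with the tangential gradient of the previous one this determines the next
`X`. -/
lemma good (hρ : 1 ≤ ρ) {k : ℕ} (hk : k < d) : M.Good ρ k := by
  induction k with
  | zero => exact good_one.mono zero_le_one
  | succ k ih =>
    rcases Nat.eq_zero_or_pos k with rfl | hpos
    · exact good_one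
    obtain ⟨n, rfl⟩ : ∃ n, k = n + 1 := ⟨k - 1, by omega⟩
    have hG := ih (by omega)
    have h1 := recursion hρ n hG
    have hT : M.HC0 ρ (n + 2) 1 (M.tdiv (M.X (n + 1))) :=
      (HypAlg.HC0_tdiv (hG (n + 1) le_rfl)).cast rfl (by omega) rfl
    have hr := ((hG.mono (Nat.le_succ n)).r hρ).anti hρ
    have hj := ((hG.mono (Nat.le_succ n)).j hρ).anti hρ
    have hrem := Cl0.of_ideal (h := M.h) (At := M.HAtom ρ) (w := n + 2) (δ := 1)
      (M.rem_mem (k := n + 2) (by omega))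
    obtain ⟨m, hm⟩ : ∃ m, d = n + 2 + m := ⟨d - (n + 2), by omega⟩
    have hu : M.HC0 ρ (n + 2) 1 (M.u (n + 2)) := by
      have h2 := ((h1.anti (show 1 ≤ 2 by omega)).add (hrem.natMul d)).add
        (((hT.sub hr).add (hj.natMul (n + 1))).natMul (2 * (n + 2)))
      -- `m = d - (n + 2)` is the coefficient of `u (n + 2)` in the recursion, non-zero below order
      -- `d`.
      refine Cl0.of_natMul (n := 2 * m) (by omega) (h2.congr ?_)
      have : (d : A) = n + 2 + m := by rw [hm]; push_cast; ring
      rw [this, YamabeAlg.r, YamabeAlg.j]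
      push_cast
      ring
    intro i hi
    rcases Nat.lt_or_ge i (n + 2) with h | h
    · exact hG i (by omega)
    obtain rfl : i = n + 2 := by omega
    refine Cl1.cast (((HC1_X_sub hρ hG).anti (show 1 ≤ 2 by omega)).add
      (((HypAlg.HC1_tgrad (hG.u le_rfl)).cast (w' := n + 2) (δ' := 1) rfl (by omega)
      fun _ => rfl).add (HypAlg.HC1_N_mul hu))) rfl (by omega) fun c => by ring

/-- The recursion for `u k`. -/
lemma recursion_succ (hρ : 1 ≤ ρ) {n : ℕ} (hn : n + 2 < d) :
    M.HC0 ρ (n + 3) 2 (2 * (d * M.u (n + 3) - (n + 3 : ℕ) * (M.u (n + 3) + M.tLap (M.u (n + 1))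
      - M.r (n + 1) + (n + 2 : ℕ) * M.j (n + 1))) - d * M.rem (n + 3)) := by
  have h1 := recursion (M := M) hρ (n + 1) (good hρ (by omega))
  have h2 := (HC0_tdiv_X (M := M) hρ (good hρ (show n + 1 < d by omega))
    (((good hρ hn).u le_rfl).cast rfl (by omega) rfl)).natMul (2 * (n + 3))
  refine (h1.add h2).congr ?_
  rw [YamabeAlg.r, YamabeAlg.j]
  push_cast
  ring

/-- The second-order step is special: no Laplacian occurs, because the divergence of `X_1` is
already quadratic. -/
lemma recursion_zero (hρ : 1 ≤ ρ) : M.HC0 ρ 2 2 (2 * (d * M.u 2 - 2 * (M.u 2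
      - M.r 0 + M.j 0)) - d * M.rem 2) := by
  have h1 := recursion (M := M) hρ 0 good_one
  have h2 := (HC0_tdiv_X_one (M := M) (ρ := ρ)).natMul 4
  refine (h1.add h2).congr ?_
  rw [YamabeAlg.r, YamabeAlg.j]
  push_cast
  ring

/-- The leading part of `u (2 k + 1)`. -/
lemma u_odd (k : ℕ) (hk : 2 * k + 1 < d) :
    ∃ c : ℝ, c ≠ 0 ∧ M.HC0 2 (2 * k + 1) 2 (M.u (2 * k + 1) - c • M.tLap^[k] M.mean) := by
  induction k with
  | zero => exact ⟨1, one_ne_zero, (Cl0.of_ideal M.u_one_sub_mean).congr (by simp)⟩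
  | succ k ih =>
    obtain ⟨c, hc, h⟩ := ih (by omega)
    have h1 := recursion_succ (M := M) (ρ := 2) (by norm_num) (n := 2 * k) (by omega)
    have hG := good (M := M) (ρ := 2) (by norm_num) (show 2 * k + 1 < d by omega)
    have hr := hG.r (by norm_num)
    have hj := hG.j (by norm_num)
    have hrem := Cl0.of_ideal (h := M.h) (At := M.HAtom 2) (w := 2 * k + 3) (δ := 2)
      (M.rem_mem (k := 2 * k + 3) (by omega))
    obtain ⟨m, hm⟩ : ∃ m, d = 2 * k + 3 + m := ⟨d - (2 * k + 3), by omega⟩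
    have hm0 : (m : ℝ) ≠ 0 := by norm_cast; omega
    -- With `m = d - (2 k + 3)`, the recursion reads `m u_{2k+3} ≈ (2 k + 3) Δ̄ u_{2k+1}`, the
    -- curvature terms being errors of degree `ρ = 2`.
    refine ⟨(2 * k + 3) / m * c, mul_ne_zero (div_ne_zero (by positivity) hm0) hc, ?_⟩
    refine Cl0.of_natMul (n := 2 * m) (by omega) ?_
    have h2 := ((h1.add (hrem.natMul d)).add (((hj.natMul (2 * k + 2)).sub hr).natMul
      (2 * (2 * k + 3)))).add ((HypAlg.HC0_tLap h).natMul (2 * (2 * k + 3)))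
    refine h2.congr ?_
    have : (d : A) = 2 * k + 3 + m := by rw [hm]; push_cast; ring
    rw [HypAlg.tLap_sub, HypAlg.tLap_smul, Function.iterate_succ_apply', this]
    have h3 : ((2 * k + 3) / m * c : ℝ) • M.tLap (M.tLap^[k] M.mean) * m
        = (2 * k + 3) * c • M.tLap (M.tLap^[k] M.mean) := by
      have h4 : (((2 * k + 3 : ℕ) : ℝ) / m * c) * m = ((2 * k + 3 : ℕ) : ℝ) * c := by
        field_simp
      have h5 := congrArg (algebraMap ℝ A) h4
      simp only [Algebra.smul_def]
      push_cast at h5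
      simp only [map_mul, map_ofNat] at h5 ⊢
      linear_combination (M.tLap (M.tLap^[k] M.mean)) * h5
    push_cast
    linear_combination (-2) * h3

/-- The obstruction density, if `d` is odd. -/
theorem B_odd (hd : Odd d) : ∃ a : ℝ, a ≠ 0 ∧ M.HC0 2 d 2 (M.B - a • M.tLap^[(d - 1) / 2] M.mean) := by
  have h3 := M.three_le
  obtain ⟨k, hk⟩ : ∃ k, d = 2 * k + 3 := by obtain ⟨k, hk⟩ := hd; exact ⟨k - 1, by omega⟩
  obtain ⟨c, hc, h⟩ := u_odd (M := M) k (by omega)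
  have hd' : (d : A) = 2 * k + 3 := by rw [hk]; push_cast; ring
  have h1 := recursion_succ (M := M) (ρ := 2) (by norm_num) (n := 2 * k) (by omega)
  have hG := good (M := M) (ρ := 2) (by norm_num) (show 2 * k + 1 < d by omega)
  have hr := hG.r (by norm_num)
  have hj := hG.j (by norm_num)
  have hrem := Cl0.of_ideal (h := M.h) (At := M.HAtom 2) (w := 2 * k + 3) (δ := 2) M.rem_self
  have hfac : ((d.factorial : ℕ) : ℝ) ≠ 0 := by exact_mod_cast d.factorial_ne_zero
  have e1 : (d - 1) / 2 = k + 1 := by omega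
  have e2 : M.rem d = M.rem (2 * k + 3) := by rw [← hk]
  -- At order `d` the two occurrences of `u_d` cancel and the remainder is `d! B`, leaving `-2 d Δ̄
  -- u_{d-2} ≈ d · d! B`.
  refine ⟨-2 * c / d.factorial, div_ne_zero (by simpa using hc) hfac, ?_⟩
  rw [e1]
  have h2 := ((((HypAlg.HC0_tLap h).natMul (2 * d)).add h1).add ((((hj.natMul (2 * k + 2)).sub
    hr).natMul (2 * d)))).add (hrem.natMul d)
  have h4 : M.HC0 2 (2 * k + 3) 2 (M.B - (-2 * c / d.factorial : ℝ) • M.tLap^[k + 1] M.mean) := by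
    refine Cl0.of_natMul (n := d * d.factorial) (by positivity) (h2.neg.congr ?_)
    rw [HypAlg.tLap_sub, HypAlg.tLap_smul, Function.iterate_succ_apply', e2]
    have h5 : (-2 * c / d.factorial : ℝ) • M.tLap (M.tLap^[k] M.mean) * (d.factorial : A)
        = -2 * c • M.tLap (M.tLap^[k] M.mean) := by
      have h4 : (-2 * c / d.factorial : ℝ) * d.factorial = -2 * c := by field_simp
      have h6 := congrArg (algebraMap ℝ A) h4
      simp only [Algebra.smul_def]
      simp only [map_mul, map_natCast, map_neg, map_ofNat] at h6 ⊢
      linear_combination (M.tLap (M.tLap^[k] M.mean)) * h6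
    simp only [Algebra.smul_def, map_natCast] at h5 ⊢
    push_cast
    rw [hd'] at *
    linear_combination (-(2 * k + 3) : A) * h5
  exact Cl0.cast h4 hk le_rfl rfl

end YamabeAlg

end SingularYamabe

/-! ### Full contractions with a vector and commutation of covariant derivatives -/

namespace SingularYamabe

variable {d : ℕ} {A : Type*} [CommRing A] [Algebra ℝ A]

/-- Contraction of all indices with a vector. -/
def full {κ : Type} [Fintype κ] [DecidableEq κ] (v : Fin d → A) (F : Ten d A κ) : A :=
  ∑ I : κ → Fin d, (∏ i, v (I i)) * F I

lemma re_sub' {κ μ : Type} (e : κ ≃ μ) (F H : Ten d A κ) : re e (F - H) = re e F - re e H := rfl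

lemma ctr_sub {κ : Type} (h : Fin d → Fin d → A) (F H : Ten d A (Fin 2 ⊕ κ)) :
    ctr h (F - H) = ctr h F - ctr h H := by
  funext J; simp [ctr, mul_sub, Finset.sum_sub_distrib]

section full

variable {κ μ : Type} [Fintype κ] [DecidableEq κ] [Fintype μ] [DecidableEq μ] (v : Fin d → A)

lemma full_re (e : κ ≃ μ) (F : Ten d A κ) : full v (re e F) = full v F := by
  unfold full
  rw [← Equiv.sum_comp (e.arrowCongr (Equiv.refl (Fin d)))]
  refine Finset.sum_congr rfl fun I _ => ?_
  congr 1
  · rw [← Equiv.prod_comp e]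
    simp
  · simp only [re]
    congr 1
    funext i
    simp

lemma full_add (F H : Ten d A κ) : full v (F + H) = full v F + full v H := by
  simp [full, mul_add, Finset.sum_add_distrib]

lemma full_sub (F H : Ten d A κ) : full v (F - H) = full v F - full v H := by
  simp [full, mul_sub, Finset.sum_sub_distrib]

lemma full_smul (r : ℝ) (F : Ten d A κ) : full v (r • F) = r • full v F := by
  simp [full, Finset.smul_sum]

lemma full_sum_elim (F : Ten d A (κ ⊕ μ)) :
    full v F = full v fun J : μ → Fin d => full v fun I : κ → Fin d => F (Sum.elim I J) := by
  unfold full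
  rw [← (Equiv.sumArrowEquivProdArrow κ μ (Fin d)).symm.sum_comp, Fintype.sum_prod_type,
    Finset.sum_comm]
  refine Finset.sum_congr rfl fun J _ => ?_
  rw [Finset.mul_sum]
  refine Finset.sum_congr rfl fun I _ => ?_
  rw [Fintype.prod_sum_type]
  simp only [Equiv.sumArrowEquivProdArrow_symm_apply_inl, Equiv.sumArrowEquivProdArrow_symm_apply_inr]
  rw [mul_comm (∏ i, v (I i)), mul_assoc]
  rfl

lemma full_mulT (F : Ten d A κ) (H : Ten d A μ) : full v (mulT F H) = full v F * full v H := by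
  rw [full_sum_elim]
  simp only [full, mulT, Sum.elim_comp_inl, Sum.elim_comp_inr, Finset.sum_mul, Finset.mul_sum]
  exact Finset.sum_congr rfl fun _ _ => Finset.sum_congr rfl fun _ _ => by ring

lemma full_unit (F : Ten d A Unit) : full v F = ∑ b, v b * F fun _ => b := by
  unfold full
  rw [← (Equiv.funUnique Unit (Fin d)).symm.sum_comp]
  simp [Equiv.funUnique]
  rfl

lemma full_iv (F : Ten d A (Unit ⊕ κ)) : full v (iv v F) = full v F := by
  rw [full_sum_elim]
  simp only [full_unit]
  rfl

lemma full_isEmpty [IsEmpty κ] (F : Ten d A κ) (J : κ → Fin d) : full v F = F J := by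
  have : ∀ I, I = J := fun I => Subsingleton.elim _ _
  simp [full, this]

end full

namespace MetricAlg

variable (M : MetricAlg d A) {κ μ : Type} [Fintype κ] [DecidableEq κ] [Fintype μ] [DecidableEq μ]

lemma nabla_re (e : κ ≃ μ) (F : Ten d A κ) :
    M.nabla (re e F) = re ((Equiv.refl Unit).sumCongr e) (M.nabla F) := by
  funext I
  simp only [nabla, cd_re]
  rfl

lemma nabla_sub (F H : Ten d A κ) : M.nabla (F - H) = M.nabla F - M.nabla H := by
  funext I; simp only [nabla, cd_sub]; rfl

lemma nabla_ctr (F : Ten d A (Fin 2 ⊕ κ)) :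
    M.nabla (ctr M.h F) = ctr M.h (re (sumLeftComm Unit (Fin 2) κ) (M.nabla F)) := by
  funext I
  simp only [nabla, cd_ctr]
  refine Finset.sum_congr rfl fun b _ => Finset.sum_congr rfl fun c _ => ?_
  congr 1
  simp only [re]
  congr 1
  funext i; rcases i with i | i <;> rfl

/-- The change of indices of `covF` induced by one of the tensor. -/
def succEquiv {k l : ℕ} (e : Fin k ≃ Fin l) : Fin (k + 1) ≃ Fin (l + 1) :=
  ((consEquiv k).trans ((Equiv.refl Unit).sumCongr e)).trans (consEquiv l).symm

lemma covF_re {k l : ℕ} (e : Fin k ≃ Fin l) (F : Ten d A (Fin k)) :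
    M.covF (re e F) = re (succEquiv e) (M.covF F) := by
  rw [covF_eq_re, nabla_re, nabla_eq_re]; rfl

lemma covF_sub {k : ℕ} (F H : Ten d A (Fin k)) : M.covF (F - H) = M.covF F - M.covF H := by
  funext I; simp only [covF, cd_sub]; rfl

lemma covF_smul {k : ℕ} (r : ℝ) (F : Ten d A (Fin k)) : M.covF (r • F) = r • M.covF F := by
  funext I; simp only [covF, cd_smul]; rfl

lemma iterCov_sub {k : ℕ} (F H : Ten d A (Fin k)) (m : ℕ) :
    M.iterCov (F - H) m = M.iterCov F m - M.iterCov H m := by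
  induction m with
  | zero => rfl
  | succ m ih => simp only [iterCov, ih, covF_sub]

lemma iterCov_smul {k : ℕ} (r : ℝ) (F : Ten d A (Fin k)) (m : ℕ) :
    M.iterCov (r • F) m = r • M.iterCov F m := by
  induction m with
  | zero => rfl
  | succ m ih => simp only [iterCov, ih, covF_smul]

/-- The resulting permutation is left unspecified: only full contractions with one vector are taken
in the end, and these are insensitive to it. -/
lemma iterCov_re {k l : ℕ} (e : Fin k ≃ Fin l) (F : Ten d A (Fin k)) (m : ℕ) :
    ∃ e' : Fin (k + m) ≃ Fin (l + m), M.iterCov (re e F) m = re e' (M.iterCov F m) := by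
  induction m with
  | zero => exact ⟨e, rfl⟩
  | succ m ih =>
    obtain ⟨e', h⟩ := ih
    exact ⟨succEquiv e', by rw [iterCov, h, covF_re]; rfl⟩

lemma full_iterCov_re (v : Fin d → A) {k l : ℕ} (e : Fin k ≃ Fin l) (F : Ten d A (Fin k)) (m : ℕ) :
    full v (M.iterCov (re e F) m) = full v (M.iterCov F m) := by
  obtain ⟨e', h⟩ := M.iterCov_re e F m
  rw [h, full_re]

lemma iterCov_covF {k : ℕ} (F : Ten d A (Fin k)) (m : ℕ) :
    ∃ e : Fin (k + (m + 1)) ≃ Fin (k + 1 + m), M.iterCov (M.covF F) m = re e (M.iterCov F (m + 1)) := by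
  induction m with
  | zero => exact ⟨Equiv.refl _, rfl⟩
  | succ m ih =>
    obtain ⟨e, h⟩ := ih
    exact ⟨succEquiv e, by rw [iterCov, h, covF_re]; rfl⟩

lemma full_iterCov_covF (v : Fin d → A) {k : ℕ} (F : Ten d A (Fin k)) (m : ℕ) :
    full v (M.iterCov (M.covF F) m) = full v (M.iterCov F (m + 1)) := by
  obtain ⟨e, h⟩ := M.iterCov_covF F m
  rw [h, full_re]

lemma nabla_gT_mul (F : Ten d A κ) :
    M.nabla (mulT M.gT F) = re (sumLeftComm (Fin 2) Unit κ) (mulT M.gT (M.nabla F)) := by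
  funext I
  simp only [nabla, cd_mulT, cd_gT]
  simp only [mulT, Pi.add_apply, Pi.zero_apply, zero_mul, zero_add, re]
  rfl

/-- The metric is parallel, so all derivatives pass to the other factor. -/
lemma iterCov_gT_mul {k l : ℕ} (e : Fin 2 ⊕ Fin k ≃ Fin l) (F : Ten d A (Fin k)) (m : ℕ) :
    ∃ e' : Fin 2 ⊕ Fin (k + m) ≃ Fin (l + m),
      M.iterCov (re e (mulT M.gT F)) m = re e' (mulT M.gT (M.iterCov F m)) := by
  induction m with
  | zero => exact ⟨e, rfl⟩
  | succ m ih =>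
    obtain ⟨e', h⟩ := ih
    refine ⟨((((Equiv.refl (Fin 2)).sumCongr (consEquiv (k + m))).trans
      (sumLeftComm (Fin 2) Unit (Fin (k + m)))).trans ((Equiv.refl Unit).sumCongr e')).trans
      (consEquiv (l + m)).symm, ?_⟩
    rw [iterCov, h, covF_eq_re, nabla_re, nabla_gT_mul, nabla_eq_re]
    rfl

/-- Bringing two separate indices together. -/
def pairEquiv (κ : Type) : Unit ⊕ (Unit ⊕ κ) ≃ Fin 2 ⊕ κ where
  toFun := Sum.elim (fun _ => Sum.inl 0) (Sum.elim (fun _ => Sum.inl 1) Sum.inr)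
  invFun := Sum.elim ![Sum.inl (), Sum.inr (Sum.inl ())] fun i => Sum.inr (Sum.inr i)
  left_inv i := by rcases i with i | i | i <;> rfl
  right_inv i := by
    rcases i with i | i
    · fin_cases i <;> rfl
    · rfl

/-- The Laplacian of a tensor. -/
def lap (F : Ten d A κ) : Ten d A κ := ctr M.h (re (pairEquiv κ) (M.nabla (M.nabla F)))

lemma lap_re (e : κ ≃ μ) (F : Ten d A κ) : M.lap (re e F) = re e (M.lap F) := by
  rw [lap, nabla_re, nabla_re]
  funext J
  refine Finset.sum_congr rfl fun b _ => Finset.sum_congr rfl fun c _ => ?_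
  refine congrArg (M.h b c * ·) ?_
  simp only [re]
  congr 1
  funext i; rcases i with i | i | i <;> rfl

/-- Covariant derivatives of the Riemann tensor. -/
inductive RAtom : Atoms d A
  | R (m : ℕ) : RAtom (Fin (4 + m)) (2 + m) 1 (M.iterCov M.Riem m)

/-- The class of tensors generated by the covariant derivatives of the Riemann tensor. -/
abbrev RC (κ : Type) [Fintype κ] [DecidableEq κ] (w δ : ℕ) : Submodule ℝ (Ten d A κ) :=
  Cl M.h M.RAtom ⊥ κ w δ

variable {M} {w δ : ℕ}

lemma nabla_eq_dV (F : Ten d A κ) :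
    M.nabla F = M.dV (fun (f : Unit → Fin d) b => if f () = b then 1 else 0) F := by
  funext I
  simp [nabla, dV_apply]

lemma RC_R (m : ℕ) : M.iterCov M.Riem m ∈ M.RC (Fin (4 + m)) (2 + m) 1 := Cl.of_atom (RAtom.R m)

lemma RC_nabla_atom {κ : Type} {F : Ten d A κ} (hF : M.RAtom κ w δ F) :
    ∃ (_ : Fintype κ) (_ : DecidableEq κ), M.dV (fun (f : Unit → Fin d) b =>
      if f () = b then 1 else 0) F ∈ M.RC (Unit ⊕ κ) (w + 1) δ := by
  cases hF with
  | R m =>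
    refine ⟨inferInstance, inferInstance, ?_⟩
    rw [← nabla_eq_dV, nabla_eq_re]
    exact Cl.re _ (RC_R (m + 1))

lemma RC_nabla {F : Ten d A κ} (hF : F ∈ M.RC κ w δ) : M.nabla F ∈ M.RC (Unit ⊕ κ) (w + 1) δ := by
  rw [nabla_eq_dV]
  refine M.dV_mem (At := M.RAtom) _ ?_ (fun _ _ _ _ h => h) (fun _ _ _ _ _ _ h => RC_nabla_atom h) hF
  intro f hf _
  rw [Ideal.mem_bot] at hf
  simp [hf]

lemma RC_covF {k : ℕ} {F : Ten d A (Fin k)} (hF : F ∈ M.RC (Fin k) w δ) :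
    M.covF F ∈ M.RC (Fin (k + 1)) (w + 1) δ := by
  rw [covF_eq_re]; exact Cl.re _ (RC_nabla hF)

lemma RC_iterCov {k : ℕ} {F : Ten d A (Fin k)} (hF : F ∈ M.RC (Fin k) w δ) (m : ℕ) :
    M.iterCov F m ∈ M.RC (Fin (k + m)) (w + m) δ := by
  induction m with
  | zero => exact hF
  | succ m ih => exact RC_covF ih

lemma RC_Ric : M.Ric ∈ M.RC (Fin 2) 2 1 := by
  rw [M.Ric_eq_ctr]
  exact Cl.ctr (Cl.re _ (RC_R 0))

lemma RC_J : (fun _ : Fin 0 → Fin d => M.J) ∈ M.RC (Fin 0) 2 1 := by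
  refine (Cl2.trace (Y := fun a b => M.Ric ![a, b]) ?_).smul (1 / (2 * ((d : ℝ) - 1)))
  exact Cl.cast RC_Ric rfl le_rfl fun I => congrArg _ (MetricAlg.eq_vec_two I).symm

/-- Bringing the indices of the curvature acting in the slot `m` into position. -/
def actEquiv (m : κ) : κ ⊕ Fin 4 ≃ Fin 2 ⊕ (Unit ⊕ (Unit ⊕ κ)) where
  toFun := Sum.elim (fun i => if i = m then Sum.inl 0 else Sum.inr (Sum.inr (Sum.inr i)))
    ![Sum.inr (Sum.inl ()), Sum.inr (Sum.inr (Sum.inl ())), Sum.inl 1, Sum.inr (Sum.inr (Sum.inr m))]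
  invFun := Sum.elim ![Sum.inl m, Sum.inr 2] (Sum.elim (fun _ => Sum.inr 0)
    (Sum.elim (fun _ => Sum.inr 1) fun i => if i = m then Sum.inr 3 else Sum.inl i))
  left_inv i := by
    rcases i with i | i
    · by_cases h : i = m <;> simp [h]
    · fin_cases i <;> simp
  right_inv i := by
    rcases i with i | i | i | i
    · fin_cases i <;> simp
    · simp
    · simp
    · by_cases h : i = m <;> simp [h]

/-- Covariant derivatives commute up to terms of higher degree. -/
lemma RC_comm {F : Ten d A κ} (hF : F ∈ M.RC κ w δ) :
    M.nabla (M.nabla F) - re (sumLeftComm Unit Unit κ) (M.nabla (M.nabla F))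
      ∈ M.RC (Unit ⊕ (Unit ⊕ κ)) (w + 2) (δ + 1) := by
  -- The Ricci identity, with the action of the curvature in each slot `m` of `F` rewritten as a
  -- contraction with the Riemann tensor.
  have key : M.nabla (M.nabla F) - re (sumLeftComm Unit Unit κ) (M.nabla (M.nabla F))
      = - ∑ m : κ, fun J : Unit ⊕ (Unit ⊕ κ) → Fin d => ∑ b, ∑ c, M.h b c *
        (F (fun i => Sum.elim ![b, c] J (actEquiv m (Sum.inl i)))
        * M.Riem (fun i => Sum.elim ![b, c] J (actEquiv m (Sum.inr i)))) := by
    funext J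
    have h := M.ricci_identity (J (Sum.inl ())) (J (Sum.inr (Sum.inl ()))) F
      (fun i => J (Sum.inr (Sum.inr i)))
    have h1 : M.nabla (M.nabla F) J = M.cd (J (Sum.inl ())) (M.nabla F)
        (Sum.elim (fun _ => J (Sum.inr (Sum.inl ()))) fun i => J (Sum.inr (Sum.inr i))) := by
      rw [nabla]; congr 1; funext i; rcases i with i | i <;> rfl
    have h2 : re (sumLeftComm Unit Unit κ) (M.nabla (M.nabla F)) J
        = M.cd (J (Sum.inr (Sum.inl ()))) (M.nabla F)
        (Sum.elim (fun _ => J (Sum.inl ())) fun i => J (Sum.inr (Sum.inr i))) := by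
      rw [re, nabla]; congr 1; funext i; rcases i with i | i <;> rfl
    rw [Pi.sub_apply, h1, h2, h, Pi.neg_apply, Finset.sum_apply, act]
    congr 1
    refine Finset.sum_congr rfl fun m _ => Finset.sum_congr rfl fun b _ => ?_
    rw [← h_mul_Riem, Finset.sum_mul]
    refine Finset.sum_congr rfl fun c _ => ?_
    have h3 : (fun i => Sum.elim ![b, c] J (actEquiv m (Sum.inl i)))
        = Function.update (fun i => J (Sum.inr (Sum.inr i))) m b := by
      funext i
      by_cases hi : i = m
      · subst hi; simp [actEquiv]
      · simp [actEquiv, hi]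
    have h4 : (fun i => Sum.elim ![b, c] J (actEquiv m (Sum.inr i)))
        = ![J (Sum.inl ()), J (Sum.inr (Sum.inl ())), c, J (Sum.inr (Sum.inr m))] := by
      funext i; fin_cases i <;> rfl
    rw [h3, h4]
    ring
  rw [key]
  refine Submodule.neg_mem _ (Submodule.sum_mem _ fun m _ => ?_)
  exact Cl.mul_ctr hF (RC_R 0) (actEquiv m)

/-- The Laplacian commutes with the covariant derivative up to terms of higher degree. -/
lemma RC_lap_nabla {F : Ten d A κ} (hF : F ∈ M.RC κ w δ) :
    M.lap (M.nabla F) - M.nabla (M.lap F) ∈ M.RC (Unit ⊕ κ) (w + 3) (δ + 1) := by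
  -- The derivative has to pass both derivatives of the Laplacian: `h1` exchanges the two inner
  -- derivatives of `∇³F`, and `h2` the two outer ones.
  have h1 := RC_nabla (RC_comm hF)
  have h2 := RC_comm (RC_nabla hF)
  rw [nabla_sub, nabla_re] at h1
  have h3 : M.nabla (M.lap F) = ctr M.h (re (pairEquiv _) (re ((Equiv.refl Unit).sumCongr
      (sumLeftComm Unit Unit κ))
      (re (sumLeftComm Unit Unit (Unit ⊕ κ)) (M.nabla (M.nabla (M.nabla F)))))) := by
    rw [lap, nabla_ctr, nabla_re]
    funext J
    refine Finset.sum_congr rfl fun b _ => Finset.sum_congr rfl fun c _ => ?_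
    refine congrArg (M.h b c * ·) ?_
    simp only [re]
    congr 1
    funext i; rcases i with i | i | i | i <;> rfl
  have h4 := Cl.ctr (Cl.re (pairEquiv _) h1)
  have h5 := Cl.ctr (Cl.re (pairEquiv _) (Cl.re ((Equiv.refl Unit).sumCongr
    (sumLeftComm Unit Unit κ)) h2))
  rw [re_sub', re_sub', ctr_sub, ← h3] at h5
  rw [re_sub', ctr_sub] at h4
  have h6 := Submodule.add_mem _ h4 (Cl.cast h5 (w' := w + 2 + 1) (by omega) le_rfl fun _ => rfl)
  rw [sub_add_sub_cancel] at h6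
  exact h6

/-- Iterates `RC_lap_nabla`; earlier errors stay of higher degree because differentiation does not
lower it. -/
lemma RC_lap_iterCov {k : ℕ} {F : Ten d A (Fin k)} (hF : F ∈ M.RC (Fin k) w δ) (m : ℕ) :
    M.lap (M.iterCov F m) - M.iterCov (M.lap F) m ∈ M.RC (Fin (k + m)) (w + m + 2) (δ + 1) := by
  induction m with
  | zero =>
    rw [iterCov, iterCov, sub_self]; exact Submodule.zero_mem _
  | succ m ih =>
    have h1 := Cl.re (consEquiv (k + m)).symm (RC_lap_nabla (RC_iterCov hF m))
    have h2 := RC_covF ih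
    refine Cl.cast (Submodule.add_mem _ (Cl.cast h1 (w' := w + m + 2 + 1) (δ' := δ + 1) (by omega) le_rfl
      fun _ => rfl) h2) (by omega) le_rfl fun J => ?_
    rw [covF_sub, iterCov, iterCov, covF_eq_re, lap_re, covF_eq_re _ (M.lap _)]
    simp only [Pi.add_apply, Pi.sub_apply, re]
    exact (sub_add_sub_cancel _ _ _).symm

end MetricAlg

end SingularYamabe

/-! ### The double divergence of the Weyl tensor -/

namespace SingularYamabe

variable {d : ℕ} {A : Type*} [CommRing A] [Algebra ℝ A]

lemma ctr_eq {κ : Type} {h : Fin d → Fin d → A} {F : Ten d A (Fin 2 ⊕ κ)} {J : κ → Fin d}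
    {f : Fin d → Fin d → A} (hF : ∀ b c, F (Sum.elim ![b, c] J) = f b c) :
    ctr h F J = ∑ b, ∑ c, h b c * f b c :=
  Finset.sum_congr rfl fun b _ => Finset.sum_congr rfl fun c _ => by rw [hF]

namespace MetricAlg

variable (M : MetricAlg d A) {κ μ : Type} [Fintype κ] [DecidableEq κ] [Fintype μ] [DecidableEq μ]

/-- `J` as a tensor. -/
def JT : Ten d A (Fin 0) := fun _ => M.J

lemma cd_JT (a : Fin d) (I : Fin 0 → Fin d) : M.cd a M.JT I = M.D a M.J := by
  simp [JT, cd_apply, act]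

/-- The index renaming for the divergence of the Weyl tensor. -/
def divEquiv₁ : Unit ⊕ Fin 4 ≃ Fin 2 ⊕ Fin 3 where
  toFun := Sum.elim (fun _ => Sum.inl 0) ![Sum.inl 1, Sum.inr 0, Sum.inr 1, Sum.inr 2]
  invFun := Sum.elim ![Sum.inl (), Sum.inr 0] ![Sum.inr 1, Sum.inr 2, Sum.inr 3]
  left_inv := by decide
  right_inv := by decide

/-- The index renaming for the second divergence of the Weyl tensor. -/
def divEquiv₂ : Unit ⊕ Fin 3 ≃ Fin 2 ⊕ Fin 2 where
  toFun := Sum.elim (fun _ => Sum.inl 0) ![Sum.inr 0, Sum.inl 1, Sum.inr 1]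
  invFun := Sum.elim ![Sum.inl (), Sum.inr 1] ![Sum.inr 0, Sum.inr 2]
  left_inv := by decide
  right_inv := by decide

/-- The divergence of the Weyl tensor. -/
def divW : Ten d A (Fin 3) := ctr M.h (re divEquiv₁ (M.nabla M.Weyl))

/-- The double divergence of the Weyl tensor. -/
def divDivW : Ten d A (Fin 2) := ctr M.h (re divEquiv₂ (M.nabla M.divW))

/-- Placing the indices of the covariant derivative of a bilinear form. -/
def placeEquiv₁ : Unit ⊕ Fin 2 ≃ Fin 3 where
  toFun := Sum.elim (fun _ => 1) ![2, 0]
  invFun := ![Sum.inr 1, Sum.inl (), Sum.inr 0]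
  left_inv := by decide
  right_inv := by decide

/-- Placing the indices of the covariant derivative of a bilinear form. -/
def placeEquiv₂ : Unit ⊕ Fin 2 ≃ Fin 3 where
  toFun := Sum.elim (fun _ => 2) ![1, 0]
  invFun := ![Sum.inr 1, Sum.inr 0, Sum.inl ()]
  left_inv := by decide
  right_inv := by decide

/-- Placing the indices of the product of a covector and a bilinear form. -/
def placeEquiv₃ : (Unit ⊕ Fin 0) ⊕ Fin 2 ≃ Fin 3 where
  toFun := Sum.elim (Sum.elim (fun _ => 1) Fin.elim0) ![2, 0]
  invFun := ![Sum.inr 1, Sum.inl (Sum.inl ()), Sum.inr 0]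
  left_inv := by decide
  right_inv := by decide

/-- Placing the indices of the product of a covector and a bilinear form. -/
def placeEquiv₄ : (Unit ⊕ Fin 0) ⊕ Fin 2 ≃ Fin 3 where
  toFun := Sum.elim (Sum.elim (fun _ => 2) Fin.elim0) ![1, 0]
  invFun := ![Sum.inr 1, Sum.inr 0, Sum.inl (Sum.inl ())]
  left_inv := by decide
  right_inv := by decide

lemma divW_eq (hd : 3 ≤ d) : M.divW = (((d : ℝ) - 3) / ((d : ℝ) - 2)) •
    (re placeEquiv₁ (M.nabla M.Ric) - re placeEquiv₂ (M.nabla M.Ric)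
      - re placeEquiv₃ (mulT (M.nabla M.JT) M.gT) + re placeEquiv₄ (mulT (M.nabla M.JT) M.gT)) := by
  funext I
  have h := M.div_Weyl hd (I 0) (I 1) (I 2)
  have h1 : M.divW I = ∑ e, ∑ a, M.h e a * M.cd e M.Weyl ![a, I 0, I 1, I 2] := by
    refine ctr_eq fun e a => congrArg (M.cd e M.Weyl) ?_
    funext i; fin_cases i <;> rfl
  have h2 : M.nabla M.Ric (I ∘ placeEquiv₁) = M.cd (I 1) M.Ric ![I 2, I 0] :=
    congrArg (M.cd (I 1) M.Ric) (by funext i; fin_cases i <;> rfl)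
  have h3 : M.nabla M.Ric (I ∘ placeEquiv₂) = M.cd (I 2) M.Ric ![I 1, I 0] :=
    congrArg (M.cd (I 2) M.Ric) (by funext i; fin_cases i <;> rfl)
  have h4 : mulT (M.nabla M.JT) M.gT (I ∘ placeEquiv₃) = M.D (I 1) M.J * M.g (I 2) (I 0) :=
    congrArg (· * M.g (I 2) (I 0)) (M.cd_JT _ _)
  have h5 : mulT (M.nabla M.JT) M.gT (I ∘ placeEquiv₄) = M.D (I 2) M.J * M.g (I 1) (I 0) :=
    congrArg (· * M.g (I 1) (I 0)) (M.cd_JT _ _)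
  rw [h1, h]
  simp only [Pi.smul_apply, Pi.sub_apply, Pi.add_apply, re, h2, h3, h4, h5]

lemma cd_divW (hd : 3 ≤ d) (p : Fin d) : M.cd p M.divW = (((d : ℝ) - 3) / ((d : ℝ) - 2)) •
    (re placeEquiv₁ (M.cd p (M.nabla M.Ric)) - re placeEquiv₂ (M.cd p (M.nabla M.Ric))
      - re placeEquiv₃ (mulT (M.cd p (M.nabla M.JT)) M.gT)
      + re placeEquiv₄ (mulT (M.cd p (M.nabla M.JT)) M.gT)) := by
  have h0 : ∀ F : Ten d A (Unit ⊕ Fin 0), mulT F (0 : Ten d A (Fin 2)) = 0 := fun F => by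
    funext I; simp [mulT]
  rw [divW_eq _ hd, cd_smul, cd_add, cd_sub, cd_sub, cd_re, cd_re, cd_re, cd_re, cd_mulT, cd_gT,
    h0, add_zero]

/-- The index renaming for the divergence of the Ricci tensor inside its second derivative. -/
def divEquiv₃ : Unit ⊕ (Unit ⊕ Fin 2) ≃ Fin 2 ⊕ Fin 2 where
  toFun := Sum.elim (fun _ => Sum.inl 0) (Sum.elim (fun _ => Sum.inr 1) ![Sum.inl 1, Sum.inr 0])
  invFun := Sum.elim ![Sum.inl (), Sum.inr (Sum.inr 0)] ![Sum.inr (Sum.inr 1), Sum.inr (Sum.inl ())]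
  left_inv := by decide
  right_inv := by decide

/-- `∇ᵖ∇_f Ric_pb` -/
def divDRic : Ten d A (Fin 2) := ctr M.h (re divEquiv₃ (M.nabla (M.nabla M.Ric)))

/-- Take the divergence of `divW_eq` in its middle index. As `g` is parallel, the last term
collapses to the second derivative of `J`. -/
lemma divDivW_eq (hd : 3 ≤ d) : M.divDivW = (((d : ℝ) - 3) / ((d : ℝ) - 2)) •
    (re (Equiv.swap 0 1) (M.lap M.Ric) - M.divDRic
      - re (Equiv.sumEmpty (Fin 2) (Fin 0)) (mulT M.gT (M.lap M.JT))
      + M.covF (M.covF M.JT)) := by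
  funext I
  have h1 : ∀ p c, M.nabla M.divW (Sum.elim ![p, c] I ∘ divEquiv₂) = M.cd p M.divW ![I 0, c, I 1] :=
    fun p c => congrArg (M.cd p M.divW) (by funext i; fin_cases i <;> rfl)
  have h2 : ∀ p c, M.cd p (M.nabla M.Ric) (![I 0, c, I 1] ∘ placeEquiv₁)
      = M.cd p (M.nabla M.Ric) (Sum.elim (fun _ => c) (I ∘ Equiv.swap 0 1)) := fun p c =>
    congrArg (M.cd p (M.nabla M.Ric)) (by
      funext i; rcases i with i | i; · rfl
      · fin_cases i <;> rfl)
  have h3 : ∀ p c, M.cd p (M.nabla M.Ric) (![I 0, c, I 1] ∘ placeEquiv₂)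
      = M.cd p (M.nabla M.Ric) (Sum.elim (fun _ => I 1) ![c, I 0]) := fun p c =>
    congrArg (M.cd p (M.nabla M.Ric)) (by
      funext i; rcases i with i | i; · rfl
      · fin_cases i <;> rfl)
  have h4 : ∀ p c, mulT (M.cd p (M.nabla M.JT)) M.gT (![I 0, c, I 1] ∘ placeEquiv₃)
      = M.cd p (M.nabla M.JT) (Sum.elim (fun _ => c) Fin.elim0) * M.g (I 1) (I 0) := fun p c =>
    congrArg (fun J => M.cd p (M.nabla M.JT) J * M.g (I 1) (I 0)) (by
      funext i; rcases i with i | i; · rfl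
      · exact i.elim0)
  have h5 : ∀ p c, mulT (M.cd p (M.nabla M.JT)) M.gT (![I 0, c, I 1] ∘ placeEquiv₄)
      = M.cd p (M.nabla M.JT) (Sum.elim (fun _ => I 1) Fin.elim0) * M.g c (I 0) := fun p c =>
    congrArg (fun J => M.cd p (M.nabla M.JT) J * M.g c (I 0)) (by
      funext i; rcases i with i | i; · rfl
      · exact i.elim0)
  have g1 : re (Equiv.swap 0 1) (M.lap M.Ric) I = ∑ p, ∑ c, M.h p c *
      M.cd p (M.nabla M.Ric) (Sum.elim (fun _ => c) (I ∘ Equiv.swap 0 1)) := by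
    refine ctr_eq fun p c => congrArg (M.cd p (M.nabla M.Ric)) ?_
    funext i; rcases i with i | i <;> rfl
  have g2 : M.divDRic I = ∑ p, ∑ c, M.h p c *
      M.cd p (M.nabla M.Ric) (Sum.elim (fun _ => I 1) ![c, I 0]) := by
    refine ctr_eq fun p c => congrArg (M.cd p (M.nabla M.Ric)) ?_
    funext i; rcases i with i | i; · rfl
    · fin_cases i <;> rfl
  have g3 : re (Equiv.sumEmpty (Fin 2) (Fin 0)) (mulT M.gT (M.lap M.JT)) I
      = M.g (I 0) (I 1) * ∑ p, ∑ c, M.h p c *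
      M.cd p (M.nabla M.JT) (Sum.elim (fun _ => c) Fin.elim0) := by
    refine congrArg (fun x => M.g (I 0) (I 1) * x) ?_
    refine ctr_eq fun p c => congrArg (M.cd p (M.nabla M.JT)) ?_
    funext i; rcases i with i | i; · rfl
    · exact i.elim0
  have g4 : M.covF (M.covF M.JT) I
      = M.cd (I 0) (M.nabla M.JT) (Sum.elim (fun _ => I 1) Fin.elim0) := by
    rw [MetricAlg.covF, covF_eq_re, cd_re]
    refine congrArg (M.cd (I 0) (M.nabla M.JT)) ?_
    funext i; rcases i with i | i; · rfl
    · exact i.elim0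
  have g5 : ∑ p, ∑ c, M.h p c * (M.cd p (M.nabla M.JT) (Sum.elim (fun _ => I 1) Fin.elim0)
      * M.g c (I 0)) = M.cd (I 0) (M.nabla M.JT) (Sum.elim (fun _ => I 1) Fin.elim0) := by
    have : ∀ p, ∑ c, M.h p c * (M.cd p (M.nabla M.JT) (Sum.elim (fun _ => I 1) Fin.elim0)
      * M.g c (I 0)) = (if p = I 0 then 1 else 0) *
        M.cd p (M.nabla M.JT) (Sum.elim (fun _ => I 1) Fin.elim0) := fun p => by
      rw [← M.h_mul_g, Finset.sum_mul]
      exact Finset.sum_congr rfl fun _ _ => by ring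
    simp [this]
  have h6 : M.divDivW I = ∑ p, ∑ c, M.h p c * M.cd p M.divW ![I 0, c, I 1] :=
    ctr_eq h1
  rw [h6]
  simp only [Pi.smul_apply, Pi.sub_apply, Pi.add_apply, g1, g2, g3, g4]
  rw [← g5]
  simp only [M.cd_divW hd, Pi.smul_apply, Pi.sub_apply, Pi.add_apply]
  simp only [re, h2, h3, h4, h5, mul_smul_comm, ← Finset.smul_sum, mul_add, mul_sub,
    Finset.sum_add_distrib, Finset.sum_sub_distrib, Finset.mul_sum]
  rw [M.g_symm (I 0) (I 1)]
  congr 4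
  funext p
  exact Finset.sum_congr rfl fun _ _ => by ring

/-- The index renaming for the divergence of the Ricci tensor. -/
def divEquiv₄ : Unit ⊕ Fin 2 ≃ Fin 2 ⊕ Fin 1 where
  toFun := Sum.elim (fun _ => Sum.inl 0) ![Sum.inl 1, Sum.inr 0]
  invFun := Sum.elim ![Sum.inl (), Sum.inr 0] ![Sum.inr 1]
  left_inv := by decide
  right_inv := by decide

lemma divRic_eq (hd : 3 ≤ d) :
    ctr M.h (re divEquiv₄ (M.nabla M.Ric)) = ((d : ℝ) - 1) • M.covF M.JT := by
  funext I
  have h := M.div_Ric hd (I 0)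
  have h1 : M.covF M.JT I = M.D (I 0) M.J := M.cd_JT _ _
  rw [Pi.smul_apply, h1, ← h]
  refine ctr_eq fun p c => congrArg (M.cd p M.Ric) ?_
  funext i; fin_cases i <;> rfl

/-- The divergence of the Ricci tensor inside its second derivative. -/
lemma divDRic_sub (hd : 3 ≤ d) :
    M.divDRic - ((d : ℝ) - 1) • re (Equiv.swap 0 1) (M.covF (M.covF M.JT)) ∈ M.RC (Fin 2) 4 2 := by
  have h1 := Cl.ctr (Cl.re divEquiv₃ (RC_comm (M := M) RC_Ric))
  rw [re_sub', ctr_sub] at h1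
  refine Cl.cast h1 rfl le_rfl fun I => ?_
  refine congrArg (fun x => M.divDRic I - x) ?_
  have h2 := congrFun (M.cd_ctr (I 1) (re divEquiv₄ (M.nabla M.Ric))) ![I 0]
  rw [divRic_eq _ hd, cd_smul, cd_re] at h2
  have h3 : (re (Equiv.swap 0 1) (M.covF (M.covF M.JT)) : Ten d A (Fin 2)) I
      = M.cd (I 1) (M.covF M.JT) ![I 0] :=
    congrArg (M.cd (I 1) (M.covF M.JT)) (by funext i; fin_cases i; rfl)
  rw [Pi.smul_apply, h3]
  rw [Pi.smul_apply] at h2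
  rw [h2]
  refine ctr_eq fun p c => congrArg (M.cd (I 1) (M.nabla M.Ric)) ?_
  funext i; rcases i with i | i; · rfl
  · fin_cases i <;> rfl

/-- The divergence of `Ric` is `(d - 1) dJ`, so `∇∇J` occurs with coefficients `-(d - 1)` and `1` in
the bracket of `divDivW_eq`; a unit vector turns `g` into `1`. Dividing by `d - 3` is where `4 ≤ d`
enters. -/
lemma full_iterCov_divDivW (v : Fin d → A) (hv : full v M.gT = 1) (hd : 4 ≤ d) (m : ℕ) :
    ∃ E ∈ M.RC (Fin (2 + m)) (4 + m) 2, full v (M.iterCov (M.lap M.Ric) m)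
      - full v (M.iterCov (M.lap M.JT) m) - ((d : ℝ) - 2) • full v (M.iterCov M.JT (m + 2))
      = (((d : ℝ) - 2) / ((d : ℝ) - 3)) • full v (M.iterCov M.divDivW m) + full v E := by
  have hd3 : (d : ℝ) - 3 ≠ 0 := by
    have : (4 : ℝ) ≤ d := by exact_mod_cast hd
    linarith
  have hd2 : (d : ℝ) - 2 ≠ 0 := by
    have : (4 : ℝ) ≤ d := by exact_mod_cast hd
    linarith
  have h1 := M.divDRic_sub (by omega)
  set E := M.divDRic - ((d : ℝ) - 1) • re (Equiv.swap 0 1) (M.covF (M.covF M.JT)) with hE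
  have h2 : M.divDRic = ((d : ℝ) - 1) • re (Equiv.swap 0 1) (M.covF (M.covF M.JT)) + E := by
    rw [hE]; abel
  refine ⟨M.iterCov E m, RC_iterCov h1 m, ?_⟩
  have h3 : M.divDivW = (((d : ℝ) - 3) / ((d : ℝ) - 2)) •
    (re (Equiv.swap 0 1) (M.lap M.Ric) - ((d : ℝ) - 1) • re (Equiv.swap 0 1) (M.covF (M.covF M.JT))
      - E - re (Equiv.sumEmpty (Fin 2) (Fin 0)) (mulT M.gT (M.lap M.JT))
      - (-1 : ℝ) • M.covF (M.covF M.JT)) := by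
    rw [M.divDivW_eq (by omega), h2, neg_smul, one_smul]
    congr 1; abel
  obtain ⟨e', he⟩ := M.iterCov_gT_mul (Equiv.sumEmpty (Fin 2) (Fin 0)) (M.lap M.JT) m
  rw [h3, iterCov_smul, iterCov_sub, iterCov_sub, iterCov_sub, iterCov_sub, iterCov_smul,
    iterCov_smul, he]
  simp only [full_smul, full_sub, full_iterCov_re, full_iterCov_covF, full_re, full_mulT, hv, one_mul]
  rw [smul_smul, div_mul_div_cancel₀ hd3, div_self hd2, one_smul]
  simp only [sub_smul, one_smul, neg_smul]
  module

/-- Derivatives pass through traces, so a derivative of a double trace of `∇^n F` is again a double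
trace, now of `∇^{n+m} F`. -/
lemma iterCov_ctr_ctr {F : Ten d A (Fin 4)} (m n l : ℕ)
    (e : Fin (4 + n) ≃ Fin 2 ⊕ (Fin 2 ⊕ Fin l)) : ∃ e' : Fin (4 + (n + m)) ≃ Fin 2 ⊕ (Fin 2 ⊕ Fin (l + m)),
    M.iterCov (ctr M.h (ctr M.h (re e (M.iterCov F n)))) m
      = ctr M.h (ctr M.h (re e' (M.iterCov F (n + m)))) := by
  induction m with
  | zero => exact ⟨e, rfl⟩
  | succ m ih =>
    obtain ⟨e', h⟩ := ih
    refine ⟨((((consEquiv (4 + (n + m))).trans ((Equiv.refl Unit).sumCongr e')).trans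
      (sumLeftComm Unit (Fin 2) _)).trans ((Equiv.refl (Fin 2)).sumCongr
      ((sumLeftComm Unit (Fin 2) _).trans
      ((Equiv.refl (Fin 2)).sumCongr (consEquiv (l + m)).symm)))), ?_⟩
    rw [iterCov, h, covF_eq_re, nabla_ctr, nabla_ctr, nabla_re, nabla_eq_re]
    funext J
    simp only [ctr, re]
    refine Finset.sum_congr rfl fun b _ => Finset.sum_congr rfl fun c _ => ?_
    refine congrArg (fun x => M.h b c * x) ?_
    refine Finset.sum_congr rfl fun b' _ => Finset.sum_congr rfl fun c' _ => ?_
    refine congrArg (fun x => M.h b' c' * x) ?_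
    refine congrArg (M.iterCov F (n + m + 1)) ?_
    funext i
    simp only [Function.comp_apply, Equiv.trans_apply]
    rcases consEquiv (4 + (n + m)) i with i | i
    · rfl
    · simp only [Equiv.sumCongr_apply, Sum.map_inr]
      rcases e' i with i | i | i <;> rfl

end MetricAlg

end SingularYamabe

/-! ### The intrinsic Laplacian of full normal contractions -/

namespace SingularYamabe

variable {d : ℕ} {A : Type*} [CommRing A] [Algebra ℝ A]

/-- Contraction of the first indices with a vector. -/
def fcp {k : ℕ} {μ : Type} (v : Fin d → A) (F : Ten d A (Fin k ⊕ μ)) : Ten d A μ :=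
  fun J => full v fun I : Fin k → Fin d => F (Sum.elim I J)

/-- Separating the first index. -/
def consS (k : ℕ) (μ : Type) : Fin (k + 1) ⊕ μ ≃ Unit ⊕ (Fin k ⊕ μ) :=
  ((MetricAlg.consEquiv k).sumCongr (Equiv.refl μ)).trans (Equiv.sumAssoc Unit (Fin k) μ)

lemma full_succ {k : ℕ} (v : Fin d → A) (F : Ten d A (Fin (k + 1))) :
    full v F = full v (iv v (re (MetricAlg.consEquiv k) F)) := by
  rw [full_iv, full_re]

lemma fcp_succ {k : ℕ} {μ : Type} (v : Fin d → A) (F : Ten d A (Fin (k + 1) ⊕ μ)) :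
    fcp v F = fcp v (iv v (re (consS k μ) F)) := by
  funext J
  rw [fcp, full_succ]
  refine congrArg (full v) ?_
  funext I
  refine Finset.sum_congr rfl fun b _ => ?_
  refine congrArg (fun x => v b * F x) ?_
  funext i
  rcases i with i | i
  · simp only [Function.comp_apply, Sum.elim_inl, consS, Equiv.trans_apply, Equiv.sumCongr_apply,
      Sum.map_inl]
    rcases MetricAlg.consEquiv k i with i | i <;> rfl
  · rfl

lemma fcp_zero {μ : Type} (v : Fin d → A) (F : Ten d A (Fin 0 ⊕ μ)) :
    fcp v F = re (Equiv.emptySum (Fin 0) μ) F := by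
  funext J
  rw [fcp, full_isEmpty v _ Fin.elim0]
  refine congrArg F ?_
  funext i
  rcases i with i | i
  · exact i.elim0
  · rfl

lemma fcp_sub {k : ℕ} {μ : Type} (v : Fin d → A) (F H : Ten d A (Fin k ⊕ μ)) :
    fcp v (F - H) = fcp v F - fcp v H := by
  funext J
  exact full_sub v _ _

lemma full_sum_mul {κ ι : Type} [Fintype κ] [DecidableEq κ] [Fintype ι] (v : Fin d → A) (c : ι → A)
    (F : ι → Ten d A κ) : full v (fun I => ∑ b, c b * F b I) = ∑ b, c b * full v (F b) := by
  simp only [full, Finset.mul_sum]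
  rw [Finset.sum_comm]
  exact Finset.sum_congr rfl fun _ _ => Finset.sum_congr rfl fun _ _ => by ring

lemma full_sub_mem {κ : Type} [Fintype κ] [DecidableEq κ] {Z : Ideal A} {v v' : Fin d → A}
    (h : ∀ a, v a - v' a ∈ Z) (F : Ten d A κ) : full v F - full v' F ∈ Z := by
  have h1 : ∀ a, Ideal.Quotient.mk Z (v a) = Ideal.Quotient.mk Z (v' a) := fun a =>
    Ideal.Quotient.eq.2 (h a)
  rw [← Ideal.Quotient.eq]
  simp only [full, map_sum, map_mul, map_prod, h1]

lemma iv_ctr {κ : Type} (v : Fin d → A) (h : Fin d → Fin d → A) (F : Ten d A (Fin 2 ⊕ (Unit ⊕ κ))) :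
    iv v (ctr h F) = ctr h (iv v (re (MetricAlg.sumLeftComm (Fin 2) Unit κ) F)) := by
  funext J
  simp only [iv, ctr, Finset.mul_sum]
  rw [Finset.sum_comm]
  refine Finset.sum_congr rfl fun b _ => ?_
  rw [Finset.sum_comm]
  refine Finset.sum_congr rfl fun c _ => Finset.sum_congr rfl fun e _ => ?_
  rw [mul_left_comm]
  refine congrArg (fun x => h b c * (v e * F x)) ?_
  funext i; rcases i with i | i | i <;> rfl

namespace MetricAlg

variable {M : MetricAlg d A} {At : Atoms d A} {Z : Ideal A} {w δ : ℕ} {μ : Type} [Fintype μ]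
  [DecidableEq μ]

lemma Cl_fcp {X : Fin d → A} (hX : Cl1 M.h At Z 0 0 X) {k : ℕ} {F : Ten d A (Fin k ⊕ μ)}
    (hF : F ∈ Cl M.h At Z (Fin k ⊕ μ) w δ) : fcp (M.up X) F ∈ Cl M.h At Z μ w δ := by
  induction k with
  | zero => rw [fcp_zero]; exact Cl.re _ hF
  | succ k ih =>
    rw [fcp_succ]
    exact ih (Cl.cast (M.Cl_iv_up hX (Cl.re (consS k μ) hF)) (by omega) (by omega) fun _ => rfl)

lemma Cl0_full {X : Fin d → A} (hX : Cl1 M.h At Z 0 0 X) {k : ℕ} {F : Ten d A (Fin k)}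
    (hF : F ∈ Cl M.h At Z (Fin k) w δ) : Cl0 M.h At Z w δ (full (M.up X) F) :=
  Cl.cast (Cl_fcp hX (Cl.re (Equiv.sumEmpty (Fin k) (Fin 0)).symm hF)) rfl le_rfl fun _ => rfl

end MetricAlg

namespace HypAlg

variable {M : HypAlg d A} {ρ w δ : ℕ} {κ μ : Type} [Fintype κ] [DecidableEq κ] [Fintype μ]
  [DecidableEq μ]

lemma tnab_re (e : κ ≃ μ) (F : Ten d A κ) :
    M.tnab (re e F) = re ((Equiv.refl Unit).sumCongr e) (M.tnab F) := M.dV_re _ e F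

/-- Each of the `k` normals contributes, when differentiated, a factor `II`; this is `HC_tnab_iv`
applied once per normal. -/
lemma HC_tnab_fcp {k : ℕ} {F : Ten d A (Fin k ⊕ μ)} (hF : F ∈ M.HC ρ (Fin k ⊕ μ) w δ) :
    M.tnab (fcp M.Nup F) - fcp M.Nup (re (MetricAlg.sumLeftComm Unit (Fin k) μ) (M.tnab F))
      ∈ M.HC ρ (Unit ⊕ μ) (w + 1) (δ + 1) := by
  induction k with
  | zero =>
    have : M.tnab (fcp M.Nup F)
        = fcp M.Nup (re (MetricAlg.sumLeftComm Unit (Fin 0) μ) (M.tnab F)) := by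
      rw [fcp_zero, fcp_zero, tnab_re]
      funext J
      refine congrArg (M.tnab F) ?_
      funext i; rcases i with i | i | i
      · rfl
      · exact i.elim0
      · rfl
    rw [this, sub_self]
    exact Submodule.zero_mem _
  | succ k ih =>
    have h1 := ih (HC_iv (Cl.re (consS k μ) hF))
    have h2 := HC_tnab_iv (Cl.re (consS k μ) hF)
    have h3 := MetricAlg.Cl_fcp HC1_N (Cl.re (MetricAlg.sumLeftComm Unit (Fin k) μ) h2)
    rw [re_sub', fcp_sub] at h3
    have h4 := Submodule.add_mem _ h1 h3
    change _ + (fcp M.Nup _ - fcp M.Nup _) ∈ _ at h4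
    rw [sub_add_sub_cancel, ← fcp_succ, tnab_re, re_iv] at h4
    have h5 : re ((Equiv.refl Unit).sumCongr (MetricAlg.sumLeftComm Unit (Fin k) μ))
        (re (MetricAlg.sumLeftComm Unit Unit (Fin k ⊕ μ))
          (re ((Equiv.refl Unit).sumCongr (consS k μ)) (M.tnab F)))
        = re (consS k (Unit ⊕ μ)) (re (MetricAlg.sumLeftComm Unit (Fin (k + 1)) μ) (M.tnab F)) := by
      funext J
      refine congrArg (M.tnab F) ?_
      funext i; rcases i with i | i | i
      · rfl
      · simp only [Function.comp_apply]
        refine Fin.cases ?_ (fun i => ?_) i <;> rfl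
      · rfl
    rw [h5, ← fcp_succ] at h4
    exact h4

lemma HC_of_RC {F : Ten d A κ} (hF : F ∈ M.RC κ w δ) : F ∈ M.HC 1 κ w δ := by
  refine Cl.subst hF bot_le fun κ _ _ w δ F h => ?_
  cases h with
  | R m => exact ⟨inferInstance, inferInstance, Cl.of_atom (HAtom.R m)⟩

lemma HC0_full {k : ℕ} {F : Ten d A (Fin k)} (hF : F ∈ M.HC ρ (Fin k) w δ) :
    M.HC0 ρ w δ (full M.Nup F) := MetricAlg.Cl0_full HC1_N hF

/-- Moving a separate first index to the end. -/
def lastEquiv (k : ℕ) : Unit ⊕ Fin k ≃ Fin k ⊕ Fin 1 :=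
  (Equiv.sumComm Unit (Fin k)).trans ((Equiv.refl (Fin k)).sumCongr (Equiv.ofUnique Unit (Fin 1)))

lemma HC1_full_cd {k : ℕ} {F : Ten d A (Fin k)} (hF : F ∈ M.RC (Fin k) w δ) :
    M.HC1 1 (w + 1) δ (fun c => full M.Nup (M.cd c F)) :=
  MetricAlg.Cl_fcp HC1_N (Cl.re (lastEquiv k) (HC_of_RC (MetricAlg.RC_nabla hF)))

lemma HC1_tgrad_full {k : ℕ} {F : Ten d A (Fin k)} (hF : F ∈ M.RC (Fin k) w δ) :
    M.HC1 1 (w + 1) (δ + 1) (fun a => M.tgrad (full M.Nup F) a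
      - ∑ b, M.γ a b * full M.Nup (M.cd b F)) := by
  have h1 := HC_tnab_fcp (HC_of_RC (Cl.re (Equiv.sumEmpty (Fin k) (Fin 0)).symm hF))
  refine Cl.cast (Cl.re (⟨Sum.elim (fun _ => 0) Fin.elim0, fun _ => Sum.inl (), by decide,
    by decide⟩ : Unit ⊕ Fin 0 ≃ Fin 1) h1) rfl le_rfl fun I => ?_
  have h2 : M.tnab (fcp M.Nup (re (Equiv.sumEmpty (Fin k) (Fin 0)).symm F)) (fun _ => I 0)
      = M.tgrad (full M.Nup F) (I 0) := by
    simp [tnab_apply, tgrad, MetricAlg.cd_apply, act]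
    rfl
  have h3 : fcp M.Nup (re (MetricAlg.sumLeftComm Unit (Fin k) (Fin 0))
      (M.tnab (re (Equiv.sumEmpty (Fin k) (Fin 0)).symm F))) (fun _ => I 0)
      = ∑ b, M.γ (I 0) b * full M.Nup (M.cd b F) := by
    rw [tnab_re, ← full_sum_mul]
    rfl
  rw [re_sub', Pi.sub_apply]
  refine congrArg₂ (fun x y => x - y) ?_ ?_
  · rw [← h2]
    change M.tnab _ _ = M.tnab _ _
    refine congrArg (M.tnab _) ?_
    funext i; rcases i with i | i
    · rfl
    · exact i.elim0
  · rw [← h3]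
    change fcp M.Nup _ _ = fcp M.Nup _ _
    refine congrArg (fcp M.Nup _) ?_
    funext i; rcases i with i | i
    · rfl
    · exact i.elim0

lemma HC2_tcd_full {k : ℕ} {F : Ten d A (Fin k)} (hF : F ∈ M.RC (Fin k) w δ) :
    M.HC2 1 (w + 2) (δ + 1) (fun a c => M.tcd (fun c => full M.Nup (M.cd c F)) a c
      - ∑ b, M.γ a b * full M.Nup (fun I => M.cd b (M.nabla F) (Sum.elim (fun _ => c) I))) := by
  have h1 := HC_tnab_fcp (HC_of_RC (Cl.re (lastEquiv k) (MetricAlg.RC_nabla hF)))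
  refine Cl.cast (Cl.re (MetricAlg.consEquiv 1).symm h1) rfl le_rfl fun I => ?_
  rw [re_sub', Pi.sub_apply]
  refine congrArg₂ (fun x y => x - y) ?_ ?_
  · simp only [re, tnab_apply, tcd]
    refine Finset.sum_congr rfl fun b _ => ?_
    refine congrArg (fun x => M.γ (I 0) b * x) ?_
    exact (M.cd_fin_one b (fun c => full M.Nup (M.cd c F))
      ((I ∘ (MetricAlg.consEquiv 1).symm) ∘ Sum.inr)).symm
  · rw [tnab_re, ← full_sum_mul]
    simp only [re, fcp]
    refine congrArg (full M.Nup) ?_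
    funext J
    rw [tnab_apply]
    refine Finset.sum_congr rfl fun b _ => ?_
    refine congrArg (fun x => M.γ (I 0) b * M.cd b (M.nabla F) x) ?_
    funext i; rcases i with i | i <;> rfl

lemma sum_h_γ (b c : Fin d) : ∑ a, M.h a c * M.γ a b = M.h b c - M.Nup b * M.Nup c := by
  simp only [γ, mul_sub, Finset.sum_sub_distrib, ← mul_assoc, ← Finset.sum_mul]
  have : ∑ a, M.h a c * M.N a = M.Nup c := Finset.sum_congr rfl fun a _ => by rw [M.h_symm]
  rw [this]
  simp [mul_comm]

/-- The classical relation between Laplacians: `Δ̄` is `Δ` minus the second normal derivative minus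
a mean curvature times the first normal derivative. The last term, and every derivative of a normal,
raises the degree. -/
lemma HC0_tLap_full {k : ℕ} {F : Ten d A (Fin k)} (hF : F ∈ M.RC (Fin k) w δ) :
    M.HC0 1 (w + 2) (δ + 1) (M.tLap (full M.Nup F)
      - (full M.Nup (M.lap F) - full M.Nup (M.nabla (M.nabla F)))) := by
  set V : Fin d → A := fun c => full M.Nup (M.cd c F) with hV
  set Q : Fin d → Fin d → A := fun b c =>
    full M.Nup (fun I => M.cd b (M.nabla F) (Sum.elim (fun _ => c) I)) with hQ
  have hV1 : M.HC1 1 (w + 1) δ V := HC1_full_cd hF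
  have h1 := HC0_tdiv (HC1_tgrad_full hF)
  have h2 := Cl2.trace (HC2_tcd_full hF)
  -- The normal derivative times the trace of `II`, the mean curvature term of the comparison.
  have h3 := ((HC1_N (M := M) (ρ := 1)).dot hV1).mul (HC0_tdiv_N (M := M) (ρ := 1))
  have e1 : M.tdiv (fun a => ∑ b, M.γ a b * V b) = M.tdiv V - M.dot M.N V * M.tdiv M.N := by
    have : (fun a => ∑ b, M.γ a b * V b) = fun a => V a - (fun a => M.N a * M.dot M.N V) a := by
      funext a
      rw [γ_mul]
      exact congrArg (fun x => V a - M.N a * x) (M.sum_up_mul _ _)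
    rw [this, tdiv_sub, tdiv_N_mul]
  -- Since `h γ = h - n ⊗ n`, the trace over tangential directions is the full trace minus the
  -- normal-normal component.
  have e2 : ∑ a, ∑ c, M.h a c * ∑ b, M.γ a b * Q b c
      = full M.Nup (M.lap F) - full M.Nup (M.nabla (M.nabla F)) := by
    have e3 : full M.Nup (M.lap F) = ∑ b, ∑ c, M.h b c * Q b c := by
      have : M.lap F = fun I => ∑ p : Fin d × Fin d, M.h p.1 p.2
          * M.cd p.1 (M.nabla F) (Sum.elim (fun _ => p.2) I) := by
        funext I
        rw [Fintype.sum_prod_type]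
        refine ctr_eq fun b c => ?_
        refine congrArg (M.cd b (M.nabla F)) ?_
        funext i; rcases i with i | i <;> rfl
      rw [this, full_sum_mul, Fintype.sum_prod_type]
    have e4 : full M.Nup (M.nabla (M.nabla F)) = ∑ b, ∑ c, M.Nup b * M.Nup c * Q b c := by
      rw [← full_iv, ← full_iv]
      have : iv M.Nup (iv M.Nup (M.nabla (M.nabla F))) = fun I => ∑ p : Fin d × Fin d,
          (M.Nup p.1 * M.Nup p.2) * M.cd p.1 (M.nabla F) (Sum.elim (fun _ => p.2) I) := by
        funext I
        rw [Fintype.sum_prod_type, Finset.sum_comm]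
        refine Finset.sum_congr rfl fun c _ => ?_
        rw [iv, Finset.mul_sum]
        exact Finset.sum_congr rfl fun b _ => by rw [MetricAlg.nabla_elim]; ring
      rw [this, full_sum_mul, Fintype.sum_prod_type]
    have e5 : ∑ a, ∑ c, M.h a c * ∑ b, M.γ a b * Q b c
        = ∑ b, ∑ c, (∑ a, M.h a c * M.γ a b) * Q b c := by
      simp only [Finset.mul_sum, Finset.sum_mul]
      rw [Finset.sum_comm]
      conv_rhs => rw [Finset.sum_comm]
      refine Finset.sum_congr rfl fun c _ => ?_
      rw [Finset.sum_comm]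
      exact Finset.sum_congr rfl fun _ _ => Finset.sum_congr rfl fun _ _ => by ring
    rw [e5, e3, e4]
    simp only [sum_h_γ, sub_mul, Finset.sum_sub_distrib]
  refine ((h1.cast (w' := w + 2) (δ' := δ + 1) rfl le_rfl rfl).add ((h2.cast (w' := w + 2)
    (δ' := δ + 1) rfl le_rfl rfl).sub (h3.cast (w' := w + 2) (δ' := δ + 1) (by omega) (by omega)
    rfl))).congr ?_
  have e6 : M.tdiv (fun a => M.tgrad (full M.Nup F) a - ∑ b, M.γ a b * V b)
      = M.tLap (full M.Nup F) - (M.tdiv V - M.dot M.N V * M.tdiv M.N) := by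
    rw [← e1, tdiv_sub]; rfl
  have e7 : ∑ b, ∑ c, M.h b c * (M.tcd V b c - ∑ b', M.γ b b' * Q b' c)
      = M.tdiv V - (full M.Nup (M.lap F) - full M.Nup (M.nabla (M.nabla F))) := by
    rw [← e2]
    simp only [mul_sub, Finset.sum_sub_distrib]
    rfl
  rw [e6]
  change _ = _ + ((∑ b, ∑ c, M.h b c * (M.tcd V b c - ∑ b', M.γ b b' * Q b' c)) - _)
  rw [e7]
  simp only [MetricAlg.dot]
  ring

lemma full_Nup_gT : full M.Nup M.gT = 1 := by
  have h1 : full M.Nup M.gT = full M.Nup (re (MetricAlg.consEquiv 1) M.gT) := (full_re _ _ _).symm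
  have h2 : ∀ a, ∑ b, M.g a b * M.Nup b = M.N a := fun a => M.g_mul_h_mul a M.N
  rw [h1, ← full_iv, ← full_re _ (Equiv.ofUnique (Fin 1) Unit), full_unit, ← M.Nup_mul_N]
  change ∑ b, M.Nup b * ∑ c, M.Nup c * M.g c b = _
  refine Finset.sum_congr rfl fun b _ => ?_
  refine congrArg (fun x => M.Nup b * x) ?_
  rw [← h2]
  refine Finset.sum_congr rfl fun c _ => ?_
  rw [mul_comm (M.g b c), M.g_symm]

/-- Two traces use up four of the `4 + n` indices and `2 + m` remain, all contracted with normals.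
There are thus at least two normals on a single Weyl factor, which is an atom of degree two. -/
lemma HC0_full_ctr_ctr_Weyl {n m : ℕ} (e : Fin (4 + n) ≃ Fin 2 ⊕ (Fin 2 ⊕ Fin (2 + m))) :
    M.HC0 ρ (2 + n) 2 (full M.Nup (ctr M.h (ctr M.h (re e (M.iterCov M.Weyl n))))) := by
  let f : Fin (2 + m) ≃ Unit ⊕ (Unit ⊕ Fin m) := (finCongr (add_comm 2 m)).trans
    ((MetricAlg.consEquiv (m + 1)).trans ((Equiv.refl Unit).sumCongr (MetricAlg.consEquiv m)))
  have hre : ∀ {κ μ : Type} (e : κ ≃ μ) (F : Ten d A (Fin 2 ⊕ κ)),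
      re e (ctr M.h F) = ctr M.h (re ((Equiv.refl (Fin 2)).sumCongr e) F) := by
    intro κ μ e F
    funext J
    refine ctr_eq fun b c => congrArg F ?_
    funext i; rcases i with i | i <;> rfl
  have hiv : ∀ {κ μ : Type} (e : κ ≃ μ) (F : Ten d A (Unit ⊕ κ)),
      re e (iv M.Nup F) = iv M.Nup (re ((Equiv.refl Unit).sumCongr e) F) := by
    intro κ μ e F
    funext J
    simp only [re, iv]
    refine Finset.sum_congr rfl fun b _ => congrArg (fun x => M.Nup b * F x) ?_
    funext i; rcases i with i | i <;> rfl
  have hrr : ∀ {κ μ ν : Type} (e : κ ≃ μ) (e' : μ ≃ ν) (F : Ten d A κ),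
      re e' (re e F) = re (e.trans e') F := fun _ _ _ => rfl
  clear_value f
  rw [← full_re _ f, ← full_iv, ← full_iv]
  simp only [hre, hiv, iv_ctr, hrr]
  exact HC0_full (Cl.ctr (Cl.ctr (Cl.of_atom (HAtom.WNN n _ _))))

end HypAlg

end SingularYamabe

/-! ### Cancellation of the linear curvature terms; even ambient dimension -/

namespace SingularYamabe

variable {d : ℕ} {A : Type*} [CommRing A] [Algebra ℝ A]

namespace MetricAlg

variable (M : MetricAlg d A)

/-- The double divergence in terms of iterated derivatives. -/
lemma divDivW_eq_ctr : ∃ e : Fin (4 + 2) ≃ Fin 2 ⊕ (Fin 2 ⊕ Fin 2),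
    M.divDivW = ctr M.h (ctr M.h (re e (M.iterCov M.Weyl 2))) := by
  have hre : ∀ {κ μ : Type} (e : κ ≃ μ) (F : Ten d A (Fin 2 ⊕ κ)),
      re e (ctr M.h F) = ctr M.h (re ((Equiv.refl (Fin 2)).sumCongr e) F) := by
    intro κ μ e F
    funext J
    refine ctr_eq fun b c => congrArg F ?_
    funext i; rcases i with i | i <;> rfl
  have hrr : ∀ {κ μ ν : Type} (e : κ ≃ μ) (e' : μ ≃ ν) (F : Ten d A κ),
      re e' (re e F) = re (e.trans e') F := fun _ _ _ => rfl
  have h1 : M.nabla (M.nabla M.Weyl) = re ((consEquiv 5).trans ((Equiv.refl Unit).sumCongr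
      (consEquiv 4))) (M.iterCov M.Weyl 2) := by
    rw [M.nabla_eq_re M.Weyl, nabla_re, nabla_eq_re]; rfl
  rw [divDivW, divW, nabla_ctr, nabla_re, h1, hre, hrr, hrr, hrr]
  exact ⟨_, rfl⟩

lemma full_nabla_nabla (v : Fin d → A) {k : ℕ} (F : Ten d A (Fin k)) (m : ℕ) :
    full v (M.nabla (M.nabla (M.iterCov F m))) = full v (M.iterCov F (m + 2)) := by
  rw [M.nabla_eq_re (M.iterCov F m), nabla_re, full_re, nabla_eq_re, full_re]
  rfl

end MetricAlg

namespace HypAlg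

variable {M : HypAlg d A}

/-- The tangential Laplacian of the leading parts of the curvature terms. -/
lemma HC0_tLap_Ric_sub_J (hd : 4 ≤ d) (m : ℕ) :
    M.HC0 1 (m + 4) 2 (M.tLap (full M.Nup (M.iterCov M.Ric m) - full M.Nup (M.iterCov M.JT m))
      - (((d : ℝ) - 1) • full M.Nup (M.iterCov M.JT (m + 2))
        - full M.Nup (M.iterCov M.Ric (m + 2)))) := by
  have a1 := HC0_tLap_full (MetricAlg.RC_iterCov (MetricAlg.RC_Ric (M := M.toMetricAlg)) m)
  have a2 := HC0_tLap_full (MetricAlg.RC_iterCov (MetricAlg.RC_J (M := M.toMetricAlg)) m)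
  have b1 := HC0_full (HC_of_RC (MetricAlg.RC_lap_iterCov (MetricAlg.RC_Ric (M := M.toMetricAlg)) m))
  have b2 := HC0_full (HC_of_RC (MetricAlg.RC_lap_iterCov (MetricAlg.RC_J (M := M.toMetricAlg)) m))
  -- This trades the ambient Laplacian of `Ric - g J` in normal directions for `(d - 2)` times a
  -- normal derivative of `J`, at the price of a double divergence of `W`, which has degree two by
  -- `HC0_full_ctr_ctr_Weyl`.
  obtain ⟨E, hE, h⟩ := M.full_iterCov_divDivW M.Nup M.full_Nup_gT hd m
  have c1 := HC0_full (HC_of_RC hE)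
  obtain ⟨e, he⟩ := M.divDivW_eq_ctr
  obtain ⟨e', he'⟩ := M.iterCov_ctr_ctr m 2 2 e
  have c2 := HC0_full_ctr_ctr_Weyl (M := M) (ρ := 1) e'
  rw [← he', ← he] at c2
  rw [full_sub] at b1 b2
  rw [MetricAlg.full_nabla_nabla] at a1 a2
  have s1 := (a1.cast (w' := m + 4) (δ' := 2) (by omega) le_rfl rfl).add
    (b1.cast (w' := m + 4) (δ' := 2) (by omega) le_rfl rfl)
  have s2 := (a2.cast (w' := m + 4) (δ' := 2) (by omega) le_rfl rfl).add
    (b2.cast (w' := m + 4) (δ' := 2) (by omega) le_rfl rfl)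
  refine ((s1.sub s2).add (((c2.smul (((d : ℝ) - 2) / ((d : ℝ) - 3))).cast (w' := m + 4) (δ' := 2)
    (by omega) le_rfl rfl).add (c1.cast (w' := m + 4) (δ' := 2) (by omega) le_rfl rfl))).congr ?_
  rw [← h, tLap_sub]
  change _ = _ - ((M.tLap (full M.Nup (M.iterCov M.JT m))
    - (full M.Nup (M.lap (M.iterCov M.JT m)) - full M.Nup (M.iterCov M.JT (m + 2))))
    + (full M.Nup (M.lap (M.iterCov M.JT m)) - full M.Nup (M.iterCov (M.lap M.JT) m))) + _
  module

end HypAlg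

namespace YamabeAlg

variable {M : YamabeAlg d A} {ρ K w δ : ℕ}

lemma L_full_eq {k : ℕ} (F : Ten d A (Fin (k + 1))) :
    M.cdX (iv M.Xup (re (MetricAlg.consEquiv k) F))
      = iv M.Xup (re (MetricAlg.consEquiv k) (M.cdX F))
        + iv (M.up (M.X 1)) (re (MetricAlg.consEquiv k) F) := by
  have h1 : ∀ c, ∑ b, M.Xup b * M.cdUp b M.Xup c = M.up (M.X 1) c := by
    intro c
    simp only [Xup_eq, MetricAlg.cdUp_up, MetricAlg.up, X, Finset.mul_sum]
    rw [Finset.sum_comm]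
    refine Finset.sum_congr rfl fun b _ => Finset.sum_congr rfl fun e _ => ?_
    rw [mul_left_comm]
  funext J
  simp only [cdX, MetricAlg.cd_iv, Pi.add_apply, mul_add, Finset.sum_add_distrib, MetricAlg.cd_re]
  congr 1
  · simp only [iv, re, cdX, Finset.mul_sum]
    rw [Finset.sum_comm]
    exact Finset.sum_congr rfl fun _ _ => Finset.sum_congr rfl fun _ _ => by ring
  · simp only [iv, ← h1, Finset.mul_sum, Finset.sum_mul]
    rw [Finset.sum_comm]
    exact Finset.sum_congr rfl fun _ _ => Finset.sum_congr rfl fun _ _ => by ring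

/-- If `L` falls on one of the contracting gradients it produces `X_1`, one more factor; so up to
higher degree only the tensor is differentiated. -/
lemma AC0_L_full {k : ℕ} {F : Ten d A (Fin k)} (hF : F ∈ M.AC ρ K (Fin k) w δ) :
    M.AC0 ρ (K + 1) (w + 1) (δ + 1) (M.L (full M.Xup F) - full M.Xup (M.cdX F)) := by
  induction k with
  | zero =>
    refine (Cl0.zero).congr ?_
    rw [full_isEmpty _ _ Fin.elim0, full_isEmpty _ _ Fin.elim0, sub_eq_zero]
    simp [cdX, L, MetricAlg.cd_apply, act]
  | succ k ih =>
    have h0 := AC1_X (M := M) (ρ := ρ) (Nat.zero_le (K + 1))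
    have h1 := ih (Cl.cast (M.Cl_iv_up (AC1_X (M := M) (ρ := ρ) (Nat.zero_le K))
      (Cl.re (MetricAlg.consEquiv k) hF)) (w' := w) (δ' := δ) (by omega) (by omega) fun _ => rfl)
    have h2 := MetricAlg.Cl0_full h0 (M.Cl_iv_up
      (AC1_X (M := M) (ρ := ρ) (show 1 ≤ K + 1 by omega))
      (Cl.re (MetricAlg.consEquiv k) (AC_mono (Nat.le_succ K) hF)))
    refine (h1.add (h2.cast (w' := w + 1) (δ' := δ + 1) (by omega) (by omega) rfl)).congr ?_
    have e1 : full (M.up (M.X 0)) = full (A := A) (κ := Fin k) M.Xup := rfl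
    rw [e1, ← Xup_eq, full_succ, full_succ _ (M.cdX F), L_full_eq, full_add]
    ring

lemma AC_of_RC {κ : Type} [Fintype κ] [DecidableEq κ] {F : Ten d A κ} (hF : F ∈ M.RC κ w δ) :
    F ∈ M.AC 1 K κ w δ := by
  refine Cl.subst hF bot_le fun κ _ _ w δ F h => ?_
  cases h with
  | R m => exact ⟨inferInstance, inferInstance, Cl.of_atom (AAtom.R m)⟩

lemma AC0_iterate_L_full {k : ℕ} {F : Ten d A (Fin k)} (hF : F ∈ M.RC (Fin k) w δ) (m : ℕ) :
    M.AC0 1 m (w + m) (δ + 1) (M.L^[m] (full M.Xup F) - full M.Xup (M.iterCov F m)) := by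
  induction m with
  | zero => exact (Cl0.zero).congr (sub_self _)
  | succ m ih =>
    have h1 := AC0_L le_rfl ih
    have h2 := AC0_L_full (M := M) (K := 0) (AC_of_RC (MetricAlg.RC_iterCov hF m))
    refine (h1.add ((AC0.mono (show 0 + 1 ≤ m + 1 by omega) h2).cast (w' := w + m + 1)
      (δ' := δ + 1) rfl le_rfl rfl)).congr ?_
    rw [Function.iterate_succ_apply', L_sub, cdX_iterCov, full_iv, full_re]
    ring

lemma full_Xup_Ric : full M.Xup M.Ric = M.ric (M.X 0) (M.X 0) := by
  rw [full_succ, full_succ, full_isEmpty _ _ Fin.elim0]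
  simp only [iv, re, Finset.mul_sum, MetricAlg.ric]
  rw [Finset.sum_comm]
  refine Finset.sum_congr rfl fun a _ => Finset.sum_congr rfl fun e _ => ?_
  rw [← mul_assoc, mul_comm (M.Xup e)]
  refine congrArg₂ (· * ·) rfl (congrArg M.Ric ?_)
  funext i; fin_cases i <;> rfl

/-- On the hypersurface the gradient of `σ` is the unit normal, which permits exchanging the two in
undifferentiated contractions. -/
lemma full_Nup_sub_full_Xup {κ : Type} [Fintype κ] [DecidableEq κ] (F : Ten d A κ) :
    full M.Nup F - full M.Xup F ∈ M.Z := full_sub_mem M.Nup_sub_Xup F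

lemma HC0_r_sub {m : ℕ} (hG : M.Good 1 m) :
    M.HC0 1 (m + 2) 2 (M.r m - full M.Nup (M.iterCov M.Ric m)) := by
  have h1 := HC0_of_AC0 hG (AC0_iterate_L_full (MetricAlg.RC_Ric (M := M.toMetricAlg)) m)
  refine ((h1.cast (w' := m + 2) (δ' := 2) (by omega) le_rfl rfl).sub
    (Cl0.of_ideal (full_Nup_sub_full_Xup (M.iterCov M.Ric m)))).congr ?_
  rw [full_Xup_Ric, r]
  ring

lemma HC0_j_sub {m : ℕ} (hG : M.Good 1 m) :
    M.HC0 1 (m + 2) 2 (M.j m - full M.Nup (M.iterCov M.JT m)) := by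
  have h1 := HC0_of_AC0 hG (AC0_iterate_L_full (MetricAlg.RC_J (M := M.toMetricAlg)) m)
  refine ((h1.cast (w' := m + 2) (δ' := 2) (by omega) le_rfl rfl).sub
    (Cl0.of_ideal (full_Nup_sub_full_Xup (M.iterCov M.JT m)))).congr ?_
  rw [full_isEmpty _ (fun _ : Fin 0 → Fin d => M.J) Fin.elim0, j]
  change _ = _ - full M.Xup (M.iterCov M.JT m) - _
  ring

/-- The tangential Laplacian of the curvature terms. -/
lemma HC0_tLap_r_sub_j (hd : 4 ≤ d) {m : ℕ} (hm : m + 2 < d) :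
    M.HC0 1 (m + 4) 2 (M.tLap (M.r m - M.j m) - ((d - 1 : A) * M.j (m + 2) - M.r (m + 2))) := by
  have hG := good (M := M) le_rfl hm
  have hG' : M.Good 1 m := hG.mono (by omega)
  have h1 := HypAlg.HC0_tLap_Ric_sub_J (M := M.toHypAlg) hd m
  have h2 := HypAlg.HC0_tLap ((HC0_r_sub hG').sub (HC0_j_sub hG'))
  have h3 := (HC0_j_sub hG).smul ((d : ℝ) - 1)
  have h4 := HC0_r_sub hG
  refine ((h1.add (h2.cast (w' := m + 4) (δ' := 2) rfl le_rfl rfl)).sub ((h3.sub h4).cast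
    (w' := m + 4) (δ' := 2) rfl le_rfl rfl)).congr ?_
  have h5 : ∀ x : A, ((d : ℝ) - 1) • x = (d - 1 : A) * x := fun x => by
    rw [Algebra.smul_def, map_sub, map_natCast, map_one]
  simp only [HypAlg.tLap_sub, h5]
  ring

lemma tLap_natMul (n : ℕ) (f : A) : M.tLap (n * f) = n * M.tLap f := by
  have h : ∀ f : A, (n : A) * f = (n : ℝ) • f := fun f => by rw [Algebra.smul_def, map_natCast]
  rw [h, h, HypAlg.tLap_smul]

/-- The leading part of `u (2 k + 2)`. -/
lemma u_even (k : ℕ) (hd : 4 ≤ d) (hk : 2 * k + 2 < d) :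
    M.HC0 1 (2 * k + 2) 2 ((d - 2 : ℕ) * M.u (2 * k + 2)
      - (2 * k + 2 : ℕ) * (M.j (2 * k) - M.r (2 * k))) := by
  induction k with
  | zero =>
    have hrem := Cl0.of_ideal (h := M.h) (At := M.HAtom 1) (w := 2) (δ := 2)
      (M.rem_mem (k := 2) (by omega))
    refine Cl0.of_natMul (n := 2) (by omega) ((recursion_zero (M := M) (ρ := 1) le_rfl).add
      (hrem.natMul d) |>.congr ?_)
    rw [Nat.cast_sub (by omega)]
    push_cast
    ring
  | succ k ih =>
    have h1 := recursion_succ (M := M) (ρ := 1) le_rfl (n := 2 * k + 1) (by omega)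
    have hrem := Cl0.of_ideal (h := M.h) (At := M.HAtom 1) (w := 2 * k + 1 + 3) (δ := 2)
      (M.rem_mem (k := 2 * k + 1 + 3) (by omega))
    have h2 := HypAlg.HC0_tLap (ih (by omega))
    have h3 := HC0_tLap_r_sub_j (M := M) hd (m := 2 * k) (by omega)
    obtain ⟨m, hm⟩ : ∃ m, d = 2 * k + 4 + m := ⟨d - (2 * k + 4), by omega⟩
    have hd' : (d : A) = 2 * k + 4 + m := by rw [hm]; push_cast; ring
    refine Cl0.of_natMul (n := 2 * m) (by omega) ?_
    -- The recursion times `d - 2`, with `(d - 2) Δ̄ u_{2k+2}` replaced by the induction hypothesis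
    -- and `Δ̄(r - j)` by `HC0_tLap_r_sub_j`. For `K = 2 k + 4` the coefficients of `j` and `r`
    -- become `K (d - K)` and `-K (d - K)`, and the common factor `m = d - K` can be divided out.
    have h4 := (((h1.add (hrem.natMul d)).natMul (d - 2)).add (((h2.cast (w' := 2 * k + 1 + 3)
      (δ' := 2) rfl le_rfl rfl).sub ((h3.cast (w' := 2 * k + 1 + 3) (δ' := 2) rfl le_rfl rfl).natMul
      (2 * k + 2))).natMul (2 * (2 * k + 4))))
    refine h4.congr ?_
    rw [HypAlg.tLap_sub, tLap_natMul, tLap_natMul, HypAlg.tLap_sub, HypAlg.tLap_sub,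
      Nat.cast_sub (by omega), hd']
    push_cast
    ring_nf

/-- The obstruction density, if `d` is even. -/
theorem B_even (hd : Even d) : M.HC0 1 d 2 M.B := by
  have h3 := M.three_le
  obtain ⟨k, hk⟩ : ∃ k, d = 2 * k + 4 := by obtain ⟨k, hk⟩ := hd; exact ⟨k - 2, by omega⟩
  have h1 := recursion_succ (M := M) (ρ := 1) le_rfl (n := 2 * k + 1) (by omega)
  have hrem := Cl0.of_ideal (h := M.h) (At := M.HAtom 1) (w := 2 * k + 1 + 3) (δ := 2) M.rem_self
  have h2 := HypAlg.HC0_tLap (u_even (M := M) k (by omega) (by omega))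
  have h3 := HC0_tLap_r_sub_j (M := M) (by omega) (m := 2 * k) (by omega)
  have hd' : (d : A) = 2 * k + 4 := by rw [hk]; push_cast; ring
  have e2 : M.rem d = M.rem (2 * k + 1 + 3) := congrArg M.rem (show d = 2 * k + 1 + 3 by omega)
  have h4 : M.HC0 1 (2 * k + 4) 2 M.B := by
    refine Cl0.of_natMul (n := (d - 2) * (d * d.factorial))
      (Nat.mul_ne_zero (by omega) (by positivity)) ?_
    -- The combination used in `u_even`, at order `d`: the coefficient of `u_d` and those of the
    -- curvature terms all carry the factor `d - d`, so only the remainder, a multiple of `B`, is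
    -- left.
    refine (((h1.add (hrem.natMul d)).natMul (d - 2)).add (((h2.cast (w' := 2 * k + 1 + 3)
      (δ' := 2) rfl le_rfl rfl).sub ((h3.cast (w' := 2 * k + 1 + 3) (δ' := 2) rfl le_rfl rfl).natMul
      (2 * k + 2))).natMul (2 * (2 * k + 4)))).neg.congr ?_
    rw [HypAlg.tLap_sub, tLap_natMul, tLap_natMul, HypAlg.tLap_sub, HypAlg.tLap_sub, e2]
    simp only [Algebra.smul_def, map_natCast]
    push_cast
    rw [Nat.cast_sub (by omega), hd']
    push_cast
    ring_nf
  exact h4.cast hk le_rfl rfl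

end YamabeAlg

end SingularYamabe

namespace SingularYamabe

variable {d : ℕ} {A : Type*} [CommRing A] [Algebra ℝ A]

/-! ### Normal form of scalars -/

lemma exists_equiv_of_fix {μ ν : Type} (E : Unit ⊕ μ ≃ Unit ⊕ ν) (hE : E (Sum.inl ()) = Sum.inl ()) :
    ∃ f : μ ≃ ν, E = (Equiv.refl Unit).sumCongr f := by
  have h1 : ∀ m, ∃ n, E (Sum.inr m) = Sum.inr n := by
    intro m
    rcases h : E (Sum.inr m) with u | n
    · exact absurd (E.injective (h.trans hE.symm)) (by simp)
    · exact ⟨n, rfl⟩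
  have h2 : ∀ n, ∃ m, E.symm (Sum.inr n) = Sum.inr m := by
    intro n
    rcases h : E.symm (Sum.inr n) with u | m
    · rw [Equiv.symm_apply_eq, show u = () from rfl, hE] at h
      exact absurd h (by simp)
    · exact ⟨m, rfl⟩
  choose f hf using h1
  choose g hg using h2
  refine ⟨⟨f, g, fun m => ?_, fun n => ?_⟩, ?_⟩
  · apply Sum.inr_injective (α := Unit)
    rw [← hg, ← hf, Equiv.symm_apply_apply]
  · apply Sum.inr_injective (α := Unit)
    rw [← hf, ← hg, Equiv.apply_symm_apply]
  · ext i
    rcases i with i | i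
    · rw [show i = () from rfl, hE]; rfl
    · rw [hf]; rfl

lemma exists_equiv_of_eq {κ μ ν : Type} (e : Unit ⊕ μ ≃ κ) (c : Unit ⊕ ν ≃ κ)
    (h : e (Sum.inl ()) = c (Sum.inl ())) :
    ∃ f : μ ≃ ν, e = ((Equiv.refl Unit).sumCongr f).trans c := by
  obtain ⟨f, hf⟩ := exists_equiv_of_fix (e.trans c.symm) (by simp [h])
  refine ⟨f, ?_⟩
  rw [← hf]
  ext i
  simp

lemma exists_slot {κ : Type} (k : κ) : ∃ (ν : Type) (s : Unit ⊕ ν ≃ κ), s (Sum.inl ()) = k := by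
  classical
  refine ⟨{j // ¬ j = k}, ((Equiv.ofUnique Unit {j // j = k}).sumCongr (Equiv.refl _)).trans
    (Equiv.sumCompl (fun j => j = k)), ?_⟩
  rfl

namespace HypAlg

variable (M : HypAlg d A)

/-- Functionals built from contractions with `h` and with `q` copies of the normal. -/
inductive Fun : (κ : Type) → ℕ → (Ten d A κ → A) → Prop
  | nil : Fun Empty 0 (fun F => F Empty.elim)
  | re {κ μ : Type} {q : ℕ} {φ : Ten d A μ → A} (e : κ ≃ μ) :
      Fun μ q φ → Fun κ q (fun F => φ (re e F))
  | ctr {κ : Type} {q : ℕ} {φ : Ten d A κ → A} :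
      Fun κ q φ → Fun (Fin 2 ⊕ κ) q (fun F => φ (ctr M.h F))
  | iv {κ : Type} {q : ℕ} {φ : Ten d A κ → A} :
      Fun κ q φ → Fun (Unit ⊕ κ) (q + 1) (fun F => φ (iv M.Nup F))

/-- The product of the conormal and a tensor. -/
def NT {μ : Type} (T : Ten d A μ) : Ten d A (Unit ⊕ μ) :=
  fun I => M.N (I (Sum.inl ())) * T (I ∘ Sum.inr)

variable {M}

/-- A factor `N` can always be absorbed: paired by `h` with another slot it becomes a normal there,
and paired with a normal it becomes `1`. -/
lemma Fun.plug {κ : Type} {q : ℕ} {φ : Ten d A κ → A} (hφ : M.Fun κ q φ) {μ : Type}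
    (e : Unit ⊕ μ ≃ κ) :
    ∃ q' ψ, M.Fun μ q' ψ ∧ ∀ T, φ (SingularYamabe.re e (M.NT T)) = ψ T := by
  classical
  induction hφ generalizing μ with
  | nil => exact (e (Sum.inl ())).elim
  | re e₀ h ih => exact ih (e.trans e₀)
  | @ctr κ q φ h ih =>
    -- The slot of the conormal is either one of the two contracted at this stage, or it is passed
    -- on to the inner functional.
    rcases he : e (Sum.inl ()) with i | k
    · have key : ∀ c : Unit ⊕ (Unit ⊕ κ) ≃ Fin 2 ⊕ κ, e (Sum.inl ()) = c (Sum.inl ()) →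
          (∀ T : Ten d A (Unit ⊕ κ), SingularYamabe.ctr M.h (SingularYamabe.re c (M.NT T))
            = SingularYamabe.iv M.Nup T) →
          ∃ q' ψ, M.Fun μ q' ψ ∧ ∀ T, φ (SingularYamabe.ctr M.h (SingularYamabe.re e (M.NT T)))
            = ψ T := by
        intro c hc hT
        obtain ⟨f, hf⟩ := exists_equiv_of_eq e c hc
        exact ⟨_, _, Fun.re f (Fun.iv h), fun T => congrArg φ (by rw [← hT, hf]; rfl)⟩
      have h0 : ∀ (T : Ten d A (Unit ⊕ κ)) (J : κ → Fin d),
          ∑ b, ∑ c, M.h b c * (M.N b * T (Sum.elim (fun _ => c) J))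
            = SingularYamabe.iv M.Nup T J := by
        intro T J
        simp only [SingularYamabe.iv, Nup, MetricAlg.up, Finset.sum_mul]
        rw [Finset.sum_comm]
        refine Finset.sum_congr rfl fun c _ => Finset.sum_congr rfl fun b _ => ?_
        rw [M.h_symm, mul_assoc]
      fin_cases i
      · refine key (MetricAlg.pairEquiv κ) he fun T => ?_
        funext J
        rw [← h0]
        refine ctr_eq fun b c => ?_
        refine congrArg (fun x => M.N b * T x) ?_
        funext i; rcases i with i | i <;> rfl
      · refine key ((MetricAlg.pairEquiv κ).trans ((Equiv.swap 0 1).sumCongr (Equiv.refl κ))) he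
          fun T => ?_
        funext J
        rw [← h0, Finset.sum_comm]
        refine (ctr_eq (f := fun b c => M.N c * T (Sum.elim (fun _ => b) J)) fun b c => ?_).trans
          (Finset.sum_congr rfl fun b _ => Finset.sum_congr rfl fun c _ => by rw [M.h_symm])
        refine congrArg (fun x => M.N c * T x) ?_
        funext i; rcases i with i | i <;> rfl
    · obtain ⟨ν, s, hs⟩ := exists_slot k
      obtain ⟨q', ψ, hψ, hT⟩ := ih s
      obtain ⟨f, hf⟩ := exists_equiv_of_eq e ((MetricAlg.sumLeftComm Unit (Fin 2) _).trans
        ((Equiv.refl (Fin 2)).sumCongr s)) (by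
          rw [he, ← hs]; rfl)
      refine ⟨q', _, Fun.re f (Fun.ctr hψ), fun T => ?_⟩
      rw [← hT]
      refine congrArg φ ?_
      funext J
      simp only [SingularYamabe.ctr, SingularYamabe.re, NT, Finset.mul_sum]
      refine Finset.sum_congr rfl fun b _ => Finset.sum_congr rfl fun c _ => ?_
      rw [mul_left_comm, hf]
      refine congrArg₂ (fun x y => x * (M.h b c * T y)) rfl ?_
      funext i
      simp only [Function.comp_apply, Equiv.trans_apply, Equiv.sumCongr_apply, Sum.map_inr]
      rcases f i with j | j <;> rfl
  | @iv κ q φ h ih =>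
    rcases he : e (Sum.inl ()) with i | k
    · obtain ⟨f, hf⟩ := exists_equiv_of_fix e he
      refine ⟨_, _, Fun.re f h, fun T => congrArg φ ?_⟩
      funext J
      have : ∀ b, SingularYamabe.re e (M.NT T) (Sum.elim (fun _ => b) J)
          = M.N b * SingularYamabe.re f T J := by
        intro b; rw [hf]; rfl
      simp only [SingularYamabe.iv, this, ← mul_assoc, ← Finset.sum_mul, M.Nup_mul_N, one_mul]
    · obtain ⟨ν, s, hs⟩ := exists_slot k
      obtain ⟨q', ψ, hψ, hT⟩ := ih s
      obtain ⟨f, hf⟩ := exists_equiv_of_eq e ((MetricAlg.sumLeftComm Unit Unit _).trans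
        ((Equiv.refl Unit).sumCongr s)) (by
          rw [he, ← hs]; rfl)
      refine ⟨_, _, Fun.re f (Fun.iv hψ), fun T => ?_⟩
      rw [← hT]
      refine congrArg φ ?_
      funext J
      simp only [SingularYamabe.iv, SingularYamabe.re, NT, Finset.mul_sum]
      refine Finset.sum_congr rfl fun b _ => ?_
      rw [mul_left_comm, hf]
      refine congrArg₂ (fun x y => x * (M.Nup b * T y)) rfl ?_
      funext i
      simp only [Function.comp_apply, Equiv.trans_apply, Equiv.sumCongr_apply, Sum.map_inr]
      rcases f i with j | j <;> rfl

end HypAlg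

end SingularYamabe

/-! ### Products of atoms without conormals -/

namespace SingularYamabe

variable {d : ℕ} {A : Type*} [CommRing A] [Algebra ℝ A]

namespace HypAlg

variable (M : HypAlg d A)

/-- Products of the atoms other than the conormal. -/
inductive HProd (ρ : ℕ) : (κ : Type) → ℕ → ℕ → Ten d A κ → Prop
  | one : HProd ρ Empty 0 0 (fun _ => 1)
  | II (ℓ : ℕ) : HProd ρ (Fin (2 + ℓ)) (1 + ℓ) 1 (M.iterII ℓ)
  | R (m : ℕ) : HProd ρ (Fin (4 + m)) (2 + m) ρ (M.iterCov M.Riem m)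
  | W (m : ℕ) : HProd ρ (Fin (4 + m)) (2 + m) 1 (M.iterCov M.Weyl m)
  | WNN (m : ℕ) (κ : Type) (e : Fin (4 + m) ≃ Unit ⊕ (Unit ⊕ κ)) :
      HProd ρ κ (2 + m) 2 (SingularYamabe.iv M.Nup (SingularYamabe.iv M.Nup
        (SingularYamabe.re e (M.iterCov M.Weyl m))))
  | mul {κ μ : Type} {w δ w' δ' : ℕ} {F : Ten d A κ} {H : Ten d A μ} :
      HProd ρ κ w δ F → HProd ρ μ w' δ' H → HProd ρ (κ ⊕ μ) (w + w') (δ + δ') (mulT F H)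

variable {M} {ρ w δ : ℕ}

/-- Elimination of the conormals. -/
lemma exists_HProd {κ : Type} [Fintype κ] [DecidableEq κ] {F : Ten d A κ}
    (hF : Gen M.h (M.HAtom ρ) κ w δ F) :
    ∃ (Λ : Type) (T : Ten d A Λ), M.HProd ρ Λ w δ T ∧ ∀ (μ : Type) (q : ℕ) (φ : Ten d A (κ ⊕ μ) → A),
      M.Fun (κ ⊕ μ) q φ → ∃ q' ψ, M.Fun (Λ ⊕ μ) q' ψ ∧ ∀ C, φ (mulT F C) = ψ (mulT T C) := by
  induction hF with
  | one => exact ⟨_, _, HProd.one, fun μ q φ hφ => ⟨q, φ, hφ, fun _ => rfl⟩⟩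
  | atom h =>
    cases h with
    | N =>
      refine ⟨_, _, HProd.one, fun μ q φ hφ => ?_⟩
      obtain ⟨q', ψ, hψ, h⟩ := hφ.plug ((Equiv.ofUnique Unit (Fin 1)).sumCongr (Equiv.refl μ))
      refine ⟨q', _, Fun.re (Equiv.emptySum Empty μ) hψ, fun C => ?_⟩
      rw [← h]
      refine congrArg φ ?_
      funext J
      simp only [mulT, SingularYamabe.re, NT, one_mul]
      rfl
    | II ℓ => exact ⟨_, _, HProd.II ℓ, fun μ q φ hφ => ⟨q, φ, hφ, fun _ => rfl⟩⟩
    | R m => exact ⟨_, _, HProd.R m, fun μ q φ hφ => ⟨q, φ, hφ, fun _ => rfl⟩⟩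
    | W m => exact ⟨_, _, HProd.W m, fun μ q φ hφ => ⟨q, φ, hφ, fun _ => rfl⟩⟩
    | WNN m κ e => exact ⟨_, _, HProd.WNN m _ e, fun μ q φ hφ => ⟨q, φ, hφ, fun _ => rfl⟩⟩
  -- The spectator tensor `C` makes the induction work for products: one factor is replaced while
  -- the other waits in `C`.
  | @mul κ κ' _ _ _ _ _ _ _ _ F H _ _ ih₁ ih₂ =>
    obtain ⟨Λ, T, hT, h₁⟩ := ih₁
    obtain ⟨Λ', T', hT', h₂⟩ := ih₂
    refine ⟨_, _, HProd.mul hT hT', fun μ q φ hφ => ?_⟩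
    obtain ⟨q₁, ψ₁, hψ₁, e₁⟩ := h₁ (κ' ⊕ μ) q _ (Fun.re (Equiv.sumAssoc κ κ' μ).symm hφ)
    obtain ⟨q₂, ψ₂, hψ₂, e₂⟩ := h₂ (Λ ⊕ μ) q₁ _
      (Fun.re (MetricAlg.sumLeftComm κ' Λ μ) hψ₁)
    refine ⟨q₂, _, Fun.re ((Equiv.sumAssoc Λ Λ' μ).trans (MetricAlg.sumLeftComm Λ Λ' μ)) hψ₂,
      fun C => ?_⟩
    have a₁ : mulT (mulT F H) C
        = SingularYamabe.re (Equiv.sumAssoc κ κ' μ).symm (mulT F (mulT H C)) := by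
      funext J; exact mul_assoc _ _ _
    have a₂ : mulT T (mulT H C)
        = SingularYamabe.re (MetricAlg.sumLeftComm κ' Λ μ) (mulT H (mulT T C)) := by
      funext J; exact mul_left_comm _ _ _
    have a₃ : SingularYamabe.re ((Equiv.sumAssoc Λ Λ' μ).trans (MetricAlg.sumLeftComm Λ Λ' μ))
        (mulT (mulT T T') C) = mulT T' (mulT T C) := by
      funext J
      exact (mul_assoc _ _ _).trans (mul_left_comm _ _ _)
    rw [a₁, e₁, a₂, e₂, a₃]
  | re e _ ih =>
    obtain ⟨Λ, T, hT, h⟩ := ih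
    refine ⟨Λ, T, hT, fun μ q φ hφ => ?_⟩
    exact h μ q _ (Fun.re (e.sumCongr (Equiv.refl μ)) hφ)
  | @ctr κ _ _ _ _ F _ ih =>
    obtain ⟨Λ, T, hT, h⟩ := ih
    refine ⟨Λ, T, hT, fun μ q φ hφ => ?_⟩
    obtain ⟨q', ψ, hψ, e⟩ := h μ q _ (Fun.re (Equiv.sumAssoc (Fin 2) κ μ) (Fun.ctr hφ))
    refine ⟨q', ψ, hψ, fun C => ?_⟩
    rw [← e]
    refine congrArg φ ?_
    funext J
    simp only [mulT, SingularYamabe.ctr, SingularYamabe.re, Finset.sum_mul, mul_assoc]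
    refine Finset.sum_congr rfl fun b _ => Finset.sum_congr rfl fun c _ => ?_
    refine congrArg (fun x => M.h b c * (F x * _)) ?_
    funext i; rcases i with i | i <;> rfl

/-- The index slots of a product of families of tensors. -/
abbrev SlotsG {ι₁ ι₂ ι₃ : Type} (α : ι₁ → ℕ) (β : ι₂ → ℕ) (γ : ι₃ → ℕ) : Type :=
  ((Σ i : ι₁, Fin (2 + α i)) ⊕ (Σ j : ι₂, Fin (4 + β j))) ⊕ (Σ j : ι₃, Fin (4 + γ j))

variable (M) in
/-- A product of families of tensors. -/
def TT {ι₁ ι₂ ι₃ : Type} [Fintype ι₁] [Fintype ι₂] [Fintype ι₃] (α : ι₁ → ℕ) (β : ι₂ → ℕ)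
    (γ : ι₃ → ℕ) : Ten d A (SlotsG α β γ) := fun I =>
  (∏ i, M.iterII (α i) (fun m => I (Sum.inl (Sum.inl ⟨i, m⟩))))
    * (∏ j, M.iterCov M.Riem (β j) (fun m => I (Sum.inl (Sum.inr ⟨j, m⟩))))
    * (∏ j, M.iterCov M.Weyl (γ j) (fun m => I (Sum.inr ⟨j, m⟩)))

/-- The slots of the product of two products. -/
def slotsEquiv {ι₁ ι₂ ι₃ ι₁' ι₂' ι₃' : Type} (α : ι₁ → ℕ) (β : ι₂ → ℕ) (γ : ι₃ → ℕ)
    (α' : ι₁' → ℕ) (β' : ι₂' → ℕ) (γ' : ι₃' → ℕ) :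
    SlotsG (Sum.elim α α') (Sum.elim β β') (Sum.elim γ γ') ≃ SlotsG α β γ ⊕ SlotsG α' β' γ' where
  toFun
    | Sum.inl (Sum.inl ⟨Sum.inl i, m⟩) => Sum.inl (Sum.inl (Sum.inl ⟨i, m⟩))
    | Sum.inl (Sum.inl ⟨Sum.inr i, m⟩) => Sum.inr (Sum.inl (Sum.inl ⟨i, m⟩))
    | Sum.inl (Sum.inr ⟨Sum.inl i, m⟩) => Sum.inl (Sum.inl (Sum.inr ⟨i, m⟩))
    | Sum.inl (Sum.inr ⟨Sum.inr i, m⟩) => Sum.inr (Sum.inl (Sum.inr ⟨i, m⟩))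
    | Sum.inr ⟨Sum.inl i, m⟩ => Sum.inl (Sum.inr ⟨i, m⟩)
    | Sum.inr ⟨Sum.inr i, m⟩ => Sum.inr (Sum.inr ⟨i, m⟩)
  invFun
    | Sum.inl (Sum.inl (Sum.inl ⟨i, m⟩)) => Sum.inl (Sum.inl ⟨Sum.inl i, m⟩)
    | Sum.inr (Sum.inl (Sum.inl ⟨i, m⟩)) => Sum.inl (Sum.inl ⟨Sum.inr i, m⟩)
    | Sum.inl (Sum.inl (Sum.inr ⟨i, m⟩)) => Sum.inl (Sum.inr ⟨Sum.inl i, m⟩)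
    | Sum.inr (Sum.inl (Sum.inr ⟨i, m⟩)) => Sum.inl (Sum.inr ⟨Sum.inr i, m⟩)
    | Sum.inl (Sum.inr ⟨i, m⟩) => Sum.inr ⟨Sum.inl i, m⟩
    | Sum.inr (Sum.inr ⟨i, m⟩) => Sum.inr ⟨Sum.inr i, m⟩
  left_inv := by rintro ((⟨i | i, m⟩ | ⟨i | i, m⟩) | ⟨i | i, m⟩) <;> rfl
  right_inv := by rintro (((⟨i, m⟩ | ⟨i, m⟩) | ⟨i, m⟩) | ((⟨i, m⟩ | ⟨i, m⟩) | ⟨i, m⟩)) <;> rfl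

lemma TT_elim {ι₁ ι₂ ι₃ ι₁' ι₂' ι₃' : Type} [Fintype ι₁] [Fintype ι₂] [Fintype ι₃] [Fintype ι₁']
    [Fintype ι₂'] [Fintype ι₃'] (α : ι₁ → ℕ) (β : ι₂ → ℕ) (γ : ι₃ → ℕ)
    (α' : ι₁' → ℕ) (β' : ι₂' → ℕ) (γ' : ι₃' → ℕ) :
    mulT (M.TT α β γ) (M.TT α' β' γ') = SingularYamabe.re (slotsEquiv α β γ α' β' γ')
      (M.TT (Sum.elim α α') (Sum.elim β β') (Sum.elim γ γ')) := by
  funext I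
  simp only [mulT, TT, SingularYamabe.re, Fintype.prod_sum_type]
  have hc : ∀ a b c a' b' c' : A, a * b * c * (a' * b' * c') = a * a' * (b * b') * (c * c') := by
    intros; ring
  exact hc _ _ _ _ _ _

/-- A tensor that is a product up to a contraction with `2 k` normals. -/
def HasForm (M : HypAlg d A) (ρ w δ : ℕ) {Λ : Type} (T : Ten d A Λ) : Prop :=
  ∃ (ι₁ ι₂ ι₃ : Type) (_ : Fintype ι₁) (_ : Fintype ι₂) (_ : Fintype ι₃) (α : ι₁ → ℕ) (β : ι₂ → ℕ)
    (γ : ι₃ → ℕ) (k : ℕ), w = (∑ i, (1 + α i)) + (∑ j, (2 + β j)) + (∑ j, (2 + γ j)) ∧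
    δ ≤ Fintype.card ι₁ + ρ * Fintype.card ι₂ + Fintype.card ι₃ + k ∧ k ≤ Fintype.card ι₃ ∧
    ∀ (μ : Type) (q : ℕ) (φ : Ten d A (Λ ⊕ μ) → A), M.Fun (Λ ⊕ μ) q φ →
      ∃ ψ, M.Fun (SlotsG α β γ ⊕ μ) (q + 2 * k) ψ ∧ ∀ C, φ (mulT T C) = ψ (mulT (M.TT α β γ) C)

lemma HasForm.of_re {Λ ι₁ ι₂ ι₃ : Type} [Fintype ι₁] [Fintype ι₂] [Fintype ι₃] {α : ι₁ → ℕ}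
    {β : ι₂ → ℕ} {γ : ι₃ → ℕ} {T : Ten d A Λ}
    (hw : w = (∑ i, (1 + α i)) + (∑ j, (2 + β j)) + (∑ j, (2 + γ j)))
    (hδ : δ ≤ Fintype.card ι₁ + ρ * Fintype.card ι₂ + Fintype.card ι₃) (e : SlotsG α β γ ≃ Λ)
    (hT : T = SingularYamabe.re e (M.TT α β γ)) : M.HasForm ρ w δ T := by
  refine ⟨ι₁, ι₂, ι₃, inferInstance, inferInstance, inferInstance, α, β, γ, 0, hw, hδ, by simp,
    fun μ q φ hφ => ⟨_, Fun.re (e.sumCongr (Equiv.refl μ)) hφ, fun C => ?_⟩⟩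
  rw [hT]; rfl

/-- The slots of a single tensor in a family. -/
def sigmaUnit (n : ℕ) : (Σ _ : Unit, Fin n) ≃ Fin n where
  toFun x := x.2
  invFun m := ⟨(), m⟩
  left_inv _ := rfl
  right_inv _ := rfl

/-- The slots of a single curvature tensor. -/
def slotsW (m : ℕ) : SlotsG (ι₁ := Empty) (ι₂ := Empty) Empty.elim Empty.elim (fun _ : Unit => m)
    ≃ Fin (4 + m) :=
  (Equiv.emptySum _ _).trans (sigmaUnit (4 + m))

lemma TT_W (m : ℕ) : M.iterCov M.Weyl m = SingularYamabe.re (slotsW m)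
    (M.TT (ι₁ := Empty) (ι₂ := Empty) Empty.elim Empty.elim (fun _ : Unit => m)) := by
  funext I
  simp [SingularYamabe.re, TT]
  rfl

/-- Single atoms are families with one member, and a product corresponds to the disjoint union of
the families. The number `k` counts the Weyl factors that came with two normals. -/
lemma HProd.hasForm {Λ : Type} {T : Ten d A Λ} (hT : M.HProd ρ Λ w δ T) : M.HasForm ρ w δ T := by
  induction hT with
  | one =>
    refine HasForm.of_re (ι₁ := Empty) (ι₂ := Empty) (ι₃ := Empty) (α := Empty.elim)
      (β := Empty.elim) (γ := Empty.elim) (by simp) (by simp) (Equiv.equivOfIsEmpty _ _) ?_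
    funext I
    simp [SingularYamabe.re, TT]
  | II ℓ =>
    refine HasForm.of_re (ι₁ := Unit) (ι₂ := Empty) (ι₃ := Empty) (α := fun _ => ℓ)
      (β := Empty.elim) (γ := Empty.elim) (by simp) (by simp)
      ((Equiv.sumEmpty _ _).trans ((Equiv.sumEmpty _ _).trans (sigmaUnit (2 + ℓ)))) ?_
    funext I
    simp [SingularYamabe.re, TT]
    rfl
  | R m =>
    refine HasForm.of_re (ι₁ := Empty) (ι₂ := Unit) (ι₃ := Empty) (α := Empty.elim)
      (β := fun _ => m) (γ := Empty.elim) (by simp) (by simp)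
      ((Equiv.sumEmpty _ _).trans ((Equiv.emptySum _ _).trans (sigmaUnit (4 + m)))) ?_
    funext I
    simp [SingularYamabe.re, TT]
    rfl
  | W m => exact HasForm.of_re (by simp) (by simp) (slotsW m) (TT_W m)
  | WNN m κ e =>
    -- Here `k = 1`: the two normals hidden in the atom become two explicit contractions with
    -- normals.
    refine ⟨Empty, Empty, Unit, inferInstance, inferInstance, inferInstance, Empty.elim, Empty.elim,
      fun _ => m, 1, by simp, by simp, by simp, fun μ q φ hφ => ?_⟩
    refine ⟨_, Fun.re (((slotsW m).sumCongr (Equiv.refl μ)).trans ((e.sumCongr (Equiv.refl μ)).trans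
      ((Equiv.sumAssoc Unit (Unit ⊕ κ) μ).trans ((Equiv.refl Unit).sumCongr
      (Equiv.sumAssoc Unit κ μ))))) (Fun.iv (Fun.iv hφ)), fun C => ?_⟩
    refine congrArg φ ?_
    rw [TT_W m]
    funext J
    simp only [mulT, SingularYamabe.iv, SingularYamabe.re, Finset.sum_mul, mul_assoc, Finset.mul_sum]
    refine Finset.sum_congr rfl fun b _ => Finset.sum_congr rfl fun c _ => ?_
    refine congrArg (fun x => M.Nup b * (M.Nup c * x)) ?_
    refine congrArg₂ (fun x y => M.TT _ _ _ x * C y) ?_ rfl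
    funext i
    simp only [Function.comp_apply, Equiv.trans_apply, Equiv.sumCongr_apply, Sum.map_inl]
    rcases e (slotsW m i) with i | i | i <;> rfl
  | @mul κ κ' _ _ _ _ F H _ _ ih₁ ih₂ =>
    obtain ⟨ι₁, ι₂, ι₃, _, _, _, α, β, γ, k, hw, hδ, hk, h₁⟩ := ih₁
    obtain ⟨ι₁', ι₂', ι₃', _, _, _, α', β', γ', k', hw', hδ', hk', h₂⟩ := ih₂
    refine ⟨ι₁ ⊕ ι₁', ι₂ ⊕ ι₂', ι₃ ⊕ ι₃', inferInstance, inferInstance, inferInstance,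
      Sum.elim α α', Sum.elim β β', Sum.elim γ γ', k + k', ?_, ?_, ?_, fun μ q φ hφ => ?_⟩
    · simp only [Fintype.sum_sum_type, Sum.elim_inl, Sum.elim_inr]; omega
    · simp only [Fintype.card_sum, mul_add]; omega
    · simp only [Fintype.card_sum]; omega
    obtain ⟨ψ₁, hψ₁, e₁⟩ := h₁ (κ' ⊕ μ) q _ (Fun.re (Equiv.sumAssoc κ κ' μ).symm hφ)
    obtain ⟨ψ₂, hψ₂, e₂⟩ := h₂ (SlotsG α β γ ⊕ μ) _ _
      (Fun.re (MetricAlg.sumLeftComm κ' (SlotsG α β γ) μ) hψ₁)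
    have h := Fun.re (((slotsEquiv α β γ α' β' γ').sumCongr (Equiv.refl μ)).trans
      ((Equiv.sumAssoc (SlotsG α β γ) (SlotsG α' β' γ') μ).trans
      (MetricAlg.sumLeftComm (SlotsG α β γ) (SlotsG α' β' γ') μ))) hψ₂
    rw [show q + 2 * k + 2 * k' = q + 2 * (k + k') by ring] at h
    refine ⟨_, h, fun C => ?_⟩
    have a₁ : mulT (mulT F H) C
        = SingularYamabe.re (Equiv.sumAssoc κ κ' μ).symm (mulT F (mulT H C)) := by
      funext J; exact mul_assoc _ _ _
    have a₂ : mulT (M.TT α β γ) (mulT H C) = SingularYamabe.re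
        (MetricAlg.sumLeftComm κ' (SlotsG α β γ) μ) (mulT H (mulT (M.TT α β γ) C)) := by
      funext J; exact mul_left_comm _ _ _
    have a₃ : SingularYamabe.re (((slotsEquiv α β γ α' β' γ').sumCongr (Equiv.refl μ)).trans
      ((Equiv.sumAssoc (SlotsG α β γ) (SlotsG α' β' γ') μ).trans
      (MetricAlg.sumLeftComm (SlotsG α β γ) (SlotsG α' β' γ') μ)))
        (mulT (M.TT (Sum.elim α α') (Sum.elim β β') (Sum.elim γ γ')) C)
        = mulT (M.TT α' β' γ') (mulT (M.TT α β γ) C) := by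
      funext J
      have := congrFun (TT_elim (M := M) α β γ α' β' γ') ((J ∘ (Equiv.sumAssoc (SlotsG α β γ)
        (SlotsG α' β' γ') μ).trans (MetricAlg.sumLeftComm (SlotsG α β γ) (SlotsG α' β' γ') μ)) ∘
        Sum.inl)
      refine Eq.trans (congrArg (fun x => x * C (J ∘ fun i => Sum.inr (Sum.inr i))) this.symm) ?_
      exact (mul_assoc _ _ _).trans (mul_left_comm _ _ _)
    rw [a₁, e₁, a₂, e₂, a₃]

end HypAlg

end SingularYamabe

/-! ### Explicit wirings and the final normal form -/

namespace SingularYamabe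

variable {d : ℕ} {A : Type*} [CommRing A] [Algebra ℝ A]

/-- Adding a pair of slots. -/
def addPair (p q : ℕ) : Fin 2 ⊕ ((Fin p × Fin 2) ⊕ Fin q) ≃ (Fin (p + 1) × Fin 2) ⊕ Fin q where
  toFun := Sum.elim (fun i => Sum.inl (0, i)) (Sum.elim (fun c => Sum.inl (c.1.succ, c.2)) Sum.inr)
  invFun := Sum.elim (fun c => Fin.cases (Sum.inl c.2) (fun j => Sum.inr (Sum.inl (j, c.2))) c.1)
    (fun c => Sum.inr (Sum.inr c))
  left_inv := by rintro (i | c | c) <;> rfl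
  right_inv := by
    rintro (⟨c, i⟩ | c)
    · refine Fin.cases ?_ (fun c => ?_) c <;> rfl
    · rfl

/-- Adding a single slot. -/
def addSingle (p q : ℕ) : Unit ⊕ ((Fin p × Fin 2) ⊕ Fin q) ≃ (Fin p × Fin 2) ⊕ Fin (q + 1) where
  toFun := Sum.elim (fun _ => Sum.inr 0) (Sum.elim Sum.inl (fun c => Sum.inr c.succ))
  invFun := Sum.elim (fun c => Sum.inr (Sum.inl c))
    (fun c => Fin.cases (Sum.inl ()) (fun j => Sum.inr (Sum.inr j)) c)
  left_inv := by rintro (i | c | c) <;> rfl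
  right_inv := by
    rintro (c | c)
    · rfl
    · refine Fin.cases ?_ (fun c => ?_) c <;> rfl

namespace HypAlg

variable {M : HypAlg d A}

/-- Each contraction with `h` adds a pair and each contraction with the normal a single slot;
collecting them gives one sum over all index values. -/
lemma Fun.exists_wiring {κ : Type} {q : ℕ} {φ : Ten d A κ → A} (hφ : M.Fun κ q φ) :
    ∃ (p : ℕ) (e : κ ≃ (Fin p × Fin 2) ⊕ Fin q), ∀ F, φ F
      = ∑ I : (Fin p × Fin 2) ⊕ Fin q → Fin d, F (I ∘ e)
        * (∏ c, M.h (I (Sum.inl (c, 0))) (I (Sum.inl (c, 1)))) * (∏ c, M.Nup (I (Sum.inr c))) := by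
  induction hφ with
  | nil =>
    refine ⟨0, Equiv.equivOfIsEmpty _ _, fun F => ?_⟩
    rw [Fintype.sum_unique]
    simp only [Finset.univ_eq_empty, Finset.prod_empty, mul_one]
    exact congrArg F (Subsingleton.elim _ _)
  | re e₀ _ ih =>
    obtain ⟨p, e, h⟩ := ih
    exact ⟨p, e₀.trans e, fun F => h _⟩
  | @ctr κ q φ _ ih =>
    obtain ⟨p, e, h⟩ := ih
    refine ⟨p + 1, ((Equiv.refl (Fin 2)).sumCongr e).trans (addPair p q), fun F => ?_⟩
    refine (h _).trans ?_
    rw [← Equiv.sum_comp ((addPair p q).arrowCongr (Equiv.refl (Fin d))),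
      ← Equiv.sum_comp (Equiv.sumArrowEquivProdArrow (Fin 2) ((Fin p × Fin 2) ⊕ Fin q) (Fin d)).symm, Fintype.sum_prod_type,
      Finset.sum_comm]
    refine Finset.sum_congr rfl fun I _ => ?_
    rw [← Equiv.sum_comp (finTwoArrowEquiv (Fin d)).symm, Fintype.sum_prod_type]
    simp only [SingularYamabe.ctr, Finset.sum_mul]
    refine Finset.sum_congr rfl fun b _ => Finset.sum_congr rfl fun c _ => ?_
    rw [Fin.prod_univ_succ]
    have h1 : Sum.elim ![b, c] (I ∘ e) = ((addPair p q).arrowCongr (Equiv.refl (Fin d)))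
        ((Equiv.sumArrowEquivProdArrow (Fin 2) ((Fin p × Fin 2) ⊕ Fin q) (Fin d)).symm
          ((finTwoArrowEquiv (Fin d)).symm (b, c), I)) ∘
        ((Equiv.refl (Fin 2)).sumCongr e).trans (addPair p q) := by
      funext i
      rcases i with i | i
      · rfl
      · simp [Equiv.arrowCongr]
    rw [h1]
    have h2 : ∀ a b c F : A, a * F * b * c = F * (a * b) * c := by intros; ring
    exact h2 _ _ _ _
  | @iv κ q φ _ ih =>
    obtain ⟨p, e, h⟩ := ih
    refine ⟨p, ((Equiv.refl Unit).sumCongr e).trans (addSingle p q), fun F => ?_⟩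
    refine (h _).trans ?_
    rw [← Equiv.sum_comp ((addSingle p q).arrowCongr (Equiv.refl (Fin d))),
      ← Equiv.sum_comp (Equiv.sumArrowEquivProdArrow Unit ((Fin p × Fin 2) ⊕ Fin q) (Fin d)).symm, Fintype.sum_prod_type,
      Finset.sum_comm]
    refine Finset.sum_congr rfl fun I _ => ?_
    rw [← Equiv.sum_comp (Equiv.funUnique Unit (Fin d)).symm]
    simp only [SingularYamabe.iv, Finset.sum_mul]
    refine Finset.sum_congr rfl fun b _ => ?_
    rw [Fin.prod_univ_succ]
    have h1 : Sum.elim (fun _ => b) (I ∘ e) = ((addSingle p q).arrowCongr (Equiv.refl (Fin d)))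
        ((Equiv.sumArrowEquivProdArrow Unit ((Fin p × Fin 2) ⊕ Fin q) (Fin d)).symm
          ((Equiv.funUnique Unit (Fin d)).symm b, I)) ∘
        ((Equiv.refl Unit).sumCongr e).trans (addSingle p q) := by
      funext i
      rcases i with i | i
      · rfl
      · simp [Equiv.arrowCongr]
    rw [h1]
    have h2 : ∀ a b c F : A, a * F * b * c = F * b * (a * c) := by intros; ring
    exact h2 _ _ _ _

/-- Passing to families indexed by `Fin p`. -/
def slotsCongr {ι₁ ι₂ ι₃ ι₁' ι₂' ι₃' : Type} (α : ι₁ → ℕ) (β : ι₂ → ℕ) (γ : ι₃ → ℕ)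
    (ε₁ : ι₁' ≃ ι₁) (ε₂ : ι₂' ≃ ι₂) (ε₃ : ι₃' ≃ ι₃) :
    SlotsG (α ∘ ε₁) (β ∘ ε₂) (γ ∘ ε₃) ≃ SlotsG α β γ :=
  ((Equiv.sigmaCongrLeft (β := fun i => Fin (2 + α i)) ε₁).sumCongr
    (Equiv.sigmaCongrLeft (β := fun i => Fin (4 + β i)) ε₂)).sumCongr
    (Equiv.sigmaCongrLeft (β := fun i => Fin (4 + γ i)) ε₃)

lemma TT_comp {ι₁ ι₂ ι₃ ι₁' ι₂' ι₃' : Type} [Fintype ι₁] [Fintype ι₂] [Fintype ι₃] [Fintype ι₁']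
    [Fintype ι₂'] [Fintype ι₃'] (α : ι₁ → ℕ) (β : ι₂ → ℕ) (γ : ι₃ → ℕ)
    (ε₁ : ι₁' ≃ ι₁) (ε₂ : ι₂' ≃ ι₂) (ε₃ : ι₃' ≃ ι₃) :
    M.TT α β γ = SingularYamabe.re (slotsCongr α β γ ε₁ ε₂ ε₃)
      (M.TT (α ∘ ε₁) (β ∘ ε₂) (γ ∘ ε₃)) := by
  funext I
  simp only [TT, SingularYamabe.re]
  rw [← Equiv.prod_comp ε₁, ← Equiv.prod_comp ε₂, ← Equiv.prod_comp ε₃]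
  rfl

variable (M) in
/-- The value of a contraction. -/
def evalC (t : Contraction) : A :=
  ∑ I : Slots t.ordII t.ordR t.ordW → Fin d,
    M.TT t.ordII t.ordR t.ordW I
    * (∏ c, M.h (I (t.wiring.symm (Sum.inl (c, 0)))) (I (t.wiring.symm (Sum.inl (c, 1)))))
    * (∏ c, M.Nup (I (t.wiring.symm (Sum.inr c))))

variable (M) in
/-- The value of an expression. -/
def evalE (L : Expression) : A := (L.map (fun t => t.1 • M.evalC t.2)).sum

/-- A contraction of weight `w` and degree at least `δ`. -/
def Tagged (ρ w δ : ℕ) (t : Contraction) : Prop :=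
  ∃ k, w = (∑ i, (1 + t.ordII i)) + (∑ j, (2 + t.ordR j)) + (∑ j, (2 + t.ordW j)) ∧
    δ ≤ t.numII + ρ * t.numR + t.numW + k ∧ k ≤ t.numW ∧ 2 * k ≤ t.numNormals

/-- Absorbing conormals does not touch the normals stored in the Weyl atoms, so `2 k` of the normals
are certain to survive; this is the last clause of `Tagged`. -/
lemma exists_contraction {ρ w δ : ℕ} {F : Ten d A (Fin 0)} (hF : Gen M.h (M.HAtom ρ) (Fin 0) w δ F) :
    ∃ t : Contraction, Tagged ρ w δ t ∧ F Fin.elim0 = M.evalC t := by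
  obtain ⟨Λ, T, hT, h⟩ := exists_HProd hF
  obtain ⟨q₁, ψ₁, hψ₁, h₁⟩ := h Empty 0 _ (Fun.re (Equiv.equivOfIsEmpty _ _) Fun.nil)
  obtain ⟨ι₁, ι₂, ι₃, _, _, _, α, β, γ, k, hw, hδ, hk, h₂⟩ := hT.hasForm
  obtain ⟨ψ₂, hψ₂, e₂⟩ := h₂ Empty _ _ hψ₁
  have h3 := Fun.re (((slotsCongr α β γ (Fintype.equivFin ι₁).symm (Fintype.equivFin ι₂).symm
    (Fintype.equivFin ι₃).symm)).trans (Equiv.sumEmpty _ Empty).symm) hψ₂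
  obtain ⟨p, e, he⟩ := h3.exists_wiring
  refine ⟨⟨_, α ∘ (Fintype.equivFin ι₁).symm, _, β ∘ (Fintype.equivFin ι₂).symm, _,
    γ ∘ (Fintype.equivFin ι₃).symm, p, q₁ + 2 * k, e⟩, ⟨k, ?_, hδ, hk, ?_⟩, ?_⟩
  · rw [hw]
    congr 1
    · congr 1
      · exact (Equiv.sum_comp (Fintype.equivFin ι₁).symm (fun i => 1 + α i)).symm
      · exact (Equiv.sum_comp (Fintype.equivFin ι₂).symm (fun i => 2 + β i)).symm
    · exact (Equiv.sum_comp (Fintype.equivFin ι₃).symm (fun i => 2 + γ i)).symm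
  · exact Nat.le_add_left _ _
  · have a1 := (h₁ (fun _ => 1)).trans (e₂ (fun _ => 1))
    have a2 : F Fin.elim0 = ψ₂ (mulT (M.TT α β γ) fun _ => 1) := by
      rw [← a1]
      simp only [SingularYamabe.re, mulT, mul_one]
      exact congrArg F (Subsingleton.elim _ _)
    have a3 := he (M.TT (α ∘ (Fintype.equivFin ι₁).symm) (β ∘ (Fintype.equivFin ι₂).symm)
      (γ ∘ (Fintype.equivFin ι₃).symm))
    have a4 : mulT (M.TT α β γ) (fun _ : Empty → Fin d => (1 : A))
        = SingularYamabe.re (((slotsCongr α β γ (Fintype.equivFin ι₁).symm (Fintype.equivFin ι₂).symm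
          (Fintype.equivFin ι₃).symm)).trans (Equiv.sumEmpty _ Empty).symm)
          (M.TT (α ∘ (Fintype.equivFin ι₁).symm) (β ∘ (Fintype.equivFin ι₂).symm)
          (γ ∘ (Fintype.equivFin ι₃).symm)) := by
      funext J
      rw [mulT, mul_one, TT_comp α β γ (Fintype.equivFin ι₁).symm (Fintype.equivFin ι₂).symm
        (Fintype.equivFin ι₃).symm]
      rfl
    rw [a2, a4, a3, evalC, ← Equiv.sum_comp (e.arrowCongr (Equiv.refl (Fin d)))]
    refine Finset.sum_congr rfl fun I _ => ?_
    refine congrArg₂ (fun x y => x * y) (congrArg₂ (fun x y => x * y) ?_ rfl) rfl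
    refine congrArg _ ?_
    funext i
    simp [Equiv.arrowCongr]

/-- The normal form of scalars. -/
theorem exists_expression {ρ w δ : ℕ} {f : A} (hf : M.HC0 ρ w δ f) :
    ∃ L : Expression, (∀ t ∈ L, Tagged ρ w δ t.2) ∧ f - M.evalE L ∈ M.Z := by
  let S : Submodule ℝ (Ten d A (Fin 0)) :=
    { carrier := {F | ∃ L : Expression, (∀ t ∈ L, Tagged ρ w δ t.2) ∧ F Fin.elim0 - M.evalE L ∈ M.Z}
      add_mem' := by
        rintro F G ⟨L, hL, hF⟩ ⟨L', hL', hG⟩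
        refine ⟨L ++ L', fun t ht => ?_, ?_⟩
        · rcases List.mem_append.1 ht with h | h
          · exact hL t h
          · exact hL' t h
        · have := M.Z.add_mem hF hG
          simp only [evalE, List.map_append, List.sum_append, Pi.add_apply] at this ⊢
          convert this using 1
          ring
      zero_mem' := ⟨[], by simp, by simp [evalE]⟩
      smul_mem' := by
        rintro r F ⟨L, hL, hF⟩
        refine ⟨L.map fun t => (r * t.1, t.2), fun t ht => ?_, ?_⟩
        · obtain ⟨t', ht', rfl⟩ := List.mem_map.1 ht
          exact hL t' ht'
        · have h1 : M.evalE (L.map fun t => (r * t.1, t.2)) = r • M.evalE L := by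
            simp only [evalE, List.map_map, List.smul_sum]
            refine congrArg List.sum (List.map_congr_left fun t _ => ?_)
            simp [mul_smul]
          rw [h1, Pi.smul_apply, ← smul_sub, Algebra.smul_def]
          exact M.Z.mul_mem_left _ hF }
  refine Cl.induct (S := S) hf ?_ ?_
  · intro δ' F hδ hF
    obtain ⟨t, ⟨k, h1, h2, h3, h4⟩, ht⟩ := exists_contraction hF
    refine ⟨[(1, t)], ?_, ?_⟩
    · intro t' ht'
      rw [List.mem_singleton] at ht'
      subst ht'
      exact ⟨k, h1, hδ.trans h2, h3, h4⟩
    · rw [ht]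
      simp [evalE]
  · intro F hF
    exact ⟨[], by simp, by simpa [evalE] using hF _⟩

/-- Weight `d` alone bounds the order of a curvature factor by `d - 2` and that of `II` by `d - 1`.
The value `d - 1` would exhaust the weight with a single factor of degree one, contrary to degree at
least two. -/
lemma Tagged.isLowerOrder {t : Contraction} (ht : Tagged 2 d 2 t) : t.IsLowerOrder d := by
  obtain ⟨k, h1, h2, h3, -⟩ := ht
  have e1 : ∀ {n : ℕ} (f : Fin n → ℕ), ∀ i, f i ≤ ∑ i, f i := fun f i =>
    Finset.single_le_sum (fun _ _ => Nat.zero_le _) (Finset.mem_univ i)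
  simp only [Finset.sum_add_distrib, Finset.sum_const, Finset.card_univ, Fintype.card_fin,
    smul_eq_mul] at h1
  refine ⟨fun i => ?_, fun i => ?_, fun i => ?_⟩
  · have := e1 t.ordII i
    omega
  · have := e1 t.ordR i
    have := i.pos
    omega
  · have := e1 t.ordW i
    have := i.pos
    omega

/-- With at most one factor, degree two is possible only if `k = 1`, that is for one Weyl factor
with at least two normals. -/
lemma Tagged.isNonlinear {t : Contraction} (ht : Tagged 1 d 2 t) : t.IsNonlinear := by
  obtain ⟨k, h1, h2, h3, h4⟩ := ht
  by_cases h : 2 ≤ t.numII + t.numR + t.numW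
  · exact Or.inl h
  · refine Or.inr ⟨?_, ?_, ?_, ?_⟩ <;> omega

end HypAlg

end SingularYamabe

namespace SingularYamabe

/-! ### The universal algebra of coordinate expressions -/

/-- A hypersurface and a defining density in a coordinate domain. -/
structure Setup (d : ℕ) where
  /-- the coordinate domain -/
  V : Set (Coord d)
  /-- the metric -/
  G : MetricField d
  /-- the defining function -/
  s : Coord d → ℝ
  /-- the defining density -/
  σ : Coord d → ℝ
  /-- the remainder -/
  B : Coord d → ℝ
  isOpen : IsOpen V
  G_smooth : ∀ i j, ContDiffOn ℝ ∞ (fun x => G x i j) V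
  G_posDef : ∀ x ∈ V, (G x).PosDef
  s_smooth : ContDiffOn ℝ ∞ s V
  σ_smooth : ContDiffOn ℝ ∞ σ V
  B_smooth : ContDiffOn ℝ ∞ B V
  ds_ne : ∀ x ∈ V, ∃ a, partialDeriv a s x ≠ 0
  σ_zero : ∀ x ∈ V, s x = 0 → σ x = 0
  dσ_eq : ∀ x ∈ V, s x = 0 → ∃ c : ℝ, 0 < c ∧ ∀ a, partialDeriv a σ x = c * partialDeriv a s x
  eqn : ∀ x ∈ V, yamabeS G σ x = 1 + σ x ^ d * B x

variable {d : ℕ}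

/-- The points of the coordinate domains. -/
abbrev Pt (d : ℕ) : Type := Σ S : Setup d, S.V

/-- The extension by zero of a function on a coordinate domain. -/
def ext (f : Pt d → ℝ) (S : Setup d) (y : Coord d) : ℝ :=
  open Classical in if h : y ∈ S.V then f ⟨S, y, h⟩ else 0

lemma ext_apply (f : Pt d → ℝ) {S : Setup d} {y : Coord d} (h : y ∈ S.V) :
    ext f S y = f ⟨S, y, h⟩ := dif_pos h

/-- Families of smooth functions on the coordinate domains. -/
def UA (d : ℕ) : Subalgebra ℝ (Pt d → ℝ) where
  carrier := {f | ∀ S, ContDiffOn ℝ ∞ (ext f S) S.V}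
  mul_mem' hf hg S := ((hf S).mul (hg S)).congr fun y hy => by simp [ext_apply _ hy]
  add_mem' hf hg S := ((hf S).add (hg S)).congr fun y hy => by simp [ext_apply _ hy]
  algebraMap_mem' r S := (contDiffOn_const (c := r)).congr fun y hy => by
    simp [ext_apply _ hy]

lemma contDiffOn_ext (f : UA d) (S : Setup d) : ContDiffOn ℝ ∞ (ext f.1 S) S.V := f.2 S

/-- Evaluation at a point. -/
def ev (p : Pt d) : UA d →ₐ[ℝ] ℝ := (Pi.evalAlgHom ℝ (fun _ : Pt d => ℝ) p).comp (UA d).val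

lemma UA_ext {f g : UA d} (h : ∀ p, ev p f = ev p g) : f = g := Subtype.ext (funext h)

/-- The family `f` is given on the coordinate domain of `S` by the function `F`. -/
def Rep (S : Setup d) (f : UA d) (F : Coord d → ℝ) : Prop :=
  ∀ x (hx : x ∈ S.V), ev ⟨S, x, hx⟩ f = F x

/-- The element of the universal algebra given by a family of functions. -/
def ofFam (F : Setup d → Coord d → ℝ) (hF : ∀ S, ContDiffOn ℝ ∞ (F S) S.V) : UA d :=
  ⟨fun p => F p.1 p.2, fun S => (hF S).congr fun _ hy => ext_apply _ hy⟩

lemma rep_ofFam (F : Setup d → Coord d → ℝ) (hF : ∀ S, ContDiffOn ℝ ∞ (F S) S.V) (S : Setup d) :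
    Rep S (ofFam F hF) (F S) := fun _ _ => rfl

lemma partialDeriv_congr {S : Setup d} {F F' : Coord d → ℝ} (h : ∀ x ∈ S.V, F x = F' x) (a : Fin d)
    {x : Coord d} (hx : x ∈ S.V) : partialDeriv a F x = partialDeriv a F' x := by
  rw [partialDeriv, partialDeriv, Filter.EventuallyEq.fderiv_eq]
  exact Filter.eventuallyEq_of_mem (S.isOpen.mem_nhds hx) h

lemma contDiffOn_partialDeriv {S : Setup d} {F : Coord d → ℝ} (hF : ContDiffOn ℝ ∞ F S.V)
    (a : Fin d) : ContDiffOn ℝ ∞ (partialDeriv a F) S.V :=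
  (hF.fderiv_of_isOpen S.isOpen (by simp)).clm_apply contDiffOn_const

lemma differentiableAt_of_smooth {S : Setup d} {F : Coord d → ℝ} (hF : ContDiffOn ℝ ∞ F S.V)
    {x : Coord d} (hx : x ∈ S.V) : DifferentiableAt ℝ F x :=
  (hF.contDiffAt (S.isOpen.mem_nhds hx)).differentiableAt (by simp)

/-- The partial derivatives as derivations. -/
def UD (a : Fin d) : Derivation ℝ (UA d) (UA d) :=
  Derivation.mk'
    { toFun := fun f => ofFam (fun S => partialDeriv a (ext f.1 S))
        fun S => contDiffOn_partialDeriv (contDiffOn_ext f S) a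
      map_add' := fun f g => UA_ext fun ⟨S, x, hx⟩ => by
        have h1 : partialDeriv a (ext (f + g).1 S) x
            = partialDeriv a (fun y => ext f.1 S y + ext g.1 S y) x :=
          partialDeriv_congr (fun y hy => by simp [ext_apply _ hy]) a hx
        rw [map_add]
        refine h1.trans ?_
        rw [partialDeriv, fderiv_fun_add (differentiableAt_of_smooth (contDiffOn_ext f S) hx)
          (differentiableAt_of_smooth (contDiffOn_ext g S) hx)]
        rfl
      map_smul' := fun r f => UA_ext fun ⟨S, x, hx⟩ => by
        have h1 : partialDeriv a (ext (r • f).1 S) x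
            = partialDeriv a (fun y => r * ext f.1 S y) x :=
          partialDeriv_congr (fun y hy => by simp [ext_apply _ hy]) a hx
        rw [map_smul]
        refine h1.trans ?_
        rw [partialDeriv, fderiv_const_mul (differentiableAt_of_smooth (contDiffOn_ext f S) hx)]
        rfl }
    fun f g => UA_ext fun ⟨S, x, hx⟩ => by
      have h1 : partialDeriv a (ext (f * g).1 S) x
          = partialDeriv a (fun y => ext f.1 S y * ext g.1 S y) x :=
        partialDeriv_congr (fun y hy => by simp [ext_apply _ hy]) a hx
      refine h1.trans ?_
      rw [partialDeriv, fderiv_fun_mul (differentiableAt_of_smooth (contDiffOn_ext f S) hx)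
        (differentiableAt_of_smooth (contDiffOn_ext g S) hx), smul_eq_mul, smul_eq_mul, map_add,
        map_mul, map_mul]
      simp only [ext_apply _ hx]
      rfl

lemma ev_UD (a : Fin d) (f : UA d) (p : Pt d) : ev p (UD a f) = partialDeriv a (ext f.1 p.1) p.2 := rfl

section rep

variable {S : Setup d} {f f' : UA d} {F F' : Coord d → ℝ}

lemma Rep.add (h : Rep S f F) (h' : Rep S f' F') : Rep S (f + f') (fun x => F x + F' x) :=
  fun x hx => by rw [map_add, h x hx, h' x hx]

lemma Rep.sub (h : Rep S f F) (h' : Rep S f' F') : Rep S (f - f') (fun x => F x - F' x) :=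
  fun x hx => by rw [map_sub, h x hx, h' x hx]

lemma Rep.mul (h : Rep S f F) (h' : Rep S f' F') : Rep S (f * f') (fun x => F x * F' x) :=
  fun x hx => by rw [map_mul, h x hx, h' x hx]

lemma Rep.smul (r : ℝ) (h : Rep S f F) : Rep S (r • f) (fun x => r * F x) :=
  fun x hx => by rw [map_smul, h x hx, smul_eq_mul]

lemma Rep.sum {ι : Type*} [Fintype ι] {f : ι → UA d} {F : ι → Coord d → ℝ}
    (h : ∀ i, Rep S (f i) (F i)) : Rep S (∑ i, f i) (fun x => ∑ i, F i x) :=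
  fun x hx => by rw [map_sum]; exact Finset.sum_congr rfl fun i _ => h i x hx

lemma Rep.prod {ι : Type*} [Fintype ι] {f : ι → UA d} {F : ι → Coord d → ℝ}
    (h : ∀ i, Rep S (f i) (F i)) : Rep S (∏ i, f i) (fun x => ∏ i, F i x) :=
  fun x hx => by rw [map_prod]; exact Finset.prod_congr rfl fun i _ => h i x hx

lemma Rep.ite (P : Prop) [Decidable P] :
    Rep S (if P then 1 else 0) (fun _ => if P then 1 else 0) := fun x hx => by
  split_ifs <;> simp

lemma Rep.congr (h : Rep S f F) (h' : ∀ x ∈ S.V, F' x = F x) : Rep S f F' :=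
  fun x hx => (h x hx).trans (h' x hx).symm

lemma Rep.pd (h : Rep S f F) (a : Fin d) : Rep S (UD a f) (partialDeriv a F) := fun x hx => by
  rw [ev_UD]
  exact partialDeriv_congr (fun y hy => (ext_apply _ hy).trans (h y hy)) a hx

end rep

lemma UD_comm (a b : Fin d) (f : UA d) : UD a (UD b f) = UD b (UD a f) := by
  refine UA_ext fun ⟨S, x, hx⟩ => ?_
  have h0 : Rep S f (ext f.1 S) := fun y hy => (ext_apply _ hy).symm
  rw [(h0.pd b).pd a x hx, (h0.pd a).pd b x hx]
  have hf := contDiffOn_ext f S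
  have h1 : ∀ a b, partialDeriv a (partialDeriv b (ext f.1 S)) x
      = fderiv ℝ (fderiv ℝ (ext f.1 S)) x (EuclideanSpace.single a 1) (EuclideanSpace.single b 1) := by
    intro a b
    have h2 : DifferentiableAt ℝ (fderiv ℝ (ext f.1 S)) x :=
      ((hf.fderiv_of_isOpen S.isOpen (m := ∞) (by simp)).contDiffAt
        (S.isOpen.mem_nhds hx)).differentiableAt (by simp)
    change fderiv ℝ (fun y => fderiv ℝ (ext f.1 S) y (EuclideanSpace.single b 1)) x _ = _
    rw [fderiv_clm_apply h2 (differentiableAt_const _)]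
    simp
  rw [h1, h1]
  exact ((hf.contDiffAt (S.isOpen.mem_nhds hx)).isSymmSndFDerivAt (by
    simp only [minSmoothness_of_isRCLikeNormedField]; exact WithTop.coe_le_coe.2 (OrderTop.le_top (2 : ℕ∞)))) _ _

end SingularYamabe

/-! ### The universal metric and its agreement with the coordinate formulas -/

namespace SingularYamabe

variable {d : ℕ}

lemma contDiffOn_det {E : Type*} [NormedAddCommGroup E] [NormedSpace ℝ E] {V : Set E}
    {G : E → Matrix (Fin d) (Fin d) ℝ} (h : ∀ i j, ContDiffOn ℝ ∞ (fun x => G x i j) V) :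
    ContDiffOn ℝ ∞ (fun x => (G x).det) V := by
  simp only [Matrix.det_apply]
  exact ContDiffOn.sum fun τ _ => (contDiffOn_prod fun i _ => h _ _).const_smul _

/-- Cramer's rule: entries of the adjugate over a determinant that is positive on the domain. -/
lemma contDiffOn_inv {S : Setup d} (a b : Fin d) :
    ContDiffOn ℝ ∞ (fun x => (S.G x)⁻¹ a b) S.V := by
  have h1 : ContDiffOn ℝ ∞ (fun x => (S.G x).adjugate a b) S.V := by
    simp only [Matrix.adjugate_apply]
    refine contDiffOn_det fun i j => ?_
    by_cases h : i = b
    · subst h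
      simpa using contDiffOn_const
    · simpa [Matrix.updateRow_ne h] using S.G_smooth i j
  have h2 := (contDiffOn_det S.G_smooth).inv fun x hx => (S.G_posDef x hx).det_pos.ne'
  refine (h2.mul h1).congr fun x hx => ?_
  rw [Matrix.inv_def, Ring.inverse_eq_inv', Matrix.smul_apply, smul_eq_mul]
  rfl

lemma Setup.G_symm (S : Setup d) {x : Coord d} (hx : x ∈ S.V) (a b : Fin d) :
    S.G x a b = S.G x b a := by
  have := (S.G_posDef x hx).isHermitian.apply b a
  simpa using this

lemma Setup.G_mul_inv (S : Setup d) {x : Coord d} (hx : x ∈ S.V) : S.G x * (S.G x)⁻¹ = 1 :=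
  Matrix.mul_nonsing_inv _ (isUnit_iff_ne_zero.2 (S.G_posDef x hx).det_pos.ne')

lemma Setup.inv_symm (S : Setup d) {x : Coord d} (hx : x ∈ S.V) (a b : Fin d) :
    (S.G x)⁻¹ a b = (S.G x)⁻¹ b a := by
  have := (S.G_posDef x hx).isHermitian.inv.apply b a
  simpa using this

variable (d) in
/-- The universal metric. -/
def UM : MetricAlg d (UA d) where
  D := UD
  D_comm := UD_comm
  g a b := ofFam (fun S x => S.G x a b) fun S => S.G_smooth a b
  h a b := ofFam (fun S x => (S.G x)⁻¹ a b) fun _ => contDiffOn_inv a b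
  g_symm a b := UA_ext fun ⟨S, _, hx⟩ => S.G_symm hx a b
  h_symm a b := UA_ext fun ⟨S, _, hx⟩ => S.inv_symm hx a b
  g_mul_h a b := UA_ext fun ⟨S, x, hx⟩ => by
    rw [map_sum]
    simp only [map_mul]
    have h := congrFun (congrFun (S.G_mul_inv hx) a) b
    rw [Matrix.mul_apply, Matrix.one_apply] at h
    refine Eq.trans h ?_
    split_ifs <;> simp

/-- The tensor `F` is given on the coordinate domain of `S` by the tensor field `T`. -/
def RepT (S : Setup d) {k : ℕ} (F : Ten d (UA d) (Fin k)) (T : Tensor d k) : Prop :=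
  ∀ I, Rep S (F I) (fun x => T x I)

section

variable (S : Setup d)

lemma rep_g (a b : Fin d) : Rep S ((UM d).g a b) (fun x => S.G x a b) := rep_ofFam _ _ S

lemma rep_h (a b : Fin d) : Rep S ((UM d).h a b) (fun x => (S.G x)⁻¹ a b) := rep_ofFam _ _ S

lemma rep_Γ (c a b : Fin d) : Rep S ((UM d).Γ c a b) (christoffel S.G c a b) :=
  (Rep.sum fun e => (rep_h S c e).mul ((((rep_g S e b).pd a).add ((rep_g S e a).pd b)).sub
    ((rep_g S a b).pd e))).smul (1 / 2)

lemma repT_covF {k : ℕ} {F : Ten d (UA d) (Fin k)} {T : Tensor d k} (h : RepT S F T) :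
    RepT S ((UM d).covF F) (covD S.G T) := fun I =>
  ((h (Fin.tail I)).pd (I 0)).sub (Rep.sum fun m => Rep.sum fun c =>
    (rep_Γ S c (I 0) (Fin.tail I m)).mul (h (Function.update (Fin.tail I) m c)))

lemma repT_iterCov {k : ℕ} {F : Ten d (UA d) (Fin k)} {T : Tensor d k} (h : RepT S F T) (m : ℕ) :
    RepT S ((UM d).iterCov F m) (iterCovD S.G T m) := by
  induction m with
  | zero => exact h
  | succ m ih => exact repT_covF S ih

lemma rep_Rup (a b c e : Fin d) : Rep S ((UM d).Rup a b c e) (riemannUp S.G a b c e) :=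
  (((rep_Γ S c b e).pd a).sub ((rep_Γ S c a e).pd b)).add (Rep.sum fun f =>
    ((rep_Γ S c a f).mul (rep_Γ S f b e)).sub ((rep_Γ S c b f).mul (rep_Γ S f a e)))

lemma repT_Riem : RepT S (UM d).Riem (riemann S.G) := fun I =>
  Rep.sum fun f => (rep_g S (I 2) f).mul (rep_Rup S (I 0) (I 1) f (I 3))

lemma rep_Ric (a b : Fin d) : Rep S ((UM d).Ric ![a, b]) (fun x => ricci S.G x a b) :=
  Rep.sum fun c => rep_Rup S c a c b

lemma rep_Sc : Rep S (UM d).Sc (scalarCurv S.G) :=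
  Rep.sum fun a => Rep.sum fun b => (rep_h S a b).mul (rep_Ric S a b)

lemma rep_J : Rep S (UM d).J (traceSchouten S.G) :=
  ((rep_Sc S).smul (1 / (2 * ((d : ℝ) - 1)))).congr fun x _ => by
    rw [traceSchouten, one_div, div_eq_inv_mul]

lemma rep_P (a b : Fin d) : Rep S ((UM d).P ![a, b]) (fun x => schouten S.G x a b) :=
  (((rep_Ric S a b).sub ((rep_J S).mul (rep_g S a b))).smul (1 / ((d : ℝ) - 2))).congr fun x _ => by
    rw [schouten, one_div, div_eq_inv_mul]

lemma repT_Weyl : RepT S (UM d).Weyl (weyl S.G) := fun I =>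
  ((repT_Riem S I).sub (((rep_g S (I 2) (I 0)).mul (rep_P S (I 1) (I 3))).sub
    ((rep_g S (I 2) (I 1)).mul (rep_P S (I 0) (I 3))))).sub
    (((rep_g S (I 3) (I 1)).mul (rep_P S (I 0) (I 2))).sub
    ((rep_g S (I 3) (I 0)).mul (rep_P S (I 1) (I 2))))

/-- The squared length of a differential. -/
lemma rep_dot_grad {f : UA d} {F : Coord d → ℝ} (h : Rep S f F) :
    Rep S ((UM d).dot ((UM d).grad f) ((UM d).grad f)) (gradSq S.G F) :=
  (Rep.sum fun a => Rep.sum fun b => (rep_h S a b).mul ((h.pd a).mul (h.pd b))).congr fun _ _ =>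
    Finset.sum_congr rfl fun _ _ => Finset.sum_congr rfl fun _ _ => mul_assoc _ _ _

end

namespace MetricAlg

variable {A : Type*} [CommRing A] [Algebra ℝ A] (M : MetricAlg d A)

lemma covF_const (f : A) : M.covF (fun _ : Fin 0 → Fin d => f) = fun I => M.grad f (I 0) := by
  funext I
  simp [covF, cd_apply, act, grad]

lemma covF_covec (X : Fin d → A) :
    M.covF (fun I : Fin 1 → Fin d => X (I 0)) = fun I => M.cdC (I 0) X (I 1) := by
  funext I
  exact M.cd_fin_one _ _ _

end MetricAlg

lemma repT_ofFun {S : Setup d} {f : UA d} {F : Coord d → ℝ} (h : Rep S f F) :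
    RepT S (fun _ : Fin 0 → Fin d => f) (ofFun F) := fun _ => h

lemma rep_laplacian {S : Setup d} {f : UA d} {F : Coord d → ℝ} (h : Rep S f F) :
    Rep S (∑ b, ∑ c, (UM d).h b c * (UM d).cdC b ((UM d).grad f) c) (laplacian S.G F) := by
  have h1 := repT_covF S (repT_covF S (repT_ofFun h))
  rw [MetricAlg.covF_const, MetricAlg.covF_covec] at h1
  exact Rep.sum fun a => Rep.sum fun b => (rep_h S a b).mul (h1 ![a, b])

end SingularYamabe

/-! ### The universal hypersurface and the universal density -/

namespace SingularYamabe

variable {d : ℕ}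

lemma Setup.gradSq_pos (S : Setup d) {x : Coord d} (hx : x ∈ S.V) : 0 < gradSq S.G S.s x := by
  obtain ⟨a, ha⟩ := S.ds_ne x hx
  have h := (S.G_posDef x hx).inv.dotProduct_mulVec_pos (x := fun a => partialDeriv a S.s x)
    (fun h => ha (congrFun h a))
  refine h.trans_eq ?_
  simp only [dotProduct, Matrix.mulVec, Pi.star_apply, star_trivial, gradSq, Finset.mul_sum]
  exact Finset.sum_congr rfl fun _ _ => Finset.sum_congr rfl fun _ _ => by ring

lemma contDiffOn_gradSq {S : Setup d} {F : Coord d → ℝ} (hF : ContDiffOn ℝ ∞ F S.V) :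
    ContDiffOn ℝ ∞ (gradSq S.G F) S.V :=
  ContDiffOn.sum fun a _ => ContDiffOn.sum fun b _ => ((contDiffOn_inv a b).mul
    (contDiffOn_partialDeriv hF a)).mul (contDiffOn_partialDeriv hF b)

lemma contDiffOn_conormal (S : Setup d) (a : Fin d) :
    ContDiffOn ℝ ∞ (conormal S.G S.s a) S.V :=
  (contDiffOn_partialDeriv S.s_smooth a).div ((contDiffOn_gradSq S.s_smooth).sqrt
    fun _ hx => (S.gradSq_pos hx).ne') fun _ hx => (Real.sqrt_pos.2 (S.gradSq_pos hx)).ne'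

lemma Setup.conormal_unit (S : Setup d) {x : Coord d} (hx : x ∈ S.V) :
    ∑ b, ∑ c, (S.G x)⁻¹ b c * (conormal S.G S.s b x * conormal S.G S.s c x) = 1 := by
  have h0 := S.gradSq_pos hx
  have h1 : ∀ b c, (S.G x)⁻¹ b c * (conormal S.G S.s b x * conormal S.G S.s c x)
      = ((S.G x)⁻¹ b c * partialDeriv b S.s x * partialDeriv c S.s x) / gradSq S.G S.s x := by
    intro b c
    rw [conormal, conormal, div_mul_div_comm, Real.mul_self_sqrt h0.le]
    ring
  simp only [h1, ← Finset.sum_div]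
  exact div_self h0.ne'

/-- The functions that vanish on the hypersurfaces. -/
def UZ (d : ℕ) : Ideal (UA d) where
  carrier := {f | ∀ p : Pt d, p.1.s p.2 = 0 → ev p f = 0}
  add_mem' hf hg p hp := by rw [map_add, hf p hp, hg p hp, add_zero]
  zero_mem' p _ := map_zero _
  smul_mem' r f hf p hp := by rw [smul_eq_mul, map_mul, hf p hp, mul_zero]

/-- A function vanishing on the hypersurface has a differential proportional to that of the
defining function. -/
lemma exists_partialDeriv_eq {S : Setup d} {F : Coord d → ℝ} (hF : ContDiffOn ℝ ∞ F S.V)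
    (h0 : ∀ x ∈ S.V, S.s x = 0 → F x = 0) {x : Coord d} (hx : x ∈ S.V) (hs : S.s x = 0) :
    ∃ c : ℝ, ∀ a, partialDeriv a F x = c * partialDeriv a S.s x := by
  have hn := S.isOpen.mem_nhds hx
  have h1 : HasStrictFDerivAt S.s (fderiv ℝ S.s x) x :=
    (S.s_smooth.contDiffAt hn).hasStrictFDerivAt (by simp)
  have h2 : HasStrictFDerivAt F (fderiv ℝ F x) x :=
    (hF.contDiffAt hn).hasStrictFDerivAt (by simp)
  -- `F` vanishes on the level set, so the point is trivially a constrained extremum and the rule of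
  -- Lagrange multipliers applies.
  have h3 : IsLocalExtrOn F {y | S.s y = S.s x} x := by
    refine Or.inl ?_
    filter_upwards [mem_nhdsWithin_of_mem_nhds hn, self_mem_nhdsWithin] with y hy hys
    rw [h0 x hx hs, h0 y hy (hys.trans hs)]
  obtain ⟨a, b, hab, h⟩ := h3.exists_multipliers_of_hasStrictFDerivAt_1d h1 h2
  have h4 : ∀ i, a * partialDeriv i S.s x + b * partialDeriv i F x = 0 := fun i => by
    have h5 := congrArg (fun T => T (EuclideanSpace.single i (1 : ℝ))) h
    simpa [partialDeriv] using h5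
  -- A vanishing multiplier of `dF` would force `ds = 0`.
  have hb : b ≠ 0 := by
    rintro rfl
    obtain ⟨i, hi⟩ := S.ds_ne x hx
    have := h4 i
    rw [zero_mul, add_zero] at this
    exact hab (by simp [(mul_eq_zero.1 this).resolve_right hi])
  refine ⟨-a / b, fun i => ?_⟩
  field_simp
  linear_combination h4 i

lemma partialDeriv_eq_mul_conormal {S : Setup d} {x : Coord d} (hx : x ∈ S.V) (a : Fin d) :
    partialDeriv a S.s x = √(gradSq S.G S.s x) * conormal S.G S.s a x := by
  rw [conormal, mul_div_cancel₀]
  exact (Real.sqrt_pos.2 (S.gradSq_pos hx)).ne'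

variable (d) in
/-- The universal conormal. -/
def UN (a : Fin d) : UA d := ofFam (fun S => conormal S.G S.s a) fun S => contDiffOn_conormal S a

lemma rep_UN (S : Setup d) (a : Fin d) : Rep S (UN d a) (conormal S.G S.s a) := rep_ofFam _ _ S

lemma rep_up (S : Setup d) (a : Fin d) : Rep S ((UM d).up (UN d) a) (normal S.G S.s a) :=
  Rep.sum fun b => (rep_h S a b).mul (rep_UN S b)

lemma rep_γ (S : Setup d) (a b : Fin d) :
    Rep S ((if a = b then 1 else 0) - UN d a * (UM d).up (UN d) b) (proj S.G S.s a b) :=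
  (Rep.ite _).sub ((rep_UN S a).mul (rep_up S b))

variable (d) in
/-- The universal hypersurface. -/
def UH : HypAlg d (UA d) where
  toMetricAlg := UM d
  N := UN d
  Z := UZ d
  N_unit := UA_ext fun ⟨S, x, hx⟩ => by
    rw [(Rep.sum fun b => Rep.sum fun c => (rep_h S b c).mul ((rep_UN S b).mul (rep_UN S c))) x hx,
      map_one]
    exact S.conormal_unit hx
  Z_tan f hf a := by
    rintro ⟨S, x, hx⟩ hs
    have h0 : Rep S f (ext f.1 S) := fun y hy => (ext_apply _ hy).symm
    refine ((Rep.sum fun b => (rep_γ S a b).mul (h0.pd b)) x hx).trans ?_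
    beta_reduce
    -- The differential is a multiple of `ds`, hence of the conormal, which the tangential
    -- projection annihilates.
    obtain ⟨c, hc⟩ := exists_partialDeriv_eq (contDiffOn_ext f S)
      (fun y hy hys => (ext_apply _ hy).trans (hf ⟨S, y, hy⟩ hys)) hx hs
    have h1 : ∑ b, normal S.G S.s b x * conormal S.G S.s b x = 1 := by
      rw [← S.conormal_unit hx]
      refine Finset.sum_congr rfl fun b _ => ?_
      rw [normal, Finset.sum_mul]
      exact Finset.sum_congr rfl fun _ _ => by ring
    simp only [hc, partialDeriv_eq_mul_conormal hx, proj, sub_mul, Finset.sum_sub_distrib, ite_mul,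
      one_mul, zero_mul, Finset.sum_ite_eq, Finset.mem_univ, if_true]
    have h2 : ∑ b, conormal S.G S.s a x * normal S.G S.s b x
        * (c * (√(gradSq S.G S.s x) * conormal S.G S.s b x))
        = conormal S.G S.s a x * c * √(gradSq S.G S.s x)
          * ∑ b, normal S.G S.s b x * conormal S.G S.s b x := by
      rw [Finset.mul_sum]
      exact Finset.sum_congr rfl fun _ _ => by ring
    rw [h2, h1]
    ring

lemma Setup.gradSq_σ (S : Setup d) (hd : d ≠ 0) {x : Coord d} (hx : x ∈ S.V) (hs : S.s x = 0) :
    gradSq S.G S.σ x = 1 := by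
  have h := S.eqn x hx
  rw [yamabeS, S.σ_zero x hx hs, zero_pow hd] at h
  linarith

/-- The equation forces `|dσ| = 1` on the hypersurface, so `dσ` is the conormal up to sign; the
orientation `0 < c` fixes the sign. -/
lemma Setup.partialDeriv_σ (S : Setup d) (hd : d ≠ 0) {x : Coord d} (hx : x ∈ S.V) (hs : S.s x = 0)
    (a : Fin d) : partialDeriv a S.σ x = conormal S.G S.s a x := by
  obtain ⟨c, hc, h⟩ := S.dσ_eq x hx hs
  have h1 := S.gradSq_σ hd hx hs
  have h2 : gradSq S.G S.σ x = c ^ 2 * gradSq S.G S.s x := by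
    simp only [gradSq, h, Finset.mul_sum]
    exact Finset.sum_congr rfl fun _ _ => Finset.sum_congr rfl fun _ _ => by ring
  have h3 : c * √(gradSq S.G S.s x) = 1 := by
    rw [← Real.sqrt_sq hc.le, ← Real.sqrt_mul (sq_nonneg c), ← h2, h1, Real.sqrt_one]
  rw [h, partialDeriv_eq_mul_conormal hx, ← mul_assoc, h3, one_mul]

variable (d) in
/-- The universal defining density. -/
def UY (hd : 3 ≤ d) : YamabeAlg d (UA d) where
  toHypAlg := UH d
  σ := ofFam (fun S => S.σ) fun S => S.σ_smooth
  B := ofFam (fun S => S.B) fun S => S.B_smooth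
  three_le := hd
  σ_mem := fun ⟨S, x, hx⟩ hs => S.σ_zero x hx hs
  D_σ a := fun ⟨S, x, hx⟩ hs => by
    have h := (((rep_ofFam (fun S => S.σ) (fun S => S.σ_smooth) S).pd a).sub (rep_UN S a)) x hx
    refine h.trans ?_
    beta_reduce
    rw [S.partialDeriv_σ (by omega) hx hs, sub_self]
  eqn := UA_ext fun ⟨S, x, hx⟩ => by
    have hσ := rep_ofFam (fun S : Setup d => S.σ) (fun S => S.σ_smooth) S
    have h1 := ((rep_dot_grad S hσ).sub ((hσ.mul ((rep_laplacian hσ).add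
      ((rep_J S).mul hσ))).smul (2 / (d : ℝ)))) x hx
    refine h1.trans ?_
    have h2 := S.eqn x hx
    rw [yamabeS, mul_assoc] at h2
    refine h2.trans ?_
    rw [map_add, map_one, map_mul, map_pow]
    rfl

end SingularYamabe

/-! ### The theorem in coordinates -/

namespace SingularYamabe

variable {d : ℕ}

namespace HypAlg

variable {A : Type*} [CommRing A] [Algebra ℝ A] (M : HypAlg d A)

lemma tang_covF_const (f : A) :
    M.tang (M.covF (fun _ : Fin 0 → Fin d => f)) = fun I => M.tgrad f (I 0) := by
  funext I
  rw [MetricAlg.covF_const, tang, ← Equiv.sum_comp (Equiv.funUnique (Fin 1) (Fin d)).symm]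
  simp [tgrad, MetricAlg.grad]

lemma tang_covF_covec (X : Fin d → A) (a b : Fin d) :
    M.tang (M.covF (fun I : Fin 1 → Fin d => X (I 0))) ![a, b]
      = ∑ c, ∑ e, M.γ a c * (M.γ b e * M.cdC c X e) := by
  rw [MetricAlg.covF_covec]
  change ∑ L : Fin 2 → Fin d, (∏ m : Fin 2, M.γ (![a, b] m) (L m)) * M.cdC (L 0) X (L 1) = _
  simp only [Fin.prod_univ_two, Matrix.cons_val_zero, Matrix.cons_val_one]
  rw [← Equiv.sum_comp (finTwoArrowEquiv (Fin d)).symm, Fintype.sum_prod_type]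
  simp only [finTwoArrowEquiv_symm_apply, Matrix.cons_val_zero, Matrix.cons_val_one, mul_assoc]

lemma sum_h_γ_γ (c e : Fin d) :
    ∑ a, ∑ b, M.h a b * (M.γ a c * M.γ b e) = ∑ a, M.h a e * M.γ a c := by
  rw [Finset.sum_comm]
  have h1 : ∀ b, ∑ a, M.h a b * (M.γ a c * M.γ b e)
      = M.h b c * M.γ b e - M.Nup c * (M.Nup b * M.γ b e) := fun b => by
    simp only [← mul_assoc, ← Finset.sum_mul]
    rw [sum_h_γ, M.h_symm c b]
    ring
  simp only [h1, Finset.sum_sub_distrib, ← Finset.mul_sum, Nup_mul_γ]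
  rw [sum_h_γ, sum_h_γ, M.h_symm e c]
  ring

/-- The intrinsic derivative projects both indices, the divergence used so far only the derivative
index. Under the trace this makes no difference, by `sum_h_γ_γ`. -/
lemma tdiv_eq (X : Fin d → A) :
    M.tdiv X = ∑ a, ∑ b, M.h a b * M.tang (M.covF (fun I : Fin 1 → Fin d => X (I 0))) ![a, b] := by
  simp only [tang_covF_covec]
  have h1 : ∑ a, ∑ b, M.h a b * ∑ c, ∑ e, M.γ a c * (M.γ b e * M.cdC c X e)
      = ∑ c, ∑ e, (∑ a, ∑ b, M.h a b * (M.γ a c * M.γ b e)) * M.cdC c X e := by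
    simp only [Finset.mul_sum, Finset.sum_mul]
    rw [Finset.sum_comm_cycle]
    refine Finset.sum_congr rfl fun c _ => ?_
    rw [Finset.sum_comm_cycle]
    exact Finset.sum_congr rfl fun e _ => Finset.sum_congr rfl fun a _ =>
      Finset.sum_congr rfl fun b _ => by ring
  rw [h1]
  simp only [sum_h_γ_γ, tdiv, tcd, Finset.mul_sum, Finset.sum_mul]
  rw [Finset.sum_comm_cycle]
  refine Finset.sum_congr rfl fun c _ => ?_
  rw [Finset.sum_comm]
  exact Finset.sum_congr rfl fun e _ => Finset.sum_congr rfl fun a _ => by ring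

lemma tLap_eq (f : A) : M.tLap f = ∑ a, ∑ b, M.h a b *
    M.tang (M.covF (M.tang (M.covF (fun _ : Fin 0 → Fin d => f)))) ![a, b] := by
  rw [tang_covF_const]
  exact M.tdiv_eq (M.tgrad f)

end HypAlg

section

variable (S : Setup d)

lemma repT_tang {k : ℕ} {F : Ten d (UA d) (Fin k)} {T : Tensor d k} (h : RepT S F T) :
    RepT S ((UH d).tang F) (tangential S.G S.s T) := fun I =>
  Rep.sum fun L => (Rep.prod fun m => rep_γ S (I m) (L m)).mul (h L)

lemma repT_II : RepT S (UH d).II (secondFF S.G S.s) :=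
  repT_tang S (repT_covF S fun I => rep_UN S (I 0))

lemma repT_iterII (ℓ : ℕ) : RepT S ((UH d).iterII ℓ) (iterBarD S.G S.s (secondFF S.G S.s) ℓ) := by
  induction ℓ with
  | zero => exact repT_II S
  | succ ℓ ih => exact repT_tang S (repT_covF S ih)

lemma rep_mean : Rep S (UH d).mean (meanCurv S.G S.s) :=
  (Rep.sum fun a => Rep.sum fun b => (rep_h S a b).mul (repT_II S ![a, b])).smul _

lemma rep_tLap {f : UA d} {F : Coord d → ℝ} (h : Rep S f F) :
    Rep S ((UH d).tLap f) (barLaplacian S.G S.s F) := by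
  rw [HypAlg.tLap_eq]
  exact Rep.sum fun a => Rep.sum fun b => (rep_h S a b).mul
    (repT_tang S (repT_covF S (repT_tang S (repT_covF S (repT_ofFun h)))) ![a, b])

lemma rep_iterate_tLap (k : ℕ) :
    Rep S ((UH d).tLap^[k] (UH d).mean) ((barLaplacian S.G S.s)^[k] (meanCurv S.G S.s)) := by
  induction k with
  | zero => exact rep_mean S
  | succ k ih =>
    rw [Function.iterate_succ_apply', Function.iterate_succ_apply']
    exact rep_tLap S ih

lemma rep_evalC (t : Contraction) : Rep S ((UH d).evalC t) (t.eval S.G S.s) :=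
  Rep.sum fun _ => ((((Rep.prod fun _ => repT_iterII S _ _).mul
    (Rep.prod fun _ => repT_iterCov S (repT_Riem S) _ _)).mul
    (Rep.prod fun _ => repT_iterCov S (repT_Weyl S) _ _)).mul
    (Rep.prod fun _ => rep_h S _ _)).mul (Rep.prod fun _ => rep_up S _)

lemma rep_evalE (L : Expression) : Rep S ((UH d).evalE L) (L.eval S.G S.s) := by
  induction L with
  | nil => exact fun x hx => map_zero _
  | cons t L ih => exact ((rep_evalC S t.2).smul t.1).add ih

end

lemma Expression.eval_smul (r : ℝ) (L : Expression) (G : MetricField d) (s : Coord d → ℝ)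
    (x : Coord d) : Expression.eval (L.map fun t => (r * t.1, t.2)) G s x = r * L.eval G s x := by
  simp only [Expression.eval, List.map_map]
  rw [← List.sum_map_mul_left]
  exact congrArg List.sum (List.map_congr_left fun t _ => mul_assoc _ _ _)

/-- The obstruction density for hypersurfaces of even dimension, in coordinates. -/
theorem exists_expression_of_odd (hd : 3 ≤ d) (ho : Odd d) :
    ∃ a : ℝ, a ≠ 0 ∧ ∃ L : Expression, (∀ t ∈ L, t.2.IsLowerOrder d) ∧
      ∀ S : Setup d, ∀ x ∈ S.V, S.s x = 0 → S.B x = a *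
        ((barLaplacian S.G S.s)^[(d - 1) / 2] (meanCurv S.G S.s) x + L.eval S.G S.s x) := by
  obtain ⟨a, ha, h⟩ := YamabeAlg.B_odd (M := UY d hd) ho
  obtain ⟨L, hL, h⟩ := HypAlg.exists_expression (M := UH d) h
  -- The coefficients are divided by `a` because the statement has `L` inside the bracket multiplied
  -- by `a`.
  refine ⟨a, ha, L.map fun t => (a⁻¹ * t.1, t.2), fun t ht => ?_, fun S x hx hs => ?_⟩
  · obtain ⟨t', ht', rfl⟩ := List.mem_map.1 ht
    exact (hL t' ht').isLowerOrder
  · have hB : Rep S (UY d hd).B S.B := fun _ _ => rfl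
    have h1 := ((hB.sub ((rep_iterate_tLap S ((d - 1) / 2)).smul a)).sub (rep_evalE S L)) x hx
    have h2 := h1.symm.trans (h ⟨S, x, hx⟩ hs)
    rw [Expression.eval_smul]
    field_simp
    linear_combination h2

/-- The obstruction density for hypersurfaces of odd dimension, in coordinates. -/
theorem exists_expression_of_even (hd : 3 ≤ d) (he : Even d) :
    ∃ L : Expression, (∀ t ∈ L, t.2.IsNonlinear) ∧
      ∀ S : Setup d, ∀ x ∈ S.V, S.s x = 0 → S.B x = L.eval S.G S.s x := by
  obtain ⟨L, hL, h⟩ := HypAlg.exists_expression (M := UH d) (YamabeAlg.B_even (M := UY d hd) he)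
  refine ⟨L, fun t ht => (hL t ht).isNonlinear, fun S x hx hs => ?_⟩
  have hB : Rep S (UY d hd).B S.B := fun _ _ => rfl
  have h1 := (hB.sub (rep_evalE S L)) x hx
  exact sub_eq_zero.1 (h1.symm.trans (h ⟨S, x, hx⟩ hs))

end SingularYamabe

/-! ### From manifolds to coordinate domains -/

namespace SingularYamabe

variable {d : ℕ} {M : Type*} [TopologicalSpace M] [ChartedSpace (EuclideanSpace ℝ (Fin d)) M]
  [IsManifold (𝓡 d) ∞ M]

lemma bilin_sum_single (b : Coord d →L[ℝ] Coord d →L[ℝ] ℝ) (v : Fin d → ℝ) :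
    b (∑ i, v i • EuclideanSpace.single i (1 : ℝ)) (∑ i, v i • EuclideanSpace.single i (1 : ℝ))
      = v ⬝ᵥ (Matrix.of fun i j => b (EuclideanSpace.single i 1) (EuclideanSpace.single j 1)).mulVec
        v := by
  simp only [map_sum, map_smul, sum_apply, smul_apply, dotProduct, Matrix.mulVec, smul_eq_mul,
    Finset.mul_sum, Matrix.of_apply]
  rw [Finset.sum_comm]
  exact Finset.sum_congr rfl fun i _ => Finset.sum_congr rfl fun j _ => by ring

section chart

variable {e : OpenPartialHomeomorph M (EuclideanSpace ℝ (Fin d))}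

lemma contMDiffAt_chart_symm (he : e ∈ IsManifold.maximalAtlas (𝓡 d) ∞ M)
    {x : Coord d} (hx : x ∈ e.target) :
    ContMDiffAt (𝓡 d) (𝓡 d) ∞ e.symm x :=
  (contMDiffOn_symm_of_mem_maximalAtlas he).contMDiffAt (e.open_target.mem_nhds hx)

lemma mdifferentiable_chart_of_mem (he : e ∈ IsManifold.maximalAtlas (𝓡 d) ∞ M) :
    e.MDifferentiable (𝓡 d) (𝓡 d) :=
  ⟨(contMDiffOn_of_mem_maximalAtlas he).mdifferentiableOn (by simp),
    (contMDiffOn_symm_of_mem_maximalAtlas he).mdifferentiableOn (by simp)⟩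

lemma contDiffOn_comp_chart_symm (he : e ∈ IsManifold.maximalAtlas (𝓡 d) ∞ M)
    {f : M → ℝ} (hf : ContMDiff (𝓡 d) 𝓘(ℝ, ℝ) ∞ f) :
    ContDiffOn ℝ ∞ (fun y => f (e.symm y)) e.target :=
  contMDiffOn_iff_contDiffOn.1 (hf.comp_contMDiffOn (contMDiffOn_symm_of_mem_maximalAtlas he))

/-- Smoothness of the coordinate vector fields as sections along the inverse chart; evaluating the
metric on two of them gives smooth components. -/
lemma contMDiffAt_coordinate_field (he : e ∈ IsManifold.maximalAtlas (𝓡 d) ∞ M)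
    (i : Fin d) {x : Coord d} (hx : x ∈ e.target) :
    ContMDiffAt (𝓡 d) (𝓡 d).tangent ∞ (fun y => Bundle.TotalSpace.mk' (EuclideanSpace ℝ (Fin d))
      (E := fun p : M => TangentSpace (𝓡 d) p) (e.symm y)
      (mfderiv (𝓡 d) (𝓡 d) e.symm y (EuclideanSpace.single i (1 : ℝ)))) x := by
  have h1 : ContMDiffAt (𝓡 d) (𝓡 d).tangent ∞ (fun y : Coord d => Bundle.TotalSpace.mk'
      (EuclideanSpace ℝ (Fin d)) (E := fun p : Coord d => TangentSpace (𝓡 d) p) y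
      (EuclideanSpace.single i (1 : ℝ))) x :=
    contMDiffAt_vectorSpace_iff_contDiffAt.2 contDiffAt_const
  have h2 := contMDiffAt_chart_symm he hx
  have h3 := h2.mfderiv_const (m := ∞) (by simp)
  exact ContMDiffAt.clm_apply_of_inCoordinates h3 h1 h2

lemma contDiffOn_metricInChart (he : e ∈ IsManifold.maximalAtlas (𝓡 d) ∞ M)
    (g : SmoothMetric d M) (i j : Fin d) :
    ContDiffOn ℝ ∞ (fun x => metricInChart g e x i j) e.target := by
  intro x hx
  refine ContDiffAt.contDiffWithinAt (contMDiffAt_iff_contDiffAt.1 ?_)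
  have h := ContMDiffAt.clm_bundle_apply₂ (F₁ := EuclideanSpace ℝ (Fin d))
    (F₂ := EuclideanSpace ℝ (Fin d)) (F₃ := ℝ) (E₃ := fun _ : M => ℝ)
    (g.contMDiff.contMDiffAt.comp x (contMDiffAt_chart_symm he hx))
    (contMDiffAt_coordinate_field he i hx) (contMDiffAt_coordinate_field he j hx)
  exact (Bundle.contMDiffAt_totalSpace.1 h).2

lemma mfderiv_chart_symm_injective (he : e ∈ IsManifold.maximalAtlas (𝓡 d) ∞ M)
    {x : Coord d} (hx : x ∈ e.target) :
    Function.Injective (mfderiv (𝓡 d) (𝓡 d) e.symm x) :=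
  (mdifferentiable_chart_of_mem he).symm.mfderiv_injective hx

/-- The differential of the inverse chart is injective, so a non-zero coordinate vector has positive
length. -/
lemma posDef_metricInChart (he : e ∈ IsManifold.maximalAtlas (𝓡 d) ∞ M)
    (g : SmoothMetric d M) {x : Coord d} (hx : x ∈ e.target) :
    (metricInChart g e x).PosDef := by
  refine Matrix.PosDef.of_dotProduct_mulVec_pos ?_ fun v hv => ?_
  · ext i j
    simp only [Matrix.conjTranspose_apply, star_trivial]
    exact g.symm _ _ _
  · have h1 : ∑ i, v i • EuclideanSpace.single i (1 : ℝ) ≠ 0 := by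
      intro h
      refine hv (funext fun j => ?_)
      have := congrArg (fun w : EuclideanSpace ℝ (Fin d) => w j) h
      simpa [Pi.single_apply] using this
    have h2 := g.pos (e.symm x) (mfderiv (𝓡 d) (𝓡 d) e.symm x
      (∑ i, v i • EuclideanSpace.single i (1 : ℝ))) fun h =>
      h1 (mfderiv_chart_symm_injective he hx (h.trans (map_zero _).symm))
    let T : Coord d →L[ℝ] Coord d := mfderiv (𝓡 d) (𝓡 d) e.symm x
    let b : Coord d →L[ℝ] Coord d →L[ℝ] ℝ := g.inner (e.symm x)
    exact h2.trans_eq (bilin_sum_single (b.bilinearComp T T) v)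

lemma fderiv_comp_chart_symm (he : e ∈ IsManifold.maximalAtlas (𝓡 d) ∞ M)
    {f : M → ℝ} (hf : ContMDiff (𝓡 d) 𝓘(ℝ, ℝ) ∞ f) {x : Coord d} (hx : x ∈ e.target)
    (w : Coord d) : fderiv ℝ (fun y => f (e.symm y)) x w
      = differential f (e.symm x) (mfderiv (𝓡 d) (𝓡 d) e.symm x w) := by
  have h := mfderiv_comp x ((hf (e.symm x)).mdifferentiableAt (by simp))
    ((contMDiffAt_chart_symm he hx).mdifferentiableAt (by simp))
  rw [mfderiv_eq_fderiv] at h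
  exact congrArg (fun T => T w) h

lemma exists_partialDeriv_ne_zero (he : e ∈ IsManifold.maximalAtlas (𝓡 d) ∞ M)
    {s : M → ℝ} (hs : IsDefiningFunction (d := d) s) {x : Coord d}
    (hx : x ∈ e.target) (h0 : s (e.symm x) = 0) :
    ∃ a, partialDeriv a (fun y => s (e.symm y)) x ≠ 0 := by
  obtain ⟨v, hv⟩ := hs.deriv_ne_zero _ h0
  obtain ⟨w, rfl⟩ := (mdifferentiable_chart_of_mem he).symm.mfderiv_surjective hx v
  by_contra! h
  refine hv ((fderiv_comp_chart_symm he hs.smooth hx w).symm.trans ?_)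
  have h1 : (fderiv ℝ (fun y => s (e.symm y)) x).toLinearMap = 0 :=
    (EuclideanSpace.basisFun (Fin d) ℝ).toBasis.ext fun i => by
      simpa [partialDeriv] using h i
  exact congrArg (fun T => T w) h1

lemma isOpen_partialDeriv_ne_zero (he : e ∈ IsManifold.maximalAtlas (𝓡 d) ∞ M)
    {s : M → ℝ} (hs : ContMDiff (𝓡 d) 𝓘(ℝ, ℝ) ∞ s) :
    IsOpen {x ∈ e.target | ∃ a, partialDeriv a (fun y => s (e.symm y)) x ≠ 0} := by
  have h : {x ∈ e.target | ∃ a, partialDeriv a (fun y => s (e.symm y)) x ≠ 0}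
      = ⋃ a, e.target ∩ partialDeriv a (fun y => s (e.symm y)) ⁻¹' {0}ᶜ := by
    ext x; simp
  rw [h]
  refine isOpen_iUnion fun a => ContinuousOn.isOpen_inter_preimage ?_ e.open_target
    isOpen_compl_singleton
  exact ((contDiffOn_comp_chart_symm he hs).continuousOn_fderiv_of_isOpen e.open_target
    (by simp)).clm_apply continuousOn_const

/-- The data on a chart domain. -/
def chartSetup (he : e ∈ IsManifold.maximalAtlas (𝓡 d) ∞ M)
    {g : SmoothMetric d M} {s σ B : M → ℝ} (hs : IsDefiningFunction (d := d) s)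
    (hσ : IsUnitDefiningDensity g s σ B) : Setup d where
  -- The chart domain is cut down to the open set where `ds ≠ 0`, since the conormal must be defined
  -- throughout; no point of the hypersurface is lost.
  V := {x ∈ e.target | ∃ a, partialDeriv a (fun y => s (e.symm y)) x ≠ 0}
  G := metricInChart g e
  s y := s (e.symm y)
  σ y := σ (e.symm y)
  B y := B (e.symm y)
  isOpen := isOpen_partialDeriv_ne_zero he hs.smooth
  G_smooth i j := (contDiffOn_metricInChart he g i j).mono fun _ h => h.1
  G_posDef x hx := posDef_metricInChart he g hx.1
  s_smooth := (contDiffOn_comp_chart_symm he hs.smooth).mono fun _ h => h.1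
  σ_smooth := (contDiffOn_comp_chart_symm he hσ.defining.smooth).mono fun _ h => h.1
  B_smooth := (contDiffOn_comp_chart_symm he hσ.smooth).mono fun _ h => h.1
  ds_ne x hx := hx.2
  σ_zero x _ h := (hσ.zero_iff _).2 h
  dσ_eq x hx h := by
    obtain ⟨c, hc, h1⟩ := hσ.oriented _ h
    refine ⟨c, hc, fun a => ?_⟩
    rw [partialDeriv, partialDeriv, fderiv_comp_chart_symm he hσ.defining.smooth hx.1,
      fderiv_comp_chart_symm he hs.smooth hx.1, h1]
  eqn x hx := hσ.equation e he x hx.1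

lemma mem_chartSetup (he : e ∈ IsManifold.maximalAtlas (𝓡 d) ∞ M) {g : SmoothMetric d M}
    {s σ B : M → ℝ} (hs : IsDefiningFunction (d := d) s) (hσ : IsUnitDefiningDensity g s σ B) {p : M}
    (hp : p ∈ e.source) (h0 : s p = 0) : e p ∈ (chartSetup he hs hσ).V :=
  ⟨e.map_source hp, exists_partialDeriv_ne_zero he hs (e.map_source hp)
    (by rw [e.left_inv hp, h0])⟩

end chart

end SingularYamabe

end

theorem mainTheorem4 (d : ℕ) (hd : 3 ≤ d) :
    (Even (d - 1) →
      ∃ a : ℝ, a ≠ 0 ∧ ∃ L : SingularYamabe.Expression,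
        (∀ t ∈ L, t.2.IsLowerOrder d) ∧
        ∀ (M : Type*) [TopologicalSpace M] [ChartedSpace (EuclideanSpace ℝ (Fin d)) M]
          [IsManifold (𝓡 d) ∞ M] (g : SingularYamabe.SmoothMetric d M) (s σ B : M → ℝ),
          SingularYamabe.IsDefiningFunction (d := d) s →
          SingularYamabe.IsUnitDefiningDensity g s σ B →
          ∀ e ∈ IsManifold.maximalAtlas (𝓡 d) ∞ M, ∀ p ∈ e.source, s p = 0 →
            B p = a *
              ((SingularYamabe.barLaplacian (SingularYamabe.metricInChart g e)
                  (fun y => s (e.symm y)))^[(d - 1) / 2]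
                (SingularYamabe.meanCurv (SingularYamabe.metricInChart g e)
                  (fun y => s (e.symm y))) (e p)
              + L.eval (SingularYamabe.metricInChart g e) (fun y => s (e.symm y)) (e p))) ∧
    (Odd (d - 1) →
      ∃ L : SingularYamabe.Expression,
        (∀ t ∈ L, t.2.IsNonlinear) ∧
        ∀ (M : Type*) [TopologicalSpace M] [ChartedSpace (EuclideanSpace ℝ (Fin d)) M]
          [IsManifold (𝓡 d) ∞ M] (g : SingularYamabe.SmoothMetric d M) (s σ B : M → ℝ),
          SingularYamabe.IsDefiningFunction (d := d) s →
          SingularYamabe.IsUnitDefiningDensity g s σ B →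
          ∀ e ∈ IsManifold.maximalAtlas (𝓡 d) ∞ M, ∀ p ∈ e.source, s p = 0 →
            B p = L.eval (SingularYamabe.metricInChart g e) (fun y => s (e.symm y)) (e p)) := by
  refine ⟨fun h => ?_, fun h => ?_⟩
  · obtain ⟨a, ha, L, hL, hS⟩ := SingularYamabe.exists_expression_of_odd hd
      (by obtain ⟨k, hk⟩ := h; exact ⟨k, by omega⟩)
    refine ⟨a, ha, L, hL, fun M _ _ _ g s σ B hs hσ e he p hp h0 => ?_⟩
    -- The coordinate statement applies at `e p`, which lies in the reduced domain because `s`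
    -- vanishes at `p`.
    have h1 := hS (SingularYamabe.chartSetup he hs hσ) (e p)
      (SingularYamabe.mem_chartSetup he hs hσ hp h0) (by
        change s (e.symm (e p)) = 0
        rw [e.left_inv hp, h0])
    refine Eq.trans ?_ h1
    change B p = B (e.symm (e p))
    rw [e.left_inv hp]
  · obtain ⟨L, hL, hS⟩ := SingularYamabe.exists_expression_of_even hd
      (by obtain ⟨k, hk⟩ := h; exact ⟨k + 1, by omega⟩)
    refine ⟨L, hL, fun M _ _ _ g s σ B hs hσ e he p hp h0 => ?_⟩
    have h1 := hS (SingularYamabe.chartSetup he hs hσ) (e p)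
      (SingularYamabe.mem_chartSetup he hs hσ hp h0) (by
        change s (e.symm (e p)) = 0
        rw [e.left_inv hp, h0])
    refine Eq.trans ?_ h1
    change B p = B (e.symm (e p))
    rw [e.left_inv hp]
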